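/- Fix a countably infinite set of names $\mathbb A$; a nominal set is a set with an action of the finite permutations of $\mathbb A$ in which each element $x$ is finitely supported, with least support $\mathrm{supp}(x)$. $\mathrm{orb}(x)$ is the orbit of $x$, $|\mathrm{orb}(\mathcal S)|$ is the number of orbits of $\mathcal S$, and $\mathrm{ri}(\mathcal S)=\max_{s\in\mathcal S}|\mathrm{supp}(s)|$. **Systems.** A *fresh labelled transition system* (FLTS) $\mathcal L$ has a nominal set $\mathcal S$ of states, an equivariant set of labels $\ell=(t,\vec a)$ (a tag and a finite sequence of names) and an equivariant transition relation $(s,H)\xrightarrow{\ell}(s',H')$ between configurations, i.e. pairs of a state $s$ and a finite $H\subseteq\mathbb A$ (the history) with $\mathrm{supp}(s)\subseteq H$. It is required that $H'=H\cup\mathrm{supp}(\ell)$, that $\mathrm{supp}(s')\subseteq\mathrm{supp}(s)\cup\mathrm{supp}(\ell)$, and that the set of pairs $(\ell,(s',H'))$ with $(s,H)\xrightarrow{\ell}(s',H')$ is fixed by every finite permutation that fixes $\mathrm{supp}(s)$ pointwise and maps $H\setminus\mathrm{supp}(s)$ onto itself. $\mathcal L$ is *fresh-orbit-finite* if its states and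 its labels form finitely many orbits. Its *branching degree* $b$ is the maximal number of successors of a configuration under one label. **Formulas.** Negation-free formulas are given by $$\phi::=u=v\mid u\ne v\mid\phi\vee\phi\mid\phi\wedge\phi\mid\textstyle\bigvee_x\phi\mid\bigwedge_x\phi\mid И_x\phi\mid\langle t,\vec u\rangle\phi\mid[t,\vec u]\phi\mid X(\vec u)\mid(\mu X(\vec x).\phi)(\vec u)\mid(\nu X(\vec x).\phi)(\vec u),$$ where $u,v,\vec u$ are names or name variables. $\mathrm{supp}(\phi)$ is the set of names in $\phi$. The size $|\phi|$ is $2$ for $u=v$ and $u\neq v$, and otherwise $1$ plus the sizes of the immediate subformulas plus $|\vec u|$. The depth $\|\phi\|$ is the maximal number of name variables bound along a branch of $\phi$ (one by each of $\bigvee_x,\bigwedge_x,И_x$, and $|\vec x|$ by a fixpoint). **Games.** A *setup* $(\mathcal L,\phi_0,s_0,H_0)$ consists of a fresh-orbit-finite FLTS, a closed negation-free formula that respects arities and binds each recursion variable at most once, and a configuration. Its *grade* is $N=|\mathrm{supp}(\phi_0)|+\|\phi_0\|+\mathrm{ri}(\mathcal S)$. Write $H'\preccurlyeq_N^{A}H$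 if either $|H|\le N$ and $H'=H$, or $|H|>N$, $A\cap H\subseteq H'\subseteq H$ and $|H'|=N+1$. The *bounded parity game* $\mathcal G_N$ has as positions the triples $(s,H,\phi)$ reachable, by the moves below, from some $(s_0,H_0',\phi_0)$ with $H_0'\preccurlyeq_N^{\mathrm{supp}(s_0)\cup\mathrm{supp}(\phi_0)}H_0$: - from $\phi_1\vee\phi_2$ and $\phi_1\wedge\phi_2$ to $\phi_i$; from $\bigvee_x\phi$ and $\bigwedge_x\phi$ to $\phi\{a/x\}$ for any name $a$; from $И_x\phi$ to $\phi\{a/x\}$ for any $a\notin H\cup\mathrm{supp}(\phi)$; from $(\sigma X(\vec x).\phi)(\vec a)$ to $\phi\{\sigma X(\vec x).\phi/X\}\{\vec a/\vec x\}$; in all these cases $s$ and $H$ stay the same; - from $(s,H,\langle t,\vec a\rangle\phi)$ and $(s,H,[t,\vec a]\phi)$ to $(s',H',\phi)$ whenever $(s,H)\xrightarrow{t,\vec a}(s',H_1)$ and $H'\preccurlyeq_N^{\mathrm{supp}(s')\cup\mathrm{supp}(\phi)}H_1$. Attacker owns the positions of $\wedge,\bigwedge,[\,]$ and of true (in)equalities,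 Defender the others. A $\nu X$-position has rank $2h$ and a $\mu X$-position rank $2h+1$, where $h$ is the maximal number of nested fixpoints in the fixpoint subformula of $\phi_0$ that binds $X$ (itself included); other positions have rank $0$. The *orbit game* $\mathrm{orb}(\mathcal G_N)$ has as positions the orbits of the positions of $\mathcal G_N$, with the induced moves, owners and ranks. **Claim.** Put $$B=|\mathrm{orb}(\mathcal S)|\cdot|\phi_0|\cdot\frac{(|\mathrm{supp}(\phi_0)|+\|\phi_0\|)!}{|\mathrm{supp}(\phi_0)|!}\cdot(N+1)^{|\mathrm{supp}(\phi_0)|+\|\phi_0\|+1}.$$ 1. There is a function $\varepsilon:\mathbb N\to\mathbb R$ with $\varepsilon(N)\to0$ as $N\to\infty$ such that, for every setup of grade $N$, the orbit game $\mathrm{orb}(\mathcal G_N)$ has finitely many positions, and at most $B\cdot(1+\varepsilon(N))$. 2. There are a single program and a constant $C$ such that, for every setup of grade $N$, the branching degree $b$ is finite and the following holds. Suppose that states are handled through numerical codes, that the supports of states and the targets of a configuration under a label can be listed by oracle calls taking at most one more time unit than the length of the list, and that an oracle decides in time at most $\Phi_{\mathcal L}(|\vec a|)$, with $\Phi_{\mathcal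 L}:\mathbb N\to\mathbb N$ nondecreasing, whether some finite permutation maps $\vec a$ to $\vec b$ and $s_1$ to $s_2$, for given sequences $\vec a,\vec b$ of distinct names, of the same length, and states $s_1,s_2$. Then for every initial history $H_0'\preccurlyeq_N^{\mathrm{supp}(s_0)\cup\mathrm{supp}(\phi_0)}H_0$ the program, given $\phi_0,s_0,H_0',N$, outputs the finite parity game $\mathrm{orb}(\mathcal G_N)$ (all positions, their owners, ranks and successors, and the initial position) in time at most $$C\cdot\bigl(|\phi_0|+\Phi_{\mathcal L}(|\mathrm{supp}(\phi_0)|+\|\phi_0\|)+N\bigr)\cdot\max(N+2,b)\cdot B^2 .$$ Programs are recursive first-order programs over binary trees with natural numbers at the leaves (constructing and taking apart pairs, successor, equality test of numbers, conditionals, function calls); each evaluation step costs one unit, and an oracle call costs in addition the time of the oracle. -/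

import Mathlib

open Filter Topology
open scoped Pointwise

universe u

/-! ## Names and nominal sets -/

/-- Names: a fixed countably infinite set of atomic identifiers. -/
structure Name where
  id : ℕ
deriving DecidableEq

/-- The group of finite permutations of the names. -/
def FinPerm : Subgroup (Equiv.Perm Name) where
  carrier := {π | {a | π a ≠ a}.Finite}
  one_mem' := by simp
  mul_mem' := by
    intro π ρ hπ hρ
    refine (Set.Finite.union hπ hρ).subset ?_
    intro a ha
    by_contra hc
    simp only [Set.mem_union, Set.mem_ofPred_eq, not_or, not_not] at hc
    apply ha
    simp [Equiv.Perm.mul_apply, hc.1, hc.2]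
  inv_mem' := by
    intro π hπ
    refine Set.Finite.subset hπ ?_
    intro a ha hc
    apply ha
    rw [Equiv.Perm.inv_eq_iff_eq]
    exact hc.symm

/-- A nominal set: an action of the finite permutations all of whose elements are
finitely supported. -/
class Nominal (X : Type*) extends MulAction FinPerm X where
  exists_support : ∀ x : X, ∃ A : Finset Name, MulAction.Supports FinPerm (A : Set Name) x

namespace Nominal

variable {X : Type*} [Nominal X]

theorem supp_finite (x : X) :
    (⋂₀ {A : Set Name | A.Finite ∧ MulAction.Supports FinPerm A x}).Finite := by
  obtain ⟨A, hA⟩ := exists_support x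
  exact A.finite_toSet.subset (Set.sInter_subset_of_mem ⟨A.finite_toSet, hA⟩)

/-- The support of `x`: the intersection of the finite sets that support `x` (which is the
least set supporting `x`). -/
noncomputable def supp (x : X) : Finset Name := (supp_finite x).toFinset

variable (X)

/-- The number of orbits of `X`. -/
noncomputable def numOrbits : ℕ := Nat.card (MulAction.orbitRel.Quotient FinPerm X)

def OrbitFinite : Prop := Finite (MulAction.orbitRel.Quotient FinPerm X)

/-- The register index of an orbit-finite nominal set: the maximal size of a support. (The
maximum exists for orbit-finite `X`, as the size of the support is constant on each orbit.) -/
noncomputable def regIndex : ℕ := ⨆ x : X, (supp x).card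

end Nominal

open Nominal

/-! ## Fresh labelled transition systems -/

/-- A label `(t, a⃗)`: a tag together with a sequence of names. -/
structure Label where
  tag : ℕ
  names : List Name

instance : MulAction FinPerm Label where
  smul π ℓ := ⟨ℓ.tag, ℓ.names.map (π • ·)⟩
  one_smul ℓ := by
    change Label.mk ℓ.tag (ℓ.names.map ((1 : FinPerm) • ·)) = ℓ
    simp
  mul_smul π ρ ℓ := by
    change Label.mk ℓ.tag (ℓ.names.map ((π * ρ) • ·)) =
      Label.mk ℓ.tag ((ℓ.names.map (ρ • ·)).map (π • ·))
    simp [mul_smul, Function.comp_def]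

/-- The support of a label. -/
def Label.supp (ℓ : Label) : Finset Name := ℓ.names.toFinset

/-- `(A, B)` freshly supports `z`: every finite permutation that fixes `A` pointwise and
maps `B \ A` onto itself fixes `z`. -/
def FreshlySupports {Z : Type*} [MulAction FinPerm Z] (A B : Finset Name) (z : Z) : Prop :=
  A ⊆ B ∧ ∀ π : FinPerm, (∀ a ∈ A, π • a = a) → π • (B \ A) = B \ A → π • z = z

/-- A fresh labelled transition system with states `S`. A configuration is a pair `(s, H)` of
a state and a finite set of names (the history) with `supp s ⊆ H`. -/
structure FLTS (S : Type u) [Nominal S] where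
  labels : Set Label
  step : S × Finset Name → Label → S × Finset Name → Prop
  labels_smul : ∀ (π : FinPerm) (ℓ : Label), ℓ ∈ labels → π • ℓ ∈ labels
  step_label : ∀ c ℓ c', step c ℓ c' → ℓ ∈ labels
  step_conf : ∀ c ℓ c', step c ℓ c' → supp c.1 ⊆ c.2 ∧ supp c'.1 ⊆ c'.2
  step_smul : ∀ (π : FinPerm) c ℓ c', step c ℓ c' → step (π • c) (π • ℓ) (π • c')
  freshly_supported : ∀ s H, supp s ⊆ H →
    FreshlySupports (supp s) H {p : Label × (S × Finset Name) | step (s, H) p.1 p.2}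
  step_supp : ∀ s H ℓ s' H', step (s, H) ℓ (s', H') →
    supp s' ⊆ supp s ∪ ℓ.supp ∧ H' = H ∪ ℓ.supp

/-- Fresh-orbit-finiteness: the states and the labels form orbit-finite nominal sets. -/
def FLTS.FreshOrbitFinite {S : Type u} [Nominal S] (L : FLTS S) : Prop :=
  OrbitFinite S ∧ ((fun ℓ : Label => MulAction.orbit FinPerm ℓ) '' L.labels).Finite

/-- The branching degree: the maximal number of successors of a configuration under one
label. -/
noncomputable def FLTS.branching {S : Type u} [Nominal S] (L : FLTS S) : ℕ∞ :=
  ⨆ (c : S × Finset Name) (ℓ : Label), {c' | L.step c ℓ c'}.encard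

/-! ## Negation-free formulas -/

/-- A term: a name or a name variable. -/
inductive Term where
  | name (a : Name)
  | var (x : ℕ)

inductive FixKind where
  | mu
  | nu

/-- Negation-free formulas of the Hennessy-Milner logic with name quantification, fresh-name
quantification and parameterised recursion. Name variables and recursion variables are natural
numbers; `fix σ X xs φ us` is `(σ X(xs). φ)(us)`. -/
inductive Formula where
  | eq (u v : Term)
  | ne (u v : Term)
  | or (φ ψ : Formula)
  | and (φ ψ : Formula)
  | some (x : ℕ) (φ : Formula)
  | all (x : ℕ) (φ : Formula)
  | fresh (x : ℕ) (φ : Formula)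
  | dia (t : ℕ) (us : List Term) (φ : Formula)
  | box (t : ℕ) (us : List Term) (φ : Formula)
  | call (X : ℕ) (us : List Term)
  | fix (σ : FixKind) (X : ℕ) (xs : List ℕ) (φ : Formula) (us : List Term)

namespace Term

def names : Term → Finset Name
  | name a => {a}
  | var _ => ∅

def rename (π : FinPerm) : Term → Term
  | name a => name (π • a)
  | var x => var x

/-- Substitution of names for name variables, given by an association list. -/
def inst (γ : List (ℕ × Name)) : Term → Term
  | name a => name a
  | var x => match γ.lookup x with
    | none => var x
    | Option.some a => name a

/-- The variables of the term are among `Γ`. -/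
def Scoped (Γ : Finset ℕ) : Term → Prop
  | name _ => True
  | var x => x ∈ Γ

end Term

namespace Formula

/-- The size `|φ|`. -/
def size : Formula → ℕ
  | eq _ _ => 2
  | ne _ _ => 2
  | or φ ψ => 1 + φ.size + ψ.size
  | and φ ψ => 1 + φ.size + ψ.size
  | some _ φ => 1 + φ.size
  | all _ φ => 1 + φ.size
  | fresh _ φ => 1 + φ.size
  | dia _ us φ => 1 + us.length + φ.size
  | box _ us φ => 1 + us.length + φ.size
  | call _ us => 1 + us.length
  | fix _ _ _ φ us => 1 + us.length + φ.size

/-- The binding depth `‖φ‖`: the maximal number of name variables bound along a branch. -/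
def depth : Formula → ℕ
  | eq _ _ => 0
  | ne _ _ => 0
  | or φ ψ => max φ.depth ψ.depth
  | and φ ψ => max φ.depth ψ.depth
  | some _ φ => 1 + φ.depth
  | all _ φ => 1 + φ.depth
  | fresh _ φ => 1 + φ.depth
  | dia _ _ φ => φ.depth
  | box _ _ φ => φ.depth
  | call _ _ => 0
  | fix _ _ xs φ _ => xs.length + φ.depth

def termNames (us : List Term) : Finset Name :=
  us.foldr (fun u A => u.names ∪ A) ∅

/-- The support of a formula: the set of names occurring in it. -/
def supp : Formula → Finset Name
  | eq u v => u.names ∪ v.names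
  | ne u v => u.names ∪ v.names
  | or φ ψ => φ.supp ∪ ψ.supp
  | and φ ψ => φ.supp ∪ ψ.supp
  | some _ φ => φ.supp
  | all _ φ => φ.supp
  | fresh _ φ => φ.supp
  | dia _ us φ => termNames us ∪ φ.supp
  | box _ us φ => termNames us ∪ φ.supp
  | call _ us => termNames us
  | fix _ _ _ φ us => φ.supp ∪ termNames us

/-- The action of a permutation of names on formulas. -/
def rename (π : FinPerm) : Formula → Formula
  | eq u v => eq (u.rename π) (v.rename π)
  | ne u v => ne (u.rename π) (v.rename π)
  | or φ ψ => or (φ.rename π) (ψ.rename π)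
  | and φ ψ => and (φ.rename π) (ψ.rename π)
  | some x φ => some x (φ.rename π)
  | all x φ => all x (φ.rename π)
  | fresh x φ => fresh x (φ.rename π)
  | dia t us φ => dia t (us.map (Term.rename π)) (φ.rename π)
  | box t us φ => box t (us.map (Term.rename π)) (φ.rename π)
  | call X us => call X (us.map (Term.rename π))
  | fix σ X xs φ us => fix σ X xs (φ.rename π) (us.map (Term.rename π))

theorem termRename_one : Term.rename 1 = id := by
  funext u
  cases u <;> simp [Term.rename]

theorem termRename_mul (π ρ : FinPerm) :
    Term.rename (π * ρ) = Term.rename π ∘ Term.rename ρ := by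
  funext u
  cases u <;> simp [Term.rename, mul_smul]

instance : MulAction FinPerm Formula where
  smul := rename
  one_smul φ := by
    change rename 1 φ = φ
    induction φ <;> simp_all [rename, termRename_one]
  mul_smul π ρ φ := by
    change rename (π * ρ) φ = rename π (rename ρ φ)
    induction φ <;> simp_all [rename, termRename_mul]

/-- Substitution of names for the free name variables listed in `γ`. -/
def inst (γ : List (ℕ × Name)) : Formula → Formula
  | eq u v => eq (u.inst γ) (v.inst γ)
  | ne u v => ne (u.inst γ) (v.inst γ)
  | or φ ψ => or (φ.inst γ) (ψ.inst γ)
  | and φ ψ => and (φ.inst γ) (ψ.inst γ)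
  | some x φ => some x (φ.inst (γ.filter (fun p => p.1 ≠ x)))
  | all x φ => all x (φ.inst (γ.filter (fun p => p.1 ≠ x)))
  | fresh x φ => fresh x (φ.inst (γ.filter (fun p => p.1 ≠ x)))
  | dia t us φ => dia t (us.map (Term.inst γ)) (φ.inst γ)
  | box t us φ => box t (us.map (Term.inst γ)) (φ.inst γ)
  | call X us => call X (us.map (Term.inst γ))
  | fix σ X xs φ us =>
      fix σ X xs (φ.inst (γ.filter (fun p => p.1 ∉ xs))) (us.map (Term.inst γ))

/-- `unfold σ X xs ψ φ` is `φ{σ X(xs). ψ / X}`: each free `X(us)` in `φ` is replaced by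
`(σ X(xs). ψ)(us)`. -/
def unfold (σ : FixKind) (X : ℕ) (xs : List ℕ) (ψ : Formula) : Formula → Formula
  | eq u v => eq u v
  | ne u v => ne u v
  | or φ₁ φ₂ => or (unfold σ X xs ψ φ₁) (unfold σ X xs ψ φ₂)
  | and φ₁ φ₂ => and (unfold σ X xs ψ φ₁) (unfold σ X xs ψ φ₂)
  | some x φ => some x (unfold σ X xs ψ φ)
  | all x φ => all x (unfold σ X xs ψ φ)
  | fresh x φ => fresh x (unfold σ X xs ψ φ)
  | dia t us φ => dia t us (unfold σ X xs ψ φ)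
  | box t us φ => box t us (unfold σ X xs ψ φ)
  | call Y us => if Y = X then fix σ X xs ψ us else call Y us
  | fix τ Y ys φ us =>
      if Y = X then fix τ Y ys φ us else fix τ Y ys (unfold σ X xs ψ φ) us

/-- `φ` is well formed with free name variables in `Γ` and free recursion variables and their
arities given by `Δ`. -/
def WellFormed : Finset ℕ → (ℕ → Option ℕ) → Formula → Prop
  | Γ, _, eq u v => u.Scoped Γ ∧ v.Scoped Γ
  | Γ, _, ne u v => u.Scoped Γ ∧ v.Scoped Γ
  | Γ, Δ, or φ ψ => WellFormed Γ Δ φ ∧ WellFormed Γ Δ ψ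
  | Γ, Δ, and φ ψ => WellFormed Γ Δ φ ∧ WellFormed Γ Δ ψ
  | Γ, Δ, some x φ => WellFormed (insert x Γ) Δ φ
  | Γ, Δ, all x φ => WellFormed (insert x Γ) Δ φ
  | Γ, Δ, fresh x φ => WellFormed (insert x Γ) Δ φ
  | Γ, Δ, dia _ us φ => (∀ u ∈ us, u.Scoped Γ) ∧ WellFormed Γ Δ φ
  | Γ, Δ, box _ us φ => (∀ u ∈ us, u.Scoped Γ) ∧ WellFormed Γ Δ φ
  | Γ, Δ, call X us => (∀ u ∈ us, u.Scoped Γ) ∧ Δ X = Option.some us.length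
  | Γ, Δ, fix _ X xs φ us => (∀ u ∈ us, u.Scoped Γ) ∧ xs.Nodup ∧ xs.length = us.length ∧
      WellFormed (Γ ∪ xs.toFinset) (Function.update Δ X (Option.some xs.length)) φ

/-- The recursion variables bound in `φ`, one entry for each binder. -/
def recBinders : Formula → List ℕ
  | eq _ _ => []
  | ne _ _ => []
  | or φ ψ => φ.recBinders ++ ψ.recBinders
  | and φ ψ => φ.recBinders ++ ψ.recBinders
  | some _ φ => φ.recBinders
  | all _ φ => φ.recBinders
  | fresh _ φ => φ.recBinders
  | dia _ _ φ => φ.recBinders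
  | box _ _ φ => φ.recBinders
  | call _ _ => []
  | fix _ X _ φ _ => X :: φ.recBinders

/-- Closed formulas in which each recursion variable is bound at most once. -/
def Closed (φ : Formula) : Prop :=
  φ.WellFormed ∅ (fun _ => none) ∧ φ.recBinders.Nodup

/-- The maximal number of nested fixpoints in `φ`. -/
def height : Formula → ℕ
  | eq _ _ => 0
  | ne _ _ => 0
  | or φ ψ => max φ.height ψ.height
  | and φ ψ => max φ.height ψ.height
  | some _ φ => φ.height
  | all _ φ => φ.height
  | fresh _ φ => φ.height
  | dia _ _ φ => φ.height
  | box _ _ φ => φ.height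
  | call _ _ => 0
  | fix _ _ _ φ _ => 1 + φ.height

/-- The height of the fixpoint subformula of `φ` that binds `X` (0 if there is none). -/
def binderHeight (X : ℕ) : Formula → ℕ
  | eq _ _ => 0
  | ne _ _ => 0
  | or φ ψ => max (φ.binderHeight X) (ψ.binderHeight X)
  | and φ ψ => max (φ.binderHeight X) (ψ.binderHeight X)
  | some _ φ => φ.binderHeight X
  | all _ φ => φ.binderHeight X
  | fresh _ φ => φ.binderHeight X
  | dia _ _ φ => φ.binderHeight X
  | box _ _ φ => φ.binderHeight X
  | call _ _ => 0
  | fix _ Y _ φ _ => if Y = X then 1 + φ.height else φ.binderHeight X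

/-- The rank of a formula in the games for `φ₀`: even for greatest and odd for least fixpoints,
larger for outer than for inner recursion variables of `φ₀`, and 0 for all other formulas. -/
def rank (φ₀ : Formula) : Formula → ℕ
  | fix .mu X _ _ _ => 2 * φ₀.binderHeight X + 1
  | fix .nu X _ _ _ => 2 * φ₀.binderHeight X
  | _ => 0

/-- Formulas at which Defender moves. A player who cannot move loses, so Attacker owns the true
(in)equalities and Defender the false ones. At fixpoints and fresh-name quantifiers the owner is
immaterial, as all moves lead to the same orbit. -/
def DefenderMoves : Formula → Prop
  | eq u v => u ≠ v
  | ne u v => u = v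
  | and _ _ => False
  | all _ _ => False
  | box _ _ _ => False
  | _ => True

end Formula

/-! ## Parity games, the bounded game and its orbit game -/

/-- A parity game: positions `pos`, of which Defender owns those in `defender` and Attacker the
others, a rank function, and a move relation. (Defender wins an infinite play if the maximal rank
that occurs infinitely often is even; a player who cannot move loses.) -/
structure ParityGame (V : Type*) where
  pos : Set V
  defender : Set V
  rank : V → ℕ
  move : V → V → Prop

/-- `H'` is an `N`-bounded version of the history `H`, keeping the names in `A`. -/
def HistBound (N : ℕ) (A H H' : Finset Name) : Prop :=
  (H.card ≤ N ∧ H' = H) ∨ (N < H.card ∧ A ∩ H ⊆ H' ∧ H' ⊆ H ∧ H'.card = N + 1)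

/-- Positions: a configuration `(s, H)` and a formula. -/
abbrev Position (S : Type u) := (S × Finset Name) × Formula

section Games

variable {S : Type u} [Nominal S]

/-- The moves of the `N`-bounded game on `L`. -/
inductive BoundedMove (L : FLTS S) (N : ℕ) : Position S → Position S → Prop
  | or_left (c φ ψ) : BoundedMove L N (c, .or φ ψ) (c, φ)
  | or_right (c φ ψ) : BoundedMove L N (c, .or φ ψ) (c, ψ)
  | and_left (c φ ψ) : BoundedMove L N (c, .and φ ψ) (c, φ)
  | and_right (c φ ψ) : BoundedMove L N (c, .and φ ψ) (c, ψ)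
  | some (c x φ) (a : Name) : BoundedMove L N (c, .some x φ) (c, φ.inst [(x, a)])
  | all (c x φ) (a : Name) : BoundedMove L N (c, .all x φ) (c, φ.inst [(x, a)])
  | fresh (c x φ) (a : Name) (ha : a ∉ c.2) (ha' : a ∉ φ.supp) :
      BoundedMove L N (c, .fresh x φ) (c, φ.inst [(x, a)])
  | dia (c t φ) (as : List Name) (s' H₁ H') (h : L.step c ⟨t, as⟩ (s', H₁))
      (hH : HistBound N (supp s' ∪ φ.supp) H₁ H') :
      BoundedMove L N (c, .dia t (as.map .name) φ) ((s', H'), φ)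
  | box (c t φ) (as : List Name) (s' H₁ H') (h : L.step c ⟨t, as⟩ (s', H₁))
      (hH : HistBound N (supp s' ∪ φ.supp) H₁ H') :
      BoundedMove L N (c, .box t (as.map .name) φ) ((s', H'), φ)
  | fix (c σ X xs φ) (as : List Name) :
      BoundedMove L N (c, .fix σ X xs φ (as.map .name))
        (c, (Formula.unfold σ X xs φ φ).inst (xs.zip as))

/-- The `N`-bounded game: the positions reachable from the initial positions `(s₀, H₀', φ₀)`,
where `H₀'` is an `N`-bounded version of `H₀`. -/
def boundedGame (L : FLTS S) (φ₀ : Formula) (s₀ : S) (H₀ : Finset Name) (N : ℕ) :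
    ParityGame (Position S) where
  pos := {P | ∃ H₀', HistBound N (supp s₀ ∪ φ₀.supp) H₀ H₀' ∧
    Relation.ReflTransGen (BoundedMove L N) ((s₀, H₀'), φ₀) P}
  defender := {P | P.2.DefenderMoves}
  rank P := φ₀.rank P.2
  move := BoundedMove L N

/-- The orbit game: its positions are the orbits of the positions of `G`, with the moves,
owners and ranks of their elements. -/
noncomputable def orbitGame {V : Type*} [MulAction FinPerm V] (G : ParityGame V) :
    ParityGame (Set V) where
  pos := (fun P => MulAction.orbit FinPerm P) '' G.pos
  defender := {O | ∃ P ∈ O, P ∈ G.pos ∧ P ∈ G.defender}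
  rank O := sInf {r | ∃ P ∈ O, P ∈ G.pos ∧ r = G.rank P}
  move O O' := ∃ P ∈ O, ∃ P' ∈ O', P ∈ G.pos ∧ P' ∈ G.pos ∧ G.move P P'

/-- A setup: a fresh-orbit-finite system, a closed negation-free formula and a configuration. -/
structure IsSetup (L : FLTS S) (φ₀ : Formula) (s₀ : S) (H₀ : Finset Name) : Prop where
  orbitFinite : L.FreshOrbitFinite
  closed : φ₀.Closed
  conf : supp s₀ ⊆ H₀

variable (S) in
/-- The grade of a setup with states `S` and formula `φ₀`. -/
noncomputable def setupGrade (φ₀ : Formula) : ℕ := φ₀.supp.card + φ₀.depth + regIndex S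

/-- The orbit game of the bounded game at the grade of the setup. -/
noncomputable def boundedOrbitGame (L : FLTS S) (φ₀ : Formula) (s₀ : S) (H₀ : Finset Name) :
    ParityGame (Set (Position S)) :=
  orbitGame (boundedGame L φ₀ s₀ H₀ (setupGrade S φ₀))

variable (S) in
/-- `|orb(S)| · |φ₀| · (k + q)! / k! · (N + 1) ^ (k + q + 1)` where `k` is the size of the support
of `φ₀`, `q` its binding depth and `N` the grade. -/
noncomputable def sizeBound (φ₀ : Formula) : ℝ :=
  numOrbits S * φ₀.size * ((φ₀.supp.card + φ₀.depth).factorial / φ₀.supp.card.factorial : ℝ) *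
    ((setupGrade S φ₀ : ℝ) + 1) ^ (φ₀.supp.card + φ₀.depth + 1)

end Games

/-! ## Programs with oracles and their running time

Data are binary trees of natural numbers; programs are finite lists of recursive first-order
function definitions over such data, evaluated by value, in which each evaluation step costs one
unit and an oracle call costs in addition the time that the oracle takes. -/

inductive Val where
  | atom (n : ℕ)
  | pair (v w : Val)

namespace Val

def fst : Val → Val
  | atom _ => atom 0
  | pair v _ => v

def snd : Val → Val
  | atom _ => atom 0
  | pair _ w => w

def succ : Val → Val
  | atom n => atom (n + 1)
  | pair _ _ => atom 0

def isPair : Val → Val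
  | atom _ => atom 0
  | pair _ _ => atom 1

/-- Equality test of numbers; it fails on pairs. -/
def eqAtom : Val → Val → Val
  | atom m, atom n => if m = n then atom 1 else atom 0
  | _, _ => atom 0

def ofList : List Val → Val
  | [] => atom 0
  | v :: vs => pair v (ofList vs)

end Val

/-- The three questions that a program can ask about a transition system. -/
inductive Query where
  | equiv
  | next
  | support

/-- An oracle: its answers and the time it takes for them. -/
structure Oracle where
  answer : Query → Val → Val
  cost : Query → Val → ℕ

/-- Expressions; `var i` is the `i`-th entry of the environment and `call f e` applies the `f`-th
function of the program. -/
inductive Expr where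
  | var (i : ℕ)
  | const (n : ℕ)
  | cons (e₁ e₂ : Expr)
  | fst (e : Expr)
  | snd (e : Expr)
  | succ (e : Expr)
  | isPair (e : Expr)
  | eqAtom (e₁ e₂ : Expr)
  | ite (e e₁ e₂ : Expr)
  | bind (e₁ e₂ : Expr)
  | call (f : ℕ) (e : Expr)
  | ask (q : Query) (e : Expr)

/-- A program: the bodies of its functions, each with one argument. -/
abbrev Program := List Expr

/-- `Eval P O env e v k`: in environment `env`, the expression `e` evaluates to `v` in time `k`. -/
inductive Eval (P : Program) (O : Oracle) : List Val → Expr → Val → ℕ → Prop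
  | var (env i) : Eval P O env (.var i) (env.getD i (.atom 0)) 1
  | const (env n) : Eval P O env (.const n) (.atom n) 1
  | cons {env e₁ e₂ v₁ v₂ k₁ k₂} (h₁ : Eval P O env e₁ v₁ k₁) (h₂ : Eval P O env e₂ v₂ k₂) :
      Eval P O env (.cons e₁ e₂) (.pair v₁ v₂) (k₁ + k₂ + 1)
  | fst {env e v k} (h : Eval P O env e v k) : Eval P O env (.fst e) v.fst (k + 1)
  | snd {env e v k} (h : Eval P O env e v k) : Eval P O env (.snd e) v.snd (k + 1)
  | succ {env e v k} (h : Eval P O env e v k) : Eval P O env (.succ e) v.succ (k + 1)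
  | isPair {env e v k} (h : Eval P O env e v k) : Eval P O env (.isPair e) v.isPair (k + 1)
  | eqAtom {env e₁ e₂ v₁ v₂ k₁ k₂} (h₁ : Eval P O env e₁ v₁ k₁) (h₂ : Eval P O env e₂ v₂ k₂) :
      Eval P O env (.eqAtom e₁ e₂) (v₁.eqAtom v₂) (k₁ + k₂ + 1)
  | ite_true {env e e₁ e₂ v v₁ k k₁} (h : Eval P O env e v k) (hv : v ≠ .atom 0)
      (h₁ : Eval P O env e₁ v₁ k₁) : Eval P O env (.ite e e₁ e₂) v₁ (k + k₁ + 1)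
  | ite_false {env e e₁ e₂ v₂ k k₂} (h : Eval P O env e (.atom 0) k)
      (h₂ : Eval P O env e₂ v₂ k₂) : Eval P O env (.ite e e₁ e₂) v₂ (k + k₂ + 1)
  | bind {env e₁ e₂ v₁ v₂ k₁ k₂} (h₁ : Eval P O env e₁ v₁ k₁)
      (h₂ : Eval P O (v₁ :: env) e₂ v₂ k₂) : Eval P O env (.bind e₁ e₂) v₂ (k₁ + k₂ + 1)
  | call {env f e v w k k'} (h : Eval P O env e v k)
      (h' : Eval P O [v] (P.getD f (.const 0)) w k') : Eval P O env (.call f e) w (k + k' + 1)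
  | ask {env q e v k} (h : Eval P O env e v k) :
      Eval P O env (.ask q e) (O.answer q v) (k + O.cost q v + 1)

/-- The program, run on `input` with the oracle `O`, returns `v` in time `k`. The main function
is the first one. -/
def Program.Runs (P : Program) (O : Oracle) (input v : Val) (k : ℕ) : Prop :=
  Eval P O [input] (P.getD 0 (.const 0)) v k

/-! ## Encodings -/

def Name.encode (a : Name) : Val := .atom a.id

def encodeNames (as : List Name) : Val := .ofList (as.map Name.encode)

def Term.encode : Term → Val
  | name a => .pair (.atom 0) a.encode
  | var x => .pair (.atom 1) (.atom x)

def encodeTerms (us : List Term) : Val := .ofList (us.map Term.encode)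

def FixKind.encode : FixKind → Val
  | mu => .atom 0
  | nu => .atom 1

def Formula.encode : Formula → Val
  | eq u v => .ofList [.atom 0, u.encode, v.encode]
  | ne u v => .ofList [.atom 1, u.encode, v.encode]
  | or φ ψ => .ofList [.atom 2, φ.encode, ψ.encode]
  | and φ ψ => .ofList [.atom 3, φ.encode, ψ.encode]
  | some x φ => .ofList [.atom 4, .atom x, φ.encode]
  | all x φ => .ofList [.atom 5, .atom x, φ.encode]
  | fresh x φ => .ofList [.atom 6, .atom x, φ.encode]
  | dia t us φ => .ofList [.atom 7, .atom t, encodeTerms us, φ.encode]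
  | box t us φ => .ofList [.atom 8, .atom t, encodeTerms us, φ.encode]
  | call X us => .ofList [.atom 9, .atom X, encodeTerms us]
  | fix σ X xs φ us => .ofList [.atom 10, σ.encode, .atom X, .ofList (xs.map .atom), φ.encode,
      encodeTerms us]

section Presentation

variable {S : Type u} [Nominal S]

open Classical in
/-- The oracle `O` presents the system `L`, whose states are handled through the numbers `code s`:
* `equiv` decides, for sequences `as`, `bs` of distinct names, of the same length, and states
  `s₁`, `s₂`, whether some finite permutation maps `as` to `bs` and `s₁` to `s₂`, in time at most
  `Φ as.length`;
* `next` lists the target states of a configuration under a label, and `support` lists the support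
  of a state, both in time at most one more than the length of the list. -/
structure Presents (L : FLTS S) (code : S ↪ ℕ) (Φ : ℕ → ℕ) (O : Oracle) : Prop where
  equiv : ∀ (as bs : List Name) (s₁ s₂ : S), as.Nodup → bs.Nodup → as.length = bs.length →
    let q := Val.ofList [encodeNames as, encodeNames bs, .atom (code s₁), .atom (code s₂)]
    O.answer .equiv q =
        .atom (if ∃ π : FinPerm, as.map (π • ·) = bs ∧ π • s₁ = s₂ then 1 else 0) ∧
      O.cost .equiv q ≤ Φ as.length
  next : ∀ (s : S) (hs : List Name) (t : ℕ) (as : List Name), hs.Nodup → supp s ⊆ hs.toFinset →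
    let q := Val.ofList [.atom (code s), encodeNames hs, .atom t, encodeNames as]
    ∃ ss : List S, ss.Nodup ∧
      (∀ s', s' ∈ ss ↔ ∃ H', L.step (s, hs.toFinset) ⟨t, as⟩ (s', H')) ∧
      O.answer .next q = .ofList (ss.map fun s' => .atom (code s')) ∧
      O.cost .next q ≤ ss.length + 1
  support : ∀ s : S, ∃ as : List Name, as.Nodup ∧ as.toFinset = supp s ∧
    O.answer .support (.atom (code s)) = encodeNames as ∧
    O.cost .support (.atom (code s)) ≤ as.length + 1

/-- The input of a program: the formula, the initial state, a duplicate-free list of the names of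
the initial history, and the grade. -/
noncomputable def encodeInput (code : S ↪ ℕ) (φ₀ : Formula) (s₀ : S) (hs : List Name) : Val :=
  .ofList [φ₀.encode, .atom (code s₀), encodeNames hs, .atom (setupGrade S φ₀)]

end Presentation

open Classical in
/-- `v` is a complete description of the parity game `G` with initial position `init`: for some
enumeration of the positions without repetition it consists of the index of `init` and, for
each position, its owner, its rank and a list of the indices of its successors. -/
def DescribesGame {V : Type*} (G : ParityGame V) (init : V) (v : Val) : Prop :=
  ∃ (n : ℕ) (f : Fin n → V) (i₀ : Fin n) (succs : Fin n → List (Fin n)),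
    Function.Injective f ∧ Set.range f = G.pos ∧ f i₀ = init ∧
    (∀ i, (succs i).Nodup ∧ ∀ j, j ∈ succs i ↔ G.move (f i) (f j)) ∧
    v = .pair (.atom i₀) (.ofList (List.ofFn fun i =>
      .ofList [.atom (if f i ∈ G.defender then 1 else 0), .atom (G.rank (f i)),
        .ofList ((succs i).map fun j => .atom j)]))

/-- The time bound
`(|φ₀| + Φ(|supp φ₀| + ‖φ₀‖) + N) · max(N + 2, b) · (size bound)²`. -/
noncomputable def timeBound (S : Type u) [Nominal S] (φ₀ : Formula) (Φ : ℕ → ℕ) (b : ℕ) : ℝ :=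
  ((φ₀.size : ℝ) + Φ (φ₀.supp.card + φ₀.depth) + setupGrade S φ₀) *
    max ((setupGrade S φ₀ : ℝ) + 2) b * sizeBound S φ₀ ^ 2

/-! ## Finite permutations and supports -/

/-! Unfolding a fixpoint copies bodies into bodies, but it creates no new text: every formula of the
game is an occurrence of a subformula of `φ₀`, with names substituted for its free name variables
and fixpoints for its free recursion variables. Let `k` be the number of names in `φ₀`, `q` its
depth and `K = k + q`. The names of `φ₀` get the slots `1, …, k`, and a bound name variable gets as
slot its binding level, so that `K` slots suffice. A formula of the game is then determined by an
occurrence and by the names stored in the slots, the first `k` of which always hold the names of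
`φ₀` (`Denotes`, `Denotes.open`, `Denotes.unfold`).

Counting. A position adds to this a state `s` and a history `H ⊇ supp s` with at most `N + 1` names.
The orbit of `(s, H)` is given by the orbit of `s` and the size `h` of `H`. With `(s, H)` fixed, the
slots are filled one after the other, up to permutations that fix `H`: the next value is a name of
`H`, an earlier value or a fresh name, and for the first `k` slots, whose values are distinct, the
earlier values are excluded. For each orbit of states and each of the at most `|φ₀|` occurrences
this leaves `Σ_{h ≤ N+1} (h+1)^k ∏_{j<q} (h+k+j+1)` choices (`historyCount`,
`finite_orbits_admissible`). In the product `h` is replaced by `N + 1`; as `N + 1 + c ≤ c (N + 1)`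
for `c ≥ 2`, it is essentially at most `(k+q)!/k! · (N+1)^q`. The remaining sum is at most
`(N+3)^(k+1) / (k+1)`. Together the quotient by the desired bound is at most `((N+3)/(N+1))^8`,
uniformly in `k` and `q` (`historyCount_le_asymp`). The estimates even leave a factor `K + 1` in
reserve: if `M` is the number of positions, then `(K + 1) M ≤ 32 B` (`mul_historyCount_le`).

The program. It keeps a list of pairwise inequivalent positions, treats them in order, and appends
those successors that are not equivalent to a listed position. Fully unfolded formulas are avoided
by lifting fixpoints: in a lifted tree a fixpoint or a call of `X` becomes a call that carries,
besides its arguments, the values of the slots on which the definition of `X` depends, and the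
definitions are kept in a static table. Lifted trees have size of order `|φ₀| (K + 1)`. They can be
expanded to the formulas that they represent, and expansion is injective and commutes with renaming
(`FTree.expand_injective`, `FTree.expand_tmap`), so orbits can be compared on lifted trees.

Two positions are compared by listing the names of both trees in the order in which they occur,
which leaves one possible renaming. It remains to check that this renaming maps one tree to the
other, that the same listed names are in the histories, that the histories have the same size, and,
by the oracle, that some permutation inducing the renaming maps one state to the other. The other
names of the histories can always be matched afterwards (`exists_finPerm_map_history`,
`CPos.equiv_iff`). By equivariance (`orbitGame_move_iff`) the successors of one representative
suffice; for a quantifier only the known names and one fresh name matter, and the choice of a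
bounded history does not matter at all.

Time. Treating a position costs a constant times `(|φ₀| + Φ K + N) · max (N+2) b · ((N+1)(K+1) + M
(K+1)²)`, where the last summand pays for comparing the successors with the list. Over `M` positions
each factor `K + 1` meets a factor `M`, and the reserve `(K + 1) M ≤ 32 B` yields a constant times
`B²` (`totalCost_le`). -/

theorem exists_finPerm_of_injOn (A : Finset Name) (f : Name → Name) (hf : Set.InjOn f A) :
    ∃ π : FinPerm, ∀ a ∈ A, π • a = f a := by
  classical
  set F : Finset Name := A ∪ A.image f with hF
  -- An injection of `A` into the finite set `A ∪ f(A)` extends to a permutation of that set, which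
  -- is continued by the identity.
  obtain ⟨g, hg⟩ := Finset.exists_equiv_extend_of_card_eq (α := F) (t := F)
    (Fintype.card_coe F) (s := Finset.univ.filter (fun x : F => x.1 ∈ A)) (f := fun x => f x.1)
    (by
      intro y hy
      simp only [Finset.mem_image, Finset.mem_filter, Finset.mem_univ, true_and] at hy
      obtain ⟨x, hx, rfl⟩ := hy
      exact Finset.mem_union_right _ (Finset.mem_image_of_mem f hx))
    (by
      intro x hx y hy hxy
      simp only [Finset.coe_filter, Finset.mem_univ, true_and] at hx hy
      exact Subtype.ext (hf hx hy hxy))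
  let ρ : Equiv.Perm Name := Equiv.Perm.ofSubtype (p := fun x => x ∈ F) g
  have hρ : ρ ∈ FinPerm := by
    refine F.finite_toSet.subset ?_
    intro a ha
    by_contra hc
    exact ha (Equiv.Perm.ofSubtype_apply_of_not_mem g hc)
  refine ⟨⟨ρ, hρ⟩, ?_⟩
  intro a ha
  have haF : a ∈ F := Finset.mem_union_left _ ha
  change ρ a = f a
  rw [Equiv.Perm.ofSubtype_apply_of_mem g haF]
  exact hg ⟨a, haF⟩ (by simpa using ha)

theorem exists_name_notMem (A : Finset Name) : ∃ a : Name, a ∉ A := by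
  have : Infinite Name := Infinite.of_injective Name.mk (fun a b h => by simpa using h)
  exact Infinite.exists_notMem_finset A

/-- The elements of `A` can be moved injectively away from `B`. -/
theorem exists_injOn_avoiding (A B : Finset Name) :
    ∃ f : Name → Name, Set.InjOn f A ∧ ∀ a ∈ A, f a ∉ B := by
  let m := B.sup Name.id + 1
  refine ⟨fun a => ⟨a.id + m⟩, ?_, ?_⟩
  · intro a _ b _ h
    cases a; cases b; simpa using h
  · intro a _ hB
    have := Finset.le_sup (f := Name.id) hB
    simp only [m] at this
    omega

/-! ### Existence and equivariance of least supports. -/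

namespace Nominal

variable {X : Type*} [Nominal X]

theorem smul_eq_of_agree {A : Set Name} {x : X} (h : MulAction.Supports FinPerm A x)
    {π ρ : FinPerm} (hπ : ∀ a ∈ A, π • a = ρ • a) : π • x = ρ • x := by
  have := h (ρ⁻¹ * π) (fun a ha => by rw [mul_smul, hπ _ ha, inv_smul_smul])
  rwa [mul_smul, inv_smul_eq_iff] at this

/-- This is what makes least supports exist. For `π` fixing `A ∩ B`, a permutation `τ` that fixes
`A` first moves `B \ A` away from `A`, `B` and `π A`; it fixes `x`. Then `ρ` may act as `π` on `A`
and as the identity on the new places of `B \ A`. It agrees with `π` on `A`, so `ρ x = π x`; and `ρ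
τ` agrees with `τ` on `B`, so `ρ τ x = τ x = x`. -/
theorem supports_inter {A B : Finset Name} {x : X}
    (hA : MulAction.Supports FinPerm (A : Set Name) x)
    (hB : MulAction.Supports FinPerm (B : Set Name) x) :
    MulAction.Supports FinPerm ((A ∩ B : Finset Name) : Set Name) x := by
  classical
  intro π hπ
  have hπ' : ∀ a ∈ A ∩ B, π • a = a := fun a ha => hπ (by exact_mod_cast ha)
  obtain ⟨f, hf, hfB⟩ := exists_injOn_avoiding (B \ A) (A ∪ B ∪ A.image (π • ·))
  -- first move `B \ A` away
  obtain ⟨τ, hτ⟩ := exists_finPerm_of_injOn (A ∪ B) (fun a => if a ∈ A then a else f a) (by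
    intro a ha b hb hab
    have mem : ∀ c, c ∈ ((A ∪ B : Finset Name) : Set Name) → c ∉ A → c ∈ B \ A := by
      intro c hc hcA
      have : c ∈ A ∨ c ∈ B := by simpa using hc
      exact Finset.mem_sdiff.2 ⟨this.resolve_left hcA, hcA⟩
    by_cases h1 : a ∈ A <;> by_cases h2 : b ∈ A <;> simp only [h1, h2, if_true, if_false] at hab
    · exact hab
    · exact absurd (by simp [← hab, h1]) (hfB b (mem b hb h2))
    · exact absurd (by simp [hab, h2]) (hfB a (mem a ha h1))
    · exact hf (mem a ha h1) (mem b hb h2) hab)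
  have hτx : τ • x = x := hA (g := τ) (fun a ha => by
    have ha : a ∈ A := by exact_mod_cast ha
    change τ • a = a
    rw [hτ a (Finset.mem_union_left _ ha), if_pos ha])
  -- The two prescriptions for `ρ` do not collide, because `f` avoids the image of `A` under `π`.
  obtain ⟨ρ, hρ⟩ := exists_finPerm_of_injOn (A ∪ (B \ A).image f)
    (fun a => if a ∈ A then π • a else a) (by
    intro a ha b hb hab
    have mem : ∀ c, c ∈ ((A ∪ (B \ A).image f : Finset Name) : Set Name) → c ∉ A →
        c ∉ A.image (π • ·) := by
      intro c hc hcA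
      have hc' : c ∈ A ∨ c ∈ (B \ A).image f := by
        simpa only [Finset.coe_union, Set.mem_union, Finset.mem_coe] using hc
      obtain ⟨d, hd, rfl⟩ := Finset.mem_image.1 (hc'.resolve_left hcA)
      intro h
      exact hfB d hd (Finset.mem_union_right _ h)
    by_cases h1 : a ∈ A <;> by_cases h2 : b ∈ A <;> simp only [h1, h2, if_true, if_false] at hab
    · exact smul_left_cancel π hab
    · exact absurd (hab ▸ Finset.mem_image_of_mem _ h1) (mem b hb h2)
    · exact absurd (hab ▸ Finset.mem_image_of_mem _ h2) (mem a ha h1)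
    · exact hab)
  have h1 : ρ • x = π • x := smul_eq_of_agree hA (fun a ha => by
    have ha : a ∈ A := by exact_mod_cast ha
    rw [hρ a (Finset.mem_union_left _ ha), if_pos ha])
  have h2 : ρ • τ • x = τ • x := by
    rw [← mul_smul]
    refine smul_eq_of_agree hB (fun b hb => ?_)
    have hb : b ∈ B := by exact_mod_cast hb
    rw [mul_smul, hτ b (Finset.mem_union_right _ hb)]
    by_cases hbA : b ∈ A
    · simp only [if_pos hbA]
      rw [hρ b (Finset.mem_union_left _ hbA), if_pos hbA, hπ' b (Finset.mem_inter.2 ⟨hbA, hb⟩)]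
    · have hb' : b ∈ B \ A := Finset.mem_sdiff.2 ⟨hb, hbA⟩
      simp only [if_neg hbA]
      rw [hρ (f b) (Finset.mem_union_right _ (Finset.mem_image_of_mem f hb')), if_neg]
      intro h
      exact hfB b hb' (by simp [h])
  rw [hτx, h1] at h2
  exact h2

/-- A finite supporting set of least size lies in every other finite supporting set, since by
`supports_inter` the intersection with it supports as well. Hence it is the intersection by which
`supp` is defined. -/
theorem supports_supp (x : X) : MulAction.Supports FinPerm (supp x : Set Name) x := by
  classical
  obtain ⟨A₀, hA₀⟩ := exists_support x
  obtain ⟨A, ⟨hA, hmin⟩⟩ : ∃ A : Finset Name, MulAction.Supports FinPerm (A : Set Name) x ∧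
      ∀ B : Finset Name, MulAction.Supports FinPerm (B : Set Name) x → A ⊆ B := by
    have hex : ∃ m, ∃ A : Finset Name, MulAction.Supports FinPerm (A : Set Name) x ∧ A.card = m :=
      ⟨_, A₀, hA₀, rfl⟩
    obtain ⟨A, hA, hc⟩ := Nat.find_spec hex
    refine ⟨A, hA, fun B hB => ?_⟩
    have h1 := Nat.find_min' hex ⟨_, supports_inter hA hB, rfl⟩
    rw [← hc] at h1
    have := Finset.eq_of_subset_of_card_le Finset.inter_subset_left h1
    rw [← this]; exact Finset.inter_subset_right
  have : supp x = A := by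
    apply Finset.coe_injective
    rw [supp, Set.Finite.coe_toFinset]
    apply subset_antisymm
    · exact Set.sInter_subset_of_mem ⟨A.finite_toSet, hA⟩
    · refine Set.subset_sInter ?_
      rintro B ⟨hBf, hB⟩
      have := hmin hBf.toFinset (by simpa using hB)
      intro a ha
      simpa using this ha
  rw [this]; exact hA

theorem supp_subset {A : Finset Name} {x : X}
    (hA : MulAction.Supports FinPerm (A : Set Name) x) : supp x ⊆ A := by
  intro a ha
  rw [supp, Set.Finite.mem_toFinset] at ha
  exact_mod_cast ha _ ⟨A.finite_toSet, hA⟩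

theorem supp_smul_subset (π : FinPerm) (x : X) : supp (π • x) ⊆ π • supp x := by
  refine supp_subset ?_
  intro ρ hρ
  have : (π⁻¹ * ρ * π) • x = x := supports_supp x _ (fun a ha => by
    have h := hρ (a := π • a) (by
      have : π • a ∈ π • supp x := Finset.smul_mem_smul_finset (by exact_mod_cast ha)
      exact_mod_cast this)
    rw [mul_smul, mul_smul, h, inv_smul_smul])
  rw [mul_smul, mul_smul, inv_smul_eq_iff] at this
  exact this

theorem supp_smul (π : FinPerm) (x : X) : supp (π • x) = π • supp x := by
  refine subset_antisymm (supp_smul_subset π x) ?_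
  have := supp_smul_subset π⁻¹ (π • x)
  rw [inv_smul_smul] at this
  rwa [Finset.smul_finset_subset_iff] 

theorem smul_congr {x : X} {π ρ : FinPerm} (h : ∀ a ∈ supp x, π • a = ρ • a) :
    π • x = ρ • x :=
  smul_eq_of_agree (supports_supp x) (fun a ha => h a (by exact_mod_cast ha))

theorem card_supp_smul (π : FinPerm) (x : X) : (supp (π • x)).card = (supp x).card := by
  rw [supp_smul, Finset.card_smul_finset]

theorem bddAbove_card_supp (h : OrbitFinite X) :
    BddAbove (Set.range fun x : X => (supp x).card) := by
  have : Finite (MulAction.orbitRel.Quotient FinPerm X) := h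
  let g : MulAction.orbitRel.Quotient FinPerm X → ℕ :=
    Quotient.lift (fun x : X => (supp x).card) (by
      rintro a b ⟨π, rfl⟩
      exact card_supp_smul π b)
  refine (Set.finite_range g).bddAbove.mono ?_
  rintro _ ⟨x, rfl⟩
  exact ⟨Quotient.mk'' x, rfl⟩

theorem card_supp_le_regIndex (h : OrbitFinite X) (x : X) : (supp x).card ≤ regIndex X :=
  le_ciSup (bddAbove_card_supp h) x

end Nominal

/-- A permutation that respects two histories on the relevant names can be corrected to map one
history onto the other. -/
theorem exists_finPerm_map_history {A H H' : Finset Name} (π : FinPerm)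
    (hcard : H.card = H'.card) (hmem : ∀ a ∈ A, a ∈ H ↔ π • a ∈ H') :
    ∃ ρ : FinPerm, (∀ a ∈ A, ρ • a = π • a) ∧ ρ • H = H' := by
  classical
  -- On `A` the permutation is prescribed and already respects the histories; outside of `A` it is
  -- free. The two remaining parts of the histories have the same size, so that any bijection `e`
  -- between them can be joined to `π`.
  have h1 : (H \ A).card = (H' \ (π • A)).card := by
    have e1 := Finset.card_sdiff_add_card_inter H A
    have e2 := Finset.card_sdiff_add_card_inter H' (π • A)
    have e3 : (H ∩ A).card = (H' ∩ (π • A)).card := by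
      rw [← Finset.card_smul_finset π (H ∩ A)]
      congr 1
      ext b
      simp only [Finset.mem_inter, Finset.mem_smul_finset]
      constructor
      · rintro ⟨a, ⟨ha, ha'⟩, rfl⟩
        exact ⟨(hmem a ha').1 ha, a, ha', rfl⟩
      · rintro ⟨hb, a, ha, rfl⟩
        exact ⟨a, ⟨(hmem a ha).2 hb, ha⟩, rfl⟩
    omega
  obtain ⟨e⟩ : Nonempty ((H \ A : Finset Name) ≃ (H' \ (π • A) : Finset Name)) :=
    ⟨Finset.equivOfCardEq h1⟩
  let g : Name → Name := fun a => if h : a ∈ H \ A then (e ⟨a, h⟩ : Name) else π • a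
  have gA : ∀ a ∈ A, g a = π • a := fun a ha => by
    simp only [g]; rw [dif_neg]; simp [ha]
  have gH : ∀ a (h : a ∈ H \ A), g a = e ⟨a, h⟩ := fun a h => by
    simp only [g]; rw [dif_pos h]
  have cov : ∀ a, a ∈ A ∪ H → a ∉ A → a ∈ H \ A := by
    intro a ha hA
    exact Finset.mem_sdiff.2 ⟨(Finset.mem_union.1 ha).resolve_left hA, hA⟩
  obtain ⟨ρ, hρ⟩ := exists_finPerm_of_injOn (A ∪ H) g (by
    intro a ha b hb hab
    have ha : a ∈ A ∪ H := by exact_mod_cast ha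
    have hb : b ∈ A ∪ H := by exact_mod_cast hb
    have key : ∀ x ∈ A, ∀ y (h : y ∈ H \ A), g x ≠ g y := by
      intro x hx y hy hxy
      rw [gA x hx, gH y hy] at hxy
      have := (e ⟨y, hy⟩).2
      rw [← hxy] at this
      exact (Finset.mem_sdiff.1 this).2 (Finset.smul_mem_smul_finset hx)
    by_cases h1 : a ∈ A <;> by_cases h2 : b ∈ A
    · rw [gA a h1, gA b h2] at hab
      exact smul_left_cancel π hab
    · exact absurd hab (key a h1 b (cov b hb h2))
    · exact absurd hab.symm (key b h2 a (cov a ha h1))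
    · rw [gH a (cov a ha h1), gH b (cov b hb h2)] at hab
      have := e.injective (Subtype.ext hab)
      simpa using this)
  refine ⟨ρ, fun a ha => by rw [hρ a (Finset.mem_union_left _ ha), gA a ha], ?_⟩
  apply Finset.eq_of_subset_of_card_le
  · intro b hb
    obtain ⟨a, ha, rfl⟩ := Finset.mem_smul_finset.1 hb
    rw [hρ a (Finset.mem_union_right _ ha)]
    by_cases hA : a ∈ A
    · rw [gA a hA]; exact (hmem a hA).1 ha
    · rw [gH a (Finset.mem_sdiff.2 ⟨ha, hA⟩)]
      exact (Finset.mem_sdiff.1 (e _).2).1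
  · rw [Finset.card_smul_finset]; exact hcard.ge

/-! ## A uniform representation of formulas and its substitution calculus -/

/-- Formulas as labelled binary trees. In `node c m xs us l r` the connective is `c` (0 to 8 for
`eq` to `box`, 9 for calls, 10 and 11 for least and greatest fixpoints), `m` is a tag or a
recursion variable, `us` are terms outside of the scope of the name variables `xs`, which
extends over the children `l` and `r`. -/
inductive FTree where
  | nil
  | node (c m : ℕ) (xs : List ℕ) (us : List Term) (l r : FTree)

def FixKind.code : FixKind → ℕ
  | mu => 10
  | nu => 11

/-- With one constructor for all connectives, every law of substitution has a single inductive case.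
-/
def Formula.tree : Formula → FTree
  | eq u v => .node 0 0 [] [u, v] .nil .nil
  | ne u v => .node 1 0 [] [u, v] .nil .nil
  | or φ ψ => .node 2 0 [] [] φ.tree ψ.tree
  | and φ ψ => .node 3 0 [] [] φ.tree ψ.tree
  | some x φ => .node 4 0 [x] [] φ.tree .nil
  | all x φ => .node 5 0 [x] [] φ.tree .nil
  | fresh x φ => .node 6 0 [x] [] φ.tree .nil
  | dia t us φ => .node 7 t [] us φ.tree .nil
  | box t us φ => .node 8 t [] us φ.tree .nil
  | call X us => .node 9 X [] us .nil .nil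
  | fix σ X xs φ us => .node σ.code X xs us φ.tree .nil

theorem FixKind.code_injective : Function.Injective FixKind.code := by
  intro a b h
  cases a <;> cases b <;> simp_all [FixKind.code]

theorem FixKind.ten_le_code (σ : FixKind) : 10 ≤ σ.code := by cases σ <;> simp [FixKind.code]

theorem FixKind.code_le (σ : FixKind) : σ.code ≤ 11 := by cases σ <;> simp [FixKind.code]

theorem Formula.tree_injective : Function.Injective Formula.tree := by
  intro φ
  induction φ with
  | fix σ X xs φ us ih =>
    intro ψ h
    have := σ.ten_le_code
    cases ψ <;> simp only [Formula.tree, FTree.node.injEq] at h <;>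
      first
      | (exfalso; omega)
      | (obtain ⟨h1, h2, h3, h4, h5, -⟩ := h
         rw [FixKind.code_injective h1, h2, h3, h4, ih h5])
  | _ =>
    intro ψ h
    cases ψ <;> first
      | (simp [Formula.tree] at h; done)
      | (rename_i τ _ _ _ _; have := τ.ten_le_code
         simp only [Formula.tree, FTree.node.injEq] at h; exfalso; omega)
      | (simp only [Formula.tree, FTree.node.injEq, List.cons.injEq] at h; simp_all <;> grind)

/-! ### Substitutions for terms, and their form below binders. -/

namespace Term

/-- The names in a term. -/
def nameList : Term → List Name
  | name a => [a]
  | var _ => []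

/-- Substitution of terms for names. -/
def tsub (g : Name → Term) : Term → Term
  | name a => g a
  | var x => var x

/-- The substitution `e` below a binder for `xs`. -/
def under (e : Term → Term) (xs : List ℕ) : Term → Term
  | name a => e (name a)
  | var x => if x ∈ xs then var x else e (var x)

theorem under_tsub (g : Name → Term) (e : Term → Term) (xs : List ℕ) :
    under (tsub g ∘ e) xs = tsub g ∘ under e xs := by
  funext u
  cases u with
  | name a => rfl
  | var x => by_cases h : x ∈ xs <;> simp [under, h, tsub]

theorem under_id (xs : List ℕ) : under id xs = id := by
  funext u
  cases u with
  | name a => rfl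
  | var x => by_cases h : x ∈ xs <;> simp [under, h]

theorem under_nil (e : Term → Term) : under e [] = e := by
  funext u; cases u <;> simp [under]

theorem under_inst (γ : List (ℕ × Name)) (xs : List ℕ) :
    under (inst γ) xs = inst (γ.filter (fun p => p.1 ∉ xs)) := by
  funext u
  cases u with
  | name a => rfl
  | var x =>
    have key : (γ.filter (fun p => p.1 ∉ xs)).lookup x = if x ∈ xs then none else γ.lookup x := by
      induction γ with
      | nil => simp
      | cons p γ ih =>
        obtain ⟨y, a⟩ := p
        by_cases hy : y ∈ xs
        · rw [List.filter_cons_of_neg (by simpa using hy), ih]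
          by_cases hx : x ∈ xs
          · simp [hx]
          · have : x ≠ y := fun h => hx (h ▸ hy)
            simp [hx, List.lookup_cons, beq_false_of_ne this]
        · rw [List.filter_cons_of_pos (by simpa using hy), List.lookup_cons, List.lookup_cons, ih]
          by_cases hxy : x = y
          · subst hxy; simp [hy]
          · simp [beq_false_of_ne hxy, hxy]
    simp only [inst, under, key]
    by_cases h : x ∈ xs <;> simp [h]

theorem rename_eq_tsub (π : FinPerm) : rename π = tsub (fun a => name (π • a)) := by
  funext u; cases u <;> rfl

end Term

open Term (tsub under)

/-- What is known about recursion variables: connective, parameters and body. -/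
abbrev RecEnv := ℕ → Option (ℕ × List ℕ × FTree)

namespace RecEnv

/-- The codes from 10 on are those of fixpoints, which hide the outer meaning of the recursion
variable that they bind. -/
def under (δ : RecEnv) (c m : ℕ) : RecEnv := if 10 ≤ c then Function.update δ m none else δ

def empty : RecEnv := fun _ => Option.none

theorem empty_under (c m : ℕ) : empty.under c m = empty := by
  unfold under
  split_ifs
  · funext X; simp [Function.update_apply, empty]
  · rfl

end RecEnv

/-! ### Simultaneous substitution for name variables and recursion variables in trees. -/

namespace FTree

def tmap (f : Term → Term) : FTree → FTree
  | nil => nil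
  | node c m xs us l r => node c m xs (us.map f) (l.tmap f) (r.tmap f)

def names : FTree → List Name
  | nil => []
  | node _ _ _ us l r => us.flatMap Term.nameList ++ (l.names ++ r.names)

/-- Substitution of terms and of fixpoints for recursion variables. -/
def den (e : Term → Term) (δ : RecEnv) : FTree → FTree
  | nil => nil
  | node c m xs us l r =>
    match (if c = 9 then δ m else none) with
    | some (c', xs', B) => node c' m xs' (us.map e) B nil
    | none => node c m xs (us.map e) (den (under e xs) (δ.under c m) l)
        (den (under e xs) (δ.under c m) r)

/-- The body `p` of a fixpoint for `X` has no free variables besides its parameters and `X`. -/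
def ClosedBody (X : ℕ) (p : ℕ × List ℕ × FTree) : Prop :=
  10 ≤ p.1 ∧ ∀ (e : Term → Term) (δ : RecEnv), (∀ a, e (.name a) = .name a) →
    (∀ x ∈ p.2.1, e (.var x) = .var x) → δ X = none → den e δ p.2.2 = p.2.2

theorem den_node_of_some {e : Term → Term} {δ : RecEnv} {m c' : ℕ} {xs xs' : List ℕ}
    {us : List Term} {l r B : FTree} (h : δ m = some (c', xs', B)) :
    den e δ (node 9 m xs us l r) = node c' m xs' (us.map e) B nil := by
  simp [den, h]

theorem den_node_of_none {e : Term → Term} {δ : RecEnv} {c m : ℕ} {xs : List ℕ}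
    {us : List Term} {l r : FTree} (h : c = 9 → δ m = none) :
    den e δ (node c m xs us l r) = node c m xs (us.map e) (den (under e xs) (δ.under c m) l)
        (den (under e xs) (δ.under c m) r) := by
  have : (if c = 9 then δ m else none) = none := by
    split_ifs with hc
    · exact h hc
    · rfl
  rw [den]; simp only [this]

/-- Substitutions compose although nothing is renamed to avoid capture. A variable that `e₁`
produces is either its own argument or is left alone by `e₂`, so it does not matter whether a binder
captures it. The bodies that `δ₁` inserts are closed and pass unchanged through the second
substitution, so `δ₂` only counts where `δ₁` is undefined. -/
theorem den_den (t : FTree) : ∀ (e₁ e₂ : Term → Term) (δ₁ δ₂ : RecEnv),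
    (∀ a, e₂ (.name a) = .name a) →
    (∀ u y, e₁ u = .var y → u = .var y ∨ e₂ (.var y) = .var y) →
    (∀ X p, δ₁ X = some p → ClosedBody X p) →
    den e₂ δ₂ (den e₁ δ₁ t) = den (e₂ ∘ e₁) (fun X => (δ₁ X).or (δ₂ X)) t := by
  induction t with
  | nil => intros; rfl
  | node c m xs us l r ihl ihr =>
    intro e₁ e₂ δ₁ δ₂ hn hK hcl
    -- A variable obtained from another term is fixed by `e₂`, hence also by `e₂` below the binder;
    -- a variable obtained from itself is bound by `xs` in both substitutions or in neither.
    have hu : under (e₂ ∘ e₁) xs = under e₂ xs ∘ under e₁ xs := by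
      funext u
      have aux : ∀ v, (∀ y, v = .var y → e₂ (.var y) = under e₂ xs (.var y)) →
          e₂ v = under e₂ xs v := by
        intro v hv
        cases v with
        | name a => rfl
        | var y => exact hv y rfl
      cases u with
      | name a =>
        simp only [under, Function.comp]
        refine aux _ (fun y hy => ?_)
        rcases hK _ _ hy with h | h
        · simp at h
        · simp only [under, h, ite_self]
      | var x =>
        by_cases hx : x ∈ xs
        · simp [under, hx]
        · simp only [under, hx, if_false, Function.comp]
          refine aux _ (fun y hy => ?_)
          rcases hK _ _ hy with h | h
          · simp only [Term.var.injEq] at h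
            subst h
            simp [under, hx]
          · simp only [under, h, ite_self]
    have hK' : ∀ u y, under e₁ xs u = .var y → u = .var y ∨ under e₂ xs (.var y) = .var y := by
      intro u y h
      cases u with
      | name a =>
        rcases hK _ _ h with h | h
        · simp at h
        · right; simp only [under, h, ite_self]
      | var x =>
        by_cases hx : x ∈ xs
        · left; simpa [under, hx] using h
        · simp only [under, hx, if_false] at h
          rcases hK _ _ h with h | h
          · exact Or.inl h
          · right; simp only [under, h, ite_self]
    have hn' : ∀ a, under e₂ xs (.name a) = .name a := hn
    have hcl' : ∀ X p, δ₁.under c m X = some p → ClosedBody X p := by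
      intro X p h
      unfold RecEnv.under at h
      split_ifs at h with hc
      · by_cases hX : X = m
        · simp [hX] at h
        · rw [Function.update_of_ne hX] at h; exact hcl X p h
      · exact hcl X p h
    have hδ : RecEnv.under (fun X => (δ₁ X).or (δ₂ X)) c m =
        fun X => (δ₁.under c m X).or (δ₂.under c m X) := by
      unfold RecEnv.under
      split_ifs
      · funext X
        by_cases hX : X = m
        · simp [hX]
        · simp [Function.update_of_ne hX]
      · rfl
    by_cases hc : c = 9
    · subst hc
      cases h1 : δ₁ m with
      | some p =>
        obtain ⟨c', xs', B⟩ := p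
        obtain ⟨h10, hB⟩ := hcl _ _ h1
        rw [den_node_of_some h1, den_node_of_some (c' := c') (xs' := xs') (B := B) (by simp [h1]),
          den_node_of_none (by simp only at h10; omega), List.map_map]
        congr 1
        -- The inserted body stands below the binder of its own parameters and recursion variable,
        -- which are all that it has free.
        refine hB _ _ hn ?_ ?_
        · intro x hx; simp [under, show x ∈ xs' from hx]
        · simp only at h10; simp [RecEnv.under, h10]
      | none =>
        rw [den_node_of_none (fun _ => h1)]
        cases h2 : δ₂ m with
        | some p =>
          obtain ⟨c', xs', B⟩ := p
          rw [den_node_of_some h2, den_node_of_some (c' := c') (xs' := xs') (B := B) (by simp [h1, h2]), List.map_map]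
        | none =>
          rw [den_node_of_none (fun _ => h2), den_node_of_none (by simp [h1, h2]), List.map_map,
            ihl _ _ _ _ hn' hK' hcl', ihr _ _ _ _ hn' hK' hcl', hu, hδ]
    · rw [den_node_of_none (by simp [hc]), den_node_of_none (by simp [hc]),
        den_node_of_none (by simp [hc]), List.map_map,
        ihl _ _ _ _ hn' hK' hcl', ihr _ _ _ _ hn' hK' hcl', hu, hδ]

/-- The image of a recursion environment under a substitution for names. -/
def _root_.RecEnv.tsub (g : Name → Term) (δ : RecEnv) : RecEnv :=
  fun X => (δ X).map (fun p => (p.1, p.2.1, p.2.2.tmap (Term.tsub g)))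

theorem _root_.RecEnv.tsub_under (g : Name → Term) (δ : RecEnv) (c m : ℕ) :
    (δ.tsub g).under c m = (δ.under c m).tsub g := by
  unfold RecEnv.under
  split_ifs
  · funext X
    by_cases hX : X = m
    · simp [hX, RecEnv.tsub]
    · simp [Function.update_of_ne hX, RecEnv.tsub]
  · rfl

theorem tmap_den (g : Name → Term) (t : FTree) : ∀ (e : Term → Term) (δ : RecEnv),
    (den e δ t).tmap (tsub g) = den (tsub g ∘ e) (δ.tsub g) t := by
  induction t with
  | nil => intros; rfl
  | node c m xs us l r ihl ihr =>
    intro e δ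
    by_cases hc : c = 9 ∧ ∃ p, δ m = some p
    · obtain ⟨rfl, ⟨c', xs', B⟩, h⟩ := hc
      rw [den_node_of_some h, den_node_of_some (by simp [RecEnv.tsub, h]; exact ⟨rfl, rfl, rfl⟩)]
      simp [tmap]
    · have h : c = 9 → δ m = none := by
        intro h9
        cases h : δ m with
        | none => rfl
        | some p => exact absurd ⟨h9, p, h⟩ hc
      rw [den_node_of_none h, den_node_of_none (by intro h9; simp [RecEnv.tsub, h h9])]
      simp only [tmap, List.map_map, Term.under_tsub, RecEnv.tsub_under, ihl, ihr]

/-- When all outer variables become names and all outer recursion variables get closed bodies, only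
the parameters and `X` can remain free. A further substitution that respects these is absorbed by
`den_den`. -/
theorem closedBody_den {e : Term → Term} {δ : RecEnv} (he : ∀ u, ∃ a, e u = .name a)
    (hδ : ∀ X, ∃ p, δ X = some p) (hcl : ∀ X p, δ X = some p → ClosedBody X p)
    {c : ℕ} (hc : 10 ≤ c) (X : ℕ) (xs : List ℕ) (t : FTree) :
    ClosedBody X (c, xs, den (under e xs) (Function.update δ X none) t) := by
  have hvar : ∀ u y, under e xs u = .var y → u = .var y ∧ y ∈ xs := by
    intro u y h
    cases u with
    | name a => obtain ⟨b, hb⟩ := he (.name a); simp [under, hb] at h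
    | var x =>
      by_cases hx : x ∈ xs
      · simp only [under, hx, if_true, Term.var.injEq] at h
        subst h; exact ⟨rfl, hx⟩
      · obtain ⟨b, hb⟩ := he (.var x); simp [under, hx, hb] at h
  refine ⟨hc, fun e₂ δ₂ hn hx hX => ?_⟩
  simp only
  rw [den_den _ _ _ _ _ hn (fun u y h => Or.inl (hvar u y h).1)]
  · congr 1
    · funext u
      simp only [Function.comp]
      cases h : under e xs u with
      | name a => exact hn a
      | var y => exact hx y (hvar u y h).2
    · funext Y
      by_cases hY : Y = X
      · subst hY; simp [hX]
      · rw [Function.update_of_ne hY]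
        obtain ⟨p, hp⟩ := hδ Y
        simp [hp]
  · intro Y p h
    by_cases hY : Y = X
    · subst hY; simp at h
    · rw [Function.update_of_ne hY] at h; exact hcl _ _ h

theorem mem_names_tmap {g : Name → Term} {a : Name} {t : FTree} :
    a ∈ (t.tmap (tsub g)).names ↔ ∃ b ∈ t.names, a ∈ (g b).nameList := by
  induction t with
  | nil => simp [tmap, names]
  | node c m xs us l r ihl ihr =>
    have : a ∈ (us.map (tsub g)).flatMap Term.nameList ↔
        ∃ b ∈ us.flatMap Term.nameList, a ∈ (g b).nameList := by
      simp only [List.mem_flatMap, List.mem_map]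
      constructor
      · rintro ⟨_, ⟨u, hu, rfl⟩, ha⟩
        cases u with
        | name b => exact ⟨b, ⟨_, hu, by simp [Term.nameList]⟩, ha⟩
        | var x => simp [tsub, Term.nameList] at ha
      · rintro ⟨b, ⟨u, hu, hb⟩, ha⟩
        cases u with
        | name b' =>
          simp only [Term.nameList, List.mem_singleton] at hb
          subst hb
          exact ⟨_, ⟨_, hu, rfl⟩, ha⟩
        | var x => simp [Term.nameList] at hb
    simp only [tmap, names, List.mem_append, this, ihl, ihr]
    grind

theorem tmap_congr {f g : Name → Term} {t : FTree} (h : ∀ a ∈ t.names, f a = g a) :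
    t.tmap (tsub f) = t.tmap (tsub g) := by
  induction t with
  | nil => rfl
  | node c m xs us l r ihl ihr =>
    simp only [names, List.mem_append] at h
    simp only [tmap]
    rw [ihl (fun a ha => h a (Or.inr (Or.inl ha))), ihr (fun a ha => h a (Or.inr (Or.inr ha)))]
    congr 1
    refine List.map_congr_left (fun u hu => ?_)
    cases u with
    | name a => exact h a (Or.inl (List.mem_flatMap.2 ⟨_, hu, by simp [Term.nameList]⟩))
    | var x => rfl

theorem eq_of_tmap_eq {f g : Name → Term} {t : FTree} (h : t.tmap (tsub f) = t.tmap (tsub g)) :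
    ∀ a ∈ t.names, f a = g a := by
  induction t with
  | nil => simp [names]
  | node c m xs us l r ihl ihr =>
    simp only [tmap, node.injEq, true_and] at h
    intro a ha
    simp only [names, List.mem_append] at ha
    rcases ha with ha | ha | ha
    · obtain ⟨u, hu, ha⟩ := List.mem_flatMap.1 ha
      have := List.map_inj_left.1 h.1 u hu
      cases u with
      | name b => simp only [Term.nameList, List.mem_singleton] at ha; subst ha; exact this
      | var x => simp [Term.nameList] at ha
    · exact ihl h.2.1 a ha
    · exact ihr h.2.2 a ha

theorem tmap_tmap (f g : Term → Term) (t : FTree) : (t.tmap f).tmap g = t.tmap (g ∘ f) := by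
  induction t <;> simp_all [tmap]

theorem tmap_id (t : FTree) : t.tmap id = t := by induction t <;> simp_all [tmap]

end FTree

namespace Formula
open FTree

theorem tree_inst (φ : Formula) : ∀ γ : List (ℕ × Name),
    (φ.inst γ).tree = den (Term.inst γ) RecEnv.empty φ.tree := by
  induction φ with
  | fix σ X xs φ us ih =>
    intro γ
    have := σ.ten_le_code
    rw [Formula.tree, den_node_of_none (fun _ => rfl), RecEnv.empty_under, Term.under_inst, ← ih]
    rfl
  | _ =>
    intro γ
    simp_all [Formula.tree, Formula.inst, den, RecEnv.empty, RecEnv.under, Term.under_inst]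

/-- Together with `tree_inst` this turns both substitutions made by a fixpoint move into instances
of `den`, which `den_den` composes. At an inner binder of the same `X` the environment becomes
empty, in accordance with the shadowing in `unfold`. -/
theorem tree_unfold (σ : FixKind) (X : ℕ) (xs : List ℕ) (ψ φ : Formula) :
    (unfold σ X xs ψ φ).tree =
      den id (Function.update RecEnv.empty X (Option.some (σ.code, xs, ψ.tree))) φ.tree := by
  induction φ with
  | fix τ Y ys φ us ih =>
    have := τ.ten_le_code
    rw [Formula.unfold, Formula.tree, den_node_of_none (by omega), Term.under_id]
    by_cases hY : Y = X
    · subst hY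
      have e1 : RecEnv.under (Function.update RecEnv.empty Y (Option.some (σ.code, xs, ψ.tree))) τ.code Y =
          RecEnv.empty := by
        simp only [RecEnv.under, this, if_true, Function.update_idem]
        funext Z; simp [Function.update_apply, RecEnv.empty]
      have e2 : ∀ t : FTree, den id RecEnv.empty t = t := by
        intro t
        induction t with
        | nil => rfl
        | node c m zs us l r ihl ihr =>
          rw [den_node_of_none (fun _ => rfl), RecEnv.empty_under, Term.under_id, ihl, ihr]
          simp
      simp only [if_true, e1, e2, Formula.tree, den, List.map_id]
    · have e1 : RecEnv.under (Function.update RecEnv.empty X (Option.some (σ.code, xs, ψ.tree)))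
          τ.code Y = Function.update RecEnv.empty X (Option.some (σ.code, xs, ψ.tree)) := by
        simp only [RecEnv.under, this, if_true]
        funext Z
        by_cases hZ : Z = Y
        · subst hZ; simp [hY, RecEnv.empty]
        · simp [Function.update_of_ne hZ]
      simp only [if_neg hY, e1, Formula.tree, den, ih, List.map_id]
  | call Y us =>
    by_cases hY : Y = X
    · subst hY; simp [Formula.unfold, Formula.tree, den]
    · simp [Formula.unfold, Formula.tree, den, hY, RecEnv.empty]
  | _ => simp_all [Formula.tree, Formula.unfold, den, RecEnv.under, Term.under_id]

theorem smul_def (π : FinPerm) (φ : Formula) : π • φ = φ.rename π := rfl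

theorem tree_smul (π : FinPerm) (φ : Formula) : (π • φ).tree = φ.tree.tmap (Term.rename π) := by
  rw [smul_def]
  induction φ <;> simp_all [Formula.tree, Formula.rename, tmap]

theorem mem_termNames {a : Name} {us : List Term} :
    a ∈ termNames us ↔ a ∈ us.flatMap Term.nameList := by
  induction us with
  | nil => simp [termNames]
  | cons u us ih =>
    rw [List.flatMap_cons, List.mem_append, ← ih, termNames, List.foldr_cons, Finset.mem_union]
    cases u <;> simp [Term.names, Term.nameList, termNames]

theorem mem_supp_iff {a : Name} {φ : Formula} : a ∈ φ.supp ↔ a ∈ φ.tree.names := by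
  induction φ with
  | eq u v => cases u <;> cases v <;> simp [Formula.supp, Formula.tree, names, Term.names, Term.nameList]
  | ne u v => cases u <;> cases v <;> simp [Formula.supp, Formula.tree, names, Term.names, Term.nameList]
  | _ =>
    simp_all [Formula.supp, Formula.tree, names, mem_termNames] <;> first | tauto | exact or_comm

end Formula

open Term (tsub under)

/-! ## Lifting of fixpoints -/

instance : DecidableEq Term := fun u v =>
  match u, v with
  | .name a, .name b => decidable_of_iff (a = b) (by simp)
  | .var x, .var y => decidable_of_iff (x = y) (by simp)
  | .name _, .var _ => isFalse (by simp)
  | .var _, .name _ => isFalse (by simp)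

/-- A scope assigns slots to constants and name variables; the first entry of a key counts. -/
abbrev Scope := List (Term × ℕ)

namespace Scope

/-- The default 0 is harmless, since every slot that is ever assigned is positive. -/
def slot (sc : Scope) (u : Term) : ℕ := (sc.lookup u).getD 0

def enter (sc : Scope) : List Term → ℕ → Scope
  | [], _ => sc
  | u :: us, d => (u, d) :: enter sc us (d + 1)

theorem mem_enter {sc : Scope} {us : List Term} {d : ℕ} {p : Term × ℕ} (h : p ∈ sc.enter us d) :
    p ∈ sc ∨ (p.1 ∈ us ∧ d ≤ p.2 ∧ p.2 < d + us.length) := by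
  induction us generalizing d with
  | nil => exact Or.inl h
  | cons u us ih =>
    rcases List.mem_cons.1 h with rfl | h
    · right; simp
    · rcases ih h with h | ⟨h1, h2, h3⟩
      · exact Or.inl h
      · right; simp only [List.length_cons, List.mem_cons]; refine ⟨Or.inr h1, ?_, ?_⟩ <;> omega

theorem mem_enter_of_mem {sc : Scope} {us : List Term} {d : ℕ} {p : Term × ℕ} (h : p ∈ sc) :
    p ∈ sc.enter us d := by
  induction us generalizing d with
  | nil => exact h
  | cons u us ih => exact List.mem_cons_of_mem _ ih

theorem exists_mem_enter {sc : Scope} {us : List Term} {d : ℕ} {u : Term} (h : u ∈ us) :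
    ∃ ℓ, (u, ℓ) ∈ sc.enter us d := by
  induction us generalizing d with
  | nil => simp at h
  | cons v us ih =>
    rcases List.mem_cons.1 h with rfl | h
    · exact ⟨d, List.mem_cons_self⟩
    · obtain ⟨ℓ, hl⟩ := ih (d := d + 1) h
      exact ⟨ℓ, List.mem_cons_of_mem _ hl⟩

theorem slot_enter_of_notMem {sc : Scope} {us : List Term} {d : ℕ} {u : Term} (h : u ∉ us) :
    (sc.enter us d).slot u = sc.slot u := by
  induction us generalizing d with
  | nil => rfl
  | cons v us ih =>
    rw [List.mem_cons, not_or] at h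
    rw [enter, slot, List.lookup_cons, beq_false_of_ne h.1]
    exact ih h.2

theorem slot_mem {sc : Scope} {u : Term} (h : ∃ ℓ, (u, ℓ) ∈ sc) : (u, sc.slot u) ∈ sc := by
  induction sc with
  | nil => simp at h
  | cons p sc ih =>
    obtain ⟨v, m⟩ := p
    by_cases hu : u = v
    · subst hu; simp [slot, List.lookup_cons]
    · have : slot ((v, m) :: sc) u = slot sc u := by
        rw [slot, List.lookup_cons, beq_false_of_ne hu]; rfl
      rw [this]
      refine List.mem_cons_of_mem _ (ih ?_)
      obtain ⟨ℓ, hl⟩ := h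
      rcases List.mem_cons.1 hl with h | h
      · simp only [Prod.mk.injEq] at h; exact absurd h.1 hu
      · exact ⟨ℓ, h⟩

theorem slot_mem_or (sc : Scope) (u : Term) : (u, sc.slot u) ∈ sc ∨ sc.slot u = 0 := by
  by_cases h : ∃ ℓ, (u, ℓ) ∈ sc
  · exact Or.inl (slot_mem h)
  · right
    have : sc.lookup u = none := by
      rw [List.lookup_eq_none_iff]
      intro p hp
      simp only [beq_eq_false_iff_ne, bne_iff_ne, ne_eq]
      intro hu
      exact h ⟨p.2, by rw [hu]; exact hp⟩
    simp [slot, this]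

theorem slot_lt {sc : Scope} {d : ℕ} (hd : 0 < d) (h : ∀ p ∈ sc, p.2 < d) (u : Term) :
    sc.slot u < d := by
  rcases sc.slot_mem_or u with h' | h'
  · exact h _ h'
  · omega

end Scope

/-- Overwrites the values of the slots `d`, `d + 1`, … -/
def setSlots (τ : ℕ → Term) : ℕ → List Term → ℕ → Term
  | _, [] => τ
  | d, v :: vs => Function.update (setSlots τ (d + 1) vs) d v

theorem setSlots_of_lt {τ : ℕ → Term} {vs : List Term} {d ℓ : ℕ} (h : ℓ < d) :
    setSlots τ d vs ℓ = τ ℓ := by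
  induction vs generalizing d with
  | nil => rfl
  | cons v vs ih => rw [setSlots, Function.update_of_ne (by omega), ih (by omega)]

theorem comp_setSlots (f : Term → Term) (τ : ℕ → Term) (d : ℕ) (vs : List Term) :
    f ∘ setSlots τ d vs = setSlots (f ∘ τ) d (vs.map f) := by
  induction vs generalizing d with
  | nil => rfl
  | cons v vs ih =>
    rw [setSlots, List.map_cons, setSlots, ← ih]
    funext ℓ
    by_cases h : ℓ = d
    · subst h; simp
    · simp [Function.update_of_ne h]

theorem setSlots_ind {P : Term → Prop} {τ : ℕ → Term} (hτ : ∀ ℓ, P (τ ℓ)) {vs : List Term}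
    (hvs : ∀ v ∈ vs, P v) (d ℓ : ℕ) : P (setSlots τ d vs ℓ) := by
  induction vs generalizing d with
  | nil => exact hτ ℓ
  | cons v vs ih =>
    rw [setSlots]
    by_cases h : ℓ = d
    · subst h; simpa using hvs v (by simp)
    · rw [Function.update_of_ne h]; exact ih (fun w hw => hvs w (by simp [hw])) _

/-- The value of an entered key is the value stored in its slot. -/
theorem setSlots_slot_enter {sc : Scope} {τ : ℕ → Term} {us : List Term} (f : Term → Term) {d : ℕ}
    {u : Term} (h : u ∈ us) : setSlots τ d (us.map f) ((sc.enter us d).slot u) = f u := by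
  induction us generalizing d with
  | nil => simp at h
  | cons v us ih =>
    by_cases huv : u = v
    · subst huv; simp [setSlots, Scope.slot, Scope.enter, List.lookup_cons]
    · have hmem : u ∈ us := by simpa [huv] using h
      have e : (sc.enter (v :: us) d).slot u = (sc.enter us (d + 1)).slot u := by
        rw [Scope.enter, Scope.slot, List.lookup_cons, beq_false_of_ne huv]; rfl
      have hlt : d < (sc.enter us (d + 1)).slot u := by
        clear ih e h
        have : ∀ (us : List Term) (d : ℕ), u ∈ us → d ≤ (sc.enter us d).slot u := by
          intro us
          induction us with
          | nil => simp
          | cons w us ih =>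
            intro d hu
            rw [Scope.enter, Scope.slot, List.lookup_cons]
            by_cases h : u = w
            · simp [h]
            · rw [beq_false_of_ne h]
              have := ih (d + 1) (by simpa [h] using hu)
              change d ≤ Scope.slot _ _
              omega
        exact this us (d + 1) hmem
      rw [e, List.map_cons, setSlots, Function.update_of_ne (by omega)]
      exact ih hmem

def vars (xs : List ℕ) : List Term := xs.map Term.var

theorem mem_vars {x : ℕ} {xs : List ℕ} : Term.var x ∈ vars xs ↔ x ∈ xs := by simp [vars]

theorem name_notMem_vars {a : Name} {xs : List ℕ} : Term.name a ∉ vars xs := by simp [vars]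

@[simp] theorem length_vars (xs : List ℕ) : (vars xs).length = xs.length := by simp [vars]

/-- Going below a binder means giving the next slots to the bound variables, with the variables
themselves as values. All other terms have slots below `d`, which are not overwritten. -/
theorem under_slot {sc : Scope} {τ : ℕ → Term} {d : ℕ} (hd : 0 < d) (h : ∀ p ∈ sc, p.2 < d)
    (xs : List ℕ) : under (τ ∘ sc.slot) xs =
      setSlots τ d (vars xs) ∘ (sc.enter (vars xs) d).slot := by
  funext u
  have key : ∀ u ∉ vars xs, (setSlots τ d (vars xs)) ((sc.enter (vars xs) d).slot u) =
      τ (sc.slot u) := by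
    intro u hu
    rw [Scope.slot_enter_of_notMem hu, setSlots_of_lt (Scope.slot_lt hd h u)]
  cases u with
  | name a => exact (key _ name_notMem_vars).symm
  | var x =>
    by_cases hx : x ∈ xs
    · have := setSlots_slot_enter (sc := sc) (τ := τ) (d := d) id (mem_vars.2 hx)
      rw [List.map_id] at this
      simp only [under, hx, if_true, Function.comp]
      exact this.symm
    · simp only [under, hx, if_false, Function.comp]
      exact (key _ (by rwa [mem_vars])).symm

/-- The slots that are needed by the recursion variables in scope. -/
abbrev RecScope := List (ℕ × List ℕ)

def RecScope.slots (κ : RecScope) (X : ℕ) : List ℕ := (κ.lookup X).getD []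

/-- The name that stands for a slot in static texts. -/
def slotTerm (ℓ : ℕ) : Term := .name ⟨ℓ⟩

/-! ### Needed slots, and lifted trees. -/

namespace FTree

def slotsOf (sc : Scope) (bl : List ℕ) : Term → List ℕ
  | .name a => [sc.slot (.name a)]
  | .var x => if x ∈ bl then [] else [sc.slot (.var x)]

/-- The slots on which the meaning of a tree depends, where the name variables `bl` and the
recursion variables `rl` are bound. -/
def coll (sc : Scope) (κ : RecScope) (bl rl : List ℕ) : FTree → List ℕ
  | nil => []
  | node c m xs us l r => us.flatMap (slotsOf sc bl) ++
      ((if c = 9 ∧ m ∉ rl then κ.slots m else []) ++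
        (coll sc κ (xs ++ bl) (if 10 ≤ c then m :: rl else rl) l ++
          coll sc κ (xs ++ bl) (if 10 ≤ c then m :: rl else rl) r))

/-- The hidden parameters of a fixpoint. Its own parameters and recursion variable do not
contribute: recursive calls hand the hidden parameters on unchanged. -/
def hid (sc : Scope) (κ : RecScope) (X : ℕ) (xs : List ℕ) (l : FTree) : List ℕ :=
  (coll sc κ xs [X] l).dedup

/-- The lifted form: calls and fixpoints carry the values of the needed slots as additional
arguments, and `τ` gives the values of slots. -/
def lift (sc : Scope) (τ : ℕ → Term) (κ : RecScope) (d : ℕ) : FTree → FTree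
  | nil => nil
  | node c m xs us l r =>
    if c = 9 then node 9 m [] (us.map (τ ∘ sc.slot) ++ (κ.slots m).map τ) nil nil
    else if 10 ≤ c then node 9 m [] (us.map (τ ∘ sc.slot) ++ (hid sc κ m xs l).map τ) nil nil
    else node c m xs (us.map (τ ∘ sc.slot))
      (lift (sc.enter (vars xs) d) (setSlots τ d (vars xs)) κ (d + xs.length) l)
      (lift (sc.enter (vars xs) d) (setSlots τ d (vars xs)) κ (d + xs.length) r)

def WF : Finset ℕ → (ℕ → Option ℕ) → FTree → Prop
  | _, _, nil => True
  | Γ, Δ, node c m xs us l r =>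
    ((∀ u ∈ us, u.Scoped Γ) ∧ (c = 9 → Δ m = some us.length ∧ l = nil ∧ r = nil) ∧
      (10 ≤ c → xs.length = us.length ∧ r = nil) ∧ c ≤ 11) ∧
    WF (Γ ∪ xs.toFinset) (if 10 ≤ c then Function.update Δ m (some xs.length) else Δ) l ∧
    WF (Γ ∪ xs.toFinset) (if 10 ≤ c then Function.update Δ m (some xs.length) else Δ) r

/-- The body of a fixpoint over slots. -/
def fixBody (sc : Scope) (δ : RecEnv) (X : ℕ) (xs : List ℕ) (l : FTree) : FTree :=
  den (under (slotTerm ∘ sc.slot) xs) (Function.update δ X none) l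

def depth : FTree → ℕ
  | nil => 0
  | node _ _ xs _ l r => xs.length + max l.depth r.depth

def nodes : FTree → ℕ
  | nil => 0
  | node _ _ _ _ l r => 1 + (l.nodes + r.nodes)

def binders : FTree → List ℕ
  | nil => []
  | node c m _ _ l r => (if 10 ≤ c then [m] else []) ++ (l.binders ++ r.binders)

end FTree

open FTree

/-- An occurrence of a subtree together with its static context. -/
structure Ctx where
  sc : Scope
  κ : RecScope
  δ : RecEnv
  d : ℕ
  t : FTree

/-- The lifted definition of a recursion variable. -/
structure Def where
  c : ℕ
  xs : List ℕ
  h : List ℕ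
  B : FTree
  d : ℕ
  T : FTree

namespace Ctx

/-- The context of the children of a node. -/
def child (C : Ctx) (c m : ℕ) (xs : List ℕ) (l t : FTree) : Ctx where
  sc := C.sc.enter (vars xs) C.d
  κ := if 10 ≤ c then (m, hid C.sc C.κ m xs l) :: C.κ else C.κ
  δ := if 10 ≤ c then Function.update C.δ m (some (c, xs, fixBody C.sc C.δ m xs l)) else C.δ
  d := C.d + xs.length
  t := t

def lift (C : Ctx) (τ : ℕ → Term) : FTree := FTree.lift C.sc τ C.κ C.d C.t

/-- The definition that a fixpoint node makes. -/
def entry (C : Ctx) : Option (ℕ × Def) :=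
  match C.t with
  | .nil => none
  | .node c m xs _ l _ =>
    if 10 ≤ c then some (m, ⟨c, xs, hid C.sc C.κ m xs l, fixBody C.sc C.δ m xs l, C.d,
      (C.child c m xs l l).lift slotTerm⟩)
    else none

end Ctx

/-- All occurrences of subtrees with their contexts. -/
def ctxs (sc : Scope) (κ : RecScope) (δ : RecEnv) (d : ℕ) : FTree → List Ctx
  | .nil => []
  | .node c m xs us l r => ⟨sc, κ, δ, d, .node c m xs us l r⟩ ::
      (ctxs (sc.enter (vars xs) d) (if 10 ≤ c then (m, hid sc κ m xs l) :: κ else κ)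
        (if 10 ≤ c then Function.update δ m (some (c, xs, fixBody sc δ m xs l)) else δ)
        (d + xs.length) l ++
      ctxs (sc.enter (vars xs) d) (if 10 ≤ c then (m, hid sc κ m xs l) :: κ else κ)
        (if 10 ≤ c then Function.update δ m (some (c, xs, fixBody sc δ m xs l)) else δ)
        (d + xs.length) r)

def Ctx.all (C : Ctx) : List Ctx := ctxs C.sc C.κ C.δ C.d C.t

theorem Ctx.all_node (C : Ctx) {c m : ℕ} {xs : List ℕ} {us : List Term} {l r : FTree}
    (h : C.t = .node c m xs us l r) :
    C.all = C :: ((C.child c m xs l l).all ++ (C.child c m xs l r).all) := by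
  obtain ⟨sc, κ, δ, d, t⟩ := C
  simp only at h
  subst h
  simp only [Ctx.all, ctxs, Ctx.child]

theorem Ctx.all_nil (C : Ctx) (h : C.t = .nil) : C.all = [] := by
  rw [Ctx.all, h, ctxs]

/-- Induction over contexts along the tree. -/
theorem Ctx.induction {P : Ctx → Prop} (nil : ∀ C : Ctx, C.t = .nil → P C)
    (node : ∀ (C : Ctx) c m xs us l r, C.t = .node c m xs us l r → P (C.child c m xs l l) →
      P (C.child c m xs l r) → P C) (C : Ctx) : P C := by
  obtain ⟨sc, κ, δ, d, t⟩ := C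
  induction t generalizing sc κ δ d with
  | nil => exact nil _ rfl
  | node c m xs us l r ihl ihr => exact node _ c m xs us l r rfl (ihl _ _ _ _) (ihr _ _ _ _)

theorem Ctx.length_all (C : Ctx) : C.all.length = C.t.nodes := by
  induction C using Ctx.induction with
  | nil C h => rw [C.all_nil h, h]; rfl
  | node C c m xs us l r h ihl ihr =>
    rw [C.all_node h, h, List.length_cons, List.length_append, ihl, ihr]
    simp only [Ctx.child, nodes]; omega

theorem Ctx.depth_all (C : Ctx) : ∀ C' ∈ C.all, C'.d + C'.t.depth ≤ C.d + C.t.depth := by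
  induction C using Ctx.induction with
  | nil C h => rw [C.all_nil h]; simp
  | node C c m xs us l r h ihl ihr =>
    intro C' hC'
    rw [C.all_node h, List.mem_cons, List.mem_append] at hC'
    rcases hC' with rfl | hC' | hC'
    · rfl
    · have := ihl _ hC'; rw [h]; simp only [Ctx.child, depth] at this ⊢; omega
    · have := ihr _ hC'; rw [h]; simp only [Ctx.child, depth] at this ⊢; omega

/-- As each recursion variable is bound at most once in `φ₀`, this makes look-ups in the table
unambiguous. -/
theorem Ctx.keys_entries (C : Ctx) :
    (C.all.filterMap Ctx.entry).map Prod.fst = C.t.binders := by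
  induction C using Ctx.induction with
  | nil C h => rw [C.all_nil h, h]; rfl
  | node C c m xs us l r h ihl ihr =>
    rw [C.all_node h, h, List.filterMap_cons, List.filterMap_append]
    simp only [Ctx.child] at ihl ihr
    have he : C.entry = if 10 ≤ c then some (m, ⟨c, xs, hid C.sc C.κ m xs l,
        fixBody C.sc C.δ m xs l, C.d, (C.child c m xs l l).lift slotTerm⟩) else none := by
      rw [Ctx.entry, h]
    rw [he]
    split_ifs with hc <;> simp only [List.map_append, List.map_cons, binders, hc, if_true, if_false, List.nil_append] <;>
      simp only [Ctx.child, hc, if_true, if_false] at ihl ihr ⊢ <;> rw [ihl, ihr] <;> rfl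

/-- The table of the definitions made in a context. -/
def Ctx.table (C : Ctx) (X : ℕ) : Option Def := (C.all.filterMap Ctx.entry).lookup X

theorem lookup_of_mem_of_nodup {β : Type*} {L : List (ℕ × β)} (h : (L.map Prod.fst).Nodup)
    {x : ℕ} {y : β} (hm : (x, y) ∈ L) : L.lookup x = some y := by
  induction L with
  | nil => simp at hm
  | cons p L ih =>
    obtain ⟨x', y'⟩ := p
    rw [List.map_cons, List.nodup_cons] at h
    rw [List.lookup_cons]
    rcases List.mem_cons.1 hm with hm | hmem
    · simp only [Prod.mk.injEq] at hm; obtain ⟨rfl, rfl⟩ := hm; simp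
    · have : x ≠ x' := by
        rintro rfl
        exact h.1 (List.mem_map.2 ⟨(x, y), hmem, rfl⟩)
      rw [beq_false_of_ne this]
      exact ih h.2 hmem

theorem mem_of_lookup {β : Type*} {L : List (ℕ × β)} {x : ℕ} {y : β}
    (h : L.lookup x = some y) : (x, y) ∈ L := by
  induction L with
  | nil => simp at h
  | cons p L ih =>
    obtain ⟨x', y'⟩ := p
    rw [List.lookup_cons] at h
    by_cases hx : x = x'
    · subst hx; simp at h; simp [h]
    · rw [beq_false_of_ne hx] at h; exact List.mem_cons_of_mem _ (ih h)

theorem Ctx.table_of_mem {C C' : Ctx} (h : C.t.binders.Nodup) (hC : C' ∈ C.all) {X : ℕ} {D : Def}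
    (he : C'.entry = some (X, D)) : C.table X = some D :=
  lookup_of_mem_of_nodup (by rwa [Ctx.keys_entries]) (List.mem_filterMap.2 ⟨_, hC, he⟩)

theorem Ctx.exists_of_table {C : Ctx} {X : ℕ} {D : Def} (h : C.table X = some D) :
    ∃ C' ∈ C.all, C'.entry = some (X, D) :=
  List.mem_filterMap.1 (mem_of_lookup h)

open FTree

/-! ## Validity of contexts, and the formula denoted by a lifted tree -/

theorem mem_flatMap_slotsOf {sc : Scope} {bl : List ℕ} {us : List Term} {ℓ : ℕ} :
    ℓ ∈ us.flatMap (slotsOf sc bl) ↔ ∃ u ∈ us, (∀ x ∈ bl, u ≠ .var x) ∧ ℓ = sc.slot u := by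
  rw [List.mem_flatMap]
  refine exists_congr fun u => and_congr_right fun _ => ?_
  cases u with
  | name a => simp [slotsOf]
  | var x =>
    by_cases h : x ∈ bl
    · simp only [slotsOf, h, if_true, List.not_mem_nil, false_iff, not_and]
      intro h'; exact absurd rfl (h' x h)
    · simp only [slotsOf, h, if_false, List.mem_singleton, ne_eq, Term.var.injEq, iff_and_self]
      rintro - y hy rfl; exact h hy

theorem mem_coll_node {sc : Scope} {κ : RecScope} {bl rl : List ℕ} {c m : ℕ} {xs : List ℕ}
    {us : List Term} {l r : FTree} {ℓ : ℕ} : ℓ ∈ coll sc κ bl rl (node c m xs us l r) ↔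
      ℓ ∈ us.flatMap (slotsOf sc bl) ∨ ℓ ∈ (if c = 9 ∧ m ∉ rl then κ.slots m else []) ∨
      ℓ ∈ coll sc κ (xs ++ bl) (if 10 ≤ c then m :: rl else rl) l ∨
      ℓ ∈ coll sc κ (xs ++ bl) (if 10 ≤ c then m :: rl else rl) r := by
  rw [coll]
  simp only [List.mem_append]

/-- The slots of the free variables of the tree and of the recursion variables in scope. -/
theorem mem_coll {sc : Scope} {κ : RecScope} {bl rl : List ℕ} {t : FTree} {ℓ : ℕ}
    (h : ℓ ∈ coll sc κ bl rl t) : (∃ u, ℓ = sc.slot u) ∨ ∃ X, ℓ ∈ κ.slots X := by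
  induction t generalizing bl rl with
  | nil => simp [coll] at h
  | node c m xs us l r ihl ihr =>
    rw [mem_coll_node] at h
    rcases h with h | h | h | h
    · obtain ⟨u, -, -, h⟩ := mem_flatMap_slotsOf.1 h
      exact Or.inl ⟨u, h⟩
    · split_ifs at h with hc
      · exact Or.inr ⟨m, h⟩
      · simp at h
    · exact ihl h
    · exact ihr h

/-- Slots of well-scoped trees occur in the scope. -/
theorem mem_coll_of_wf {sc : Scope} {κ : RecScope} {bl rl : List ℕ} {t : FTree} {ℓ : ℕ}
    {Γ : Finset ℕ} {Δ : ℕ → Option ℕ} (hwf : t.WF Γ Δ)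
    (hn : ∀ a ∈ t.names, ∃ k, (Term.name a, k) ∈ sc)
    (hv : ∀ x ∈ Γ, x ∈ bl ∨ ∃ k, (Term.var x, k) ∈ sc)
    (h : ℓ ∈ coll sc κ bl rl t) : (∃ u, (u, ℓ) ∈ sc) ∨ ∃ X, ℓ ∈ κ.slots X := by
  induction t generalizing bl rl Γ Δ with
  | nil => simp [coll] at h
  | node c m xs us l r ihl ihr =>
    rw [mem_coll_node] at h
    obtain ⟨⟨hu, -⟩, hl, hr⟩ := hwf
    have hv' : ∀ x ∈ Γ ∪ xs.toFinset, x ∈ xs ++ bl ∨ ∃ k, (Term.var x, k) ∈ sc := by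
      intro x hx
      rcases Finset.mem_union.1 hx with hx | hx
      · rcases hv x hx with h | h
        · exact Or.inl (List.mem_append_right _ h)
        · exact Or.inr h
      · exact Or.inl (List.mem_append_left _ (List.mem_toFinset.1 hx))
    rcases h with h | h | h | h
    · obtain ⟨u, hu1, hu2, rfl⟩ := mem_flatMap_slotsOf.1 h
      refine Or.inl ⟨u, Scope.slot_mem ?_⟩
      cases u with
      | name a =>
        exact hn a (List.mem_append_left _ (List.mem_flatMap.2 ⟨_, hu1, by simp [Term.nameList]⟩))
      | var x =>
        rcases hv x (hu _ hu1) with h | h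
        · exact absurd rfl (hu2 x h)
        · exact h
    · split_ifs at h with hc
      · exact Or.inr ⟨m, h⟩
      · simp at h
    · exact ihl hl (fun a ha => hn a (by simp [names, ha])) hv' h
    · exact ihr hr (fun a ha => hn a (by simp [names, ha])) hv' h

/-- Hidden parameters are closed under recursion: below the binder a slot is needed because it was
needed before, or because it belongs to one of the new parameters, or because of a call of `X`,
which needs the slots `h`. For `h = hid …` this gives `names_def`. -/
theorem coll_enter {sc : Scope} {κ : RecScope} {xs : List ℕ} {d X : ℕ} {h : List ℕ} {t : FTree}
    {bl rl : List ℕ} {ℓ : ℕ}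
    (hl : ℓ ∈ coll (sc.enter (vars xs) d) ((X, h) :: κ) bl rl t) :
    ℓ ∈ coll sc κ (bl ++ xs) (rl ++ [X]) t ∨ (∃ u ∈ vars xs, ℓ = (sc.enter (vars xs) d).slot u) ∨
      ℓ ∈ h := by
  induction t generalizing bl rl with
  | nil => simp [coll] at hl
  | node c m ys us l r ihl ihr =>
    rw [mem_coll_node] at hl
    rw [mem_coll_node, ← List.append_assoc ys bl xs]
    have e : (if 10 ≤ c then m :: (rl ++ [X]) else rl ++ [X]) =
        (if 10 ≤ c then m :: rl else rl) ++ [X] := by split_ifs <;> rfl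
    rw [e]
    rcases hl with hl | hl | hl | hl
    · obtain ⟨u, hu, hu', rfl⟩ := mem_flatMap_slotsOf.1 hl
      by_cases hux : u ∈ vars xs
      · exact Or.inr (Or.inl ⟨u, hux, rfl⟩)
      · left; left
        refine mem_flatMap_slotsOf.2 ⟨u, hu, ?_, Scope.slot_enter_of_notMem hux⟩
        intro x hx hux'
        rcases List.mem_append.1 hx with hx | hx
        · exact hu' x hx hux'
        · exact hux (by rw [hux']; exact mem_vars.2 hx)
    · split_ifs at hl with hc
      · by_cases hm : m = X
        · subst hm
          right; right
          simpa [RecScope.slots] using hl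
        · left; right; left
          have : ¬ m ∈ rl ++ [X] := by simp [hm, hc.2]
          simp only [hc.1, this, not_false_eq_true, and_self, if_true]
          rw [RecScope.slots, List.lookup_cons, beq_false_of_ne hm] at hl
          exact hl
      · simp at hl
    · rcases ihl hl with h | h
      · left; right; right; left; exact h
      · exact Or.inr h
    · rcases ihr hl with h | h
      · left; right; right; right; exact h
      · exact Or.inr h

theorem under_under (e : Term → Term) (xs ys : List ℕ) :
    under (under e xs) ys = under e (ys ++ xs) := by
  funext u
  cases u with
  | name a => rfl
  | var x => by_cases h1 : x ∈ ys <;> by_cases h2 : x ∈ xs <;> simp [under, h1, h2]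

/-- The names in the body of a fixpoint are the needed slots. -/
theorem mem_names_den {sc : Scope} {κ : RecScope} {δ : RecEnv} {t : FTree} {bl rl : List ℕ}
    {δ' : RecEnv} {Γ : Finset ℕ} {Δ : ℕ → Option ℕ} (hwf : t.WF Γ Δ)
    (h1 : ∀ X ∈ rl, δ' X = none) (h2 : ∀ X ∉ rl, δ' X = δ X)
    (h3 : ∀ X, Δ X ≠ none → X ∉ rl → ∃ p, δ X = some p ∧ ∀ a, a ∈ p.2.2.names ↔ a.id ∈ κ.slots X)
    (a : Name) : a ∈ (den (under (slotTerm ∘ sc.slot) bl) δ' t).names ↔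
      a.id ∈ coll sc κ bl rl t := by
  induction t generalizing bl rl δ' Γ Δ with
  | nil => simp [den, coll, names]
  | node c m xs us l r ihl ihr =>
    obtain ⟨⟨hu, hc9, -⟩, hl, hr⟩ := hwf
    have hus : a ∈ (us.map (under (slotTerm ∘ sc.slot) bl)).flatMap Term.nameList ↔
        a.id ∈ us.flatMap (slotsOf sc bl) := by
      rw [mem_flatMap_slotsOf, List.flatMap_map, List.mem_flatMap]
      refine exists_congr fun u => and_congr_right fun _ => ?_
      cases u with
      | name b =>
        obtain ⟨i⟩ := a
        simp [under, slotTerm, Term.nameList]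
      | var x =>
        obtain ⟨i⟩ := a
        by_cases h : x ∈ bl
        · simp only [under, h, if_true, Term.nameList, List.not_mem_nil, false_iff, not_and]
          intro h'; exact absurd rfl (h' x h)
        · simp only [under, h, if_false, slotTerm, Function.comp, Term.nameList,
            List.mem_singleton, Name.mk.injEq, ne_eq, Term.var.injEq, iff_and_self]
          rintro - y hy rfl; exact h hy
    by_cases hc : c = 9 ∧ m ∉ rl
    · obtain ⟨rfl, hm⟩ := hc
      obtain ⟨hΔ, rfl, rfl⟩ := hc9 rfl
      obtain ⟨⟨c', xs', B⟩, hp, hB⟩ := h3 m (by rw [hΔ]; simp) hm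
      rw [den_node_of_some (by rw [h2 m hm, hp]), names, List.mem_append, List.mem_append, hus,
        mem_coll_node]
      simp only at hB
      simp only [names, coll, List.not_mem_nil, or_false, hB, hm, not_false_eq_true, and_self,
        if_true]
    · have hnone : c = 9 → δ' m = none := fun h9 => h1 m (by
        by_contra hm; exact hc ⟨h9, hm⟩)
      have hrec : ∀ (t' : FTree) (Γ' : Finset ℕ), t'.WF Γ'
          (if 10 ≤ c then Function.update Δ m (some xs.length) else Δ) →
          (∀ {bl rl : List ℕ} {δ' : RecEnv} {Γ : Finset ℕ} {Δ : ℕ → Option ℕ}, t'.WF Γ Δ →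
            (∀ X ∈ rl, δ' X = none) → (∀ X ∉ rl, δ' X = δ X) →
            (∀ X, Δ X ≠ none → X ∉ rl → ∃ p, δ X = some p ∧
              ∀ a, a ∈ p.2.2.names ↔ a.id ∈ κ.slots X) →
            (a ∈ (den (under (slotTerm ∘ sc.slot) bl) δ' t').names ↔ a.id ∈ coll sc κ bl rl t')) →
          (a ∈ (den (under (slotTerm ∘ sc.slot) (xs ++ bl)) (δ'.under c m) t').names ↔
            a.id ∈ coll sc κ (xs ++ bl) (if 10 ≤ c then m :: rl else rl) t') := by
        intro t' Γ' hw ih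
        refine ih hw ?_ ?_ ?_
        · intro X hX
          unfold RecEnv.under
          split_ifs at hX ⊢ with h10
          · rw [Function.update_apply]
            split_ifs with hXm
            · rfl
            · exact h1 X (by simpa [hXm] using hX)
          · exact h1 X hX
        · intro X hX
          unfold RecEnv.under
          split_ifs at hX ⊢ with h10
          · rw [List.mem_cons, not_or] at hX
            rw [Function.update_of_ne hX.1]; exact h2 X hX.2
          · exact h2 X hX
        · intro X hX hX'
          split_ifs at hX hX' with h10
          · rw [List.mem_cons, not_or] at hX'
            rw [Function.update_of_ne hX'.1] at hX
            exact h3 X hX hX'.2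
          · exact h3 X hX hX'
      rw [den_node_of_none hnone, names, List.mem_append, List.mem_append, hus, coll,
        List.mem_append, List.mem_append, List.mem_append, if_neg hc, under_under,
        hrec l _ hl ihl, hrec r _ hr ihr]
      simp

/-- A context is valid if its tree is well formed, the scope covers its names and variables, and
the recursion environment agrees with the table `tb`. -/
structure Ctx.Valid (tb : ℕ → Option Def) (Γ : Finset ℕ) (Δ : ℕ → Option ℕ) (C : Ctx) : Prop where
  pos : 0 < C.d
  slots : ∀ p ∈ C.sc, 0 < p.2 ∧ p.2 < C.d
  wf : C.t.WF Γ Δ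
  keys_names : ∀ a ∈ C.t.names, ∃ k, (Term.name a, k) ∈ C.sc
  keys_vars : ∀ x ∈ Γ, ∃ k, (Term.var x, k) ∈ C.sc
  recs : ∀ X a, Δ X = some a → ∃ D, tb X = some D ∧ D.xs.length = a ∧ C.κ.slots X = D.h ∧
    C.δ X = some (D.c, D.xs, D.B) ∧ ∀ a, a ∈ D.B.names ↔ a.id ∈ D.h
  κ_slots : ∀ X, ∀ ℓ ∈ C.κ.slots X, 0 < ℓ ∧ ℓ < C.d
  total : ∀ X, ∃ p, C.δ X = some p
  ten_le : ∀ X p, C.δ X = some p → 10 ≤ p.1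
  closed : ∀ g : Name → Term, (∀ a, ∃ b, g a = .name b) → ∀ X p, C.δ.tsub g X = some p →
    ClosedBody X p
  δ_slots : ∀ X p, C.δ X = some p → ∀ a ∈ p.2.2.names, a.id < C.d

namespace Ctx.Valid

variable {tb : ℕ → Option Def} {Γ : Finset ℕ} {Δ : ℕ → Option ℕ} {C : Ctx}

theorem lt (h : C.Valid tb Γ Δ) : ∀ p ∈ C.sc, p.2 < C.d := fun p hp => (h.slots p hp).2

theorem slot_lt (h : C.Valid tb Γ Δ) (u : Term) : C.sc.slot u < C.d := Scope.slot_lt h.pos h.lt u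

theorem coll_pos_lt (h : C.Valid tb Γ Δ) {t : FTree} {Γ' : Finset ℕ} {Δ' : ℕ → Option ℕ}
    (hwf : t.WF Γ' Δ') {bl rl : List ℕ} (hn : ∀ a ∈ t.names, ∃ k, (Term.name a, k) ∈ C.sc)
    (hΓ : ∀ x ∈ Γ', x ∈ bl ∨ x ∈ Γ) {ℓ : ℕ} (hl : ℓ ∈ coll C.sc C.κ bl rl t) : 0 < ℓ ∧ ℓ < C.d := by
  rcases mem_coll_of_wf hwf hn (fun x hx => (hΓ x hx).imp_right (h.keys_vars x)) hl with
    ⟨u, hu⟩ | ⟨X, hX⟩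
  · exact h.slots _ hu
  · exact h.κ_slots X ℓ hX

theorem names_fixBody (h : C.Valid tb Γ Δ) {c m : ℕ} {xs : List ℕ} {us : List Term} {l r : FTree}
    (ht : C.t = .node c m xs us l r) (hc : 10 ≤ c) (a : Name) :
    a ∈ (fixBody C.sc C.δ m xs l).names ↔ a.id ∈ hid C.sc C.κ m xs l := by
  have hwf := h.wf
  rw [ht] at hwf
  obtain ⟨-, hl, -⟩ := hwf
  rw [if_pos hc] at hl
  rw [hid, List.mem_dedup, fixBody]
  refine mem_names_den (δ := C.δ) hl ?_ ?_ ?_ a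
  · intro X hX; simp only [List.mem_singleton] at hX; subst hX; simp
  · intro X hX; simp only [List.mem_singleton] at hX; rw [Function.update_of_ne hX]
  · intro X hX hX'
    simp only [List.mem_singleton] at hX'
    rw [Function.update_of_ne hX'] at hX
    obtain ⟨k, hk⟩ := Option.ne_none_iff_exists'.1 hX
    obtain ⟨D, -, -, h3, h4, h5⟩ := h.recs X k hk
    exact ⟨_, h4, by rw [h3]; exact h5⟩

theorem hid_pos_lt (h : C.Valid tb Γ Δ) {c m : ℕ} {xs : List ℕ} {us : List Term} {l r : FTree}
    (ht : C.t = .node c m xs us l r) {ℓ : ℕ} (hl : ℓ ∈ hid C.sc C.κ m xs l) : 0 < ℓ ∧ ℓ < C.d := by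
  have hwf := h.wf
  have hk := h.keys_names
  rw [ht] at hwf hk
  obtain ⟨-, hwf, -⟩ := hwf
  rw [hid, List.mem_dedup] at hl
  refine h.coll_pos_lt hwf (fun a ha => hk a (by simp [names, ha])) ?_ hl
  intro x hx
  rw [Finset.mem_union, List.mem_toFinset] at hx
  exact hx.symm

end Ctx.Valid

theorem RecScope.slots_cons_self (κ : RecScope) (X : ℕ) (h : List ℕ) :
    RecScope.slots ((X, h) :: κ) X = h := by simp [RecScope.slots]

theorem RecScope.slots_cons_of_ne (κ : RecScope) {X Y : ℕ} (h : List ℕ) (hY : Y ≠ X) :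
    RecScope.slots ((X, h) :: κ) Y = κ.slots Y := by
  simp [RecScope.slots, List.lookup_cons, beq_false_of_ne hY]

namespace Ctx.Valid

variable {tb : ℕ → Option Def} {Γ : Finset ℕ} {Δ : ℕ → Option ℕ} {C : Ctx}

/-- The only substantial case is that of a fixpoint node: the names in its body are its hidden slots
by `names_fixBody`, and the body is closed by `closedBody_den`, because every outer variable is
replaced by a name and every outer recursion variable by a closed body. -/
theorem child (h : C.Valid tb Γ Δ) {c m : ℕ} {xs : List ℕ} {us : List Term} {l r t : FTree}
    (ht : C.t = .node c m xs us l r) (htb : ∀ X D, C.entry = some (X, D) → tb X = some D)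
    (hsub : t = l ∨ t = r) :
    (C.child c m xs l t).Valid tb (Γ ∪ xs.toFinset)
      (if 10 ≤ c then Function.update Δ m (some xs.length) else Δ) := by
  have hwf := h.wf
  have hk := h.keys_names
  rw [ht] at hwf hk
  obtain ⟨-, hl, hr⟩ := hwf
  have hB := fun hc => h.names_fixBody ht hc
  have hh := fun ℓ => h.hid_pos_lt (ℓ := ℓ) ht
  have hent : 10 ≤ c → C.entry = some (m, ⟨c, xs, hid C.sc C.κ m xs l, fixBody C.sc C.δ m xs l, C.d,
      (C.child c m xs l l).lift slotTerm⟩) := by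
    intro hc; rw [Ctx.entry, ht]; simp only [hc, if_true]
  refine ⟨?_, ?_, ?_, ?_, ?_, ?_, ?_, ?_, ?_, ?_, ?_⟩
  · have := h.pos; simp only [Ctx.child]; omega
  · intro p hp
    rcases Scope.mem_enter hp with hp | ⟨-, h2, h3⟩
    · have := h.slots p hp; simp only [Ctx.child]; omega
    · have := h.pos; simp only [Ctx.child, length_vars] at h3 ⊢; omega
  · rcases hsub with rfl | rfl
    · exact hl
    · exact hr
  · intro a ha
    obtain ⟨k, hk⟩ := hk a (by
      rcases hsub with rfl | rfl <;> simp only [Ctx.child] at ha <;> simp [names, ha])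
    exact ⟨k, Scope.mem_enter_of_mem hk⟩
  · intro x hx
    rcases Finset.mem_union.1 hx with hx | hx
    · obtain ⟨k, hk⟩ := h.keys_vars x hx
      exact ⟨k, Scope.mem_enter_of_mem hk⟩
    · exact Scope.exists_mem_enter (mem_vars.2 (List.mem_toFinset.1 hx))
  · intro X k hX
    simp only [Ctx.child]
    split_ifs at hX ⊢ with hc
    · by_cases hXm : X = m
      · subst hXm
        refine ⟨_, htb _ _ (hent hc), ?_, ?_, ?_, ?_⟩
        · simpa using hX
        · rw [RecScope.slots_cons_self]
        · simp
        · exact hB hc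
      · rw [Function.update_of_ne hXm] at hX
        obtain ⟨D, h1, h2, h3, h4, h5⟩ := h.recs X k hX
        exact ⟨D, h1, h2, by rw [RecScope.slots_cons_of_ne _ _ hXm, h3],
          by rw [Function.update_of_ne hXm, h4], h5⟩
    · exact h.recs X k hX
  · intro X ℓ hl
    have key : 0 < ℓ ∧ ℓ < C.d := by
      simp only [Ctx.child] at hl
      split_ifs at hl with hc
      · by_cases hXm : X = m
        · subst hXm; rw [RecScope.slots_cons_self] at hl; exact hh ℓ hl
        · rw [RecScope.slots_cons_of_ne _ _ hXm] at hl; exact h.κ_slots X ℓ hl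
      · exact h.κ_slots X ℓ hl
    simp only [Ctx.child]; omega
  · intro X
    simp only [Ctx.child]
    split_ifs with hc
    · by_cases hXm : X = m
      · subst hXm; simp
      · rw [Function.update_of_ne hXm]; exact h.total X
    · exact h.total X
  · intro X p hp
    simp only [Ctx.child] at hp
    split_ifs at hp with hc
    · by_cases hXm : X = m
      · subst hXm; simp at hp; subst hp; exact hc
      · rw [Function.update_of_ne hXm] at hp; exact h.ten_le X p hp
    · exact h.ten_le X p hp
  · intro g hg X p hp
    simp only [Ctx.child] at hp
    split_ifs at hp with hc
    · by_cases hXm : X = m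
      · subst hXm
        simp only [RecEnv.tsub, Function.update_self, Option.map_some, Option.some.injEq] at hp
        subst hp
        rw [fixBody, tmap_den, ← Term.under_tsub]
        have e : RecEnv.tsub g (Function.update C.δ X none) =
            Function.update (C.δ.tsub g) X none := by
          funext Y
          by_cases hY : Y = X
          · subst hY; simp [RecEnv.tsub]
          · simp [RecEnv.tsub, Function.update_of_ne hY]
        rw [e]
        refine closedBody_den ?_ ?_ (h.closed g hg) hc X xs l
        · intro u
          exact hg _
        · intro Y
          obtain ⟨p, hp⟩ := h.total Y
          exact ⟨_, by simp only [RecEnv.tsub, hp]; rfl⟩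
      · refine h.closed g hg X p ?_
        simpa only [RecEnv.tsub, Function.update_of_ne hXm] using hp
    · exact h.closed g hg X p hp
  · intro X p hp a ha
    have key : a.id < C.d := by
      simp only [Ctx.child] at hp
      split_ifs at hp with hc
      · by_cases hXm : X = m
        · subst hXm; simp at hp; subst hp
          exact (hh _ ((hB hc a).1 ha)).2
        · rw [Function.update_of_ne hXm] at hp; exact h.δ_slots X p hp a ha
      · exact h.δ_slots X p hp a ha
    simp only [Ctx.child]; omega

end Ctx.Valid

theorem Ctx.valid_all {tb : ℕ → Option Def} {C : Ctx} : ∀ {Γ : Finset ℕ} {Δ : ℕ → Option ℕ},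
    C.Valid tb Γ Δ → (∀ C' ∈ C.all, ∀ X D, C'.entry = some (X, D) → tb X = some D) →
    ∀ C' ∈ C.all, ∃ Γ Δ, C'.Valid tb Γ Δ := by
  induction C using Ctx.induction with
  | nil C h => intro Γ Δ _ _; rw [C.all_nil h]; simp
  | node C c m xs us l r h ihl ihr =>
    intro Γ Δ hv htb C' hC'
    rw [C.all_node h] at htb hC'
    rw [List.mem_cons, List.mem_append] at hC'
    have hC := htb C List.mem_cons_self
    rcases hC' with rfl | hC' | hC'
    · exact ⟨_, _, hv⟩
    · exact ihl (hv.child h hC (Or.inl rfl)) (fun C'' hC'' => htb C'' (by simp [hC''])) C' hC'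
    · exact ihr (hv.child h hC (Or.inr rfl)) (fun C'' hC'' => htb C'' (by simp [hC''])) C' hC'

/-- The value of a slot in a list of needed slots with given values. -/
def look (h : List ℕ) (vs : List Term) (a : Name) : Term :=
  ((h.zip vs).lookup a.id).getD (.name a)

theorem look_map {h : List ℕ} (τ : ℕ → Term) {a : Name} (ha : a.id ∈ h) :
    look h (h.map τ) a = τ a.id := by
  unfold look
  induction h with
  | nil => simp at ha
  | cons ℓ h ih =>
    rw [List.map_cons, List.zip_cons_cons, List.lookup_cons]
    by_cases hl : a.id = ℓ
    · simp [hl]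
    · rw [beq_false_of_ne hl]
      exact ih (by simpa [hl] using ha)

theorem look_mem {h : List ℕ} {vs : List Term} {a : Name} (ha : a.id ∈ h)
    (hlen : vs.length = h.length) : look h vs a ∈ vs := by
  unfold look
  induction h generalizing vs with
  | nil => simp at ha
  | cons ℓ h ih =>
    cases vs with
    | nil => simp at hlen
    | cons v vs =>
      rw [List.zip_cons_cons, List.lookup_cons]
      by_cases hl : a.id = ℓ
      · simp [hl]
      · rw [beq_false_of_ne hl]
        exact List.mem_cons_of_mem _ (ih (by simpa [hl] using ha) (by simpa using hlen))

theorem look_map_right {h : List ℕ} {vs : List Term} (f : Term → Term) {a : Name} (ha : a.id ∈ h)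
    (hlen : vs.length = h.length) : look h (vs.map f) a = f (look h vs a) := by
  unfold look
  induction h generalizing vs with
  | nil => simp at ha
  | cons ℓ h ih =>
    cases vs with
    | nil => simp at hlen
    | cons v vs =>
      rw [List.map_cons, List.zip_cons_cons, List.zip_cons_cons, List.lookup_cons, List.lookup_cons]
      by_cases hl : a.id = ℓ
      · simp [hl]
      · rw [beq_false_of_ne hl]
        exact ih (by simpa [hl] using ha) (by simpa using hlen)

theorem look_inj {h : List ℕ} (hnd : h.Nodup) {vs ws : List Term}
    (h1 : vs.length = h.length) (h2 : ws.length = h.length)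
    (heq : ∀ ℓ ∈ h, look h vs ⟨ℓ⟩ = look h ws ⟨ℓ⟩) : vs = ws := by
  induction h generalizing vs ws with
  | nil => simp_all
  | cons ℓ h ih =>
    cases vs with
    | nil => simp at h1
    | cons v vs =>
      cases ws with
      | nil => simp at h2
      | cons w ws =>
        rw [List.nodup_cons] at hnd
        have e : ∀ vs : List Term, ∀ v k, k ≠ ℓ → look (ℓ :: h) (v :: vs) ⟨k⟩ = look h vs ⟨k⟩ := by
          intro vs v k hk
          simp only [look, List.zip_cons_cons, List.lookup_cons, beq_false_of_ne hk]
        have hv := heq ℓ (by simp)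
        simp only [look, List.zip_cons_cons, List.lookup_cons, beq_self_eq_true,
          Option.getD_some] at hv
        subst hv
        congr 1
        refine ih hnd.2 (by simpa using h1) (by simpa using h2) (fun k hk => ?_)
        have hkl : k ≠ ℓ := by rintro rfl; exact hnd.1 hk
        have := heq k (List.mem_cons_of_mem _ hk)
        rwa [e _ _ _ hkl, e _ _ _ hkl] at this

/-- The name of a slot as a substitution for names. -/
def slotSub (τ : ℕ → Term) (a : Name) : Term := τ a.id

/-! ### Expansion of lifted trees to formulas. -/

namespace FTree

/-- The tree of the formula denoted by a lifted tree. -/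
def expand (tb : ℕ → Option Def) : FTree → FTree
  | nil => nil
  | node c m xs us l r =>
    if c = 9 then
      match tb m with
      | some D => node D.c m D.xs (us.take D.xs.length)
          (D.B.tmap (tsub (look D.h (us.drop D.xs.length)))) nil
      | none => nil
    else node c m xs us (l.expand tb) (r.expand tb)

theorem expand_of_ne {tb : ℕ → Option Def} {c m : ℕ} {xs : List ℕ} {us : List Term} {l r : FTree}
    (hc : c ≠ 9) : expand tb (node c m xs us l r) = node c m xs us (l.expand tb) (r.expand tb) := by
  rw [expand, if_neg hc]

theorem expand_call {tb : ℕ → Option Def} {m : ℕ} {xs : List ℕ} {us vs : List Term} {l r : FTree}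
    {D : Def} (hD : tb m = some D) (hlen : us.length = D.xs.length) :
    expand tb (node 9 m xs (us ++ vs) l r) =
      node D.c m D.xs us (D.B.tmap (tsub (look D.h vs))) nil := by
  rw [expand, if_pos rfl, hD]
  simp only
  rw [← hlen, List.take_left, List.drop_left]

theorem slot_mem_coll {sc : Scope} {κ : RecScope} {X : ℕ} {xs : List ℕ} {l : FTree} {ℓ : ℕ}
    (h : ℓ ∈ hid sc κ X xs l) : (∃ u, ℓ = sc.slot u) ∨ ∃ X, ℓ ∈ κ.slots X :=
  mem_coll (List.mem_dedup.1 h)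

end FTree

theorem RecEnv.tsub_congr {δ : RecEnv} {f g : Name → Term}
    (h : ∀ X p, δ X = some p → ∀ a ∈ p.2.2.names, f a = g a) : δ.tsub f = δ.tsub g := by
  funext X
  unfold RecEnv.tsub
  cases hX : δ X with
  | none => rfl
  | some p => simp only [Option.map_some]; rw [tmap_congr (h X p hX)]

/-- The bodies of the recursion variables in scope were made at lower levels, so they mention only
slots that are not overwritten. -/
theorem Ctx.Valid.tsub_setSlots {tb : ℕ → Option Def} {Γ : Finset ℕ} {Δ : ℕ → Option ℕ} {C : Ctx}
    (h : C.Valid tb Γ Δ) (τ : ℕ → Term) (vs : List Term) :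
    C.δ.tsub (slotSub (setSlots τ C.d vs)) = C.δ.tsub (slotSub τ) :=
  RecEnv.tsub_congr fun X p hp a ha => setSlots_of_lt (h.δ_slots X p hp a ha)

theorem tmap_fixBody (τ : ℕ → Term) (sc : Scope) (δ : RecEnv) (X : ℕ) (xs : List ℕ) (l : FTree) :
    (fixBody sc δ X xs l).tmap (tsub (slotSub τ)) =
      den (under (τ ∘ sc.slot) xs) (Function.update (δ.tsub (slotSub τ)) X none) l := by
  rw [fixBody, tmap_den, ← Term.under_tsub]
  congr 1
  funext Y
  by_cases hY : Y = X
  · subst hY; simp [RecEnv.tsub]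
  · simp [RecEnv.tsub, Function.update_of_ne hY]

theorem Ctx.entry_of_node (C : Ctx) {c m : ℕ} {xs : List ℕ} {us : List Term} {l r : FTree}
    (h : C.t = .node c m xs us l r) (hc : 10 ≤ c) :
    C.entry = some (m, ⟨c, xs, hid C.sc C.κ m xs l, fixBody C.sc C.δ m xs l, C.d,
      (C.child c m xs l l).lift slotTerm⟩) := by
  rw [Ctx.entry, h]; simp only [hc, if_true]

/-- The lifted form of an occurrence denotes the corresponding formula. -/
theorem Ctx.Valid.expand_lift {tb : ℕ → Option Def} {C : Ctx} :
    ∀ {Γ : Finset ℕ} {Δ : ℕ → Option ℕ}, C.Valid tb Γ Δ →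
    (∀ C' ∈ C.all, ∀ X D, C'.entry = some (X, D) → tb X = some D) → ∀ τ : ℕ → Term,
    (C.lift τ).expand tb = den (τ ∘ C.sc.slot) (C.δ.tsub (slotSub τ)) C.t := by
  induction C using Ctx.induction with
  | nil C h =>
    intro Γ Δ _ _ τ
    rw [Ctx.lift, h]; rfl
  | node C c m xs us l r h ihl ihr =>
    intro Γ Δ hv htb τ
    rw [C.all_node h] at htb
    have hC := htb C List.mem_cons_self
    have hwf := hv.wf
    rw [h] at hwf
    obtain ⟨⟨hu, hc9, h10, hc11⟩, hl, hr⟩ := hwf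
    rw [Ctx.lift, h, FTree.lift]
    by_cases c9 : c = 9
    · subst c9
      obtain ⟨hΔ, rfl, rfl⟩ := hc9 rfl
      obtain ⟨D, h1, h2, h3, h4, h5⟩ := hv.recs m _ hΔ
      rw [if_pos rfl, expand_call h1 (by rw [List.length_map, h2]),
        den_node_of_some (c' := D.c) (xs' := D.xs) (B := D.B.tmap (tsub (slotSub τ)))
          (by simp [RecEnv.tsub, h4])]
      congr 1
      -- The hidden arguments of the call are the values of exactly those slots that occur in the
      -- body.
      refine tmap_congr (fun a ha => ?_)
      rw [h3, look_map τ ((h5 a).1 ha)]; rfl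
    · rw [if_neg c9, den_node_of_none (fun h => absurd h c9)]
      by_cases hc : 10 ≤ c
      · obtain ⟨hlen, rfl⟩ := h10 hc
        have hD := hC m _ (C.entry_of_node h hc)
        rw [if_pos hc, expand_call hD (by simp [hlen])]
        have e : (C.δ.tsub (slotSub τ)).under c m =
            Function.update (C.δ.tsub (slotSub τ)) m none := by
          rw [RecEnv.under, if_pos hc]
        rw [e, ← tmap_fixBody]
        simp only
        congr 1
        refine tmap_congr (fun a ha => ?_)
        rw [look_map τ ((hv.names_fixBody h hc a).1 ha)]; rfl
      · rw [if_neg hc, expand_of_ne c9]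
        have e : (C.δ.tsub (slotSub τ)).under c m = C.δ.tsub (slotSub τ) := by
          rw [RecEnv.under, if_neg hc]
        rw [e, under_slot hv.pos hv.lt, ← hv.tsub_setSlots τ (vars xs)]
        have el := ihl (hv.child h hC (Or.inl rfl)) (fun C'' hC'' => htb C'' (by simp [hC'']))
          (setSlots τ C.d (vars xs))
        have er := ihr (hv.child h hC (Or.inr rfl)) (fun C'' hC'' => htb C'' (by simp [hC'']))
          (setSlots τ C.d (vars xs))
        simp only [Ctx.child, hc, if_false, Ctx.lift] at el er
        rw [el, er]

/-- What the table has to satisfy. -/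
structure GoodTable (tb : ℕ → Option Def) : Prop where
  ten_le : ∀ X D, tb X = some D → 10 ≤ D.c
  nodup : ∀ X D, tb X = some D → D.h.Nodup
  names : ∀ X D, tb X = some D → ∀ a, a ∈ D.B.names ↔ a.id ∈ D.h

namespace FTree

/-- The shape of lifted trees. -/
def Shape (tb : ℕ → Option Def) : FTree → Prop
  | nil => True
  | node c m xs us l r => (c = 9 ∧ xs = [] ∧ l = nil ∧ r = nil ∧
      ∃ D, tb m = some D ∧ us.length = D.xs.length + D.h.length) ∨
      (c < 9 ∧ l.Shape tb ∧ r.Shape tb)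

theorem Shape.tmap {tb : ℕ → Option Def} {t : FTree} (h : t.Shape tb) (f : Term → Term) :
    (t.tmap f).Shape tb := by
  induction t with
  | nil => trivial
  | node c m xs us l r ihl ihr =>
    rcases h with ⟨h1, h2, rfl, rfl, D, h3, h4⟩ | ⟨h1, h2, h3⟩
    · exact Or.inl ⟨h1, h2, rfl, rfl, D, h3, by simpa using h4⟩
    · exact Or.inr ⟨h1, ihl h2, ihr h3⟩

/-- A call expands to a node with a code of at least 10, whereas other nodes keep a code below 9, so
the two kinds cannot be confused. Every hidden slot occurs in the stored body, so the expanded body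
gives back the hidden arguments. Hence comparing lifted trees is comparing formulas. -/
theorem expand_injective {tb : ℕ → Option Def} (htb : GoodTable tb) {t t' : FTree}
    (ht : t.Shape tb) (ht' : t'.Shape tb) (h : t.expand tb = t'.expand tb) : t = t' := by
  induction t generalizing t' with
  | nil =>
    cases t' with
    | nil => rfl
    | node c m xs us l r =>
      rcases ht' with ⟨h1, -, -, -, D, h3, -⟩ | ⟨h1, -⟩
      · simp [expand, h1, h3] at h
      · simp [expand, show c ≠ 9 by omega] at h
  | node c m xs us l r ihl ihr =>
    cases t' with
    | nil =>
      rcases ht with ⟨h1, -, -, -, D, h3, -⟩ | ⟨h1, -⟩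
      · simp [expand, h1, h3] at h
      · simp [expand, show c ≠ 9 by omega] at h
    | node c' m' xs' us' l' r' =>
      rcases ht with ⟨rfl, rfl, rfl, rfl, D, h3, h4⟩ | ⟨h1, h2, h3⟩ <;>
      rcases ht' with ⟨rfl, rfl, rfl, rfl, D', h3', h4'⟩ | ⟨h1', h2', h3'⟩
      · simp only [expand, if_true, h3, h3', node.injEq] at h
        obtain ⟨-, rfl, -, h5, h6, -⟩ := h
        rw [h3] at h3'
        simp only [Option.some.injEq] at h3'
        subst h3'
        have := eq_of_tmap_eq h6
        have e := look_inj (htb.nodup m D h3) (vs := us.drop D.xs.length)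
          (ws := us'.drop D.xs.length) (by simp [h4]) (by simp [h4'])
          (fun ℓ hl => this ⟨ℓ⟩ ((htb.names m D h3 ⟨ℓ⟩).2 hl))
        rw [← List.take_append_drop D.xs.length us, h5, e, List.take_append_drop]
      · rw [expand_of_ne (c := c') (by omega)] at h
        have := htb.ten_le _ _ h3
        simp only [expand, if_true, h3, node.injEq] at h
        omega
      · rw [expand_of_ne (by omega)] at h
        have := htb.ten_le _ _ h3'
        simp only [expand, if_true, h3', node.injEq] at h
        omega
      · rw [expand_of_ne (by omega), expand_of_ne (by omega)] at h
        simp only [node.injEq] at h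
        obtain ⟨rfl, rfl, rfl, rfl, h5, h6⟩ := h
        rw [ihl h2 h2' h5, ihr h3 h3' h6]

/-- Hidden arguments are passed only for slots that occur in the body, so lifting neither adds nor
loses a name. In particular the supports of formulas can be computed from lifted trees. -/
theorem mem_names_expand {tb : ℕ → Option Def} (htb : GoodTable tb) {t : FTree}
    (ht : t.Shape tb) (a : Name) : a ∈ (t.expand tb).names ↔ a ∈ t.names := by
  induction t with
  | nil => rfl
  | node c m xs us l r ihl ihr =>
    rcases ht with ⟨rfl, rfl, rfl, rfl, D, h3, h4⟩ | ⟨h1, h2, h3⟩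
    · obtain ⟨vs, ws, rfl, hvs⟩ : ∃ vs ws, us = vs ++ ws ∧ vs.length = D.xs.length :=
        ⟨us.take D.xs.length, us.drop D.xs.length, by simp, by simp [h4]⟩
      have hws : ws.length = D.h.length := by simp at h4; omega
      rw [expand_call h3 hvs]
      simp only [names, List.flatMap_append, List.mem_append, List.not_mem_nil, or_false]
      refine or_congr_right ?_
      rw [mem_names_tmap]
      constructor
      · rintro ⟨b, hb, hab⟩
        exact List.mem_flatMap.2 ⟨_, look_mem ((htb.names _ _ h3 b).1 hb) hws, hab⟩
      · intro ha
        obtain ⟨w, hw, haw⟩ := List.mem_flatMap.1 ha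
        obtain ⟨i, hi, rfl⟩ := List.getElem_of_mem hw
        have hi' : i < D.h.length := hws ▸ hi
        refine ⟨⟨D.h[i]⟩, (htb.names _ _ h3 _).2 (List.getElem_mem hi'), ?_⟩
        have : look D.h ws ⟨D.h[i]⟩ = ws[i] := by
          have hz : (D.h[i], ws[i]) ∈ D.h.zip ws := by
            rw [List.mem_iff_getElem]
            exact ⟨i, by simp [hi, hi'], by simp⟩
          have hk : ((D.h.zip ws).map Prod.fst).Nodup := by
            rw [List.map_fst_zip hws.ge]; exact htb.nodup _ _ h3
          rw [look, lookup_of_mem_of_nodup hk hz]; rfl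
        rw [this]; exact haw
    · rw [expand_of_ne (by omega)]
      simp only [names, List.mem_append, ihl h2, ihr h3]

theorem expand_tmap {tb : ℕ → Option Def} (htb : GoodTable tb) {t : FTree} (ht : t.Shape tb)
    (g : Name → Term) : (t.tmap (tsub g)).expand tb = (t.expand tb).tmap (tsub g) := by
  induction t with
  | nil => rfl
  | node c m xs us l r ihl ihr =>
    rcases ht with ⟨rfl, rfl, rfl, rfl, D, h3, h4⟩ | ⟨h1, h2, h3⟩
    · simp only [FTree.tmap, expand, if_true, h3, List.map_take, List.map_drop]
      congr 1
      rw [tmap_tmap]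
      have : tsub g ∘ tsub (look D.h (us.drop D.xs.length)) =
          tsub (fun a => tsub g (look D.h (us.drop D.xs.length) a)) := by
        funext u; cases u <;> rfl
      rw [this, ← List.map_drop]
      exact tmap_congr (fun a ha => look_map_right _ ((htb.names _ _ h3 a).1 ha) (by simp [h4]))
    · rw [FTree.tmap, expand_of_ne (by omega), expand_of_ne (by omega), FTree.tmap, ihl h2, ihr h3]

theorem lift_tmap (g : Name → Term) (t : FTree) : ∀ (sc : Scope) (τ : ℕ → Term) (κ : RecScope)
    (d : ℕ), (lift sc τ κ d t).tmap (tsub g) = lift sc (tsub g ∘ τ) κ d t := by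
  induction t with
  | nil => intros; rfl
  | node c m xs us l r ihl ihr =>
    intro sc τ κ d
    have e : (vars xs).map (tsub g) = vars xs := by
      simp only [vars, List.map_map]; congr 1
    simp only [lift]
    split_ifs
    · simp only [FTree.tmap, List.map_append, List.map_map, Function.comp_assoc]
    · simp only [FTree.tmap, List.map_append, List.map_map, Function.comp_assoc]
    · simp only [FTree.tmap, List.map_map, Function.comp_assoc, ihl, ihr, comp_setSlots, e]

/-- Each occurrence has one static lifted text; values of slots are merely put in for the names that
stand for slots. -/
theorem lift_eq_tmap (sc : Scope) (τ : ℕ → Term) (κ : RecScope) (d : ℕ) (t : FTree) :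
    lift sc τ κ d t = (lift sc slotTerm κ d t).tmap (tsub (slotSub τ)) := by
  rw [lift_tmap]; rfl

/-- Opening a bound variable of a lifted tree. -/
theorem den_lift (t : FTree) : ∀ (sc : Scope) (τ τ' : ℕ → Term) (κ : RecScope) (d : ℕ)
    (e : Term → Term), (∀ a, e (.name a) = .name a) → 0 < d → (∀ p ∈ sc, p.2 < d) →
    (∀ X, ∀ ℓ ∈ κ.slots X, ℓ < d ∧ τ ℓ = τ' ℓ ∧ ∃ a, τ ℓ = .name a) →
    (∀ u y, τ (sc.slot u) = .var y → u = .var y) →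
    (∀ u, τ' (sc.slot u) = e (τ (sc.slot u))) →
    den e RecEnv.empty (lift sc τ κ d t) = lift sc τ' κ d t := by
  induction t with
  | nil => intros; rfl
  | node c m xs us l r ihl ihr =>
    intro sc τ τ' κ d e he hd hsc hκ hK hτ
    have hκ' : ∀ X, ∀ ℓ ∈ κ.slots X, e (τ ℓ) = τ' ℓ := by
      intro X ℓ hl
      obtain ⟨-, h1, a, h2⟩ := hκ X ℓ hl
      rw [← h1, h2, he]
    have hus : (us.map (τ ∘ sc.slot)).map e = us.map (τ' ∘ sc.slot) := by
      rw [List.map_map]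
      exact List.map_congr_left (fun u _ => (hτ u).symm)
    simp only [lift]
    split_ifs with h9 h10
    · rw [den_node_of_none (fun _ => rfl), List.map_append, hus, List.map_map]
      simp only [den]
      congr 2
      exact List.map_congr_left (fun ℓ hl => hκ' m ℓ hl)
    · rw [den_node_of_none (fun _ => rfl), List.map_append, hus, List.map_map]
      simp only [den]
      congr 2
      refine List.map_congr_left (fun ℓ hl => ?_)
      rcases slot_mem_coll hl with ⟨u, rfl⟩ | ⟨X, hX⟩
      · exact (hτ u).symm
      · exact hκ' X ℓ hX
    · rw [den_node_of_none (fun _ => rfl), hus, RecEnv.empty_under]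
      have hstep : ∀ t' : FTree, (∀ (sc : Scope) (τ τ' : ℕ → Term) (κ : RecScope) (d : ℕ)
          (e : Term → Term), (∀ a, e (.name a) = .name a) → 0 < d → (∀ p ∈ sc, p.2 < d) →
          (∀ X, ∀ ℓ ∈ κ.slots X, ℓ < d ∧ τ ℓ = τ' ℓ ∧ ∃ a, τ ℓ = .name a) →
          (∀ u y, τ (sc.slot u) = .var y → u = .var y) →
          (∀ u, τ' (sc.slot u) = e (τ (sc.slot u))) →
          den e RecEnv.empty (lift sc τ κ d t') = lift sc τ' κ d t') →
          den (under e xs) RecEnv.empty (lift (sc.enter (vars xs) d) (setSlots τ d (vars xs)) κ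
            (d + xs.length) t') =
          lift (sc.enter (vars xs) d) (setSlots τ' d (vars xs)) κ (d + xs.length) t' := by
        intro t' ih
        have hval : ∀ (τ : ℕ → Term) u, setSlots τ d (vars xs) ((sc.enter (vars xs) d).slot u) =
            under (τ ∘ sc.slot) xs u := by
          intro τ u; rw [under_slot hd hsc]; rfl
        refine ih _ _ _ _ _ _ he (by omega) ?_ ?_ ?_ ?_
        · intro p hp
          rcases Scope.mem_enter hp with hp | ⟨-, -, hp⟩
          · have := hsc p hp; omega
          · simpa using hp
        · intro X ℓ hl
          obtain ⟨h1, h2, h3⟩ := hκ X ℓ hl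
          rw [setSlots_of_lt h1, setSlots_of_lt h1]
          exact ⟨by omega, h2, h3⟩
        · intro u y h
          rw [hval] at h
          cases u with
          | name a => exact hK _ _ h
          | var x =>
            by_cases hx : x ∈ xs
            · simpa [under, hx] using h
            · simp only [under, hx, if_false, Function.comp] at h; exact hK _ _ h
        · intro u
          rw [hval, hval]
          -- By `hK` the only variable that can be the value of a term's slot is that term itself.
          -- Outside of `xs` it is therefore not affected by the binder.
          have aux : ∀ u, u ∉ vars xs → e (τ (sc.slot u)) = under e xs (τ (sc.slot u)) := by
            intro u hu
            cases h : τ (sc.slot u) with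
            | name a => rfl
            | var y =>
              have := hK u y h
              subst this
              rw [mem_vars] at hu
              simp [under, hu]
          cases u with
          | name a => simp only [under, Function.comp]; rw [hτ, aux _ name_notMem_vars]; rfl
          | var x =>
            by_cases hx : x ∈ xs
            · simp [under, hx]
            · simp only [under, hx, if_false, Function.comp]
              rw [hτ, aux _ (by rwa [mem_vars])]; rfl
      rw [hstep l ihl, hstep r ihr]

end FTree

/-! ## The lifting of a closed formula -/

theorem Formula.wf_tree {φ : Formula} : ∀ {Γ : Finset ℕ} {Δ : ℕ → Option ℕ},
    φ.WellFormed Γ Δ → φ.tree.WF Γ Δ := by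
  induction φ with
  | fix σ X xs φ us ih =>
    intro Γ Δ h
    have h10 := σ.ten_le_code
    have h11 := σ.code_le
    obtain ⟨h1, -, h3, h4⟩ := h
    refine ⟨⟨h1, fun h => by omega, fun _ => ⟨h3, rfl⟩, h11⟩, ?_, trivial⟩
    rw [if_pos h10]
    exact ih h4
  | some x φ ih | all x φ ih | fresh x φ ih =>
    intro Γ Δ h
    refine ⟨⟨by simp, by simp, by simp, by omega⟩, ?_, trivial⟩
    have : Γ ∪ [x].toFinset = insert x Γ := by ext y; simp [or_comm]
    rw [this]
    exact ih h
  | _ =>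
    intro Γ Δ h
    simp_all [Formula.tree, FTree.WF, Formula.WellFormed]

theorem Formula.binders_tree (φ : Formula) : φ.tree.binders = φ.recBinders := by
  induction φ with
  | fix σ X xs φ us ih =>
    simp [Formula.tree, binders, Formula.recBinders, σ.ten_le_code, ih]
  | _ => simp_all [Formula.tree, binders, Formula.recBinders]

theorem Formula.tree_ne_nil (φ : Formula) : φ.tree ≠ .nil := by
  cases φ <;> simp [Formula.tree]

theorem Formula.depth_tree (φ : Formula) : φ.tree.depth = φ.depth := by
  induction φ <;> simp_all [Formula.tree, FTree.depth, Formula.depth]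

theorem Formula.nodes_tree_le (φ : Formula) : φ.tree.nodes ≤ φ.size := by
  induction φ <;> simp_all [Formula.tree, FTree.nodes, Formula.size] <;> omega

namespace FTree

theorem den_eq_self {t : FTree} : ∀ {Γ : Finset ℕ} {Δ : ℕ → Option ℕ} {e : Term → Term}
    {δ : RecEnv}, t.WF Γ Δ → (∀ a ∈ t.names, e (.name a) = .name a) →
    (∀ x ∈ Γ, e (.var x) = .var x) → (∀ X, Δ X ≠ none → δ X = none) → den e δ t = t := by
  induction t with
  | nil => intros; rfl
  | node c m xs us l r ihl ihr =>
    intro Γ Δ e δ hwf hn hv hδ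
    obtain ⟨⟨hu, h9, -⟩, hl, hr⟩ := hwf
    have hv' : ∀ x ∈ Γ ∪ xs.toFinset, under e xs (.var x) = .var x := by
      intro x hx
      by_cases hxs : x ∈ xs
      · simp [under, hxs]
      · simp only [under, hxs, if_false]
        exact hv x (by simpa [hxs] using hx)
    have hδ' : ∀ X, (if 10 ≤ c then Function.update Δ m (some xs.length) else Δ) X ≠ none →
        δ.under c m X = none := by
      intro X hX
      unfold RecEnv.under
      split_ifs at hX ⊢ with hc
      · by_cases hXm : X = m
        · subst hXm; simp
        · rw [Function.update_of_ne hXm] at hX ⊢; exact hδ X hX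
      · exact hδ X hX
    rw [den_node_of_none (fun hc => hδ m (by rw [(h9 hc).1]; simp)),
      ihl (e := under e xs) hl (fun a ha => hn a (by simp [names, ha])) hv' hδ',
      ihr (e := under e xs) hr (fun a ha => hn a (by simp [names, ha])) hv' hδ']
    congr 1
    conv_rhs => rw [← List.map_id us]
    refine List.map_congr_left (fun u hus => ?_)
    cases u with
    | name a =>
      exact hn a (by
        rw [names, List.mem_append]
        exact Or.inl (List.mem_flatMap.2 ⟨_, hus, by simp [Term.nameList]⟩))
    | var x => exact hv x (hu _ hus)

end FTree

/-- The constants of a formula. -/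
def Formula.consts (φ : Formula) : List Name := φ.tree.names.dedup

theorem Formula.toFinset_consts (φ : Formula) : φ.consts.toFinset = φ.supp := by
  ext a; rw [Formula.consts, List.mem_toFinset, List.mem_dedup, Formula.mem_supp_iff]

theorem Formula.length_consts (φ : Formula) : φ.consts.length = φ.supp.card := by
  rw [← φ.toFinset_consts]; exact (List.toFinset_card_of_nodup (List.nodup_dedup _)).symm

/-- The constants occupy the slots from 1 on. The recursion environment is given dummy closed
bodies, because closedness of later bodies needs a total environment; a closed formula never looks
them up. -/
def rootCtx (φ : Formula) : Ctx where
  sc := Scope.enter [] (φ.consts.map Term.name) 1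
  κ := []
  δ := fun _ => some (10, [], .nil)
  d := 1 + φ.consts.length
  t := φ.tree

/-- The definitions of the recursion variables of a formula. -/
def Formula.defs (φ : Formula) : ℕ → Option Def := (rootCtx φ).table

/-- The values of the constants in their slots. -/
def rootVal (φ : Formula) : ℕ → Term :=
  setSlots slotTerm 1 (φ.consts.map Term.name)

theorem Ctx.self_mem_all {C : Ctx} (h : C.t ≠ .nil) : C ∈ C.all := by
  cases ht : C.t with
  | nil => exact absurd ht h
  | node c m xs us l r => rw [C.all_node ht]; exact List.mem_cons_self

theorem Ctx.all_subset {C : Ctx} : ∀ {C' : Ctx}, C' ∈ C.all → C'.all ⊆ C.all := by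
  induction C using Ctx.induction with
  | nil C h => rw [C.all_nil h]; simp
  | node C c m xs us l r h ihl ihr =>
    intro C' hC'
    rw [C.all_node h] at hC' ⊢
    rw [List.mem_cons, List.mem_append] at hC'
    rcases hC' with rfl | hC' | hC'
    · rw [C'.all_node h]; exact List.Subset.refl _
    · exact List.Subset.trans (ihl hC') (fun x hx => by simp [hx])
    · exact List.Subset.trans (ihr hC') (fun x hx => by simp [hx])

theorem Ctx.child_mem_all {C : Ctx} {c m : ℕ} {xs : List ℕ} {us : List Term} {l r t : FTree}
    (h : C.t = .node c m xs us l r) (ht : t = l ∨ t = r) (hne : t ≠ .nil) :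
    C.child c m xs l t ∈ C.all := by
  rw [C.all_node h]
  have := Ctx.self_mem_all (C := C.child c m xs l t) hne
  rcases ht with rfl | rfl <;> simp [this]

theorem Ctx.le_d_of_mem {C : Ctx} : ∀ C' ∈ C.all, C.d ≤ C'.d := by
  induction C using Ctx.induction with
  | nil C h => rw [C.all_nil h]; simp
  | node C c m xs us l r h ihl ihr =>
    intro C' hC'
    rw [C.all_node h, List.mem_cons, List.mem_append] at hC'
    rcases hC' with rfl | hC' | hC'
    · exact le_rfl
    · have := ihl _ hC'; simp only [Ctx.child] at this; omega
    · have := ihr _ hC'; simp only [Ctx.child] at this; omega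

/-- The lifted form of a valid occurrence has the right shape. -/
theorem Ctx.Valid.shape_lift {tb : ℕ → Option Def} {C : Ctx} :
    ∀ {Γ : Finset ℕ} {Δ : ℕ → Option ℕ}, C.Valid tb Γ Δ →
    (∀ C' ∈ C.all, ∀ X D, C'.entry = some (X, D) → tb X = some D) → ∀ τ : ℕ → Term,
    (C.lift τ).Shape tb := by
  induction C using Ctx.induction with
  | nil C h =>
    intro Γ Δ _ _ τ
    rw [Ctx.lift, h]; trivial
  | node C c m xs us l r h ihl ihr =>
    intro Γ Δ hv htb τ
    rw [C.all_node h] at htb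
    have hC := htb C List.mem_cons_self
    have hwf := hv.wf
    rw [h] at hwf
    obtain ⟨⟨hu, hc9, h10, hc11⟩, hl, hr⟩ := hwf
    rw [Ctx.lift, h, FTree.lift]
    by_cases c9 : c = 9
    · subst c9
      obtain ⟨D, h1, h2, h3, h4, h5⟩ := hv.recs m _ (hc9 rfl).1
      rw [if_pos rfl]
      exact Or.inl ⟨rfl, rfl, rfl, rfl, D, h1, by simp [h2, h3]⟩
    · rw [if_neg c9]
      by_cases hc : 10 ≤ c
      · obtain ⟨hlen, rfl⟩ := h10 hc
        rw [if_pos hc]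
        exact Or.inl ⟨rfl, rfl, rfl, rfl, _, hC m _ (C.entry_of_node h hc), by simp [hlen]⟩
      · rw [if_neg hc]
        have el := ihl (hv.child h hC (Or.inl rfl)) (fun C'' hC'' => htb C'' (by simp [hC'']))
          (setSlots τ C.d (vars xs))
        have er := ihr (hv.child h hC (Or.inr rfl)) (fun C'' hC'' => htb C'' (by simp [hC'']))
          (setSlots τ C.d (vars xs))
        simp only [Ctx.child, hc, if_false, Ctx.lift] at el er
        exact Or.inr ⟨by omega, el, er⟩

theorem map_range'_setSlots (τ : ℕ → Term) (d : ℕ) (vs : List Term) :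
    (List.range' d vs.length).map (setSlots τ d vs) = vs := by
  induction vs generalizing d with
  | nil => rfl
  | cons v vs ih =>
    rw [List.length_cons, List.range'_succ, List.map_cons, setSlots, Function.update_self]
    congr 1
    conv_rhs => rw [← ih (d + 1)]
    refine List.map_congr_left (fun ℓ hl => ?_)
    rw [List.mem_range'_1] at hl
    rw [Function.update_of_ne (by omega)]

theorem setSlots_getElem (τ : ℕ → Term) (d : ℕ) (vs : List Term) (i : ℕ) (h : i < vs.length) :
    setSlots τ d vs (d + i) = vs[i] := by
  have := map_range'_setSlots τ d vs
  have h2 : ((List.range' d vs.length).map (setSlots τ d vs))[i]'(by simpa) = vs[i] := by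
    simp only [this]
  simpa using h2

/-! ### Validity of all occurrences in a closed formula. -/

section Root

variable {φ₀ : Formula} (hφ : φ₀.Closed)
include hφ

theorem defs_of_mem {C : Ctx} (hC : C ∈ (rootCtx φ₀).all) {X : ℕ} {D : Def}
    (he : C.entry = some (X, D)) : φ₀.defs X = some D :=
  Ctx.table_of_mem (by rw [rootCtx, Formula.binders_tree]; exact hφ.2) hC he

theorem root_valid : (rootCtx φ₀).Valid φ₀.defs ∅ (fun _ => none) := by
  refine ⟨?_, ?_, Formula.wf_tree hφ.1, ?_, ?_, ?_, ?_, ?_, ?_, ?_, ?_⟩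
  · simp [rootCtx]
  · intro p hp
    rcases Scope.mem_enter hp with hp | ⟨-, h1, h2⟩
    · simp at hp
    · simp only [List.length_map] at h2
      simp only [rootCtx]; omega
  · intro a ha
    exact Scope.exists_mem_enter (List.mem_map.2 ⟨a, List.mem_dedup.2 ha, rfl⟩)
  · simp
  · simp
  · simp [rootCtx, RecScope.slots]
  · intro X; exact ⟨_, rfl⟩
  · intro X p hp; simp only [rootCtx, Option.some.injEq] at hp; subst hp; exact le_rfl
  · intro g _ X p hp
    simp only [rootCtx, RecEnv.tsub, Option.map_some, Option.some.injEq] at hp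
    subst hp
    exact ⟨le_rfl, fun _ _ _ _ _ => rfl⟩
  · intro X p hp a ha
    simp only [rootCtx, Option.some.injEq] at hp; subst hp
    simp [names] at ha

theorem valid_of_mem {C : Ctx} (hC : C ∈ (rootCtx φ₀).all) : ∃ Γ Δ, C.Valid φ₀.defs Γ Δ :=
  Ctx.valid_all (root_valid hφ) (fun _ hC' _ _ he => defs_of_mem hφ hC' he) C hC

theorem entries_of_mem {C : Ctx} (hC : C ∈ (rootCtx φ₀).all) :
    ∀ C' ∈ C.all, ∀ X D, C'.entry = some (X, D) → φ₀.defs X = some D :=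
  fun _ hC' _ _ he => defs_of_mem hφ (Ctx.all_subset hC hC') he

/-- Every definition comes from a fixpoint node. -/
theorem exists_ctx_of_defs {X : ℕ} {D : Def} (hD : φ₀.defs X = some D) :
    ∃ C ∈ (rootCtx φ₀).all, ∃ us l, C.t = .node D.c X D.xs us l .nil ∧ 10 ≤ D.c ∧
      D.h = hid C.sc C.κ X D.xs l ∧ D.B = fixBody C.sc C.δ X D.xs l ∧ D.d = C.d ∧
      D.T = (C.child D.c X D.xs l l).lift slotTerm ∧ D.xs.length = us.length := by
  obtain ⟨C, hC, he⟩ := Ctx.exists_of_table hD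
  refine ⟨C, hC, ?_⟩
  rw [Ctx.entry] at he
  obtain ⟨Γ, Δ, hv⟩ := valid_of_mem hφ hC
  have hwf := hv.wf
  cases ht : C.t with
  | nil => rw [ht] at he; simp at he
  | node c m xs us l r =>
    rw [ht] at he hwf
    simp only at he
    split_ifs at he with hc
    obtain ⟨⟨-, -, h, -⟩, -⟩ := hwf
    obtain ⟨hlen, rfl⟩ := h hc
    simp only [Option.some.injEq, Prod.mk.injEq] at he
    obtain ⟨rfl, rfl⟩ := he
    exact ⟨us, l, rfl, hc, rfl, rfl, rfl, rfl, hlen⟩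

theorem goodTable : GoodTable φ₀.defs := by
  constructor
  · intro X D hD
    obtain ⟨C, hC, us, l, -, h, -⟩ := exists_ctx_of_defs hφ hD
    exact h
  · intro X D hD
    obtain ⟨C, hC, us, l, -, -, h, -⟩ := exists_ctx_of_defs hφ hD
    rw [h]; exact List.nodup_dedup _
  · intro X D hD a
    obtain ⟨C, hC, us, l, ht, h10, h, hB, -⟩ := exists_ctx_of_defs hφ hD
    obtain ⟨Γ, Δ, hv⟩ := valid_of_mem hφ hC
    rw [h, hB]
    exact hv.names_fixBody ht h10 a

theorem expand_lift_of_mem {C : Ctx} (hC : C ∈ (rootCtx φ₀).all) (τ : ℕ → Term) :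
    (C.lift τ).expand φ₀.defs = den (τ ∘ C.sc.slot) (C.δ.tsub (slotSub τ)) C.t := by
  obtain ⟨Γ, Δ, hv⟩ := valid_of_mem hφ hC
  exact hv.expand_lift (entries_of_mem hφ hC) τ

theorem shape_of_mem {C : Ctx} (hC : C ∈ (rootCtx φ₀).all) (τ : ℕ → Term) :
    (C.lift τ).Shape φ₀.defs := by
  obtain ⟨Γ, Δ, hv⟩ := valid_of_mem hφ hC
  exact hv.shape_lift (entries_of_mem hφ hC) τ

theorem mem_names_lift {C : Ctx} (hC : C ∈ (rootCtx φ₀).all) (a : Name) :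
    a ∈ (C.lift slotTerm).names ↔ a.id ∈ coll C.sc C.κ [] [] C.t := by
  obtain ⟨Γ, Δ, hv⟩ := valid_of_mem hφ hC
  rw [← mem_names_expand (goodTable hφ) (shape_of_mem hφ hC _), expand_lift_of_mem hφ hC]
  -- With `slotTerm` as valuation every slot name is replaced by itself.
  have e : C.δ.tsub (slotSub slotTerm) = C.δ := by
    funext X
    have : slotSub slotTerm = fun a => Term.name a := rfl
    have h2 : tsub (fun a => Term.name a) = id := by funext u; cases u <;> rfl
    rw [RecEnv.tsub, this, h2]
    cases C.δ X <;> simp [FTree.tmap_id]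
  have := mem_names_den (sc := C.sc) (κ := C.κ) (δ := C.δ) (bl := []) (rl := []) (δ' := C.δ) hv.wf
    (by simp) (by simp) (fun X hX _ => by
      obtain ⟨k, hk⟩ := Option.ne_none_iff_exists'.1 hX
      obtain ⟨D, -, -, h3, h4, h5⟩ := hv.recs X k hk
      exact ⟨_, h4, by rw [h3]; exact h5⟩) a
  rw [Term.under_nil] at this
  rw [e]; exact this

theorem names_lift_pos_lt {C : Ctx} (hC : C ∈ (rootCtx φ₀).all) {a : Name}
    (ha : a ∈ (C.lift slotTerm).names) : 0 < a.id ∧ a.id < C.d := by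
  rw [mem_names_lift hφ hC] at ha
  obtain ⟨Γ, Δ, hv⟩ := valid_of_mem hφ hC
  exact hv.coll_pos_lt hv.wf hv.keys_names (fun x hx => Or.inr hx) ha

/-- The static text of a definition mentions only the slots of its parameters and its hidden slots,
so a call carries all the values that its unfolding uses. -/
theorem names_def {X : ℕ} {D : Def} (hD : φ₀.defs X = some D) {a : Name} (ha : a ∈ D.T.names) :
    a.id ∈ List.range' D.d D.xs.length ++ D.h := by
  obtain ⟨C, hC, us, l, ht, h10, hh, hB, hd, hT, -⟩ := exists_ctx_of_defs hφ hD
  have hl : l ≠ .nil := by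
    rintro rfl
    rw [hT] at ha; simp [Ctx.lift, Ctx.child, FTree.lift, names] at ha
  have hmem : C.child D.c X D.xs l l ∈ (rootCtx φ₀).all :=
    Ctx.all_subset hC (Ctx.child_mem_all ht (Or.inl rfl) hl)
  rw [hT, mem_names_lift hφ hmem] at ha
  simp only [Ctx.child, h10, if_true] at ha
  rw [List.mem_append]
  rcases coll_enter ha with h | ⟨u, hu, h⟩ | h
  · right; rw [hh, hid, List.mem_dedup]; simpa using h
  · left
    rw [List.mem_range'_1, hd, h]
    have := Scope.exists_mem_enter (sc := []) (d := C.d) hu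
    have h1 := Scope.slot_mem this
    -- The slot of a newly entered variable does not depend on the older scope. In the empty scope
    -- it visibly lies in the new range.
    have e : (Scope.enter [] (vars D.xs) C.d).slot u = (C.sc.enter (vars D.xs) C.d).slot u := by
      clear h h1 this ha hmem
      generalize C.d = d
      revert hu
      generalize vars D.xs = vs
      induction vs generalizing d with
      | nil => simp
      | cons v vs ih =>
        intro hu
        rw [Scope.enter, Scope.enter, Scope.slot, Scope.slot, List.lookup_cons, List.lookup_cons]
        by_cases huv : u = v
        · simp [huv]
        · rw [beq_false_of_ne huv]
          exact ih (d + 1) (by simpa [huv] using hu)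
    rw [e] at h1
    rcases Scope.mem_enter h1 with h1 | ⟨-, h2, h3⟩
    · simp at h1
    · rw [length_vars] at h3; exact ⟨h2, h3⟩
  · right; rw [hh]; exact h

end Root

/-! ## Lifted trees as representations of the formulas of the game -/

/-- The formula `F` is the occurrence `C`, with the slots having the values `τ`. -/
structure Denotes (φ₀ : Formula) (C : Ctx) (τ : ℕ → Term) (F : Formula) : Prop where
  mem : C ∈ (rootCtx φ₀).all
  names : ∀ ℓ, ∃ a, τ ℓ = .name a
  consts : ∀ i (h : i < φ₀.consts.length), τ (1 + i) = .name φ₀.consts[i]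
  tree : F.tree = den (τ ∘ C.sc.slot) (C.δ.tsub (slotSub τ)) C.t

/-- The lifted tree `T` represents the formula `F`. -/
def Represents (φ₀ : Formula) (T : FTree) (F : Formula) : Prop :=
  ∃ C τ, Denotes φ₀ C τ F ∧ T = C.lift τ

section

variable {φ₀ : Formula} (hφ : φ₀.Closed)
include hφ

theorem Denotes.tree_eq {C : Ctx} {τ : ℕ → Term} {F : Formula} (h : Denotes φ₀ C τ F) :
    F.tree = (C.lift τ).expand φ₀.defs := by
  rw [h.tree, expand_lift_of_mem hφ h.mem]

theorem Represents.tree_eq {T : FTree} {F : Formula} (h : Represents φ₀ T F) :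
    F.tree = T.expand φ₀.defs := by
  obtain ⟨C, τ, h, rfl⟩ := h; exact h.tree_eq hφ

theorem Represents.shape {T : FTree} {F : Formula} (h : Represents φ₀ T F) :
    T.Shape φ₀.defs := by
  obtain ⟨C, τ, h, rfl⟩ := h; exact shape_of_mem hφ h.mem τ

theorem Represents.mem_supp {T : FTree} {F : Formula} (h : Represents φ₀ T F) (a : Name) :
    a ∈ F.supp ↔ a ∈ T.names := by
  rw [Formula.mem_supp_iff, h.tree_eq hφ, mem_names_expand (goodTable hφ) (h.shape hφ)]

theorem denotes_root : Denotes φ₀ (rootCtx φ₀) (rootVal φ₀) φ₀ := by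
  refine ⟨Ctx.self_mem_all φ₀.tree_ne_nil, ?_, ?_, ?_⟩
  · exact fun ℓ => setSlots_ind (P := fun t => ∃ a, t = .name a) (fun _ => ⟨_, rfl⟩) (by simp) _ _
  · intro i h
    rw [rootVal, setSlots_getElem _ _ _ _ (by simpa)]
    simp
  · refine (den_eq_self (Formula.wf_tree hφ.1) ?_ (by simp) (by simp)).symm
    intro a ha
    have : Term.name a ∈ φ₀.consts.map Term.name :=
      List.mem_map.2 ⟨a, List.mem_dedup.2 ha, rfl⟩
    have := setSlots_slot_enter (sc := []) (τ := slotTerm) (d := 1) id this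
    rwa [List.map_id] at this

theorem represents_root : Represents φ₀ ((rootCtx φ₀).lift (rootVal φ₀)) φ₀ :=
  ⟨_, _, denotes_root hφ, rfl⟩

/-- The number of names in a formula of the game. -/
theorem Represents.card_names {T : FTree} {F : Formula} (h : Represents φ₀ T F) :
    T.names.toFinset.card ≤ φ₀.supp.card + φ₀.depth := by
  obtain ⟨C, τ, h, rfl⟩ := h
  choose f hf using h.names
  -- All names are values of slots between `1` and `C.d - 1`, and the level grows by at most the
  -- depth of `φ₀` from its initial value `1 + k`.
  have hsub : (C.lift τ).names.toFinset ⊆ (Finset.Ico 1 C.d).image f := by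
    intro a ha
    rw [List.mem_toFinset, Ctx.lift, lift_eq_tmap, mem_names_tmap] at ha
    obtain ⟨b, hb, ha⟩ := ha
    have := names_lift_pos_lt hφ h.mem hb
    rw [slotSub, hf] at ha
    simp only [Term.nameList, List.mem_singleton] at ha
    exact Finset.mem_image.2 ⟨b.id, Finset.mem_Ico.2 ⟨this.1, this.2⟩, ha.symm⟩
  have h1 := (Finset.card_le_card hsub).trans Finset.card_image_le
  have h2 := Ctx.depth_all _ _ h.mem
  simp only [rootCtx, Formula.depth_tree, Formula.length_consts] at h2
  rw [Nat.card_Ico] at h1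
  omega

theorem Represents.card_supp {T : FTree} {F : Formula} (h : Represents φ₀ T F) :
    F.supp.card ≤ φ₀.supp.card + φ₀.depth := by
  have : F.supp = T.names.toFinset := by ext a; rw [h.mem_supp hφ, List.mem_toFinset]
  rw [this]; exact h.card_names hφ

/-- Inversion at a connective that is not a fixpoint. -/
theorem Denotes.inv {C : Ctx} {τ : ℕ → Term} {F : Formula} (h : Denotes φ₀ C τ F) {c m : ℕ}
    {xs : List ℕ} {us : List Term} {l r : FTree} (hF : F.tree = .node c m xs us l r) (hc : c < 10) :
    c < 9 ∧ ∃ us₀ l₀ r₀, C.t = .node c m xs us₀ l₀ r₀ ∧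
      C.lift τ = .node c m xs us ((C.child c m xs l₀ l₀).lift (setSlots τ C.d (vars xs)))
        ((C.child c m xs l₀ r₀).lift (setSlots τ C.d (vars xs))) ∧
      l = den (setSlots τ C.d (vars xs) ∘ (C.child c m xs l₀ l₀).sc.slot)
        (C.δ.tsub (slotSub τ)) l₀ ∧
      r = den (setSlots τ C.d (vars xs) ∘ (C.child c m xs l₀ r₀).sc.slot)
        (C.δ.tsub (slotSub τ)) r₀ := by
  obtain ⟨Γ, Δ, hv⟩ := valid_of_mem hφ h.mem
  have ht := h.tree
  rw [hF] at ht
  cases htC : C.t with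
  | nil => rw [htC] at ht; simp [den] at ht
  | node c₀ m₀ xs₀ us₀ l₀ r₀ =>
    have hwf := hv.wf
    rw [htC] at ht hwf
    obtain ⟨⟨hu, hc9, h10, hc11⟩, hl, hr⟩ := hwf
    -- A call denotes a fixpoint, whose code is not below 10, so this case is excluded.
    by_cases c9 : c₀ = 9
    · subst c9
      obtain ⟨D, h1, h2, h3, h4, h5⟩ := hv.recs m₀ _ (hc9 rfl).1
      have := (goodTable hφ).ten_le _ _ h1
      rw [den_node_of_some (c' := D.c) (xs' := D.xs) (B := D.B.tmap (tsub (slotSub τ)))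
          (by simp [RecEnv.tsub, h4])] at ht
      simp only [node.injEq] at ht
      omega
    · rw [den_node_of_none (fun h => absurd h c9)] at ht
      simp only [node.injEq] at ht
      obtain ⟨rfl, rfl, rfl, rfl, hl', hr'⟩ := ht
      have e : (C.δ.tsub (slotSub τ)).under c m = C.δ.tsub (slotSub τ) := by
        rw [RecEnv.under, if_neg (by omega)]
      rw [e, under_slot hv.pos hv.lt] at hl' hr'
      refine ⟨by omega, us₀, l₀, r₀, rfl, ?_, hl', hr'⟩
      rw [Ctx.lift, htC, FTree.lift, if_neg c9, if_neg (by omega)]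
      simp only [Ctx.child, Ctx.lift, show ¬ 10 ≤ c by omega, if_false]

/-- Children outside of binders. -/
theorem Denotes.sub {C : Ctx} {τ : ℕ → Term} {F : Formula} (h : Denotes φ₀ C τ F) {c m : ℕ}
    {us : List Term} {l r : FTree} (hF : F.tree = .node c m [] us l r) (hc : c < 10) :
    ∃ l' r', C.lift τ = .node c m [] us l' r' ∧
      (∀ φ : Formula, φ.tree = l → Represents φ₀ l' φ) ∧
      (∀ φ : Formula, φ.tree = r → Represents φ₀ r' φ) ∧ (l = .nil → l' = .nil) ∧
      (r = .nil → r' = .nil) := by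
  obtain ⟨hc9, us₀, l₀, r₀, ht, hlift, hl, hr⟩ := h.inv hφ hF hc
  have key : ∀ t, (t = l₀ ∨ t = r₀) → ∀ φ : Formula,
      φ.tree = den (setSlots τ C.d (vars []) ∘ (C.child c m [] l₀ t).sc.slot)
        (C.δ.tsub (slotSub τ)) t →
      Represents φ₀ ((C.child c m [] l₀ t).lift (setSlots τ C.d (vars []))) φ := by
    intro t hsub φ hφt
    have hne : t ≠ .nil := by
      rintro rfl; exact φ.tree_ne_nil hφt
    refine ⟨_, _, ⟨Ctx.all_subset h.mem (Ctx.child_mem_all ht hsub hne), h.names, h.consts, ?_⟩, rfl⟩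
    rw [hφt]
    simp only [Ctx.child, show ¬ 10 ≤ c by omega, if_false]
    rfl
  have hnil : ∀ t : FTree, ∀ e δ, den e δ t = .nil → t = .nil := by
    intro t e δ h
    cases t with
    | nil => rfl
    | node c m xs us l r => simp only [den] at h; split at h <;> simp at h
  refine ⟨_, _, hlift, ?_, ?_, ?_, ?_⟩
  · intro φ hφl; exact key l₀ (Or.inl rfl) φ (by rw [hφl, hl])
  · intro φ hφr; exact key r₀ (Or.inr rfl) φ (by rw [hφr, hr])
  · intro hl0
    rw [hl] at hl0
    have := hnil _ _ _ hl0
    subst this; rfl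
  · intro hr0
    rw [hr] at hr0
    have := hnil _ _ _ hr0
    subst this; rfl

/-- Opening a quantifier. -/
theorem Denotes.open {C : Ctx} {τ : ℕ → Term} {F : Formula} (h : Denotes φ₀ C τ F) {c m x : ℕ}
    {us : List Term} {φ : Formula} (hF : F.tree = .node c m [x] us φ.tree .nil) (hc : c < 10) :
    ∃ l', C.lift τ = .node c m [x] us l' .nil ∧ (∀ a, a ∈ φ.supp ↔ a ∈ l'.names) ∧
      ∀ a, Represents φ₀ (den (Term.inst [(x, a)]) RecEnv.empty l') (φ.inst [(x, a)]) := by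
  obtain ⟨hc9, us₀, l₀, r₀, ht, hlift, hl, hr⟩ := h.inv hφ hF hc
  obtain ⟨Γ, Δ, hv⟩ := valid_of_mem hφ h.mem
  have hr₀ : r₀ = .nil := by
    cases r₀ with
    | nil => rfl
    | node c m xs us l r => simp only [den] at hr; split at hr <;> simp at hr
  subst hr₀
  have hne : l₀ ≠ .nil := by rintro rfl; exact φ.tree_ne_nil hl
  have hmem := Ctx.all_subset h.mem (Ctx.child_mem_all ht (Or.inl rfl) hne)
  refine ⟨_, hlift, ?_, ?_⟩
  · intro a
    have h1 := (Represents.mem_supp hφ ⟨C, τ, h, rfl⟩ a)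
    rw [Formula.mem_supp_iff, hF, hlift] at h1
    have h2 : ∀ a, a ∈ φ.tree.names ↔
        a ∈ ((C.child c m [x] l₀ l₀).lift (setSlots τ C.d (vars [x]))).names := by
      intro a
      rw [← mem_names_expand (goodTable hφ) (shape_of_mem hφ hmem _), expand_lift_of_mem hφ hmem, hl]
      simp only [Ctx.child, show ¬ 10 ≤ c by omega, if_false]
      rw [← hv.tsub_setSlots τ (vars [x])]
    rw [Formula.mem_supp_iff]; exact h2 a
  · intro a
    -- Instantiating `x` changes the value of the new slot from the variable `x` to the name `a`;
    -- every other slot already holds a name and is not touched.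
    have hinst : ∀ u, setSlots τ C.d [Term.name a] ((C.child c m [x] l₀ l₀).sc.slot u) =
        Term.inst [(x, a)] (setSlots τ C.d (vars [x]) ((C.child c m [x] l₀ l₀).sc.slot u)) := by
      intro u
      have e := congrFun (under_slot (τ := τ) hv.pos hv.lt [x]) u
      simp only [Function.comp] at e
      simp only [Ctx.child]
      rw [← e]
      by_cases hu : u = .var x
      · subst hu
        have := setSlots_slot_enter (sc := C.sc) (τ := τ) (us := vars [x]) (d := C.d)
          (fun _ => Term.name a) (u := .var x) (by simp [vars])
        simp only [vars, List.map_cons, List.map_nil] at this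
        simp only [vars, List.map_cons, List.map_nil]
        rw [this]
        simp [under, Term.inst]
      · rw [Scope.slot_enter_of_notMem (by simpa [vars] using hu), setSlots_of_lt (hv.slot_lt u)]
        obtain ⟨b, hb⟩ := h.names (C.sc.slot u)
        have : under (τ ∘ C.sc.slot) [x] u = .name b := by
          cases u with
          | name a => simpa [under] using hb
          | var y =>
            have : y ≠ x := by rintro rfl; exact hu rfl
            simpa [under, this] using hb
        rw [this, hb]; rfl
    have hvar : ∀ u y, setSlots τ C.d (vars [x]) ((C.child c m [x] l₀ l₀).sc.slot u) = .var y →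
        u = .var y := by
      intro u y hy
      have e := congrFun (under_slot (τ := τ) hv.pos hv.lt [x]) u
      simp only [Function.comp] at e
      simp only [Ctx.child] at hy
      rw [← e] at hy
      cases u with
      | name b => obtain ⟨b', hb'⟩ := h.names (C.sc.slot (.name b)); simp [under, hb'] at hy
      | var z =>
        by_cases hz : z = x
        · subst hz; simpa [under] using hy
        · obtain ⟨b', hb'⟩ := h.names (C.sc.slot (.var z)); simp [under, hz, hb'] at hy
    refine ⟨C.child c m [x] l₀ l₀, setSlots τ C.d [.name a], ⟨hmem, ?_, ?_, ?_⟩, ?_⟩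
    · exact fun ℓ => setSlots_ind (P := fun t => ∃ a, t = .name a) h.names (by simp) _ _
    · intro i hi
      have := Ctx.le_d_of_mem _ h.mem
      simp only [rootCtx] at this
      rw [setSlots_of_lt (by omega)]; exact h.consts i hi
    -- Instantiation after the substitution of slot values is again a substitution of slot values,
    -- with `a` in the new slot.
    · rw [Formula.tree_inst, hl, den_den]
      · congr 1
        · funext u; exact (hinst u).symm
        · simp only [Ctx.child, show ¬ 10 ≤ c by omega, if_false]
          rw [hv.tsub_setSlots]
          funext X
          cases C.δ.tsub (slotSub τ) X <;> simp [RecEnv.empty]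
      · intro b; rfl
      · intro u y hy; exact Or.inl (hvar u y hy)
      · exact hv.closed _ (fun b => h.names b.id)
    · have hvc := hv.child ht (fun X D he => defs_of_mem hφ h.mem he) (Or.inl rfl)
      refine den_lift _ _ _ _ _ _ _ (fun b => rfl) hvc.pos hvc.lt ?_ hvar hinst
      intro X ℓ hl
      simp only [Ctx.child, show ¬ 10 ≤ c by omega, if_false] at hl
      have hlt := (hv.κ_slots X ℓ hl).2
      obtain ⟨b, hb⟩ := h.names ℓ
      rw [setSlots_of_lt hlt, setSlots_of_lt hlt]
      refine ⟨?_, rfl, b, hb⟩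
      simp only [Ctx.child]; omega

/-- Calls do not occur as formulas of the game, and fixpoints unfold to the lifted definition. -/
theorem Denotes.unfold {C : Ctx} {τ : ℕ → Term} {σ : FixKind} {X : ℕ} {xs : List ℕ} {φ : Formula}
    {us : List Term} (h : Denotes φ₀ C τ (.fix σ X xs φ us)) :
    ∃ D hs, φ₀.defs X = some D ∧ D.c = σ.code ∧ D.xs = xs ∧ us.length = xs.length ∧
      hs.length = D.h.length ∧
      C.lift τ = .node 9 X [] (us ++ hs) .nil .nil ∧
      ∀ as : List Name, us = as.map .name → Represents φ₀
        (D.T.tmap (tsub (look (List.range' D.d xs.length ++ D.h) (us ++ hs))))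
        ((Formula.unfold σ X xs φ φ).inst (xs.zip as)) := by
  obtain ⟨Γ, Δ, hv⟩ := valid_of_mem hφ h.mem
  have htree := h.tree_eq hφ
  have hσ := σ.ten_le_code
  rw [Formula.tree] at htree
  -- the lifted form is a call
  obtain ⟨D, vs, hD, hlen, hlift⟩ : ∃ D vs, φ₀.defs X = some D ∧ vs.length = D.xs.length ∧
      C.lift τ = .node 9 X [] (vs ++ D.h.map τ) .nil .nil := by
    have hs := shape_of_mem hφ h.mem τ
    cases htC : C.t with
    | nil => rw [Ctx.lift, htC] at htree; simp [FTree.lift, expand] at htree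
    | node c₀ m₀ xs₀ us₀ l₀ r₀ =>
      have hwf := hv.wf
      rw [htC] at hwf
      obtain ⟨⟨hu, hc9, h10, hc11⟩, hl, hr⟩ := hwf
      by_cases c9 : c₀ = 9
      · subst c9
        obtain ⟨D, h1, h2, h3, h4, h5⟩ := hv.recs m₀ _ (hc9 rfl).1
        have e : C.lift τ = .node 9 m₀ [] (us₀.map (τ ∘ C.sc.slot) ++ D.h.map τ) .nil .nil := by
          rw [Ctx.lift, htC, FTree.lift, if_pos rfl, h3]
        rw [e, expand_call h1 (by simp [h2])] at htree
        simp only [node.injEq] at htree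
        obtain ⟨-, rfl, -⟩ := htree
        exact ⟨D, _, h1, by simp [h2], e⟩
      · by_cases hc : 10 ≤ c₀
        · obtain ⟨hlen, rfl⟩ := h10 hc
          have hD := defs_of_mem hφ h.mem (C.entry_of_node htC hc)
          have e : C.lift τ = .node 9 m₀ [] (us₀.map (τ ∘ C.sc.slot) ++
              (hid C.sc C.κ m₀ xs₀ l₀).map τ) .nil .nil := by
            rw [Ctx.lift, htC, FTree.lift, if_neg c9, if_pos hc]
          rw [e, expand_call hD (by simp [hlen])] at htree
          simp only [node.injEq] at htree
          obtain ⟨-, rfl, -⟩ := htree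
          exact ⟨_, _, hD, by simp [hlen], e⟩
        · rw [Ctx.lift, htC, FTree.lift, if_neg c9, if_neg hc, expand_of_ne c9] at htree
          simp only [node.injEq] at htree
          omega
  rw [hlift, expand_call hD hlen] at htree
  simp only [node.injEq, and_true, true_and] at htree
  obtain ⟨hc, rfl, rfl, hbody⟩ := htree
  refine ⟨D, D.h.map τ, hD, hc.symm, rfl, hlen, by simp, hlift, ?_⟩
  rintro as rfl
  obtain ⟨C', hC', us', l, ht, h10, hh, hB, hd, hT, -⟩ := exists_ctx_of_defs hφ hD
  obtain ⟨Γ', Δ', hv'⟩ := valid_of_mem hφ hC'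
  -- The stored body contains no slots besides the hidden ones, so reading it with the hidden
  -- arguments is the same as reading it with `τ`. This applies even though the defining node `C'`
  -- and the calling occurrence `C` have different contexts.
  have hB' : D.B.tmap (tsub (look D.h (D.h.map τ))) = D.B.tmap (tsub (slotSub τ)) :=
    tmap_congr fun a ha => look_map τ (((goodTable hφ).names _ _ hD a).1 ha)
  rw [hB'] at hbody
  have hden := hbody
  rw [hB, tmap_fixBody] at hden
  have hne : l ≠ .nil := by rintro rfl; exact φ.tree_ne_nil hden
  have hmem := Ctx.all_subset hC' (Ctx.child_mem_all ht (Or.inl rfl) hne)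
  have hvc := hv'.child ht (fun X D he => defs_of_mem hφ hC' he) (Or.inl rfl)
  rw [List.length_map] at hlen
  have hxs : (vars D.xs).length = (as.map Term.name).length := by simp [hlen]
  have hh_lt : ∀ ℓ ∈ D.h, ℓ < C'.d := fun ℓ hl => (hv'.hid_pos_lt ht (hh ▸ hl)).2
  -- In the context of the body, `X` stands for the fixpoint that is being unfolded. The values of
  -- the new arguments do not matter, since the stored bodies use lower slots.
  have hδ : (C'.child D.c X D.xs l l).δ.tsub (slotSub (setSlots τ C'.d (as.map Term.name))) =
      Function.update (C'.δ.tsub (slotSub τ)) X (some (σ.code, D.xs, φ.tree)) := by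
    simp only [Ctx.child, h10, if_true]
    funext Y
    have hs := congrFun (hv'.tsub_setSlots τ (as.map Term.name)) Y
    by_cases hY : Y = X
    · subst hY
      simp only [RecEnv.tsub, Function.update_self, Option.map_some]
      rw [hbody, ← hc, ← hB]
      refine congrArg (fun B => some (σ.code, D.xs, B)) (tmap_congr fun a ha => ?_)
      exact setSlots_of_lt (hh_lt _ (((goodTable hφ).names _ _ hD a).1 ha))
    · rw [Function.update_of_ne hY, ← hs]
      simp only [RecEnv.tsub, Function.update_of_ne hY]
  refine ⟨C'.child D.c X D.xs l l, setSlots τ C'.d (as.map .name), ⟨hmem, ?_, ?_, ?_⟩, ?_⟩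
  · exact fun ℓ => setSlots_ind (P := fun t => ∃ a, t = .name a) h.names (by simp) _ _
  · intro i hi
    have := Ctx.le_d_of_mem _ hC'
    simp only [rootCtx] at this
    rw [setSlots_of_lt (by omega)]; exact h.consts i hi
  · have hcl := hv'.closed (slotSub τ) (fun b => h.names b.id)
    have hvar : ∀ u y, under (τ ∘ C'.sc.slot) D.xs u = .var y → u = .var y ∧ y ∈ D.xs := by
      intro u y hy
      cases u with
      | name b => obtain ⟨b', hb'⟩ := h.names (C'.sc.slot (.name b)); simp [under, hb'] at hy
      | var z =>
        by_cases hz : z ∈ D.xs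
        · simp only [under, hz, if_true, Term.var.injEq] at hy; subst hy; exact ⟨rfl, hz⟩
        · obtain ⟨b', hb'⟩ := h.names (C'.sc.slot (.var z)); simp [under, hz, hb'] at hy
    have hcl2 : ∀ Y p, (C'.child D.c X D.xs l l).δ.tsub
        (slotSub (setSlots τ C'.d (as.map Term.name))) Y = some p → ClosedBody Y p :=
      hvc.closed _ (fun b => setSlots_ind (P := fun t => ∃ a, t = .name a) h.names (by simp) _ _)
    have e1 : (fun Y => (Function.update (C'.δ.tsub (slotSub τ)) X none Y).or
        (Function.update RecEnv.empty X (some (σ.code, D.xs, φ.tree)) Y)) =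
        Function.update (C'.δ.tsub (slotSub τ)) X (some (σ.code, D.xs, φ.tree)) := by
      funext Y
      by_cases hY : Y = X
      · subst hY; simp
      · simp only [Function.update_of_ne hY, RecEnv.empty, Option.or_none]
    -- In forming the body, `X` was left unsubstituted; unfolding fills this gap. By `den_den` both
    -- together are one substitution in the original text `l`.
    have e2 : den id (Function.update RecEnv.empty X (some (σ.code, D.xs, φ.tree))) φ.tree =
        den (under (τ ∘ C'.sc.slot) D.xs)
          (Function.update (C'.δ.tsub (slotSub τ)) X (some (σ.code, D.xs, φ.tree))) l := by
      refine (congrArg (den id _) hden).trans ?_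
      rw [den_den _ _ _ _ _ (fun _ => rfl) (fun _ _ _ => Or.inr rfl), e1]
      · rfl
      · intro Y p hp
        by_cases hY : Y = X
        · subst hY; simp at hp
        · rw [Function.update_of_ne hY] at hp; exact hcl Y p hp
    rw [Formula.tree_inst, Formula.tree_unfold, e2, ← hδ,
      den_den _ _ _ _ _ (fun _ => rfl) (fun u y hy => Or.inl (hvar u y hy).1) hcl2]
    -- The association list of the move and the slots of the scope give the same name to each
    -- parameter, both by the first match.
    have hinst : ∀ x ∈ D.xs, ∃ a ∈ as, Term.inst (D.xs.zip as) (.var x) = .name a ∧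
        setSlots τ C'.d (as.map Term.name) ((C'.sc.enter (vars D.xs) C'.d).slot (.var x)) =
          .name a := by
      intro x hx
      clear e1 e2 hcl2 hvar hcl hδ hden hbody hB' hvc hmem hB hlift hT hh_lt hxs h hv
      revert hlen hx
      generalize D.xs = zs
      generalize C'.d = d
      intro hlen hx
      induction zs generalizing as d with
      | nil => simp at hx
      | cons z zs ih =>
        cases as with
        | nil => simp at hlen
        | cons a as =>
          by_cases hxz : x = z
          · subst hxz
            exact ⟨a, by simp, by simp [Term.inst], by
              simp [setSlots, vars, Scope.enter, Scope.slot]⟩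
          · have hx' : x ∈ zs := by simpa [hxz] using hx
            obtain ⟨b, hb, h1, h2⟩ := ih as (d := d + 1) (by simpa using hlen) hx'
            have hne : Term.var x ≠ Term.var z := by simpa using hxz
            refine ⟨b, by simp [hb], ?_, ?_⟩
            · simp only [Term.inst, List.zip_cons_cons, List.lookup_cons, beq_false_of_ne hxz]
              exact h1
            · have e : (C'.sc.enter (vars (z :: zs)) d).slot (.var x) =
                  (C'.sc.enter (vars zs) (d + 1)).slot (.var x) := by
                rw [vars, List.map_cons, Scope.enter, Scope.slot, List.lookup_cons,
                  beq_false_of_ne hne]; rfl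
              have hlt : d < (C'.sc.enter (vars zs) (d + 1)).slot (.var x) := by
                clear ih h1 h2 e
                have : ∀ (zs : List ℕ) d, x ∈ zs → d ≤ (C'.sc.enter (vars zs) d).slot (.var x) := by
                  intro zs
                  induction zs with
                  | nil => simp
                  | cons w zs ih =>
                    intro d hw
                    rw [vars, List.map_cons, Scope.enter, Scope.slot, List.lookup_cons]
                    by_cases hxw : x = w
                    · simp [hxw]
                    · rw [beq_false_of_ne (by simpa using hxw)]
                      have := ih (d + 1) (by simpa [hxw] using hw)
                      change d ≤ Scope.slot _ _
                      simp only [vars] at this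
                      omega
                exact this zs (d + 1) hx'
              rw [e, List.map_cons, setSlots, Function.update_of_ne (by omega)]
              exact h2
    congr 1
    · funext u
      simp only [Function.comp, Ctx.child]
      by_cases hu : ∃ x ∈ D.xs, u = .var x
      · obtain ⟨x, hx, rfl⟩ := hu
        obtain ⟨a, -, h1, h2⟩ := hinst x hx
        rw [h2]
        simp only [under, hx, if_true]
        exact h1
      · rw [Scope.slot_enter_of_notMem (by
          intro hu'
          obtain ⟨x, hx, hxu⟩ := List.mem_map.1 hu'
          exact hu ⟨x, hx, hxu.symm⟩), setSlots_of_lt (hv'.slot_lt u)]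
        obtain ⟨b, hb⟩ := h.names (C'.sc.slot u)
        have : under (τ ∘ C'.sc.slot) D.xs u = .name b := by
          cases u with
          | name a => simpa [under] using hb
          | var y =>
            have : y ∉ D.xs := fun hy => hu ⟨y, hy, rfl⟩
            simpa [under, this] using hb
        rw [this, hb]; rfl
    · funext Y
      simp [RecEnv.empty]
  · have : (C'.child D.c X D.xs l l).lift (setSlots τ C'.d (as.map .name)) =
        D.T.tmap (tsub (slotSub (setSlots τ C'.d (as.map .name)))) := by
      rw [hT]; exact lift_eq_tmap _ _ _ _ _
    rw [this]
    -- By `names_def` the slots of the text are those of the parameters and the hidden ones; their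
    -- new values are just the arguments of the lifted call.
    refine tmap_congr (fun a ha => ?_)
    have hmap : as.map Term.name ++ D.h.map τ =
        (List.range' D.d D.xs.length ++ D.h).map (setSlots τ C'.d (as.map .name)) := by
      rw [List.map_append, hd]
      congr 1
      · have := map_range'_setSlots τ C'.d (as.map Term.name)
        rw [List.length_map, hlen] at this
        exact this.symm
      · exact List.map_congr_left (fun ℓ hl => (setSlots_of_lt (hh_lt ℓ hl)).symm)
    rw [hmap, look_map _ (names_def hφ hD ha)]
    rfl

theorem not_represents_call {T : FTree} {X : ℕ} {us : List Term} :
    ¬ Represents φ₀ T (.call X us) := by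
  rintro ⟨C, τ, h, -⟩
  have := (h.inv hφ (c := 9) rfl (by omega)).1
  omega

end

/-! ## The number of canonical positions -/

/-- A bound for the number of orbits of histories with at most `N + 1` names together with
`k` distinct and `q` arbitrary names. -/
def historyCount (k q N : ℕ) : ℕ :=
  ∑ h ∈ Finset.range (N + 2), (h + 1) ^ k * ∏ j ∈ Finset.range q, (h + k + j + 1)

theorem prod_range_succ_eq_factorial_div (k q : ℕ) :
    ∏ j ∈ Finset.range q, ((k : ℝ) + j + 1) = (k + q).factorial / k.factorial := by
  induction q with
  | zero => simp [Nat.factorial_ne_zero]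
  | succ q ih =>
    rw [Finset.prod_range_succ, ih, ← add_assoc, Nat.factorial_succ]
    push_cast; ring

/-- These are the two leading terms of the binomial expansion. Summation gives `sum_pow_le`, the
discrete counterpart of integrating a power; its factor `k + 1` is essential later. -/
theorem pow_add_mul_pow_le (a k : ℕ) : a ^ (k + 1) + (k + 1) * a ^ k ≤ (a + 1) ^ (k + 1) := by
  induction k with
  | zero => simp
  | succ k ih =>
    calc _ ≤ (a ^ (k + 1) + (k + 1) * a ^ k) * (a + 1) := by
          have : 0 ≤ (k + 1) * a ^ k := Nat.zero_le _
          calc _ = a ^ (k + 2) + (k + 2) * a ^ (k + 1) := by ring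
            _ ≤ a ^ (k + 2) + (k + 2) * a ^ (k + 1) + (k + 1) * a ^ k := Nat.le_add_right _ _
            _ = _ := by ring
      _ ≤ (a + 1) ^ (k + 1) * (a + 1) := Nat.mul_le_mul_right _ ih
      _ = _ := by ring

theorem sum_pow_le (k m : ℕ) : (k + 1) * ∑ h ∈ Finset.range m, (h + 1) ^ k ≤ (m + 1) ^ (k + 1) := by
  induction m with
  | zero => simp
  | succ m ih =>
    rw [Finset.sum_range_succ, mul_add]
    have := pow_add_mul_pow_le (m + 1) k
    omega

theorem sum_pow_le_real (k N : ℕ) :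
    (k + 1 : ℝ) * ∑ h ∈ Finset.range (N + 2), ((h : ℝ) + 1) ^ k ≤ (N + 3) ^ (k + 1) := by
  have := sum_pow_le k (N + 2)
  have h2 : (((k + 1) * ∑ h ∈ Finset.range (N + 2), (h + 1) ^ k : ℕ) : ℝ) ≤
    (((N + 2 + 1) ^ (k + 1) : ℕ) : ℝ) := by exact_mod_cast this
  push_cast at h2
  convert h2 using 2
  ring

/-- The quotient is at most `(1 + 2/(N+1))^(N+1) ≤ e² < 8`. -/
theorem add_three_pow_le {k N : ℕ} (h : k ≤ N) :
    ((N : ℝ) + 3) ^ (k + 1) ≤ 8 * (N + 1) ^ (k + 1) := by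
  have h1 : ((N : ℝ) + 3) = (1 + 2 / (N + 1)) * (N + 1) := by field_simp; ring
  rw [h1, mul_pow]
  refine mul_le_mul_of_nonneg_right ?_ (by positivity)
  have h0 : (0 : ℝ) ≤ 2 / (N + 1) := by positivity
  calc (1 + 2 / ((N : ℝ) + 1)) ^ (k + 1) ≤ (1 + 2 / ((N : ℝ) + 1)) ^ (N + 1) :=
        pow_le_pow_right₀ (by linarith) (by omega)
    _ ≤ (Real.exp (2 / (N + 1))) ^ (N + 1) := by
        refine pow_le_pow_left₀ (by linarith) ?_ _
        have := Real.add_one_le_exp (2 / ((N : ℝ) + 1)); linarith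
    _ = Real.exp 1 ^ 2 := by
        rw [← Real.exp_nat_mul, ← Real.exp_nat_mul]
        congr 1; push_cast; field_simp
    _ ≤ 8 := by
        have := Real.exp_one_lt_d9
        have h2 := Real.exp_pos 1
        nlinarith

/-- The sum over the sizes of the history, in terms of the largest size. -/
theorem historyCount_le (k q N : ℕ) :
    (historyCount k q N : ℝ) ≤ (∑ h ∈ Finset.range (N + 2), ((h : ℝ) + 1) ^ k) *
      ∏ j ∈ Finset.range q, ((N : ℝ) + 1 + (k + j + 1)) := by
  rw [historyCount, Finset.sum_mul]
  push_cast
  refine Finset.sum_le_sum (fun h hh => mul_le_mul_of_nonneg_left ?_ (by positivity))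
  refine Finset.prod_le_prod (fun _ _ => by positivity) (fun j _ => ?_)
  have : (h : ℝ) ≤ N + 1 := by
    have := Finset.mem_range.1 hh
    exact_mod_cast (by omega : h ≤ N + 1)
  linarith

/-- With `c = k + j + 1`, a factor `N + 1 + c` is at most `c (N + 1)` as soon as `c ≥ 2`. Only in
the first factor can `c` be 1, and there the correction `(N+3)/(N+1)` is enough. -/
theorem prod_le_add_three {k q N : ℕ} (h : k + q ≤ N) :
    ∏ j ∈ Finset.range q, ((N : ℝ) + 1 + (k + j + 1)) ≤
      ((N + 3) / (N + 1)) * (∏ j ∈ Finset.range q, ((k : ℝ) + j + 1)) * (N + 1) ^ q := by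
  have key : ∀ q, k + q ≤ N → ∏ j ∈ Finset.range q, ((N : ℝ) + 1 + (k + j + 1)) ≤
      (if q = 0 then (1 : ℝ) else (N + 3) / (N + 1)) * (∏ j ∈ Finset.range q, ((k : ℝ) + j + 1)) *
        (N + 1) ^ q := by
    intro q
    induction q with
    | zero => simp
    | succ q ih =>
      intro h
      have hN : (k : ℝ) + q + 1 ≤ N := by exact_mod_cast h
      have := ih (by omega)
      rw [Finset.prod_range_succ, Finset.prod_range_succ, pow_succ, if_neg (by omega)]
      have hk : (0 : ℝ) ≤ k := by positivity
      have hq : (0 : ℝ) ≤ q := by positivity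
      have hP : (0 : ℝ) ≤ ∏ j ∈ Finset.range q, ((k : ℝ) + j + 1) :=
        Finset.prod_nonneg (fun _ _ => by positivity)
      refine (mul_le_mul_of_nonneg_right this (by positivity)).trans ?_
      by_cases hq0 : q = 0
      · subst hq0
        simp only [if_true, Finset.range_zero, Finset.prod_empty, Nat.cast_zero, pow_zero]
        have e : ((N : ℝ) + 3) / (N + 1) * (1 * (k + 0 + 1)) * (1 * (N + 1)) =
          (N + 3) * (k + 1) := by field_simp; ring
        rw [e]
        nlinarith
      · rw [if_neg hq0]
        have hq1 : (1 : ℝ) ≤ q := by exact_mod_cast (by omega : 1 ≤ q)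
        have h2 : (N : ℝ) + 1 + (k + q + 1) ≤ (k + q + 1) * (N + 1) := by nlinarith
        calc _ ≤ (((N : ℝ) + 3) / (N + 1)) * (∏ j ∈ Finset.range q, ((k : ℝ) + j + 1)) *
              (N + 1) ^ q * ((k + q + 1) * (N + 1)) :=
              mul_le_mul_of_nonneg_left h2 (by positivity)
          _ = _ := by ring
  refine (key q h).trans ?_
  have hP : (0 : ℝ) ≤ ∏ j ∈ Finset.range q, ((k : ℝ) + j + 1) :=
    Finset.prod_nonneg (fun _ _ => by positivity)
  refine mul_le_mul_of_nonneg_right (mul_le_mul_of_nonneg_right ?_ hP) (by positivity)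
  split_ifs
  · rw [one_le_div (by positivity)]; linarith
  · exact le_rfl

/-- Relative to `c (N + 1)` a factor `N + 1 + c` has the size `1/c + 1/(N+1)`, so from the second
factor on the product loses enough to pay for `q + 1`. This loss is part of the reserve used by the
time bound. -/
theorem mul_prod_le {k q N : ℕ} (h : k + q ≤ N) :
    (q + 1 : ℝ) * ∏ j ∈ Finset.range q, ((N : ℝ) + 1 + (k + j + 1)) ≤
      4 * (∏ j ∈ Finset.range q, ((k : ℝ) + j + 1)) * (N + 1) ^ q := by
  -- The constants 1, 3, 4 let the induction go through for small `q`. From `q = 2` on the constant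
  -- need not grow, as then `(q+2)(N+1+c) ≤ (q+1) c (N+1)` for `c = k + q + 1`.
  have key : ∀ q, k + q ≤ N → (q + 1 : ℝ) * ∏ j ∈ Finset.range q, ((N : ℝ) + 1 + (k + j + 1)) ≤
      (if q = 0 then 1 else if q = 1 then 3 else 4) *
        (∏ j ∈ Finset.range q, ((k : ℝ) + j + 1)) * (N + 1) ^ q := by
    intro q
    induction q with
    | zero => simp
    | succ q ih =>
      intro h
      have hN : (k : ℝ) + q + 1 ≤ N := by exact_mod_cast h
      have := ih (by omega)
      rw [Finset.prod_range_succ, Finset.prod_range_succ, pow_succ, if_neg (by omega)]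
      have hk : (0 : ℝ) ≤ k := by positivity
      have hq : (0 : ℝ) ≤ q := by positivity
      have hP : (0 : ℝ) ≤ ∏ j ∈ Finset.range q, ((k : ℝ) + j + 1) :=
        Finset.prod_nonneg (fun _ _ => by positivity)
      have hR : (0 : ℝ) ≤ (∏ j ∈ Finset.range q, ((k : ℝ) + j + 1)) * (N + 1) ^ q := by positivity
      have h3 : (q + 1 : ℝ) * (((q + 1 : ℕ) + 1 : ℝ) * ((∏ j ∈ Finset.range q, ((N : ℝ) + 1 +
          (k + j + 1))) * ((N : ℝ) + 1 + (k + q + 1)))) ≤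
          (if q = 0 then 1 else if q = 1 then 3 else 4) *
          ((∏ j ∈ Finset.range q, ((k : ℝ) + j + 1)) * (N + 1) ^ q) *
          ((q + 2) * ((N : ℝ) + 1 + (k + q + 1))) := by
        calc _ = (q + 1 : ℝ) * (∏ j ∈ Finset.range q, ((N : ℝ) + 1 + (k + j + 1))) *
              ((q + 2) * ((N : ℝ) + 1 + (k + q + 1))) := by push_cast; ring
          _ ≤ _ := mul_le_mul_of_nonneg_right (by linarith) (by positivity)
      have h4 : (if q = 0 then (1 : ℝ) else if q = 1 then 3 else 4) *
          ((q + 2) * ((N : ℝ) + 1 + (k + q + 1))) ≤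
          (q + 1) * ((if q + 1 = 1 then 3 else 4) * ((k + q + 1) * (N + 1))) := by
        rcases q with _ | _ | q
        · simp only [if_true]; push_cast at hN ⊢; nlinarith
        · simp only [Nat.zero_add, Nat.one_ne_zero, if_true, if_false]
          push_cast at hN ⊢
          norm_num
          nlinarith
        · simp only [Nat.add_eq_zero_iff, Nat.one_ne_zero, and_false, if_false,
            show ¬ (q + 1 + 1 = 1) by omega, show ¬ (q + 1 + 1 + 1 = 1) by omega]
          push_cast at hN ⊢
          have hq : (0 : ℝ) ≤ q := by positivity
          have : ((q : ℝ) + 4) * ((N : ℝ) + 1 + (k + q + 3)) ≤ (q + 3) * ((k + q + 3) * (N + 1)) := by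
            nlinarith [mul_nonneg hq hk, mul_nonneg hq hq]
          nlinarith
      have h5 := mul_le_mul_of_nonneg_left h4 hR
      have hq1 : (0 : ℝ) < q + 1 := by positivity
      refine le_of_mul_le_mul_left (h3.trans ?_) hq1
      calc _ = _ := by ring
        _ ≤ _ := h5
        _ = _ := by ring
  refine (key q h).trans ?_
  have hP : (0 : ℝ) ≤ ∏ j ∈ Finset.range q, ((k : ℝ) + j + 1) :=
    Finset.prod_nonneg (fun _ _ => by positivity)
  refine mul_le_mul_of_nonneg_right (mul_le_mul_of_nonneg_right ?_ hP) (by positivity)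
  split_ifs <;> norm_num

/-- The exponent is 7 + 1. For `k ≤ 6` the sum of powers costs at most the seventh power of the
ratio. For `k ≥ 7` it costs nothing, because the divisor `k + 1` in `sum_pow_le_real` beats the 8 of
`add_three_pow_le`. The product costs one more factor. -/
theorem historyCount_le_asymp {k q N : ℕ} (h : k + q ≤ N) :
    (historyCount k q N : ℝ) ≤ (k + q).factorial / k.factorial * (N + 1) ^ (k + q + 1) *
      ((N + 3) / (N + 1)) ^ 8 := by
  have h1 := historyCount_le k q N
  have h2 := prod_le_add_three h
  rw [prod_range_succ_eq_factorial_div] at h2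
  have h0 : (1 : ℝ) ≤ (N + 3) / (N + 1) := by
    rw [one_le_div (by positivity)]; linarith
  have h3 : ∑ h ∈ Finset.range (N + 2), ((h : ℝ) + 1) ^ k ≤
      (N + 1) ^ (k + 1) * ((N + 3) / (N + 1)) ^ 7 := by
    have h4 := sum_pow_le_real k N
    have hk : (0 : ℝ) ≤ k := by positivity
    have hS : (0 : ℝ) ≤ ∑ h ∈ Finset.range (N + 2), ((h : ℝ) + 1) ^ k :=
      Finset.sum_nonneg (fun _ _ => by positivity)
    by_cases hk7 : 7 ≤ k
    · have h5 := add_three_pow_le (show k ≤ N by omega)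
      have hk7' : (7 : ℝ) ≤ k := by exact_mod_cast hk7
      have h6 : ∑ h ∈ Finset.range (N + 2), ((h : ℝ) + 1) ^ k ≤ (N + 1) ^ (k + 1) := by nlinarith
      refine h6.trans (le_mul_of_one_le_right (by positivity) (one_le_pow₀ h0))
    · have h5 : ((N : ℝ) + 3) ^ (k + 1) = (N + 1) ^ (k + 1) * ((N + 3) / (N + 1)) ^ (k + 1) := by
        rw [← mul_pow]; congr 1; field_simp
      have h6 := pow_le_pow_right₀ h0 (show k + 1 ≤ 7 by omega)
      have h7 : ((N : ℝ) + 1) ^ (k + 1) * ((N + 3) / (N + 1)) ^ (k + 1) ≤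
        (N + 1) ^ (k + 1) * ((N + 3) / (N + 1)) ^ 7 := mul_le_mul_of_nonneg_left h6 (by positivity)
      nlinarith
  calc _ ≤ _ := h1
    _ ≤ ((N + 1) ^ (k + 1) * ((N + 3) / (N + 1)) ^ 7) * _ :=
      mul_le_mul h3 h2 (Finset.prod_nonneg (fun _ _ => by positivity)) (by positivity)
    _ = _ := by ring

/-- As `k + q + 1 ≤ (k + 1)(q + 1)`, the sum absorbs the first factor with the constant 8 and the
product the second one with the constant 4. -/
theorem mul_historyCount_le {k q N : ℕ} (h : k + q ≤ N) :
    (k + q + 1 : ℝ) * historyCount k q N ≤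
      32 * ((k + q).factorial / k.factorial * (N + 1) ^ (k + q + 1)) := by
  have h1 := historyCount_le k q N
  have h2 := mul_prod_le h
  rw [prod_range_succ_eq_factorial_div] at h2
  have h3 := (sum_pow_le_real k N).trans (add_three_pow_le (show k ≤ N by omega))
  have hk : (0 : ℝ) ≤ k := by positivity
  have hq : (0 : ℝ) ≤ q := by positivity
  have h4 : (k + q + 1 : ℝ) ≤ (k + 1) * (q + 1) := by nlinarith
  calc _ ≤ ((k + 1) * (q + 1) : ℝ) * ((∑ h ∈ Finset.range (N + 2), ((h : ℝ) + 1) ^ k) *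
      ∏ j ∈ Finset.range q, ((N : ℝ) + 1 + (k + j + 1))) :=
        mul_le_mul h4 h1 (by positivity) (by positivity)
    _ = ((k + 1) * (∑ h ∈ Finset.range (N + 2), ((h : ℝ) + 1) ^ k)) *
      ((q + 1) * ∏ j ∈ Finset.range q, ((N : ℝ) + 1 + (k + j + 1))) := by ring
    _ ≤ _ := mul_le_mul h3 h2 (mul_nonneg (by positivity)
        (Finset.prod_nonneg (fun _ _ => by positivity))) (by positivity)
    _ = _ := by ring

theorem tendsto_ratio : Tendsto (fun N : ℕ => (((N : ℝ) + 3) / (N + 1)) ^ 8 - 1) atTop (𝓝 0) := by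
  have h1 : Tendsto (fun N : ℕ => 1 + 2 * (1 / ((N : ℝ) + 1))) atTop (𝓝 (1 + 2 * 0)) :=
    tendsto_const_nhds.add (tendsto_one_div_add_atTop_nhds_zero_nat.const_mul 2)
  have h2 : (fun N : ℕ => (((N : ℝ) + 3) / (N + 1)) ^ 8 - 1) =
      fun N : ℕ => (1 + 2 * (1 / ((N : ℝ) + 1))) ^ 8 - 1 := by
    funext N
    congr 2
    field_simp; ring
  rw [h2]
  have := (h1.pow 8).sub_const 1
  simpa using this

/-! ## Reachable positions -/

section

variable {S : Type u} [Nominal S]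

/-- The invariant of the positions of the bounded game. -/
structure Admissible (φ₀ : Formula) (N : ℕ) (P : Position S) : Prop where
  conf : supp P.1.1 ⊆ P.1.2
  card : P.1.2.card ≤ N + 1
  rep : ∃ T, Represents φ₀ T P.2

theorem HistBound.card_le {N : ℕ} {A H H' : Finset Name} (h : HistBound N A H H') :
    H'.card ≤ N + 1 := by
  rcases h with ⟨h, rfl⟩ | ⟨-, -, -, h⟩ <;> omega

theorem HistBound.inter_subset {N : ℕ} {A H H' : Finset Name} (h : HistBound N A H H') :
    A ∩ H ⊆ H' := by
  rcases h with ⟨-, rfl⟩ | ⟨-, h, -⟩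
  · exact Finset.inter_subset_right
  · exact h

theorem HistBound.subset {N : ℕ} {A H H' : Finset Name} (h : HistBound N A H H') : H' ⊆ H := by
  rcases h with ⟨-, rfl⟩ | ⟨-, -, h, -⟩
  · exact subset_rfl
  · exact h

variable {φ₀ : Formula}

/-- Formulas stay representable by `Denotes.sub`, `Denotes.open` and `Denotes.unfold`, according to
the kind of move. After a transition the pruned history still contains the support of the new state,
because those names must be kept. -/
theorem Admissible.move (hφ : φ₀.Closed) {L : FLTS S} {N : ℕ} {P P' : Position S}
    (hP : Admissible φ₀ N P) (h : BoundedMove L N P P') : Admissible φ₀ N P' := by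
  obtain ⟨hs, hc, T, C, τ, hC, rfl⟩ := hP
  have conf : ∀ {c : S × Finset Name} {ℓ s' H₁ H'} {φ : Formula}, L.step c ℓ (s', H₁) →
      HistBound N (supp s' ∪ φ.supp) H₁ H' → supp s' ⊆ H' := by
    intro c ℓ s' H₁ H' φ h hH
    refine subset_trans ?_ hH.inter_subset
    exact Finset.subset_inter Finset.subset_union_left (L.step_conf _ _ _ h).2
  cases h with
  | or_left c φ ψ | and_left c φ ψ =>
    obtain ⟨l, r, -, h, -⟩ := hC.sub hφ (by rw [Formula.tree]) (by omega)
    exact ⟨hs, hc, l, h φ rfl⟩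
  | or_right c φ ψ | and_right c φ ψ =>
    obtain ⟨l, r, -, -, h, -⟩ := hC.sub hφ (by rw [Formula.tree]) (by omega)
    exact ⟨hs, hc, r, h ψ rfl⟩
  | some c x φ a | all c x φ a | fresh c x φ a =>
    obtain ⟨l, -, -, h⟩ := hC.open hφ (φ := φ) (by rw [Formula.tree]) (by omega)
    exact ⟨hs, hc, _, h a⟩
  | dia c t φ as s' H₁ H' h hH | box c t φ as s' H₁ H' h hH =>
    obtain ⟨l, r, -, h', -⟩ := hC.sub hφ (by rw [Formula.tree]) (by omega)
    exact ⟨conf h hH, hH.card_le, l, h' φ rfl⟩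
  | fix c σ X xs φ as =>
    obtain ⟨D, hs', -, -, -, -, -, -, h⟩ := hC.unfold hφ
    exact ⟨hs, hc, _, h as rfl⟩

theorem Admissible.reflTransGen (hφ : φ₀.Closed) {L : FLTS S} {N : ℕ} {P P' : Position S}
    (hP : Admissible φ₀ N P) (h : Relation.ReflTransGen (BoundedMove L N) P P') :
    Admissible φ₀ N P' := by
  induction h with
  | refl => exact hP
  | tail _ h ih => exact ih.move hφ h

theorem admissible_init (hφ : φ₀.Closed) {N : ℕ} {s₀ : S} {H₀ H : Finset Name}
    (hs : supp s₀ ⊆ H₀) (h : HistBound N (supp s₀ ∪ φ₀.supp) H₀ H) :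
    Admissible φ₀ N ((s₀, H), φ₀) :=
  ⟨(Finset.subset_inter Finset.subset_union_left hs).trans h.inter_subset, h.card_le, _,
    represents_root hφ⟩

theorem admissible_of_pos (hφ : φ₀.Closed) {L : FLTS S} {N : ℕ} {s₀ : S} {H₀ : Finset Name}
    (hs : supp s₀ ⊆ H₀) {P : Position S} (h : P ∈ (boundedGame L φ₀ s₀ H₀ N).pos) :
    Admissible φ₀ N P := by
  obtain ⟨H, hH, h⟩ := h
  exact (admissible_init hφ hs hH).reflTransGen hφ h

end

/-! ## Extensions of a history by names -/

noncomputable def freshFor (A : Finset Name) : Name := (exists_name_notMem A).choose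

theorem freshFor_notMem (A : Finset Name) : freshFor A ∉ A := (exists_name_notMem A).choose_spec

/-- The lists of `m` names that represent all such lists up to the permutations that fix `H`;
the last `k` entries of the lists are distinct. -/
noncomputable def extensions (H : Finset Name) (k : ℕ) : ℕ → Finset (List Name)
  | 0 => {[]}
  | m + 1 => (extensions H k m).biUnion fun E =>
      (insert (freshFor (H ∪ E.toFinset)) (if m < k then H else H ∪ E.toFinset)).image (· :: E)

theorem length_of_mem_extensions {H : Finset Name} {k m : ℕ} {E : List Name}
    (h : E ∈ extensions H k m) : E.length = m := by
  induction m generalizing E with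
  | zero => simp only [extensions, Finset.mem_singleton] at h; simp [h]
  | succ m ih =>
    simp only [extensions, Finset.mem_biUnion, Finset.mem_image] at h
    obtain ⟨E', hE', a, -, rfl⟩ := h
    simp [ih hE']

theorem card_extensions_le (H : Finset Name) (k m : ℕ) : (extensions H k m).card ≤
    ∏ i ∈ Finset.range m, (if i < k then H.card + 1 else H.card + i + 1) := by
  induction m with
  | zero => simp [extensions]
  | succ m ih =>
    rw [Finset.prod_range_succ, extensions]
    refine (Finset.card_biUnion_le_card_mul _ _ _ (fun E hE => ?_)).trans (Nat.mul_le_mul_right _ ih)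
    refine Finset.card_image_le.trans ((Finset.card_insert_le _ _).trans ?_)
    split_ifs
    · exact le_rfl
    · have h1 := Finset.card_union_le H E.toFinset
      have h2 := E.toFinset_card_le
      rw [length_of_mem_extensions hE] at h2
      omega

theorem prod_extensions (h k q : ℕ) :
    ∏ i ∈ Finset.range (k + q), (if i < k then h + 1 else h + i + 1) =
      (h + 1) ^ k * ∏ j ∈ Finset.range q, (h + k + j + 1) := by
  rw [Finset.prod_range_add]
  congr 1
  · rw [Finset.prod_congr rfl (fun i hi => if_pos (Finset.mem_range.1 hi))]; simp
  · refine Finset.prod_congr rfl (fun i _ => ?_)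
    rw [if_neg (by omega)]; ring

/-- The list is normalised from its last entry forwards. A name that is neither in `H` nor among the
entries already treated can be moved to the chosen fresh name without disturbing these. Any other
name is already admissible: among the last `k` entries, which are distinct, it must lie in `H`. -/
theorem exists_smul_mem_extensions (H : Finset Name) (k : ℕ) (E : List Name)
    (hE : ∀ a E', a :: E' <:+ E → E'.length < k → a ∉ E') :
    ∃ π : FinPerm, (∀ a ∈ H, π • a = a) ∧ E.map (π • ·) ∈ extensions H k E.length := by
  induction E with
  | nil => exact ⟨1, by simp, by simp [extensions]⟩
  | cons a E ih =>
    obtain ⟨π, hπ, hm⟩ := ih (fun a E' h => hE a E' (h.trans (List.suffix_cons _ _)))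
    set A := H ∪ (E.map (π • ·)).toFinset with hA
    have key : ∃ ρ : FinPerm, (∀ b ∈ A, ρ • b = b) ∧ ρ • π • a ∈ insert (freshFor A)
        (if E.length < k then H else A) := by
      by_cases ha : π • a ∈ A
      · refine ⟨1, by simp, ?_⟩
        rw [one_smul]
        refine Finset.mem_insert_of_mem ?_
        split_ifs with hk
        · rcases Finset.mem_union.1 ha with ha | ha
          · exact ha
          · obtain ⟨b, hb, hb'⟩ := List.mem_map.1 (List.mem_toFinset.1 ha)
            have := smul_left_cancel π hb'
            exact absurd (this ▸ hb) (hE a E (List.suffix_refl _) hk)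
        · exact ha
      · obtain ⟨ρ, hρ⟩ := exists_finPerm_of_injOn (insert (π • a) A)
          (fun b => if b = π • a then freshFor A else b) (by
            have hf := freshFor_notMem A
            have hne : ∀ b ∈ insert (π • a) A, b ≠ π • a → b ∈ A :=
              fun b hb h => (Finset.mem_insert.1 hb).resolve_left h
            intro b hb c hc hbc
            simp only at hbc
            split_ifs at hbc with h1 h2 h2
            · rw [h1, h2]
            · exact absurd (hbc ▸ hne c hc h2) hf
            · exact absurd (hbc ▸ hne b hb h1) hf
            · exact hbc)
        refine ⟨ρ, fun b hb => ?_, ?_⟩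
        · rw [hρ b (Finset.mem_insert_of_mem hb), if_neg]
          rintro rfl; exact ha hb
        · rw [hρ _ (Finset.mem_insert_self _ _), if_pos rfl]
          exact Finset.mem_insert_self _ _
    obtain ⟨ρ, hρ, hρa⟩ := key
    have e : E.map ((ρ * π) • ·) = E.map (π • ·) := by
      refine List.map_congr_left (fun b hb => ?_)
      rw [mul_smul]
      exact hρ _ (Finset.mem_union_right _ (List.mem_toFinset.2 (List.mem_map.2 ⟨b, hb, rfl⟩)))
    refine ⟨ρ * π, fun b hb => ?_, ?_⟩
    · rw [mul_smul, hπ b hb, hρ b (Finset.mem_union_left _ hb)]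
    · rw [List.length_cons, extensions, Finset.mem_biUnion]
      refine ⟨_, hm, Finset.mem_image.2 ⟨ρ • π • a, hρa, ?_⟩⟩
      rw [List.map_cons, e, mul_smul]

/-! ## Counting orbits of positions -/

/-- `[f m, …, f 1]`. -/
def stack (f : ℕ → Name) : ℕ → List Name
  | 0 => []
  | m + 1 => f (m + 1) :: stack f m

theorem length_stack (f : ℕ → Name) (m : ℕ) : (stack f m).length = m := by
  induction m <;> simp_all [stack]

theorem map_stack (g : Name → Name) (f : ℕ → Name) (m : ℕ) :
    (stack f m).map g = stack (g ∘ f) m := by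
  induction m <;> simp_all [stack]

theorem getD_stack (f : ℕ → Name) {m ℓ : ℕ} (h1 : 0 < ℓ) (h2 : ℓ ≤ m) (b : Name) :
    (stack f m).getD (m - ℓ) b = f ℓ := by
  induction m with
  | zero => omega
  | succ m ih =>
    by_cases h : ℓ = m + 1
    · subst h; simp [stack]
    · rw [stack, show m + 1 - ℓ = (m - ℓ) + 1 by omega, List.getD_cons_succ]
      exact ih (by omega)

theorem mem_stack {f : ℕ → Name} {m : ℕ} {a : Name} :
    a ∈ stack f m ↔ ∃ i < m, f (1 + i) = a := by
  induction m with
  | zero => simp [stack]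
  | succ m ih =>
    rw [stack, List.mem_cons, ih]
    constructor
    · rintro (rfl | ⟨i, hi, rfl⟩)
      · exact ⟨m, by omega, by rw [add_comm]⟩
      · exact ⟨i, by omega, rfl⟩
    · rintro ⟨i, hi, rfl⟩
      by_cases h : i = m
      · left; rw [h, add_comm]
      · right; exact ⟨i, by omega, rfl⟩

theorem suffix_stack {f : ℕ → Name} {m : ℕ} {a : Name} {E : List Name}
    (h : a :: E <:+ stack f m) : ∃ j, E = stack f j ∧ a = f (j + 1) := by
  induction m with
  | zero => simp [stack] at h
  | succ m ih =>
    rw [stack, List.suffix_cons_iff] at h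
    rcases h with h | h
    · simp only [List.cons.injEq] at h; exact ⟨m, h.2, h.1⟩
    · exact ih h

/-- The list holds the slots from the highest one down to slot 1, so slot `ℓ` is at index `length -
ℓ`; slot 0 falls outside and gets the default. -/
def stackVal (E : List Name) (ℓ : ℕ) : Term := .name (E.getD (E.length - ℓ) ⟨0⟩)

section

variable {S : Type u} [Nominal S]

noncomputable instance : Inhabited Formula := ⟨.eq (.var 0) (.var 0)⟩

/-- The formula of an occurrence whose slots have the values in `E`. -/
noncomputable def formulaOf (φ₀ : Formula) (C : Ctx) (E : List Name) : Formula :=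
  Function.invFun Formula.tree ((C.lift (stackVal E)).expand φ₀.defs)

theorem expand_lift_eq_tmap {φ₀ : Formula} (hφ : φ₀.Closed) {C : Ctx}
    (hC : C ∈ (rootCtx φ₀).all) (τ : ℕ → Term) :
    (C.lift τ).expand φ₀.defs =
      ((C.lift slotTerm).expand φ₀.defs).tmap (tsub (slotSub τ)) := by
  rw [← expand_tmap (goodTable hφ) (shape_of_mem hφ hC _)]
  exact congrArg (expand φ₀.defs) (lift_eq_tmap _ _ _ _ _)

/-- The values of the slots `1, …, k + q` determine the formula at an occurrence, and permutations
act on these values. The last `k` entries of the list are the values of the first `k` slots, that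
is, the distinct constants of `φ₀`. -/
theorem exists_formulaOf {φ₀ : Formula} (hφ : φ₀.Closed) {T : FTree} {F : Formula}
    (h : Represents φ₀ T F) :
    ∃ C ∈ (rootCtx φ₀).all, ∃ E : List Name, E.length = φ₀.supp.card + φ₀.depth ∧
      (∀ a E', a :: E' <:+ E → E'.length < φ₀.supp.card → a ∉ E') ∧
      ∀ π : FinPerm, π • F = formulaOf φ₀ C (E.map (π • ·)) := by
  obtain ⟨C, τ, h, rfl⟩ := h
  choose f hf using h.names
  set m := φ₀.supp.card + φ₀.depth with hm
  refine ⟨C, h.mem, stack f m, length_stack _ _, ?_, ?_⟩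
  · intro a E' hE hk ha
    obtain ⟨j, rfl, rfl⟩ := suffix_stack hE
    rw [length_stack] at hk
    obtain ⟨i, hi, hij⟩ := mem_stack.1 ha
    have hnd : φ₀.consts.Nodup := List.nodup_dedup _
    have hl := φ₀.length_consts
    have e1 := h.consts i (by omega)
    have e2 := h.consts j (by omega)
    rw [hf, hij] at e1
    rw [add_comm 1 j, hf] at e2
    rw [e1] at e2
    have := (hnd.getElem_inj_iff).1 (Term.name.inj e2)
    omega
  · intro π
    rw [map_stack, formulaOf]
    have key : (π • F).tree = (C.lift (stackVal (stack ((π • ·) ∘ f) m))).expand φ₀.defs := by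
      rw [Formula.tree_smul, h.tree_eq hφ, expand_lift_eq_tmap hφ h.mem τ,
        expand_lift_eq_tmap hφ h.mem (stackVal _), Term.rename_eq_tsub, tmap_tmap]
      have e : ∀ a ∈ ((C.lift slotTerm).expand φ₀.defs).names,
          tsub (fun a => Term.name (π • a)) (slotSub τ a) =
            slotSub (stackVal (stack ((π • ·) ∘ f) m)) a := by
        intro a ha
        rw [mem_names_expand (goodTable hφ) (shape_of_mem hφ h.mem _)] at ha
        obtain ⟨h1, h2⟩ := names_lift_pos_lt hφ h.mem ha
        have h3 := Ctx.depth_all _ _ h.mem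
        simp only [rootCtx, Formula.depth_tree, Formula.length_consts] at h3
        rw [slotSub, hf, slotSub, stackVal, length_stack, getD_stack _ h1 (by omega)]
        rfl
      rw [← tmap_congr e]
      congr 1
      funext u
      cases u <;> rfl
    rw [← key, Function.leftInverse_invFun (Formula.tree_injective)]

/-- Pairs of a state and a history, one for each orbit and each size of the history. -/
theorem exists_history_representatives (h : OrbitFinite S) :
    ∃ r : MulAction.orbitRel.Quotient FinPerm S → ℕ → S × Finset Name,
      (∀ o n, (r o n).2.card ≤ n) ∧
      ∀ (s : S) (H : Finset Name), supp s ⊆ H →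
        ∃ π : FinPerm, π • (s, H) = r (Quotient.mk'' s) H.card := by
  classical
  have key : ∀ (o : MulAction.orbitRel.Quotient FinPerm S) (n : ℕ), ∃ p : S × Finset Name,
      p.2.card ≤ n ∧ ∀ (s : S) (H : Finset Name), supp s ⊆ H → Quotient.mk'' s = o → H.card = n →
        ∃ π : FinPerm, π • (s, H) = p := by
    intro o n
    by_cases hex : ∃ (s : S) (H : Finset Name), supp s ⊆ H ∧ Quotient.mk'' s = o ∧ H.card = n
    · obtain ⟨s, H, hs, rfl, hn⟩ := hex
      refine ⟨(s, H), hn.le, fun s' H' hs' ho hn' => ?_⟩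
      obtain ⟨π, hπ⟩ := (Quotient.exact ho : MulAction.orbitRel FinPerm S s' s)
      simp only at hπ
      -- Both histories contain the supports of their states and have the same size, so the
      -- permutation between the states can be corrected to match the histories.
      obtain ⟨ρ, h1, h2⟩ := exists_finPerm_map_history (A := supp s) (H := H) (H' := H') π
        (by omega) (fun a ha => ⟨fun _ => hs' (by
          rw [← hπ, supp_smul]; exact Finset.smul_mem_smul_finset ha), fun _ => hs ha⟩)
      refine ⟨ρ⁻¹, ?_⟩
      rw [inv_smul_eq_iff, Prod.smul_mk, h2, smul_congr h1, hπ]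
    · rcases isEmpty_or_nonempty S with hS | ⟨⟨s⟩⟩
      · induction o using Quotient.inductionOn' with | _ s => exact hS.elim s
      · exact ⟨(s, ∅), by simp, fun s H h1 h2 h3 => absurd ⟨s, H, h1, h2, h3⟩ hex⟩
  choose r hr using key
  exact ⟨r, fun o n => (hr o n).1, fun s H hs => (hr _ _).2 s H hs rfl rfl⟩

/-- A permutation first takes `(s, H)` to its representative. A second one, which fixes the
representative history pointwise and hence the state, normalises the slot values. What remains is an
orbit of states, a size of the history, an occurrence in `φ₀` and an element of `extensions`. -/
theorem finite_orbits_admissible {φ₀ : Formula} (hφ : φ₀.Closed) (h : OrbitFinite S) (N : ℕ)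
    {Q : Set (Position S)} (hQ : ∀ P ∈ Q, Admissible φ₀ N P) :
    ((fun P => MulAction.orbit FinPerm P) '' Q).Finite ∧
    ((fun P => MulAction.orbit FinPerm P) '' Q).ncard ≤
      numOrbits S * φ₀.size * historyCount φ₀.supp.card φ₀.depth N := by
  classical
  have : Finite (MulAction.orbitRel.Quotient FinPerm S) := h
  have := Fintype.ofFinite (MulAction.orbitRel.Quotient FinPerm S)
  obtain ⟨r, hr1, hr2⟩ := exists_history_representatives h
  let m := φ₀.supp.card + φ₀.depth
  let R : Finset (Set (Position S)) := (Finset.univ : Finset (MulAction.orbitRel.Quotient FinPerm S)).biUnion fun o =>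
    (Finset.univ : Finset (Fin (rootCtx φ₀).all.length)).biUnion fun i =>
      (Finset.range (N + 2)).biUnion fun n => (extensions (r o n).2 φ₀.supp.card m).image fun E =>
        MulAction.orbit FinPerm ((r o n, formulaOf φ₀ ((rootCtx φ₀).all.get i) E) : Position S)
  have hsub : (fun P => MulAction.orbit FinPerm P) '' Q ⊆ (R : Set (Set (Position S))) := by
    rintro _ ⟨⟨⟨s, H⟩, F⟩, hP, rfl⟩
    obtain ⟨hs, hc, T, hT⟩ := hQ _ hP
    simp only at hs hc hT
    obtain ⟨π, hπ⟩ := hr2 s H hs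
    obtain ⟨C, hC, E, hE, hE', hF⟩ := exists_formulaOf hφ hT
    obtain ⟨ρ, hρ, hm⟩ := exists_smul_mem_extensions (r (Quotient.mk'' s) H.card).2 φ₀.supp.card
      (E.map (π • ·)) (by
        intro a E' h1 h2 h3
        obtain ⟨E'', h4, h5⟩ := List.suffix_map_iff.1 h1
        cases E'' with
        | nil => simp at h5
        | cons b E'' =>
          simp only [List.map_cons, List.cons.injEq] at h5
          obtain ⟨rfl, rfl⟩ := h5
          obtain ⟨c, hc, hcb⟩ := List.mem_map.1 h3
          have := smul_left_cancel π hcb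
          exact hE' b E'' h4 (by simpa using h2) (this ▸ hc))
    obtain ⟨i, hi, rfl⟩ := List.getElem_of_mem hC
    simp only [R, Finset.coe_biUnion, Set.mem_iUnion, Finset.mem_coe, Finset.mem_image,
      Finset.mem_univ, Finset.mem_range, exists_prop, true_and]
    refine ⟨Quotient.mk'' s, ⟨i, hi⟩, H.card, by omega, (E.map (π • ·)).map (ρ • ·), ?_, ?_⟩
    · simpa [hE, m] using hm
    · have e1 : (ρ * π) • (((s, H), F) : Position S) =
          (r (Quotient.mk'' s) H.card, formulaOf φ₀ (rootCtx φ₀).all[i]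
            ((E.map (π • ·)).map (ρ • ·))) := by
        have e2 : ρ • (r (Quotient.mk'' s) H.card) = r (Quotient.mk'' s) H.card := by
          have hsup : supp (r (Quotient.mk'' s) H.card).1 ⊆ (r (Quotient.mk'' s) H.card).2 := by
            rw [← hπ, Prod.smul_mk, supp_smul]
            exact Finset.smul_finset_subset_smul_finset hs
          refine Prod.ext ?_ ?_
          · rw [Prod.smul_fst]
            conv_rhs => rw [← one_smul FinPerm (r (Quotient.mk'' s) H.card).1]
            exact smul_congr (fun a ha => by rw [hρ a (hsup ha), one_smul])
          · rw [Prod.smul_snd]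
            ext a
            rw [Finset.mem_smul_finset]
            constructor
            · rintro ⟨b, hb, rfl⟩; rwa [hρ b hb]
            · intro ha; exact ⟨a, ha, hρ a ha⟩
        rw [Prod.smul_mk, hF, List.map_map]
        refine Prod.ext ?_ ?_
        · simp only; rw [mul_smul, hπ, e2]
        · simp only; congr 1
      simp only [List.get_eq_getElem]
      rw [← e1]
      exact MulAction.orbit_smul _ _
  have hcard : R.card ≤ numOrbits S * φ₀.size * historyCount φ₀.supp.card φ₀.depth N := by
    have h1 : ∀ o, ((Finset.univ : Finset (Fin (rootCtx φ₀).all.length)).biUnion fun i =>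
      (Finset.range (N + 2)).biUnion fun n => (extensions (r o n).2 φ₀.supp.card m).image fun E =>
        MulAction.orbit FinPerm
          ((r o n, formulaOf φ₀ ((rootCtx φ₀).all.get i) E) : Position S)).card ≤
        φ₀.size * historyCount φ₀.supp.card φ₀.depth N := by
      intro o
      refine (Finset.card_biUnion_le_card_mul _ _ (historyCount φ₀.supp.card φ₀.depth N)
        (fun i _ => ?_)).trans ?_
      · refine Finset.card_biUnion_le.trans (Finset.sum_le_sum (fun n _ => ?_))
        refine Finset.card_image_le.trans ((card_extensions_le _ _ _).trans ?_)
        rw [prod_extensions]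
        have := hr1 o n
        gcongr
      · refine Nat.mul_le_mul_right _ ?_
        rw [Finset.card_univ, Fintype.card_fin, Ctx.length_all]
        exact φ₀.nodes_tree_le
    refine (Finset.card_biUnion_le_card_mul _ _ _ (fun o _ => h1 o)).trans ?_
    rw [Finset.card_univ, ← Nat.card_eq_fintype_card, mul_assoc]; rfl
  refine ⟨R.finite_toSet.subset hsub, ?_⟩
  refine (Set.ncard_le_ncard hsub R.finite_toSet).trans ?_
  rwa [Set.ncard_coe_finset]

variable {L : FLTS S} {φ₀ : Formula} {s₀ : S} {H₀ : Finset Name}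

/-- The number of positions of the orbit game. -/
theorem IsSetup.finite_pos (h : IsSetup L φ₀ s₀ H₀) :
    (boundedOrbitGame L φ₀ s₀ H₀).pos.Finite ∧ (boundedOrbitGame L φ₀ s₀ H₀).pos.ncard ≤
      numOrbits S * φ₀.size * historyCount φ₀.supp.card φ₀.depth (setupGrade S φ₀) :=
  finite_orbits_admissible h.closed h.orbitFinite.1 _
    (fun _ hP => admissible_of_pos h.closed h.conf hP)

theorem le_setupGrade (S : Type u) [Nominal S] (φ₀ : Formula) :
    φ₀.supp.card + φ₀.depth ≤ setupGrade S φ₀ := Nat.le_add_right _ _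

theorem IsSetup.ncard_pos_le (h : IsSetup L φ₀ s₀ H₀) :
    ((boundedOrbitGame L φ₀ s₀ H₀).pos.ncard : ℝ) ≤ sizeBound S φ₀ *
      (1 + ((((setupGrade S φ₀ : ℝ) + 3) / (setupGrade S φ₀ + 1)) ^ 8 - 1)) := by
  have h1 : ((boundedOrbitGame L φ₀ s₀ H₀).pos.ncard : ℝ) ≤
      numOrbits S * φ₀.size * historyCount φ₀.supp.card φ₀.depth (setupGrade S φ₀) := by
    exact_mod_cast h.finite_pos.2
  refine h1.trans ((mul_le_mul_of_nonneg_left (historyCount_le_asymp (le_setupGrade S φ₀))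
    (by positivity)).trans (le_of_eq ?_))
  rw [sizeBound]; ring

/-- This is the reserve of the time bound: handling lists of up to `k + q` names costs factors `k +
q + 1`, and each of them can be charged to a factor that counts positions. -/
theorem IsSetup.mul_ncard_pos_le (h : IsSetup L φ₀ s₀ H₀) :
    ((φ₀.supp.card : ℝ) + φ₀.depth + 1) * (boundedOrbitGame L φ₀ s₀ H₀).pos.ncard ≤
      32 * sizeBound S φ₀ := by
  have h1 : ((boundedOrbitGame L φ₀ s₀ H₀).pos.ncard : ℝ) ≤
      numOrbits S * φ₀.size * historyCount φ₀.supp.card φ₀.depth (setupGrade S φ₀) := by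
    exact_mod_cast h.finite_pos.2
  have h2 := mul_historyCount_le (le_setupGrade S φ₀)
  calc _ ≤ ((φ₀.supp.card : ℝ) + φ₀.depth + 1) *
        (numOrbits S * φ₀.size * historyCount φ₀.supp.card φ₀.depth (setupGrade S φ₀)) :=
        mul_le_mul_of_nonneg_left h1 (by positivity)
    _ = numOrbits S * φ₀.size * (((φ₀.supp.card : ℝ) + φ₀.depth + 1) *
        historyCount φ₀.supp.card φ₀.depth (setupGrade S φ₀)) := by ring
    _ ≤ numOrbits S * φ₀.size * _ := mul_le_mul_of_nonneg_left h2 (by positivity)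
    _ = _ := by rw [sizeBound]; ring

end

/-! ## Equivariance of the game -/

theorem Term.rename_inst (π : FinPerm) (γ : List (ℕ × Name)) (u : Term) :
    (u.inst γ).rename π = (u.rename π).inst (γ.map fun p => (p.1, π • p.2)) := by
  cases u with
  | name a => rfl
  | var x =>
    simp only [Term.inst, Term.rename]
    induction γ with
    | nil => rfl
    | cons p γ ih =>
      obtain ⟨y, b⟩ := p
      simp only [List.map_cons, List.lookup_cons]
      by_cases h : x = y
      · subst h; simp [Term.rename]
      · rw [beq_false_of_ne h]; exact ih

namespace Formula

theorem rename_inst (π : FinPerm) (φ : Formula) (γ : List (ℕ × Name)) :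
    (φ.inst γ).rename π = (φ.rename π).inst (γ.map fun p => (p.1, π • p.2)) := by
  induction φ generalizing γ with
  | _ => simp_all [inst, rename, Term.rename_inst, List.filter_map, Function.comp_def]

theorem rename_unfold (π : FinPerm) (σ : FixKind) (X : ℕ) (xs : List ℕ) (ψ φ : Formula) :
    (unfold σ X xs ψ φ).rename π = unfold σ X xs (ψ.rename π) (φ.rename π) := by
  induction φ with
  | call Y us => simp only [unfold, rename]; split_ifs <;> simp [rename]
  | fix τ Y ys φ us ih => simp only [unfold, rename]; split_ifs <;> simp [rename, ih]
  | _ => simp_all [unfold, rename]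

theorem supp_smul (π : FinPerm) (φ : Formula) : (π • φ).supp = π • φ.supp := by
  ext a
  rw [mem_supp_iff, tree_smul, Term.rename_eq_tsub, mem_names_tmap, Finset.mem_smul_finset]
  simp [Term.nameList, mem_supp_iff, eq_comm]

theorem smul_eq_self {π : FinPerm} {φ : Formula} (h : ∀ a ∈ φ.supp, π • a = a) : π • φ = φ := by
  refine tree_injective ?_
  rw [tree_smul, Term.rename_eq_tsub]
  have : φ.tree = φ.tree.tmap (tsub .name) := by
    have e : tsub Term.name = id := by funext u; cases u <;> rfl
    rw [e, tmap_id]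
  conv_rhs => rw [this]
  exact tmap_congr (fun a ha => by rw [h a (mem_supp_iff.2 ha)])

theorem defenderMoves_smul (π : FinPerm) (φ : Formula) :
    (π • φ).DefenderMoves ↔ φ.DefenderMoves := by
  have hinj : Function.Injective (Term.rename π) := by
    intro u v h
    cases u <;> cases v <;> simp_all [Term.rename]
  cases φ with
  | eq u v | ne u v => simp [smul_def, rename, DefenderMoves, hinj.eq_iff]
  | _ => simp [smul_def, rename, DefenderMoves]

theorem rank_smul (π : FinPerm) (φ₀ φ : Formula) : φ₀.rank (π • φ) = φ₀.rank φ := by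
  cases φ with
  | fix σ X xs φ us => cases σ <;> simp [smul_def, rename, rank]
  | _ => simp [smul_def, rename, rank]

end Formula

section

variable {S : Type u} [Nominal S]

theorem HistBound.smul {N : ℕ} {A H H' : Finset Name} (h : HistBound N A H H') (π : FinPerm) :
    HistBound N (π • A) (π • H) (π • H') := by
  rcases h with ⟨h, rfl⟩ | ⟨h1, h2, h3, h4⟩
  · exact Or.inl ⟨by rwa [Finset.card_smul_finset], rfl⟩
  · refine Or.inr ⟨by rwa [Finset.card_smul_finset], ?_, Finset.smul_finset_subset_smul_finset h3,
      by rwa [Finset.card_smul_finset]⟩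
    rw [← Finset.smul_finset_inter]
    exact Finset.smul_finset_subset_smul_finset h2

theorem BoundedMove.smul {L : FLTS S} {N : ℕ} {P P' : Position S} (h : BoundedMove L N P P')
    (π : FinPerm) : BoundedMove L N (π • P) (π • P') := by
  have key : ∀ (c : S × Finset Name) ℓ s' H₁ H' (φ : Formula), L.step c ℓ (s', H₁) →
      HistBound N (supp s' ∪ φ.supp) H₁ H' → L.step (π • c) (π • ℓ) (π • s', π • H₁) ∧
        HistBound N (supp (π • s') ∪ (π • φ).supp) (π • H₁) (π • H') := by
    intro c ℓ s' H₁ H' φ h hH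
    refine ⟨L.step_smul π _ _ _ h, ?_⟩
    rw [Nominal.supp_smul, Formula.supp_smul, ← Finset.smul_finset_union]
    exact hH.smul π
  have hnames : ∀ as : List Name, (as.map Term.name).map (Term.rename π) =
      (as.map (π • ·)).map .name := by
    intro as; simp [Function.comp_def, Term.rename]
  cases h with
  | or_left c φ ψ => exact .or_left _ _ _
  | or_right c φ ψ => exact .or_right _ _ _
  | and_left c φ ψ => exact .and_left _ _ _
  | and_right c φ ψ => exact .and_right _ _ _
  | some c x φ a =>
    have := BoundedMove.some (L := L) (N := N) (π • c) x (φ.rename π) (π • a)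
    have e := Formula.rename_inst π φ [(x, a)]
    rw [List.map_cons, List.map_nil] at e
    rw [← e] at this
    exact this
  | all c x φ a =>
    have := BoundedMove.all (L := L) (N := N) (π • c) x (φ.rename π) (π • a)
    have e := Formula.rename_inst π φ [(x, a)]
    rw [List.map_cons, List.map_nil] at e
    rw [← e] at this
    exact this
  | fresh c x φ a ha ha' =>
    have := BoundedMove.fresh (L := L) (N := N) (π • c) x (φ.rename π) (π • a)
      (by rw [Prod.smul_snd]; rwa [Finset.smul_mem_smul_finset_iff])
      (by rw [← Formula.smul_def, Formula.supp_smul]; rwa [Finset.smul_mem_smul_finset_iff])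
    have e := Formula.rename_inst π φ [(x, a)]
    rw [List.map_cons, List.map_nil] at e
    rw [← e] at this
    exact this
  | dia c t φ as s' H₁ H' h hH =>
    obtain ⟨h1, h2⟩ := key _ _ _ _ _ _ h hH
    have := BoundedMove.dia (π • c) t (π • φ) (as.map (π • ·)) _ _ _ h1 h2
    rw [← hnames] at this
    exact this
  | box c t φ as s' H₁ H' h hH =>
    obtain ⟨h1, h2⟩ := key _ _ _ _ _ _ h hH
    have := BoundedMove.box (π • c) t (π • φ) (as.map (π • ·)) _ _ _ h1 h2
    rw [← hnames] at this
    exact this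
  | fix c σ X xs φ as =>
    have := BoundedMove.fix (L := L) (N := N) (π • c) σ X xs (φ.rename π) (as.map (π • ·))
    rw [← hnames, List.zip_map_right, ← Formula.rename_unfold] at this
    have e := Formula.rename_inst π (Formula.unfold σ X xs φ φ) (xs.zip as)
    have e2 : (xs.zip as).map (fun p => (p.1, π • p.2)) = (xs.zip as).map (Prod.map id (π • ·)) := rfl
    rw [e2] at e
    rw [← e] at this
    exact this

/-- The choice of the bounded history is immaterial up to a permutation. -/
theorem HistBound.orbit_eq {N : ℕ} {s : S} {φ : Formula} {H H₁ H₂ : Finset Name}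
    (h₁ : HistBound N (supp s ∪ φ.supp) H H₁) (h₂ : HistBound N (supp s ∪ φ.supp) H H₂) :
    MulAction.orbit FinPerm (((s, H₁), φ) : Position S) =
      MulAction.orbit FinPerm (((s, H₂), φ) : Position S) := by
  have hcard : H₂.card = H₁.card := by
    rcases h₁ with ⟨h, rfl⟩ | ⟨h, -, -, h'⟩ <;> rcases h₂ with ⟨g, rfl⟩ | ⟨g, -, -, g'⟩ <;> omega
  -- Both bounded histories contain the same relevant names, namely those in `H`, so the identity
  -- can be corrected outside of the relevant names.
  obtain ⟨ρ, hρ, hH⟩ := exists_finPerm_map_history (A := supp s ∪ φ.supp) (1 : FinPerm) hcard (by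
    intro a ha
    rw [one_smul]
    exact ⟨fun h => h₁.inter_subset (Finset.mem_inter.2 ⟨ha, h₂.subset h⟩),
      fun h => h₂.inter_subset (Finset.mem_inter.2 ⟨ha, h₁.subset h⟩)⟩)
  have e : ρ • (((s, H₂), φ) : Position S) = ((s, H₁), φ) := by
    rw [Prod.smul_mk, Prod.smul_mk, hH]
    congr 2
    · conv_rhs => rw [← one_smul FinPerm s]
      exact smul_congr (fun a ha => hρ a (Finset.mem_union_left _ ha))
    · refine Formula.smul_eq_self (fun a ha => ?_)
      rw [hρ a (Finset.mem_union_right _ ha), one_smul]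
  rw [← e]
  exact MulAction.orbit_smul _ _

/-! ## The orbit game -/

variable {L : FLTS S} {φ₀ : Formula} {s₀ : S} {H₀ : Finset Name} {N : ℕ}

theorem pos_move {P P' : Position S} (hP : P ∈ (boundedGame L φ₀ s₀ H₀ N).pos)
    (h : BoundedMove L N P P') : P' ∈ (boundedGame L φ₀ s₀ H₀ N).pos := by
  obtain ⟨H, hH, hr⟩ := hP
  exact ⟨H, hH, hr.tail h⟩

/-- By equivariance the moves of an orbit can be read off at any of its positions, so the program
need treat only one representative. -/
theorem orbitGame_move_iff {P Q : Position S} (hP : P ∈ (boundedGame L φ₀ s₀ H₀ N).pos) :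
    (orbitGame (boundedGame L φ₀ s₀ H₀ N)).move (MulAction.orbit FinPerm P)
      (MulAction.orbit FinPerm Q) ↔
    ∃ P', BoundedMove L N P P' ∧ MulAction.orbit FinPerm P' = MulAction.orbit FinPerm Q := by
  constructor
  · rintro ⟨P₁, ⟨π, hπ⟩, Q₁, hQ, -, -, h⟩
    refine ⟨π⁻¹ • Q₁, ?_, ?_⟩
    · have := BoundedMove.smul (show BoundedMove L N P₁ Q₁ from h) π⁻¹
      simp only at hπ
      rwa [← hπ, inv_smul_smul] at this
    · rw [MulAction.orbit_smul]; exact MulAction.orbit_eq_iff.2 hQ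
  · rintro ⟨P', h, h'⟩
    exact ⟨P, MulAction.mem_orbit_self _, P', h' ▸ MulAction.mem_orbit_self _, hP, pos_move hP h, h⟩

theorem orbitGame_defender_iff {P : Position S} (hP : P ∈ (boundedGame L φ₀ s₀ H₀ N).pos) :
    MulAction.orbit FinPerm P ∈ (orbitGame (boundedGame L φ₀ s₀ H₀ N)).defender ↔
      P.2.DefenderMoves := by
  constructor
  · rintro ⟨Q, ⟨π, rfl⟩, -, h⟩
    exact (Formula.defenderMoves_smul π P.2).1 h
  · exact fun h => ⟨P, MulAction.mem_orbit_self _, hP, h⟩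

theorem orbitGame_rank {P : Position S} (hP : P ∈ (boundedGame L φ₀ s₀ H₀ N).pos) :
    (orbitGame (boundedGame L φ₀ s₀ H₀ N)).rank (MulAction.orbit FinPerm P) = φ₀.rank P.2 := by
  have : {r | ∃ Q ∈ MulAction.orbit FinPerm P, Q ∈ (boundedGame L φ₀ s₀ H₀ N).pos ∧
      r = (boundedGame L φ₀ s₀ H₀ N).rank Q} = {φ₀.rank P.2} := by
    ext r
    constructor
    · rintro ⟨Q, ⟨π, rfl⟩, -, rfl⟩
      exact Formula.rank_smul π φ₀ P.2
    · rintro rfl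
      exact ⟨P, MulAction.mem_orbit_self _, hP, rfl⟩
  change sInf _ = _
  rw [this, csInf_singleton]

/-- A set of positions that contains an initial position and is closed under moves up to
permutations contains all positions up to permutations. -/
theorem orbit_mem_of_closed {Q : Set (Set (Position S))} {H : Finset Name}
    (hH : HistBound N (supp s₀ ∪ φ₀.supp) H₀ H)
    (h0 : MulAction.orbit FinPerm (((s₀, H), φ₀) : Position S) ∈ Q)
    (hQ : ∀ P P', MulAction.orbit FinPerm P ∈ Q → BoundedMove L N P P' →
      MulAction.orbit FinPerm P' ∈ Q)
    {P : Position S} (hP : P ∈ (boundedGame L φ₀ s₀ H₀ N).pos) :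
    MulAction.orbit FinPerm P ∈ Q := by
  obtain ⟨H', hH', h⟩ := hP
  rw [hH.orbit_eq hH'] at h0
  induction h with
  | refl => exact h0
  | tail _ h ih => exact hQ _ _ ih h

/-! ## Concrete positions -/

/-- A position with a listed history and a lifted tree. -/
structure CPos (S : Type u) where
  s : S
  hs : List Name
  T : FTree

/-- The concrete position `p` represents the position `P`. -/
structure CPos.Rep (φ₀ : Formula) (p : CPos S) (P : Position S) : Prop where
  state : P.1.1 = p.s
  nodup : p.hs.Nodup
  hist : P.1.2 = p.hs.toFinset
  rep : Represents φ₀ p.T P.2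
  conf : supp p.s ⊆ p.hs.toFinset

theorem CPos.Rep.unique (hφ : φ₀.Closed) {p : CPos S} {P P' : Position S} (h : p.Rep φ₀ P)
    (h' : p.Rep φ₀ P') : P = P' := by
  refine Prod.ext (Prod.ext ?_ ?_) ?_
  · rw [h.state, h'.state]
  · rw [h.hist, h'.hist]
  · exact Formula.tree_injective (by rw [h.rep.tree_eq hφ, h'.rep.tree_eq hφ])

/-- The test for being in the same orbit. -/
def CPos.Equiv (p p' : CPos S) : Prop :=
  p.T.names.dedup.map (fun a => decide (a ∈ p.hs)) =
      p'.T.names.dedup.map (fun a => decide (a ∈ p'.hs)) ∧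
    p.hs.length = p'.hs.length ∧
    p.T.tmap (tsub fun a =>
      .name (((p.T.names.dedup.zip p'.T.names.dedup).lookup a).getD a)) = p'.T ∧
    ∃ π : FinPerm, p.T.names.dedup.map (π • ·) = p'.T.names.dedup ∧ π • p.s = p'.s

theorem lookup_zip_map {α β : Type*} [DecidableEq α] (f : α → β) {l : List α} {a : α} (h : a ∈ l) :
    (l.zip (l.map f)).lookup a = some (f a) := by
  induction l with
  | nil => simp at h
  | cons b l ih =>
    rw [List.map_cons, List.zip_cons_cons, List.lookup_cons]
    by_cases hab : a = b
    · subst hab; simp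
    · rw [beq_false_of_ne hab]; exact ih (by simpa [hab] using h)

theorem FTree.names_tmap_name (f : Name → Name) (t : FTree) :
    (t.tmap (tsub fun a => .name (f a))).names = t.names.map f := by
  have key : ∀ us : List Term, (us.map (tsub fun a => .name (f a))).flatMap Term.nameList =
      (us.flatMap Term.nameList).map f := by
    intro us
    induction us with
    | nil => rfl
    | cons u us ih => cases u <;> simp_all [tsub, Term.nameList]
  induction t with
  | nil => rfl
  | node c m xs us l r ihl ihr => simp only [tmap, names, key, ihl, ihr, List.map_append]

/-- A permutation between the positions maps the ordered list of names of one tree to that of the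
other, so the renaming of the tree is forced. Conversely, the permutation `π` of the test is right
on the state and on the formula; equal patterns and equal sizes allow it to be corrected on the rest
of the history. -/
theorem CPos.equiv_iff (hφ : φ₀.Closed) {p p' : CPos S} {P P' : Position S} (h : p.Rep φ₀ P)
    (h' : p'.Rep φ₀ P') :
    p.Equiv p' ↔ MulAction.orbit FinPerm P = MulAction.orbit FinPerm P' := by
  rw [eq_comm, MulAction.orbit_eq_iff, MulAction.mem_orbit_iff]
  constructor
  · rintro ⟨h1, h2, h3, π, h4, h5⟩
    rw [← h4, List.map_map] at h1
    obtain ⟨ρ, hρ, hH⟩ := exists_finPerm_map_history (A := supp p.s ∪ p.T.names.toFinset)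
      (H := p.hs.toFinset) (H' := p'.hs.toFinset) π (by
        rw [List.toFinset_card_of_nodup h.nodup, List.toFinset_card_of_nodup h'.nodup, h2]) (by
        intro a ha
        rcases Finset.mem_union.1 ha with ha | ha
        · refine ⟨fun _ => h'.conf ?_, fun _ => h.conf ha⟩
          rw [← h5, Nominal.supp_smul]
          exact Finset.smul_mem_smul_finset ha
        · have := List.map_inj_left.1 h1 a (List.mem_dedup.2 (List.mem_toFinset.1 ha))
          simpa using this)
    refine ⟨ρ, Prod.ext (Prod.ext ?_ ?_) ?_⟩
    · rw [Prod.smul_fst, Prod.smul_fst, h.state, h'.state, ← h5]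
      exact smul_congr (fun a ha => hρ a (Finset.mem_union_left _ ha))
    · rw [Prod.smul_fst, Prod.smul_snd, h.hist, h'.hist, hH]
    · rw [Prod.smul_snd]
      refine Formula.tree_injective ?_
      rw [Formula.tree_smul, h.rep.tree_eq hφ, h'.rep.tree_eq hφ, Term.rename_eq_tsub,
        ← expand_tmap (goodTable hφ) (h.rep.shape hφ), ← h3]
      congr 1
      refine tmap_congr (fun a ha => ?_)
      rw [← h4, lookup_zip_map _ (List.mem_dedup.2 ha), Option.getD_some,
        hρ a (Finset.mem_union_right _ (List.mem_toFinset.2 ha))]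
  · rintro ⟨π, hπ⟩
    -- That the formulas correspond is known only for the expanded trees; injectivity of the
    -- expansion transfers it to the lifted ones.
    have hT : p'.T = p.T.tmap (tsub fun a => .name (π • a)) := by
      refine expand_injective (goodTable hφ) (h'.rep.shape hφ) ((h.rep.shape hφ).tmap _) ?_
      rw [expand_tmap (goodTable hφ) (h.rep.shape hφ), ← h'.rep.tree_eq hφ, ← h.rep.tree_eq hφ,
        ← Term.rename_eq_tsub, ← Formula.tree_smul, ← hπ, Prod.smul_snd]
    have hn : p'.T.names.dedup = p.T.names.dedup.map (π • ·) := by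
      rw [hT, FTree.names_tmap_name, List.dedup_map_of_injective (MulAction.injective π)]
    have hH : π • p.hs.toFinset = p'.hs.toFinset := by
      rw [← h.hist, ← h'.hist, ← hπ]; rfl
    refine ⟨?_, ?_, ?_, π, hn.symm, ?_⟩
    · rw [hn, List.map_map]
      refine List.map_congr_left (fun a _ => ?_)
      simp only [Function.comp, decide_eq_decide]
      rw [← List.mem_toFinset, ← List.mem_toFinset, ← hH, Finset.smul_mem_smul_finset_iff]
    · rw [← List.toFinset_card_of_nodup h.nodup, ← List.toFinset_card_of_nodup h'.nodup, ← hH,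
        Finset.card_smul_finset]
    · conv_rhs => rw [hT]
      refine tmap_congr (fun a ha => ?_)
      rw [hn, lookup_zip_map _ (List.mem_dedup.2 ha), Option.getD_some]
    · rw [← h.state, ← h'.state, ← hπ]; rfl

end

/-! ## The branching degree -/

section

variable {S : Type u} [Nominal S]

/-- A state is determined by its orbit and by the finite map through which some permutation carries
the support of the orbit's representative into `A`. -/
theorem finite_states_of_supp_subset (h : OrbitFinite S) (A : Finset Name) :
    {s : S | supp s ⊆ A}.Finite := by
  classical
  have : Finite (MulAction.orbitRel.Quotient FinPerm S) := h
  have := Fintype.ofFinite (MulAction.orbitRel.Quotient FinPerm S)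
  let out : S → S := fun s =>
    Quotient.out (Quotient.mk'' s : MulAction.orbitRel.Quotient FinPerm S)
  have hex : ∀ s : S, ∃ π : FinPerm, π • out s = s := by
    intro s
    have := Quotient.exact (Quotient.out_eq (Quotient.mk'' s : MulAction.orbitRel.Quotient FinPerm S))
    obtain ⟨π, hπ⟩ := (MulAction.orbitRel FinPerm S).symm this
    exact ⟨π, hπ⟩
  choose π hπ using hex
  let U : Finset Name := (Finset.univ : Finset (MulAction.orbitRel.Quotient FinPerm S)).biUnion
    fun o => supp (Quotient.out o)
  let g : S → MulAction.orbitRel.Quotient FinPerm S × Finset (Name × Name) := fun s =>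
    (Quotient.mk'' s, (supp (out s)).image fun a => (a, π s • a))
  let R : Finset (MulAction.orbitRel.Quotient FinPerm S × Finset (Name × Name)) :=
    Finset.univ ×ˢ (U ×ˢ A).powerset
  refine Set.Finite.of_injOn (f := g) (t := (R : Set _)) ?_ ?_ (Finset.finite_toSet _)
  · intro s hs
    have hs : supp s ⊆ A := hs
    rw [Finset.mem_coe, Finset.mem_product, Finset.mem_powerset]
    refine ⟨Finset.mem_univ _, ?_⟩
    intro p hp
    obtain ⟨a, ha, rfl⟩ := Finset.mem_image.1 hp
    refine Finset.mem_product.2 ⟨Finset.mem_biUnion.2 ⟨_, Finset.mem_univ _, ha⟩, hs ?_⟩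
    rw [← hπ s, supp_smul, hπ s]
    exact Finset.smul_mem_smul_finset ha
  · intro s _ s' _ hss
    simp only [g, Prod.mk.injEq] at hss
    have e : out s = out s' := by simp only [out, hss.1]
    rw [← hπ s, ← hπ s', ← e]
    refine smul_congr (fun a ha => ?_)
    have : (a, π s • a) ∈ (supp (out s)).image fun a => (a, π s • a) :=
      Finset.mem_image_of_mem _ ha
    rw [hss.2] at this
    obtain ⟨b, -, hb⟩ := Finset.mem_image.1 this
    simp only [Prod.mk.injEq] at hb
    rw [← hb.2, hb.1]

/-- The bound is uniform, because a permutation moves any `m` names into one fixed set of `m` names.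
-/
theorem exists_bound_states (h : OrbitFinite S) (m : ℕ) :
    ∃ B : ℕ, ∀ A : Finset Name, A.card ≤ m → {s : S | supp s ⊆ A}.encard ≤ B := by
  obtain ⟨A₀, hA₀⟩ : ∃ A₀ : Finset Name, A₀.card = m :=
    ⟨(Finset.range m).map ⟨Name.mk, fun a b h => by simpa using h⟩, by simp⟩
  have hfin := finite_states_of_supp_subset h A₀
  refine ⟨{s : S | supp s ⊆ A₀}.ncard, fun A hA => ?_⟩
  rw [hfin.cast_ncard_eq]
  obtain ⟨e⟩ : Nonempty (A ↪ A₀) := by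
    rw [Function.Embedding.nonempty_iff_card_le]; simpa [hA₀] using hA
  obtain ⟨π, hπ⟩ := exists_finPerm_of_injOn A (fun a => if h : a ∈ A then e ⟨a, h⟩ else a) (by
    intro a ha b hb hab
    simp only [Finset.mem_coe.1 ha, Finset.mem_coe.1 hb, dif_pos] at hab
    simpa using e.injective (Subtype.ext hab))
  refine Set.encard_le_encard_of_injOn (f := (π • ·)) (fun s hs => ?_)
    (MulAction.injective π).injOn
  have hs : supp s ⊆ A := hs
  change supp (π • s) ⊆ A₀
  rw [supp_smul]
  intro b hb
  obtain ⟨a, ha, rfl⟩ := Finset.mem_smul_finset.1 hb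
  rw [hπ a (hs ha), dif_pos (hs ha)]
  exact (e _).2

/-- Finitely many orbits of labels have bounded length. The support of a target lies in that of the
source and the label, and the target history is determined, so a configuration has no more
successors than there are states over boundedly many names. -/
theorem FLTS.branching_lt_top {L : FLTS S} (h : L.FreshOrbitFinite) : L.branching < ⊤ := by
  classical
  obtain ⟨M, hM⟩ : ∃ M : ℕ, ∀ ℓ ∈ L.labels, ℓ.names.length ≤ M := by
    have hf : ((fun ℓ : Label => ℓ.names.length) '' L.labels).Finite := by
      -- The length is constant on an orbit, so the infimum merely reads it off.
      have : ∀ ℓ : Label, sInf ((fun ℓ : Label => ℓ.names.length) '' MulAction.orbit FinPerm ℓ) =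
          ℓ.names.length := by
        intro ℓ
        have : (fun ℓ : Label => ℓ.names.length) '' MulAction.orbit FinPerm ℓ =
            {ℓ.names.length} := by
          ext n
          constructor
          · rintro ⟨_, ⟨π, rfl⟩, rfl⟩
            exact List.length_map _
          · rintro rfl; exact ⟨ℓ, MulAction.mem_orbit_self _, rfl⟩
        rw [this, csInf_singleton]
      have h2 := h.2.image (fun O => sInf ((fun ℓ : Label => ℓ.names.length) '' O))
      rw [Set.image_image] at h2
      simpa only [this] using h2
    obtain ⟨M, hM⟩ := hf.bddAbove
    exact ⟨M, fun ℓ hℓ => hM ⟨ℓ, hℓ, rfl⟩⟩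
  obtain ⟨B, hB⟩ := exists_bound_states h.1 (regIndex S + M)
  refine lt_of_le_of_lt (iSup₂_le (a := (B : ℕ∞)) fun c ℓ => ?_) (ENat.coe_lt_top B)
  by_cases hℓ : ℓ ∈ L.labels
  · refine le_trans ?_ (hB (supp c.1 ∪ ℓ.supp) ?_)
    · refine Set.encard_le_encard_of_injOn (f := Prod.fst) (fun c' hc' => ?_) ?_
      · exact (L.step_supp _ _ _ _ _ hc').1
      · intro c' hc' c'' hc'' he
        exact Prod.ext he ((L.step_supp _ _ _ _ _ hc').2.trans (L.step_supp _ _ _ _ _ hc'').2.symm)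
    · refine (Finset.card_union_le _ _).trans (Nat.add_le_add (card_supp_le_regIndex h.1 _) ?_)
      exact (List.toFinset_card_le _).trans (hM ℓ hℓ)
  · have : {c' | L.step c ℓ c'} = ∅ := by
      ext c'; simp only [Set.mem_setOf_eq, Set.mem_empty_iff_false, iff_false]
      exact fun h => hℓ (L.step_label _ _ _ h)
    rw [this]; simp

theorem FLTS.length_le_branching {L : FLTS S} (h : L.FreshOrbitFinite) {c : S × Finset Name}
    {ℓ : Label} {ss : List S} (hnd : ss.Nodup) (hss : ∀ s' ∈ ss, ∃ H', L.step c ℓ (s', H')) :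
    ss.length ≤ L.branching.toNat := by
  classical
  have h1 : ((ss.length : ℕ) : ℕ∞) ≤ {c' | L.step c ℓ c'}.encard := by
    have : ((ss.toFinset : Finset S) : Set S) ⊆ Prod.fst '' {c' | L.step c ℓ c'} := by
      intro s' hs'
      obtain ⟨H', h⟩ := hss s' (by simpa using hs')
      exact ⟨(s', H'), h, rfl⟩
    have h2 := (Set.encard_le_encard this).trans (Set.encard_image_le _ _)
    rwa [Set.encard_coe_eq_coe_finsetCard, List.toFinset_card_of_nodup hnd] at h2
  have h2 : ((ss.length : ℕ) : ℕ∞) ≤ L.branching :=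
    h1.trans (le_iSup₂ (f := fun c ℓ => {c' | L.step c ℓ c'}.encard) c ℓ)
  have h3 := FLTS.branching_lt_top h
  rw [← ENat.coe_toNat h3.ne] at h2
  exact_mod_cast h2

/-! ## The successors of a concrete position -/

variable {L : FLTS S} {φ₀ : Formula} {N : ℕ}

/-- The list `ps` contains the successors of `P`, up to permutations. -/
structure SuccList (L : FLTS S) (φ₀ : Formula) (N : ℕ) (P : Position S) (ps : List (CPos S)) :
    Prop where
  sound : ∀ q ∈ ps, ∃ P', BoundedMove L N P P' ∧ q.Rep φ₀ P'
  complete : ∀ P', BoundedMove L N P P' → ∃ q ∈ ps, ∃ P'', q.Rep φ₀ P'' ∧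
    MulAction.orbit FinPerm P'' = MulAction.orbit FinPerm P'

theorem SuccList.of_exact {P : Position S} {ps : List (CPos S)} (Q : CPos S → Position S)
    (h1 : ∀ q ∈ ps, BoundedMove L N P (Q q) ∧ q.Rep φ₀ (Q q))
    (h2 : ∀ P', BoundedMove L N P P' → ∃ q ∈ ps,
      MulAction.orbit FinPerm (Q q) = MulAction.orbit FinPerm P') : SuccList L φ₀ N P ps := by
  refine ⟨fun q hq => ⟨_, h1 q hq⟩, fun P' h => ?_⟩
  obtain ⟨q, hq, h⟩ := h2 P' h
  exact ⟨q, hq, _, (h1 q hq).2, h⟩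

/-- Different fresh names lead to the same orbit. -/
theorem orbit_inst_fresh {c : S × Finset Name} {φ : Formula} {x : ℕ} {a b : Name}
    (hc : supp c.1 ⊆ c.2) (ha : a ∉ c.2 ∧ a ∉ φ.supp) (hb : b ∉ c.2 ∧ b ∉ φ.supp) :
    MulAction.orbit FinPerm ((c, φ.inst [(x, a)]) : Position S) =
      MulAction.orbit FinPerm ((c, φ.inst [(x, b)]) : Position S) := by
  obtain ⟨π, hπ⟩ := exists_finPerm_of_injOn (insert a (c.2 ∪ φ.supp))
    (fun d => if d = a then b else d) (by
      have hne : ∀ d ∈ insert a (c.2 ∪ φ.supp), d ≠ a → d ≠ b := by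
        rintro d hd hda rfl
        rcases Finset.mem_insert.1 hd with h | h
        · exact hda h
        · rcases Finset.mem_union.1 h with h | h
          · exact hb.1 h
          · exact hb.2 h
      intro d hd e he hde
      simp only at hde
      split_ifs at hde with h1 h2 h2
      · rw [h1, h2]
      · exact absurd hde.symm (hne e he h2)
      · exact absurd hde (hne d hd h1)
      · exact hde)
  have hfix : ∀ d ∈ c.2 ∪ φ.supp, π • d = d := by
    intro d hd
    rw [hπ d (Finset.mem_insert_of_mem hd), if_neg]
    rintro rfl
    rcases Finset.mem_union.1 hd with h | h
    · exact ha.1 h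
    · exact ha.2 h
  have hpa : π • a = b := by rw [hπ a (Finset.mem_insert_self _ _), if_pos rfl]
  have e : π • ((c, φ.inst [(x, a)]) : Position S) = (c, φ.inst [(x, b)]) := by
    refine Prod.ext (Prod.ext ?_ ?_) ?_
    · rw [Prod.smul_fst, Prod.smul_fst]
      conv_rhs => rw [← one_smul FinPerm c.1]
      exact smul_congr (fun d hd => by
        rw [hfix d (Finset.mem_union_left _ (hc hd)), one_smul])
    · rw [Prod.smul_fst, Prod.smul_snd]
      ext d
      rw [Finset.mem_smul_finset]
      constructor
      · rintro ⟨d', hd', rfl⟩; rwa [hfix d' (Finset.mem_union_left _ hd')]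
      · intro hd; exact ⟨d, hd, hfix d (Finset.mem_union_left _ hd)⟩
    · rw [Prod.smul_snd, Formula.smul_def]
      simp only
      rw [Formula.rename_inst, ← Formula.smul_def,
        Formula.smul_eq_self (fun d hd => hfix d (Finset.mem_union_right _ hd)), List.map_cons,
        List.map_nil, hpa]
  rw [← e]
  exact (MulAction.orbit_smul _ _).symm

/-- The first `N + 1` names of the history, those that have to be kept first. -/
def prune (N : ℕ) (A hs : List Name) : List Name :=
  (hs.filter (· ∈ A) ++ hs.filter (· ∉ A)).take (N + 1)

theorem histBound_prune {N : ℕ} {A hs : List Name} (hnd : hs.Nodup) (hA : A.toFinset.card ≤ N + 1) :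
    (prune N A hs).Nodup ∧ HistBound N A.toFinset hs.toFinset (prune N A hs).toFinset := by
  have hperm : (hs.filter (· ∈ A) ++ hs.filter (· ∉ A)).Perm hs := by
    have := List.filter_append_perm (fun a => decide (a ∈ A)) hs
    simpa using this
  have hnd' := hperm.nodup_iff.2 hnd
  have hnd2 : (prune N A hs).Nodup := hnd'.sublist (List.take_sublist _ _)
  refine ⟨hnd2, ?_⟩
  have hlen := hperm.length_eq
  by_cases hN : hs.length ≤ N
  · left
    rw [List.toFinset_card_of_nodup hnd]
    refine ⟨hN, ?_⟩
    rw [prune, List.take_of_length_le (by omega)]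
    exact List.toFinset_eq_of_perm _ _ hperm
  · right
    rw [List.toFinset_card_of_nodup hnd, List.toFinset_card_of_nodup hnd2]
    refine ⟨by omega, ?_, ?_, ?_⟩
    · intro a ha
      rw [Finset.mem_inter, List.mem_toFinset, List.mem_toFinset] at ha
      -- The names to be kept come first and there are at most `N + 1` of them, so cutting the list
      -- off loses none of them.
      have hl : (hs.filter (· ∈ A)).length ≤ N + 1 := by
        rw [← List.toFinset_card_of_nodup (hnd.filter _)]
        refine le_trans (Finset.card_le_card ?_) hA
        intro b hb
        rw [List.mem_toFinset, List.mem_filter] at hb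
        simpa using hb.2
      rw [List.mem_toFinset, prune, List.take_append, List.take_of_length_le hl]
      exact List.mem_append_left _ (List.mem_filter.2 ⟨ha.2, by simpa using ha.1⟩)
    · intro a ha
      rw [List.mem_toFinset] at ha ⊢
      exact hperm.mem_iff.1 (List.mem_of_mem_take ha)
    · rw [prune, List.length_take]; omega

end

/-! ## Weakest preconditions for programs -/

/-- The `f`-th function of `P` maps `v` to `w` in time at most `b`. -/
def Comp (P : Program) (O : Oracle) (f : ℕ) (v w : Val) (b : ℕ) : Prop :=
  ∃ k ≤ b, Eval P O [v] (P.getD f (.const 0)) w k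

theorem Comp.mono {P : Program} {O : Oracle} {f : ℕ} {v w : Val} {b b' : ℕ}
    (h : Comp P O f v w b) (hb : b ≤ b') : Comp P O f v w b' := by
  obtain ⟨k, hk, h⟩ := h
  exact ⟨k, hk.trans hb, h⟩

/-- A precondition that makes the evaluation of an expression satisfy `Q`. -/
def wp (P : Program) (O : Oracle) : Expr → List Val → (Val → ℕ → Prop) → Prop
  | .var i, env, Q => Q (env.getD i (.atom 0)) 1
  | .const n, _, Q => Q (.atom n) 1
  | .cons e₁ e₂, env, Q => wp P O e₁ env fun v k => wp P O e₂ env fun w k' =>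
      Q (.pair v w) (k + k' + 1)
  | .fst e, env, Q => wp P O e env fun v k => Q v.fst (k + 1)
  | .snd e, env, Q => wp P O e env fun v k => Q v.snd (k + 1)
  | .succ e, env, Q => wp P O e env fun v k => Q v.succ (k + 1)
  | .isPair e, env, Q => wp P O e env fun v k => Q v.isPair (k + 1)
  | .eqAtom e₁ e₂, env, Q => wp P O e₁ env fun v k => wp P O e₂ env fun w k' =>
      Q (v.eqAtom w) (k + k' + 1)
  | .ite e e₁ e₂, env, Q => wp P O e env fun v k =>
      (v ≠ .atom 0 → wp P O e₁ env fun w k' => Q w (k + k' + 1)) ∧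
      (v = .atom 0 → wp P O e₂ env fun w k' => Q w (k + k' + 1))
  | .bind e₁ e₂, env, Q => wp P O e₁ env fun v k => wp P O e₂ (v :: env) fun w k' =>
      Q w (k + k' + 1)
  | .call f e, env, Q => wp P O e env fun v k => ∃ w b, Comp P O f v w b ∧ Q w (k + b + 1)
  | .ask q e, env, Q => wp P O e env fun v k =>
      ∃ b, O.cost q v ≤ b ∧ Q (O.answer q v) (k + b + 1)

theorem wp_mono {P : Program} {O : Oracle} (e : Expr) : ∀ {env : List Val}
    {Q Q' : Val → ℕ → Prop}, (∀ v k, Q v k → Q' v k) → wp P O e env Q → wp P O e env Q' := by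
  induction e with
  | var i => exact fun h hw => h _ _ hw
  | const n => exact fun h hw => h _ _ hw
  | cons e₁ e₂ ih₁ ih₂ | eqAtom e₁ e₂ ih₁ ih₂ | bind e₁ e₂ ih₁ ih₂ =>
    exact fun h hw => ih₁ (fun v k hv => ih₂ (fun w k' hw => h _ _ hw) hv) hw
  | fst e ih | snd e ih | succ e ih | isPair e ih => exact fun h hw => ih (fun v k hv => h _ _ hv) hw
  | ite e e₁ e₂ ih ih₁ ih₂ =>
    exact fun h hw => ih (fun v k hv => ⟨fun hn => ih₁ (fun w k' hw => h _ _ hw) (hv.1 hn),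
      fun hn => ih₂ (fun w k' hw => h _ _ hw) (hv.2 hn)⟩) hw
  | call f e ih =>
    exact fun h hw => ih (fun v k ⟨w, b, hc, hv⟩ => ⟨w, b, hc, h _ _ hv⟩) hw
  | ask q e ih => exact fun h hw => ih (fun v k ⟨b, hc, hv⟩ => ⟨b, hc, h _ _ hv⟩) hw

/-- `Comp` only bounds the time of a call, so the time at which `Q` is established may exceed the
actual one; hence `Q` has to be closed under smaller times. -/
theorem wp_sound {P : Program} {O : Oracle} (e : Expr) : ∀ {env : List Val} {Q : Val → ℕ → Prop},
    (∀ v k k', Q v k → k' ≤ k → Q v k') → wp P O e env Q → ∃ v k, Eval P O env e v k ∧ Q v k := by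
  induction e with
  | var i => exact fun _ h => ⟨_, _, .var _ _, h⟩
  | const n => exact fun _ h => ⟨_, _, .const _ _, h⟩
  | cons e₁ e₂ ih₁ ih₂ =>
    intro env Q hQ h
    obtain ⟨v, k, h1, h⟩ := ih₁
      (Q := fun v k => wp P O e₂ env fun w k' => Q (.pair v w) (k + k' + 1)) (fun v k k' h hk =>
      wp_mono _ (fun w k'' hw => hQ _ _ _ hw (by omega)) h) h
    obtain ⟨w, k', h2, h⟩ := ih₂ (Q := fun w k' => Q (.pair v w) (k + k' + 1))
      (fun w k₁ k' hw hk => hQ _ _ _ hw (by omega)) h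
    exact ⟨_, _, .cons h1 h2, h⟩
  | eqAtom e₁ e₂ ih₁ ih₂ =>
    intro env Q hQ h
    obtain ⟨v, k, h1, h⟩ := ih₁
      (Q := fun v k => wp P O e₂ env fun w k' => Q (v.eqAtom w) (k + k' + 1)) (fun v k k' h hk =>
      wp_mono _ (fun w k'' hw => hQ _ _ _ hw (by omega)) h) h
    obtain ⟨w, k', h2, h⟩ := ih₂ (Q := fun w k' => Q (v.eqAtom w) (k + k' + 1))
      (fun w k₁ k' hw hk => hQ _ _ _ hw (by omega)) h
    exact ⟨_, _, .eqAtom h1 h2, h⟩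
  | bind e₁ e₂ ih₁ ih₂ =>
    intro env Q hQ h
    obtain ⟨v, k, h1, h⟩ := ih₁
      (Q := fun v k => wp P O e₂ (v :: env) fun w k' => Q w (k + k' + 1)) (fun v k k' h hk =>
      wp_mono _ (fun w k'' hw => hQ _ _ _ hw (by omega)) h) h
    obtain ⟨w, k', h2, h⟩ := ih₂ (Q := fun w k' => Q w (k + k' + 1))
      (fun w k₁ k' hw hk => hQ _ _ _ hw (by omega)) h
    exact ⟨_, _, .bind h1 h2, h⟩
  | fst e ih =>
    intro env Q hQ h
    obtain ⟨v, k, h1, h⟩ := ih (Q := fun v k => Q v.fst (k + 1)) (fun v k k' h hk => hQ _ _ _ h (by omega)) h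
    exact ⟨_, _, .fst h1, h⟩
  | snd e ih =>
    intro env Q hQ h
    obtain ⟨v, k, h1, h⟩ := ih (Q := fun v k => Q v.snd (k + 1)) (fun v k k' h hk => hQ _ _ _ h (by omega)) h
    exact ⟨_, _, .snd h1, h⟩
  | succ e ih =>
    intro env Q hQ h
    obtain ⟨v, k, h1, h⟩ := ih (Q := fun v k => Q v.succ (k + 1)) (fun v k k' h hk => hQ _ _ _ h (by omega)) h
    exact ⟨_, _, .succ h1, h⟩
  | isPair e ih =>
    intro env Q hQ h
    obtain ⟨v, k, h1, h⟩ := ih (Q := fun v k => Q v.isPair (k + 1)) (fun v k k' h hk => hQ _ _ _ h (by omega)) h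
    exact ⟨_, _, .isPair h1, h⟩
  | ite e e₁ e₂ ih ih₁ ih₂ =>
    intro env Q hQ h
    obtain ⟨v, k, h1, h⟩ := ih (fun v k k' h hk =>
      ⟨fun hn => wp_mono _ (fun w k'' hw => hQ _ _ _ hw (by omega)) (h.1 hn),
        fun hn => wp_mono _ (fun w k'' hw => hQ _ _ _ hw (by omega)) (h.2 hn)⟩) h
    by_cases hv : v = .atom 0
    · obtain ⟨w, k', h2, h⟩ := ih₂ (Q := fun w k' => Q w (k + k' + 1))
        (fun w k₁ k' hw hk => hQ _ _ _ hw (by omega)) (h.2 hv)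
      exact ⟨_, _, .ite_false (hv ▸ h1) h2, h⟩
    · obtain ⟨w, k', h2, h⟩ := ih₁ (Q := fun w k' => Q w (k + k' + 1))
        (fun w k₁ k' hw hk => hQ _ _ _ hw (by omega)) (h.1 hv)
      exact ⟨_, _, .ite_true h1 hv h2, h⟩
  | call f e ih =>
    intro env Q hQ h
    obtain ⟨v, k, h1, w, b, ⟨k', hk', h2⟩, h⟩ := ih (fun v k k' ⟨w, b, hc, h⟩ hk =>
      ⟨w, b, hc, hQ _ _ _ h (by omega)⟩) h
    exact ⟨_, _, .call h1 h2, hQ _ _ _ h (by omega)⟩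
  | ask q e ih =>
    intro env Q hQ h
    obtain ⟨v, k, h1, b, hb, h⟩ := ih (fun v k k' ⟨b, hc, h⟩ hk =>
      ⟨b, hc, hQ _ _ _ h (by omega)⟩) h
    exact ⟨_, _, .ask h1, hQ _ _ _ h (by omega)⟩

theorem Comp.of_wp {P : Program} {O : Oracle} {f : ℕ} {v w : Val} {b : ℕ}
    (h : wp P O (P.getD f (.const 0)) [v] fun w' k => w' = w ∧ k ≤ b) : Comp P O f v w b := by
  obtain ⟨w', k, h1, rfl, h2⟩ := wp_sound _ (fun v k k' h hk => ⟨h.1, hk.trans h.2⟩) h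
  exact ⟨k, h2, h1⟩

/-! ## The program -/

namespace Expr

/-- The components of a tuple. -/
def nth (e : Expr) : ℕ → Expr
  | 0 => .fst e
  | n + 1 => nth (.snd e) n

def rest (e : Expr) : ℕ → Expr
  | 0 => e
  | n + 1 => rest (.snd e) n

def tuple : List Expr → Expr
  | [] => .const 0
  | [e] => e
  | e :: es => .cons e (tuple es)

/-- The node `c m xs us l r` of an encoded tree. -/
def node (c m xs us l r : Expr) : Expr := tuple [.cons c m, xs, us, l, r]

/-- Case distinction on a number below the length of the list. -/
def switch (e : Expr) : ℕ → List Expr → Expr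
  | _, [] => .const 0
  | n, e' :: es => .ite (.eqAtom e (.const n)) e' (switch e (n + 1) es)

end Expr

open Expr in
/-- The bodies of the functions, in the order of their numbers. -/
def orbitProgram : Program :=
  let x : Expr := .var 0
  let y : Expr := .var 1
  let o : Expr := .const 0
  let i : Expr := .const 1
  let eqv e f : Expr := call 1 (cons e f)
  let mem e f : Expr := call 2 (cons e f)
  let app e f : Expr := call 4 (cons e f)
  let fix? e : Expr := ite (eqAtom e (const 10)) i (eqAtom e (const 11))
  [ -- 0: main
    bind (call 27 (nth x 0))
      (bind (call 9 (cons o (call 5 (call 8 (cons x o)))))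
        (bind (call 31 (cons (cons o i) x))
          (bind (tuple [call 6 (tuple [y, x, o]), o, call 32 (cons (cons o i) x), .var 2])
            (cons o (call 26 (tuple [o,
              cons (tuple [nth (.var 4) 1, nth (.var 4) 2,
                call 30 (tuple [nth x 0, call 6 (tuple [y, .var 2, o]), rest x 1])]) o,
              succ (nth (.var 4) 3),
              call 36 (tuple [nth x 0, o, nth x 2, rest x 3, o])])))))),
    -- 1: equality
    ite (isPair (fst x)) (ite (isPair (snd x)) (ite (eqv (fst (fst x)) (fst (snd x)))
      (eqv (snd (fst x)) (snd (snd x))) o) o) (eqAtom (fst x) (snd x)),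
    -- 2: membership in a list
    ite (isPair (snd x)) (ite (eqv (fst x) (fst (snd x))) i (mem (fst x) (snd (snd x)))) o,
    -- 3: association lists
    ite (isPair (rest x 2)) (ite (eqv (fst x) (fst (fst (rest x 2)))) (snd (fst (rest x 2)))
      (call 3 (tuple [fst x, nth x 1, snd (rest x 2)]))) (nth x 1),
    -- 4: append
    ite (isPair (fst x)) (cons (fst (fst x)) (app (snd (fst x)) (snd x))) (snd x),
    -- 5: removal of duplicates
    ite (isPair x) (bind (call 5 (snd x)) (ite (mem (fst y) x) x (cons (fst y) x))) o,
    -- 6: the pairs of elements of two lists, in front of a list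
    ite (isPair (fst x)) (ite (isPair (nth x 1)) (cons (cons (fst (fst x)) (fst (nth x 1)))
      (call 6 (tuple [snd (fst x), snd (nth x 1), rest x 2]))) (rest x 2)) (rest x 2),
    -- 7: the names in a list of terms
    ite (isPair (fst x)) (bind (call 7 (cons (snd (fst x)) (snd x)))
      (ite (eqAtom (fst (fst (fst y))) o) (cons (snd (fst (fst y))) x) x)) (snd x),
    -- 8: the names in a tree
    ite (isPair (fst x)) (call 7 (cons (nth (fst x) 2) (call 8 (cons (nth (fst x) 3)
      (call 8 (cons (rest (fst x) 4) (snd x))))))) (snd x),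
    -- 9: pairs with a fixed first component
    ite (isPair (snd x)) (cons (cons (fst x) (fst (snd x))) (call 9 (cons (fst x) (snd (snd x))))) o,
    -- 10: substitution in a list of terms
    ite (isPair (snd x)) (cons (call 3 (tuple [fst (snd x), fst (snd x), fst x]))
      (call 10 (cons (fst x) (snd (snd x))))) o,
    -- 11: substitution in a tree
    ite (isPair (snd x)) (bind (call 9 (cons i (nth (snd x) 1)))
      (bind (call 6 (tuple [x, x, fst y]))
        (tuple [fst (snd (.var 2)), nth (snd (.var 2)) 1,
          call 10 (cons (fst (.var 2)) (nth (snd (.var 2)) 2)),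
          call 11 (cons x (nth (snd (.var 2)) 3)), call 11 (cons x (rest (snd (.var 2)) 4))]))) o,
    -- 12: the elements of a list that are, or are not, in another list
    ite (isPair (rest x 2)) (bind (call 12 (tuple [fst x, nth x 1, snd (rest x 2)]))
      (ite (eqAtom (mem (fst (rest y 2)) (nth y 1)) (fst y)) (cons (fst (rest y 2)) x) x)) o,
    -- 13: initial segments
    ite (isPair (rest x 2)) (ite (eqAtom (fst x) (nth x 1)) o
      (cons (fst (rest x 2)) (call 13 (tuple [succ (fst x), nth x 1, snd (rest x 2)])))) o,
    -- 14: comparison of lengths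
    ite (isPair (fst x)) (ite (isPair (snd x)) (call 14 (cons (snd (fst x)) (snd (snd x)))) o)
      (ite (isPair (snd x)) o i),
    -- 15: which elements of a list are in another list
    ite (isPair (fst x)) (cons (mem (fst (fst x)) (snd x)) (call 15 (cons (snd (fst x)) (snd x)))) o,
    -- 16: equivalence of positions
    bind (call 5 (call 8 (cons (rest (fst x) 2) o)))
      (bind (call 5 (call 8 (cons (rest (snd y) 2) o)))
        (ite (eqv (call 15 (cons y (nth (fst (.var 2)) 1))) (call 15 (cons x (nth (snd (.var 2)) 1))))
          (ite (call 14 (cons (nth (fst (.var 2)) 1) (nth (snd (.var 2)) 1)))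
            (ite (eqv (call 11 (cons (call 6 (tuple [call 9 (cons o y), call 9 (cons o x), o]))
                (rest (fst (.var 2)) 2))) (rest (snd (.var 2)) 2))
              (ask .equiv (tuple [y, x, nth (fst (.var 2)) 0, nth (snd (.var 2)) 0, o])) o) o) o)),
    -- 17: the index of a position in a list, to which it is added if necessary
    ite (isPair (snd x)) (ite (call 16 (cons (fst x) (fst (snd x)))) (cons o (snd x))
      (bind (call 17 (cons (fst x) (snd (snd x))))
        (cons (succ (fst x)) (cons (fst (snd y)) (snd x))))) (cons o (cons (fst x) o)),
    -- 18: the same for a list of positions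
    ite (isPair (fst x)) (bind (call 17 (cons (fst (fst x)) (snd x)))
      (bind (call 18 (cons (snd (fst y)) (snd x))) (cons (cons (fst y) (fst x)) (snd x))))
      (cons o (snd x)),
    -- 19: a number that is not in a list
    ite (mem (fst x) (snd x)) (call 19 (cons (succ (fst x)) (snd x))) (fst x),
    -- 20: the instances of a quantifier
    ite (isPair (rest x 2)) (cons (tuple [nth (nth x 1) 0, nth (nth x 1) 1,
        call 11 (cons (cons (cons (cons i (fst x)) (cons o (fst (rest x 2)))) o)
          (rest (nth x 1) 2))])
      (call 20 (tuple [fst x, nth x 1, snd (rest x 2)]))) o,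
    -- 21: the successors under a label
    ite (isPair (fst x)) (cons
      (bind (app (ask .support (fst (fst x))) (call 8 (cons (rest x 3) o)))
        (tuple [fst (fst y), call 13 (tuple [o, nth y 1,
          app (call 12 (tuple [i, x, nth y 2])) (call 12 (tuple [o, x, nth y 2]))]), rest y 3]))
      (call 21 (cons (snd (fst x)) (snd x)))) o,
    -- 22: the successors of a position
    bind (rest (fst x) 2)
      (bind (call 5 (call 8 (cons x o)))
        (switch (fst (fst y)) 0 [o, o,
          tuple [tuple [nth (fst (.var 2)) 0, nth (fst (.var 2)) 1, nth y 3],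
            tuple [nth (fst (.var 2)) 0, nth (fst (.var 2)) 1, rest y 4], o],
          tuple [tuple [nth (fst (.var 2)) 0, nth (fst (.var 2)) 1, nth y 3],
            tuple [nth (fst (.var 2)) 0, nth (fst (.var 2)) 1, rest y 4], o],
          bind (app (nth (fst (.var 2)) 1) x) (call 20 (tuple [fst (nth (.var 2) 1),
            tuple [nth (fst (.var 3)) 0, nth (fst (.var 3)) 1, nth (.var 2) 3],
            cons (call 19 (cons o x)) x])),
          bind (app (nth (fst (.var 2)) 1) x) (call 20 (tuple [fst (nth (.var 2) 1),
            tuple [nth (fst (.var 3)) 0, nth (fst (.var 3)) 1, nth (.var 2) 3],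
            cons (call 19 (cons o x)) x])),
          bind (app (nth (fst (.var 2)) 1) x) (call 20 (tuple [fst (nth (.var 2) 1),
            tuple [nth (fst (.var 3)) 0, nth (fst (.var 3)) 1, nth (.var 2) 3],
            cons (call 19 (cons o x)) o])),
          bind (call 7 (cons (nth y 2) o)) (call 21 (tuple [
            ask .next (tuple [nth (fst (.var 3)) 0, nth (fst (.var 3)) 1, snd (fst (.var 2)), x, o]),
            nth (.var 3) 1,
            app (call 5 (call 12 (tuple [o, nth (fst (.var 3)) 1, x]))) (nth (fst (.var 3)) 1),
            nth (.var 2) 3])),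
          bind (call 7 (cons (nth y 2) o)) (call 21 (tuple [
            ask .next (tuple [nth (fst (.var 3)) 0, nth (fst (.var 3)) 1, snd (fst (.var 2)), x, o]),
            nth (.var 3) 1,
            app (call 5 (call 12 (tuple [o, nth (fst (.var 3)) 1, x]))) (nth (fst (.var 3)) 1),
            nth (.var 2) 3])),
          bind (call 3 (tuple [snd (fst y), o, rest (.var 2) 2]))
            (cons (tuple [nth (fst (.var 3)) 0, nth (fst (.var 3)) 1,
              call 11 (cons (call 6 (tuple [nth x 0, nth (.var 2) 2, o])) (nth x 1))]) o)])),
    -- 23: does Defender move?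
    switch (fst (fst x)) 0 [ite (eqv (fst (nth x 2)) (fst (snd (nth x 2)))) o i,
      eqv (fst (nth x 2)) (fst (snd (nth x 2))), i, o, i, o, i, i, o, i],
    -- 24: the rank
    ite (eqAtom (fst (fst (fst x))) (const 9))
      (rest (call 3 (tuple [snd (fst (fst x)), o, snd x])) 2) o,
    -- 25: removal of as many elements as another list has
    ite (isPair (fst x)) (call 25 (cons (snd (fst x)) (snd (snd x)))) (snd x),
    -- 26: the rows of the positions that have not been treated
    bind (call 25 (cons (fst x) (nth x 1)))
      (ite (isPair x)
        (bind (call 18 (cons (call 22 (cons (fst x) (rest y 2))) (nth y 1)))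
          (cons (tuple [call 23 (rest (fst y) 2),
              call 24 (cons (rest (fst y) 2) (rest (.var 2) 3)), call 5 (fst x), o])
            (call 26 (tuple [cons o (fst (.var 2)), snd x, rest (.var 2) 2])))) o),
    -- 27: from formulas to trees
    switch (fst x) 0 [node o o o (snd x) o o, node i o o (snd x) o o,
      node (const 2) o o o (call 27 (nth x 1)) (call 27 (nth x 2)),
      node (const 3) o o o (call 27 (nth x 1)) (call 27 (nth x 2)),
      node (const 4) o (cons (nth x 1) o) o (call 27 (nth x 2)) o,
      node (const 5) o (cons (nth x 1) o) o (call 27 (nth x 2)) o,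
      node (const 6) o (cons (nth x 1) o) o (call 27 (nth x 2)) o,
      node (const 7) (nth x 1) o (nth x 2) (call 27 (nth x 3)) o,
      node (const 8) (nth x 1) o (nth x 2) (call 27 (nth x 3)) o,
      node (const 9) (nth x 1) o (nth x 2) o o,
      node (ite (nth x 1) (const 11) (const 10)) (nth x 2) (nth x 3) (nth x 5)
        (call 27 (nth x 4)) o],
    -- 28: the slots of a list of terms
    ite (isPair (snd x)) (cons (call 3 (tuple [fst (snd x), cons o o, fst x]))
      (call 28 (cons (fst x) (snd (snd x))))) o,
    -- 29: the slots that are used in a tree, in front of a list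
    ite (isPair (nth x 4))
      (bind (app (call 9 (cons i (nth (nth x 4) 1))) (fst x))
        (bind (ite (fix? (fst (fst (nth y 4)))) (cons (snd (fst (nth y 4))) (nth y 1)) (nth y 1))
          (app (call 28 (cons (nth (.var 2) 2)
              (call 12 (tuple [o, fst (.var 2), nth (nth (.var 2) 4) 2]))))
            (app (ite (eqAtom (fst (fst (nth (.var 2) 4))) (const 9))
                (ite (mem (snd (fst (nth (.var 2) 4))) (nth (.var 2) 1)) o
                  (call 3 (tuple [snd (fst (nth (.var 2) 4)), o, nth (.var 2) 3]))) o)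
              (call 29 (tuple [y, x, nth (.var 2) 2, nth (.var 2) 3, nth (nth (.var 2) 4) 3,
                call 29 (tuple [y, x, nth (.var 2) 2, nth (.var 2) 3, rest (nth (.var 2) 4) 4,
                  rest (.var 2) 5])])))))) (rest x 5),
    -- 30: lifting
    ite (isPair (rest x 4))
      (bind (call 10 (cons (nth x 1) (call 28 (cons (fst x) (nth (rest x 4) 2)))))
        (ite (eqAtom (fst (fst (rest y 4))) (const 9))
          (node (const 9) (snd (fst (rest y 4))) o (app x (call 10 (cons (nth y 1)
            (call 3 (tuple [snd (fst (rest y 4)), o, nth y 2]))))) o o)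
          (ite (fix? (fst (fst (rest y 4))))
            (node (const 9) (snd (fst (rest y 4))) o (app x (call 10 (cons (nth y 1)
              (call 33 (tuple [nth y 0, nth y 2, rest y 4]))))) o o)
            (bind (call 9 (cons i (nth (rest y 4) 1)))
              (bind (call 31 (cons (nth (.var 2) 3) x))
                (bind (tuple [call 6 (tuple [y, x, nth (.var 3) 0]),
                    call 6 (tuple [x, y, nth (.var 3) 1]), nth (.var 3) 2,
                    call 32 (cons (nth (.var 3) 3) y)])
                  (tuple [fst (rest (.var 4) 4), nth (rest (.var 4) 4) 1, .var 3,
                    call 30 (tuple [nth x 0, nth x 1, nth x 2, rest x 3, nth (rest (.var 4) 4) 3]),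
                    call 30 (tuple [nth x 0, nth x 1, nth x 2, rest x 3,
                      rest (rest (.var 4) 4) 4])]))))))) o,
    -- 31: consecutive slots, as many as a list has elements
    ite (isPair (snd x)) (cons (fst x) (call 31 (cons (cons o (succ (snd (fst x)))) (snd (snd x))))) o,
    -- 32: the slot after these
    ite (isPair (snd x)) (call 32 (cons (cons o (succ (snd (fst x)))) (snd (snd x)))) (fst x),
    -- 33: the needed slots of a fixpoint node
    call 5 (call 29 (tuple [call 9 (cons i (nth (rest x 2) 1)), cons (snd (fst (rest x 2))) o,
      nth x 0, nth x 1, nth (rest x 2) 3, o])),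
    -- 34: the number of nested fixpoints, as a list
    ite (isPair x) (bind (call 37 (cons (call 34 (nth x 3)) (call 34 (rest x 4))))
      (ite (fix? (fst (fst y))) (cons o x) x)) o,
    -- 35: twice the length of a list, added to a number
    ite (isPair (fst x)) (call 35 (cons (snd (fst x)) (succ (succ (snd x))))) (snd x),
    -- 36: the table of definitions, in front of a list
    ite (isPair (nth x 3))
      (bind (call 9 (cons i (nth (nth x 3) 1)))
        (bind (call 31 (cons (nth y 2) x))
          (bind (ite (fix? (fst (fst (nth (.var 2) 3)))) (call 33 (tuple [nth (.var 2) 0,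
              nth (.var 2) 1, nth (.var 2) 3])) o)
            (bind (tuple [call 6 (tuple [.var 2, y, nth (.var 3) 0]),
                ite (fix? (fst (fst (nth (.var 3) 3))))
                  (cons (cons (snd (fst (nth (.var 3) 3))) x) (nth (.var 3) 1)) (nth (.var 3) 1),
                call 32 (cons (nth (.var 3) 2) (.var 2))])
              (bind (call 36 (tuple [nth x 0, nth x 1, rest x 2, nth (nth (.var 4) 3) 3,
                  call 36 (tuple [nth x 0, nth x 1, rest x 2, rest (nth (.var 4) 3) 4,
                    rest (.var 4) 4])]))
                (ite (fix? (fst (fst (nth (.var 5) 3))))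
                  (cons (tuple [snd (fst (nth (.var 5) 3)), app (.var 3) (.var 2),
                    call 30 (tuple [nth y 0, o, nth y 1, rest y 2, nth (nth (.var 5) 3) 3]),
                    call 35 (cons (call 34 (nth (.var 5) 3))
                      (ite (eqAtom (fst (fst (nth (.var 5) 3))) (const 10)) i o))]) x) x))))))
      (rest x 4),
    -- 37: the longer one of two unary numbers
    ite (isPair (fst x)) (ite (isPair (snd x)) (cons o (call 37 (cons (snd (fst x)) (snd (snd x)))))
      (fst x)) (snd x) ]

section

attribute [local simp] wp

attribute [simp] Expr.nth Expr.rest Expr.tuple Expr.switch Expr.node Val.fst Val.snd Val.isPair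
  Val.succ Val.eqAtom Val.ofList

/-! ## Lists and equality -/

namespace Val

def size : Val → ℕ
  | atom _ => 1
  | pair v w => v.size + w.size + 1

open Classical in
/-- The truth value of a proposition. -/
noncomputable def bit (p : Prop) : Val := atom (if p then 1 else 0)

theorem bit_pos {p : Prop} (h : p) : bit p = atom 1 := by simp [bit, h]

theorem bit_neg {p : Prop} (h : ¬ p) : bit p = atom 0 := by simp [bit, h]

theorem ofList_injective : Function.Injective ofList := by
  intro l l' h
  induction l generalizing l' with
  | nil => cases l' <;> simp_all
  | cons a l ih =>
    cases l' with
    | nil => simp at h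
    | cons b l' =>
      simp only [ofList, pair.injEq] at h
      rw [h.1, ih h.2]

end Val

/-- Data with small codes. -/
class Coded (α : Type) where
  enc : α → Val
  inj : Function.Injective enc
  size_le : ∀ a, (enc a).size ≤ 3

open Coded (enc)

instance : Coded Name := ⟨Name.encode, fun a b h => by cases a; cases b; simpa [Name.encode] using h,
  fun a => by simp [Name.encode, Val.size]⟩

instance : Coded ℕ := ⟨.atom, fun a b h => by simpa using h, fun a => by simp [Val.size]⟩

instance : Coded Term := ⟨Term.encode, fun u v h => by
    cases u <;> cases v <;> simp_all [Term.encode, Name.encode]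
    exact congrArg Name.mk h, fun u => by
    cases u <;> simp [Term.encode, Name.encode, Val.size]⟩

def codeList {α : Type} [Coded α] (l : List α) : Val := .ofList (l.map enc)

section

variable {α : Type} [Coded α]

@[simp] theorem codeList_nil : codeList ([] : List α) = .atom 0 := rfl

@[simp] theorem codeList_cons (a : α) (l : List α) :
    codeList (a :: l) = .pair (enc a) (codeList l) := rfl

theorem codeList_injective : Function.Injective (codeList : List α → Val) := fun _ _ h =>
  (List.map_injective_iff.2 Coded.inj) (Val.ofList_injective h)

end

section

variable {O : Oracle}

/-- The recursion follows the first value and stops at the first difference, so the size of the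
second value does not enter. -/
theorem comp_eqv (v w : Val) :
    Comp orbitProgram O 1 (.pair v w) (.bit (v = w)) (30 * v.size) := by
  induction v generalizing w with
  | atom m =>
    refine Comp.of_wp ?_
    by_cases h : Val.atom m = w
    · subst h; simp [orbitProgram, Val.bit, Val.size]
    · cases w <;> simp_all [orbitProgram, Val.bit, Val.size]
  | pair v₁ v₂ ih₁ ih₂ =>
    refine Comp.of_wp ?_
    cases w with
    | atom n => simp [orbitProgram, Val.bit, Val.size]; omega
    | pair w₁ w₂ =>
      simp [orbitProgram]
      refine ⟨_, _, ih₁ w₁, ?_⟩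
      by_cases h : v₁ = w₁
      · rw [Val.bit_pos h]
        simp [h]
        exact ⟨_, ih₂ w₂, by simp only [Val.size]; omega⟩
      · rw [Val.bit_neg h]
        simp [h, Val.bit, Val.size]; omega

theorem comp_append (l h : List Val) :
    Comp orbitProgram O 4 (.pair (.ofList l) (.ofList h)) (.ofList (l ++ h))
      (20 * (l.length + 1)) := by
  induction l with
  | nil => exact Comp.of_wp (by simp [orbitProgram])
  | cons a l ih =>
    refine Comp.of_wp ?_
    simp [orbitProgram]
    exact ⟨_, ih, by omega⟩

theorem comp_zip (l m h : List Val) :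
    Comp orbitProgram O 6 (.pair (.ofList l) (.pair (.ofList m) (.ofList h)))
      (.ofList ((l.zip m).map (fun p => .pair p.1 p.2) ++ h)) (50 * (l.length + 1)) := by
  induction l generalizing m with
  | nil => exact Comp.of_wp (by simp [orbitProgram])
  | cons a l ih =>
    refine Comp.of_wp ?_
    cases m with
    | nil => simp [orbitProgram]; omega
    | cons b m =>
      simp [orbitProgram]
      exact ⟨_, ih m, by omega⟩

theorem comp_wrap (v : Val) (l : List Val) :
    Comp orbitProgram O 9 (.pair v (.ofList l)) (.ofList (l.map (.pair v)))
      (50 * (l.length + 1)) := by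
  induction l with
  | nil => exact Comp.of_wp (by simp [orbitProgram])
  | cons a l ih =>
    refine Comp.of_wp ?_
    simp [orbitProgram]
    exact ⟨_, ih, by omega⟩

theorem comp_take (i n : ℕ) (l : List Val) (h : i ≤ n) :
    Comp orbitProgram O 13 (.pair (.atom i) (.pair (.atom n) (.ofList l))) (.ofList (l.take (n - i)))
      (50 * (l.length + 1)) := by
  induction l generalizing i with
  | nil => exact Comp.of_wp (by simp [orbitProgram])
  | cons a l ih =>
    refine Comp.of_wp ?_
    by_cases hi : i = n
    · subst hi; simp [orbitProgram]; omega
    · simp [orbitProgram, hi]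
      have := ih (i + 1) (by omega)
      rw [show n - i = (n - (i + 1)) + 1 by omega, List.take_succ_cons]
      exact ⟨_, _, this, rfl, by omega⟩

theorem comp_eqLength (l m : List Val) :
    Comp orbitProgram O 14 (.pair (.ofList l) (.ofList m)) (.bit (l.length = m.length))
      (50 * (l.length + 1)) := by
  induction l generalizing m with
  | nil => refine Comp.of_wp ?_; cases m <;> simp [orbitProgram, Val.bit]
  | cons a l ih =>
    refine Comp.of_wp ?_
    cases m with
    | nil => simp [orbitProgram, Val.bit]; omega
    | cons b m =>
      simp [orbitProgram]
      exact ⟨_, ih m, by omega⟩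

theorem comp_drop (l m : List Val) :
    Comp orbitProgram O 25 (.pair (.ofList l) (.ofList m)) (.ofList (m.drop l.length))
      (50 * (l.length + 1)) := by
  induction l generalizing m with
  | nil => exact Comp.of_wp (by simp [orbitProgram])
  | cons a l ih =>
    refine Comp.of_wp ?_
    cases m with
    | nil =>
      have := ih []
      simp [orbitProgram] at this ⊢
      exact ⟨_, this, by omega⟩
    | cons b m =>
      simp [orbitProgram]
      exact ⟨_, ih m, by omega⟩

/-- Unary numbers. -/
def unary (n : ℕ) : Val := .ofList (List.replicate n (.atom 0))

theorem comp_double (n k : ℕ) :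
    Comp orbitProgram O 35 (.pair (unary n) (.atom k)) (.atom (2 * n + k)) (50 * (n + 1)) := by
  induction n generalizing k with
  | zero => exact Comp.of_wp (by simp [orbitProgram, unary])
  | succ n ih =>
    refine Comp.of_wp ?_
    have := ih (k + 1 + 1)
    rw [show 2 * n + (k + 1 + 1) = 2 * (n + 1) + k by ring] at this
    simp [orbitProgram, unary, List.replicate_succ] at this ⊢
    exact ⟨_, this, by omega⟩

theorem comp_max (m n : ℕ) :
    Comp orbitProgram O 37 (.pair (unary m) (unary n)) (unary (max m n)) (50 * (m + 1)) := by
  induction m generalizing n with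
  | zero => refine Comp.of_wp ?_; simp [orbitProgram, unary]
  | succ m ih =>
    refine Comp.of_wp ?_
    cases n with
    | zero => simp [orbitProgram, unary, List.replicate_succ]; omega
    | succ n =>
      have := ih n
      rw [show max (m + 1) (n + 1) = max m n + 1 by omega]
      simp [orbitProgram, unary, List.replicate_succ] at this ⊢
      exact ⟨_, this, by omega⟩

/-! ### Programs on lists of small data. -/

variable {α : Type} [Coded α]

theorem comp_append_code (l h : List α) :
    Comp orbitProgram O 4 (.pair (codeList l) (codeList h)) (codeList (l ++ h))
      (20 * (l.length + 1)) := by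
  have := comp_append (O := O) (l.map enc) (h.map enc)
  rwa [← List.map_append, List.length_map] at this

theorem comp_take_code (n : ℕ) (l : List α) :
    Comp orbitProgram O 13 (.pair (.atom 0) (.pair (.atom n) (codeList l))) (codeList (l.take n))
      (50 * (l.length + 1)) := by
  have := comp_take (O := O) 0 n (l.map enc) (Nat.zero_le _)
  rwa [← List.map_take, List.length_map] at this

theorem comp_mem (a : α) (l : List α) :
    Comp orbitProgram O 2 (.pair (enc a) (codeList l)) (.bit (a ∈ l)) (150 * (l.length + 1)) := by
  induction l with
  | nil => exact Comp.of_wp (by simp [orbitProgram, Val.bit])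
  | cons b l ih =>
    refine Comp.of_wp ?_
    simp [orbitProgram]
    refine ⟨_, _, comp_eqv _ _, ?_⟩
    have hs := Coded.size_le a
    by_cases h : a = b
    · subst h; simp [Val.bit]; omega
    · rw [Val.bit_neg (by simpa [Coded.inj.eq_iff] using h)]
      simp [h]
      exact ⟨_, ih, by omega⟩

variable [DecidableEq α]

/-- Encoding of association lists. -/
def codeAssoc (γ : List (α × Val)) : Val := .ofList (γ.map fun p => .pair (enc p.1) p.2)

theorem comp_lookup (a : α) (d : Val) (γ : List (α × Val)) :
    Comp orbitProgram O 3 (.pair (enc a) (.pair d (codeAssoc γ))) ((γ.lookup a).getD d)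
      (150 * (γ.length + 1)) := by
  induction γ with
  | nil => exact Comp.of_wp (by simp [orbitProgram, codeAssoc])
  | cons p γ ih =>
    refine Comp.of_wp ?_
    simp [orbitProgram, codeAssoc]
    refine ⟨_, _, comp_eqv _ _, ?_⟩
    have hs := Coded.size_le a
    obtain ⟨b, v⟩ := p
    by_cases h : a = b
    · subst h; simp [Val.bit]; omega
    · rw [Val.bit_neg (by simpa [Coded.inj.eq_iff] using h)]
      rw [List.lookup_cons, beq_false_of_ne h]
      simp [codeAssoc] at ih ⊢
      exact ⟨_, ih, by omega⟩

/-- Membership is tested in the part that is already free of duplicates. So the second factor is the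
number of different entries, which is much smaller than the length for the names of a tree. -/
theorem comp_dedup (l : List α) :
    Comp orbitProgram O 5 (codeList l) (codeList l.dedup)
      (200 * (l.length + 1) * (l.dedup.length + 1)) := by
  induction l with
  | nil => exact Comp.of_wp (by simp [orbitProgram])
  | cons a l ih =>
    refine Comp.of_wp ?_
    simp [orbitProgram]
    refine ⟨_, _, ih, _, _, comp_mem _ _, ?_⟩
    by_cases h : a ∈ l
    · rw [Val.bit_pos (List.mem_dedup.2 h), List.dedup_cons_of_mem h]
      simp; nlinarith
    · rw [Val.bit_neg (by rwa [List.mem_dedup]), List.dedup_cons_of_notMem h]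
      simp; nlinarith

theorem comp_filter (b : Bool) (l us : List α) :
    Comp orbitProgram O 12 (.pair (.atom b.toNat) (.pair (codeList l) (codeList us)))
      (codeList (us.filter fun a => decide (a ∈ l) == b)) (200 * (us.length + 1) * (l.length + 1)) := by
  induction us with
  | nil => exact Comp.of_wp (by simp [orbitProgram]; omega)
  | cons a us ih =>
    refine Comp.of_wp ?_
    simp [orbitProgram]
    refine ⟨_, _, ih, _, _, comp_mem _ _, ?_⟩
    by_cases h : a ∈ l <;> cases b <;> simp [Val.bit, h] <;> nlinarith

theorem comp_pattern (l h : List α) :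
    Comp orbitProgram O 15 (.pair (codeList l) (codeList h))
      (.ofList (l.map fun a => .bit (a ∈ h))) (200 * (l.length + 1) * (h.length + 1)) := by
  induction l with
  | nil => exact Comp.of_wp (by simp [orbitProgram]; omega)
  | cons a l ih =>
    refine Comp.of_wp ?_
    simp [orbitProgram]
    exact ⟨_, comp_mem _ _, _, ih, by nlinarith⟩

end

/-- Search for a number that is not in a list. -/
theorem comp_fresh {O : Oracle} (l : List Name) (i : ℕ) (hi : ∀ j < i, (⟨j⟩ : Name) ∈ l) :
    ∃ a : Name, a ∉ l ∧ Comp orbitProgram O 19 (.pair (.atom i) (codeList l)) (enc a)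
      (200 * (l.length + 1) * (l.length + 1 - i)) := by
  -- The numbers below `i` are different entries of the list, so the search stops after at most
  -- `l.length` steps.
  have hle : i ≤ l.length := by
    have : ((Finset.range i).map ⟨Name.mk, fun a b h => by simpa using h⟩) ⊆ l.toFinset := by
      intro a ha
      obtain ⟨j, hj, rfl⟩ := Finset.mem_map.1 ha
      exact List.mem_toFinset.2 (hi j (Finset.mem_range.1 hj))
    have h := Finset.card_le_card this
    rw [Finset.card_map, Finset.card_range] at h
    exact h.trans (List.toFinset_card_le _)
  by_cases h : (⟨i⟩ : Name) ∈ l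
  · obtain ⟨a, ha, hc⟩ := comp_fresh (O := O) l (i + 1) (fun j hj => by
      rcases Nat.lt_succ_iff_lt_or_eq.1 hj with h' | rfl
      · exact hi j h'
      · exact h)
    refine ⟨a, ha, Comp.of_wp ?_⟩
    simp [orbitProgram]
    refine ⟨_, _, comp_mem (α := Name) ⟨i⟩ l, ?_⟩
    rw [Val.bit_pos h]
    simp
    refine ⟨_, hc, ?_⟩
    obtain ⟨k, hk⟩ : ∃ k, l.length + 1 - i = k + 1 := ⟨l.length - i, by omega⟩
    rw [hk, show l.length + 1 - (i + 1) = k by omega]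
    nlinarith
  · refine ⟨⟨i⟩, h, Comp.of_wp ?_⟩
    simp [orbitProgram]
    refine ⟨_, _, comp_mem (α := Name) ⟨i⟩ l, ?_⟩
    rw [Val.bit_neg h]
    obtain ⟨k, hk⟩ : ∃ k, l.length + 1 - i = k + 1 := ⟨l.length - i, by omega⟩
    rw [hk]
    simp [enc, Name.encode]
    nlinarith
termination_by l.length + 1 - i
decreasing_by
  omega

end

open Coded (enc)

section

attribute [local simp] wp

/-! ## Programs on trees -/

/-- Substitution by an association list. -/
def assocSub (γ : List (Term × Term)) (u : Term) : Term := (γ.lookup u).getD u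

def codePairs {α β : Type} [Coded α] [Coded β] (γ : List (α × β)) : Val :=
  .ofList (γ.map fun p => .pair (enc p.1) (enc p.2))

def slotTerms (d n : ℕ) : List Term := (List.range' d n).map slotTerm

@[simp] theorem length_slotTerms (d n : ℕ) : (slotTerms d n).length = n := by simp [slotTerms]

namespace FTree

def code : FTree → Val
  | nil => .atom 0
  | node c m xs us l r => .pair (.pair (.atom c) (.atom m))
      (.pair (codeList xs) (.pair (codeList us) (.pair l.code r.code)))

def weight : FTree → ℕ
  | nil => 0
  | node _ _ xs us l r => 1 + xs.length + us.length + (l.weight + r.weight)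

/-- The number of nested fixpoints. -/
def height : FTree → ℕ
  | nil => 0
  | node c _ _ _ l r => max l.height r.height + if 10 ≤ c then 1 else 0

/-- All connectives are legal. -/
def Tagged : FTree → Prop
  | nil => True
  | node c _ _ _ l r => c ≤ 11 ∧ l.Tagged ∧ r.Tagged

theorem code_injective : Function.Injective code := by
  intro t t' h
  induction t generalizing t' with
  | nil => cases t' <;> simp_all [code]
  | node c m xs us l r ihl ihr =>
    cases t' with
    | nil => simp [code] at h
    | node c' m' xs' us' l' r' =>
      simp only [code, Val.pair.injEq, Val.atom.injEq] at h
      obtain ⟨⟨rfl, rfl⟩, h1, h2, h3, h4⟩ := h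
      rw [codeList_injective h1, codeList_injective h2, ihl h3, ihr h4]

theorem size_code (t : FTree) : t.code.size ≤ 20 * t.weight + 1 := by
  have key : ∀ {α : Type} [Coded α] (l : List α), (codeList l).size ≤ 4 * l.length + 1 := by
    intro α _ l
    induction l with
    | nil => simp [Val.size]
    | cons a l ih =>
      have := Coded.size_le a
      rw [codeList_cons, Val.size, List.length_cons]; omega
  induction t with
  | nil => simp [code, Val.size, weight]
  | node c m xs us l r ihl ihr =>
    have h1 := key xs
    have h2 := key us
    simp only [code, Val.size, weight]
    omega

theorem height_le_weight (t : FTree) : t.height ≤ t.weight := by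
  induction t with
  | nil => simp [height]
  | node c m xs us l r ihl ihr => simp only [height, weight]; split_ifs <;> omega

/-- The program does not remove the entries of bound variables; it hides them by putting identical
pairs in front. -/
theorem under_assocSub (γ : List (Term × Term)) (xs : List ℕ) :
    under (assocSub γ) xs = assocSub ((vars xs).zip (vars xs) ++ γ) := by
  funext u
  have key : ∀ us : List Term, assocSub (us.zip us ++ γ) u =
      if u ∈ us then u else assocSub γ u := by
    intro us
    induction us with
    | nil => simp
    | cons v us ih =>
      rw [List.zip_cons_cons, List.cons_append, assocSub, List.lookup_cons]
      by_cases h : u = v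
      · subst h; simp
      · rw [beq_false_of_ne h]
        simp only [List.mem_cons, h, false_or]
        exact ih
  rw [key]
  cases u with
  | name a => simp [under, vars]
  | var x => simp [under, vars]

/-- A substitution that fixes all variables is not changed by binders. -/
theorem den_empty_of_vars {e : Term → Term} (h : ∀ x, e (.var x) = .var x) (t : FTree) :
    den e RecEnv.empty t = t.tmap e := by
  have hu : ∀ xs, under e xs = e := by
    intro xs
    funext u
    cases u with
    | name a => rfl
    | var x => by_cases hx : x ∈ xs <;> simp [under, hx, h]
  induction t with
  | nil => rfl
  | node c m xs us l r ihl ihr =>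
    rw [den_node_of_none (fun _ => rfl), RecEnv.empty_under, hu, ihl, ihr, tmap]

end FTree

theorem Formula.tagged_tree (φ : Formula) : φ.tree.Tagged := by
  induction φ with
  | fix σ X xs φ us ih => exact ⟨σ.code_le, ih, trivial⟩
  | _ => simp_all [Formula.tree, FTree.Tagged]

theorem Formula.height_tree (φ : Formula) : φ.tree.height = φ.height := by
  induction φ with
  | fix σ X xs φ us ih =>
    simp [Formula.tree, FTree.height, Formula.height, ih, σ.ten_le_code, add_comm]
  | _ => simp_all [Formula.tree, FTree.height, Formula.height]

/-- The weight also counts bound variables. A fixpoint has as many parameters as arguments by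
well-formedness, whence the factor 2. -/
theorem Formula.weight_tree {φ : Formula} {Γ : Finset ℕ} {Δ : ℕ → Option ℕ}
    (h : φ.WellFormed Γ Δ) : φ.tree.weight ≤ 2 * φ.size := by
  induction φ generalizing Γ Δ with
  | fix σ X xs φ us ih =>
    have := ih h.2.2.2
    have := h.2.2.1
    simp only [Formula.tree, FTree.weight, Formula.size]; omega
  | or φ ψ ih₁ ih₂ | and φ ψ ih₁ ih₂ =>
    have := ih₁ h.1
    have := ih₂ h.2
    simp only [Formula.tree, FTree.weight, Formula.size, List.length_nil]; omega
  | some x φ ih | all x φ ih | fresh x φ ih =>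
    have := ih h
    simp only [Formula.tree, FTree.weight, Formula.size, List.length_nil, List.length_cons]; omega
  | dia t us φ ih | box t us φ ih =>
    have := ih h.2
    simp only [Formula.tree, FTree.weight, Formula.size, List.length_nil]; omega
  | _ => simp [Formula.tree, FTree.weight, Formula.size]; try omega

section

variable {O : Oracle}

theorem comp_namesL (us : List Term) (acc : List Name) :
    Comp orbitProgram O 7 (.pair (codeList us) (codeList acc))
      (codeList (us.flatMap Term.nameList ++ acc)) (50 * (us.length + 1)) := by
  induction us with
  | nil => exact Comp.of_wp (by simp [orbitProgram])
  | cons u us ih =>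
    refine Comp.of_wp ?_
    simp [orbitProgram]
    refine ⟨_, _, ih, ?_⟩
    cases u <;> simp [enc, Term.encode, Term.nameList] <;> omega

theorem comp_names (t : FTree) (acc : List Name) :
    Comp orbitProgram O 8 (.pair t.code (codeList acc)) (codeList (t.names ++ acc))
      (500 * t.weight + 20) := by
  induction t generalizing acc with
  | nil => exact Comp.of_wp (by simp [orbitProgram, FTree.code, FTree.names])
  | node c m xs us l r ihl ihr =>
    refine Comp.of_wp ?_
    simp [orbitProgram, FTree.code, FTree.names]
    refine ⟨_, _, ihr acc, _, _, ihl _, _, comp_namesL _ _, ?_⟩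
    simp only [FTree.weight]; omega

theorem lookup_map_snd {α β γ : Type*} [DecidableEq α] (f : β → γ) (l : List (α × β)) (a : α) :
    (l.map fun p => (p.1, f p.2)).lookup a = (l.lookup a).map f := by
  induction l with
  | nil => rfl
  | cons p l ih =>
    obtain ⟨b, c⟩ := p
    rw [List.map_cons, List.lookup_cons, List.lookup_cons]
    by_cases h : a = b
    · simp [h]
    · rw [beq_false_of_ne h]; exact ih

theorem comp_lookup_pairs {α β : Type} [Coded α] [Coded β] [DecidableEq α] (a : α) (d : β)
    (γ : List (α × β)) :
    Comp orbitProgram O 3 (.pair (enc a) (.pair (enc d) (codePairs γ)))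
      (enc ((γ.lookup a).getD d)) (150 * (γ.length + 1)) := by
  have := comp_lookup (O := O) a (enc d) (γ.map fun p => (p.1, enc p.2))
  rw [lookup_map_snd, List.length_map, codeAssoc, List.map_map] at this
  cases h : γ.lookup a <;> simpa [h, codePairs, Function.comp_def] using this

theorem comp_zip_pairs {α β : Type} [Coded α] [Coded β] (l : List α) (m : List β)
    (γ : List (α × β)) :
    Comp orbitProgram O 6 (.pair (codeList l) (.pair (codeList m) (codePairs γ)))
      (codePairs (l.zip m ++ γ)) (50 * (l.length + 1)) := by
  have := comp_zip (O := O) (l.map enc) (m.map enc) (γ.map fun p => .pair (enc p.1) (enc p.2))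
  rw [List.length_map, List.zip_map, List.map_map] at this
  simpa [codePairs, Function.comp_def, codeList] using this

theorem comp_vars (xs : List ℕ) :
    Comp orbitProgram O 9 (.pair (.atom 1) (codeList xs)) (codeList (vars xs))
      (50 * (xs.length + 1)) := by
  have := comp_wrap (O := O) (.atom 1) (xs.map enc)
  simpa [codeList, vars, Function.comp_def, enc, Term.encode] using this

theorem comp_nameTerms (as : List Name) :
    Comp orbitProgram O 9 (.pair (.atom 0) (codeList as)) (codeList (as.map Term.name))
      (50 * (as.length + 1)) := by
  have := comp_wrap (O := O) (.atom 0) (as.map enc)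
  simpa [codeList, Function.comp_def, enc, Term.encode] using this

theorem comp_mapSub (γ : List (Term × Term)) (us : List Term) :
    Comp orbitProgram O 10 (.pair (codePairs γ) (codeList us)) (codeList (us.map (assocSub γ)))
      (200 * (us.length + 1) * (γ.length + 1)) := by
  induction us with
  | nil => exact Comp.of_wp (by simp [orbitProgram]; omega)
  | cons u us ih =>
    refine Comp.of_wp ?_
    simp [orbitProgram]
    exact ⟨_, comp_lookup_pairs u u γ, _, ih, by nlinarith⟩

/-- The association list grows by the variables bound along a branch, so every look-up takes place
in a list of length at most `γ.length + t.depth`. -/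
theorem comp_subst (t : FTree) (γ : List (Term × Term)) :
    Comp orbitProgram O 11 (.pair (codePairs γ) t.code) (den (assocSub γ) RecEnv.empty t).code
      (1000 * t.weight * (γ.length + t.depth + 1) + 20) := by
  induction t generalizing γ with
  | nil => exact Comp.of_wp (by simp [orbitProgram, FTree.code, den])
  | node c m xs us l r ihl ihr =>
    refine Comp.of_wp ?_
    rw [den_node_of_none (fun _ => rfl), RecEnv.empty_under, under_assocSub]
    simp [orbitProgram, FTree.code]
    refine ⟨_, _, comp_vars xs, _, _, comp_zip_pairs _ _ _, _, comp_mapSub _ _, _, ihl _, _, ihr _, ?_⟩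
    simp only [List.length_append, List.length_zip, length_vars, min_self, FTree.weight,
      FTree.depth]
    set D := γ.length + (xs.length + max l.depth r.depth) + 1
    have h1 : l.weight * (xs.length + γ.length + l.depth + 1) ≤ l.weight * D :=
      Nat.mul_le_mul_left _ (by omega)
    have h2 : r.weight * (xs.length + γ.length + r.depth + 1) ≤ r.weight * D :=
      Nat.mul_le_mul_left _ (by omega)
    have h3 : (us.length + 1) * (γ.length + 1) ≤ (us.length + 1) * D :=
      Nat.mul_le_mul_left _ (by omega)
    have h4 : xs.length ≤ xs.length * D := Nat.le_mul_of_pos_right _ (by omega)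
    have h5 : 1 ≤ D := by omega
    nlinarith

theorem comp_slots (d : ℕ) (l : List Val) :
    Comp orbitProgram O 31 (.pair (enc (slotTerm d)) (.ofList l)) (codeList (slotTerms d l.length))
      (50 * (l.length + 1)) := by
  induction l generalizing d with
  | nil => exact Comp.of_wp (by simp [orbitProgram, slotTerms])
  | cons a l ih =>
    refine Comp.of_wp ?_
    have := ih (d + 1)
    simp [orbitProgram, slotTerms, List.range'_succ, enc, Term.encode, slotTerm, Name.encode] at this ⊢
    exact ⟨_, this, by omega⟩

theorem comp_advance (d : ℕ) (l : List Val) :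
    Comp orbitProgram O 32 (.pair (enc (slotTerm d)) (.ofList l)) (enc (slotTerm (d + l.length)))
      (50 * (l.length + 1)) := by
  induction l generalizing d with
  | nil => exact Comp.of_wp (by simp [orbitProgram])
  | cons a l ih =>
    refine Comp.of_wp ?_
    have := ih (d + 1)
    rw [show d + 1 + l.length = d + (l.length + 1) by omega] at this
    simp [orbitProgram, enc, Term.encode, slotTerm, Name.encode] at this ⊢
    exact ⟨_, this, by omega⟩

theorem comp_height (t : FTree) (ht : t.Tagged) :
    Comp orbitProgram O 34 t.code (unary t.height) (200 * t.weight * (t.weight + 1) + 20) := by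
  induction t with
  | nil => exact Comp.of_wp (by simp [orbitProgram, FTree.code, unary, FTree.height])
  | node c m xs us l r ihl ihr =>
    refine Comp.of_wp ?_
    obtain ⟨hc, hl, hr⟩ := ht
    have h1 := l.height_le_weight
    simp [orbitProgram, FTree.code]
    refine ⟨_, _, ihl hl, _, _, ihr hr, _, _, comp_max _ _, ?_⟩
    simp only [FTree.height, FTree.weight]
    have hcost : ∀ k, k ≤ 40 → k + (200 * l.weight * (l.weight + 1) + 20) +
        (200 * r.weight * (r.weight + 1) + 20) + 50 * (l.height + 1) ≤
        200 * (1 + xs.length + us.length + (l.weight + r.weight)) *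
          (1 + xs.length + us.length + (l.weight + r.weight) + 1) + 20 := by
      intro k hk
      set z := xs.length + us.length
      have : 1 + xs.length + us.length = 1 + z := by omega
      rw [this]
      nlinarith [mul_nonneg (Nat.zero_le z) (Nat.zero_le l.weight),
        mul_nonneg (Nat.zero_le l.weight) (Nat.zero_le r.weight)]
    rcases (by omega : c = 10 ∨ c = 11 ∨ c < 10) with rfl | rfl | h
    · simp [unary, List.replicate_succ]
      have := hcost 40 (by omega); omega
    · simp [unary, List.replicate_succ]
      have := hcost 40 (by omega); omega
    · rw [if_neg (by omega)]
      simp [unary, show c ≠ 10 by omega, show c ≠ 11 by omega]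
      have := hcost 40 (by omega); omega

theorem comp_tree (φ : Formula) :
    Comp orbitProgram O 27 φ.encode φ.tree.code (500 * φ.size) := by
  induction φ with
  | fix σ X xs φ us ih =>
    refine Comp.of_wp ?_
    cases σ <;>
    · simp [orbitProgram, Formula.encode, Formula.tree, FTree.code, FixKind.encode, FixKind.code,
        Formula.size, encodeTerms, codeList]
      exact ⟨_, ih, ⟨rfl, rfl⟩, by omega⟩
  | or φ ψ ih₁ ih₂ | and φ ψ ih₁ ih₂ =>
    refine Comp.of_wp ?_
    simp [orbitProgram, Formula.encode, Formula.tree, FTree.code, Formula.size]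
    exact ⟨_, ih₁, _, ih₂, by omega⟩
  | some x φ ih | all x φ ih | fresh x φ ih =>
    refine Comp.of_wp ?_
    simp [orbitProgram, Formula.encode, Formula.tree, FTree.code, Formula.size]
    exact ⟨_, ih, rfl, by omega⟩
  | dia t us φ ih | box t us φ ih =>
    refine Comp.of_wp ?_
    simp [orbitProgram, Formula.encode, Formula.tree, FTree.code, Formula.size, encodeTerms,
      codeList]
    exact ⟨_, ih, rfl, by omega⟩
  | eq u v | ne u v | call X us =>
    refine Comp.of_wp ?_
    simp [orbitProgram, Formula.encode, Formula.tree, FTree.code, Formula.size, encodeTerms,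
      codeList, enc]
    try omega

end

end

set_option maxRecDepth 4000

/-! ## Symbolic evaluation -/

/-- After calling the `f`-th function of `P`, `Q` holds of the result and the time. -/
inductive Calls (P : Program) (O : Oracle) (f : ℕ) (v : Val) (Q : Val → ℕ → Prop) : Prop
  | intro (w : Val) (b : ℕ) (h : Comp P O f v w b) (hQ : Q w b)

/-- After asking the oracle, `Q` holds of the answer and the time. -/
inductive Asks (O : Oracle) (q : Query) (v : Val) (Q : Val → ℕ → Prop) : Prop
  | intro (b : ℕ) (h : O.cost q v ≤ b) (hQ : Q (O.answer q v) b)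

/-- A match instead of a test, so that conditionals on evaluated data reduce by definitional
unfolding. -/
def Val.cond (p q : Prop) : Val → Prop
  | .atom 0 => q
  | _ => p

/-- A variant of `wp` that evaluates by reduction up to the next call. -/
def run (P : Program) (O : Oracle) : Expr → List Val → (Val → ℕ → Prop) → Prop
  | .var i, env, Q => Q (env.getD i (.atom 0)) 1
  | .const n, _, Q => Q (.atom n) 1
  | .cons e₁ e₂, env, Q => run P O e₁ env fun v k => run P O e₂ env fun w k' =>
      Q (.pair v w) (k + k' + 1)
  | .fst e, env, Q => run P O e env fun v k => Q v.fst (k + 1)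
  | .snd e, env, Q => run P O e env fun v k => Q v.snd (k + 1)
  | .succ e, env, Q => run P O e env fun v k => Q v.succ (k + 1)
  | .isPair e, env, Q => run P O e env fun v k => Q v.isPair (k + 1)
  | .eqAtom e₁ e₂, env, Q => run P O e₁ env fun v k => run P O e₂ env fun w k' =>
      Q (v.eqAtom w) (k + k' + 1)
  | .ite e e₁ e₂, env, Q => run P O e env fun v k =>
      v.cond (run P O e₁ env fun w k' => Q w (k + k' + 1))
        (run P O e₂ env fun w k' => Q w (k + k' + 1))
  | .bind e₁ e₂, env, Q => run P O e₁ env fun v k => run P O e₂ (v :: env) fun w k' =>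
      Q w (k + k' + 1)
  | .call f e, env, Q => run P O e env fun v k => Calls P O f v fun w b => Q w (k + b + 1)
  | .ask q e, env, Q => run P O e env fun v k => Asks O q v fun w b => Q w (k + b + 1)

theorem wp_of_run {P : Program} {O : Oracle} (e : Expr) : ∀ {env : List Val}
    {Q : Val → ℕ → Prop}, run P O e env Q → wp P O e env Q := by
  induction e with
  | var i | const n => exact id
  | cons e₁ e₂ ih₁ ih₂ | eqAtom e₁ e₂ ih₁ ih₂ | bind e₁ e₂ ih₁ ih₂ =>
    exact fun h => wp_mono e₁ (fun _ _ h => ih₂ h) (ih₁ h)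
  | fst e ih | snd e ih | succ e ih | isPair e ih => exact fun h => ih h
  | ite e e₁ e₂ ih ih₁ ih₂ =>
    refine fun h => wp_mono e (fun v k h => ?_) (ih h)
    rcases v with n | ⟨v, w⟩
    · cases n with
      | zero => exact ⟨fun h => absurd rfl h, fun _ => ih₂ h⟩
      | succ n => exact ⟨fun _ => ih₁ h, fun h => by simp at h⟩
    · exact ⟨fun _ => ih₁ h, fun h => by simp at h⟩
  | call f e ih => exact fun h => wp_mono e (fun _ _ ⟨w, b, h, hQ⟩ => ⟨w, b, h, hQ⟩) (ih h)
  | ask q e ih => exact fun h => wp_mono e (fun _ _ ⟨b, h, hQ⟩ => ⟨b, h, hQ⟩) (ih h)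

section

variable {P : Program} {O : Oracle} {Q : Val → ℕ → Prop} {f : ℕ} {q : Query} {v w : Val} {b : ℕ}

theorem Comp.of_run (h : run P O (P.getD f (.const 0)) [v] fun w' k => w' = w ∧ k ≤ b) :
    Comp P O f v w b := .of_wp (wp_of_run _ h)

theorem Comp.calls (h : Comp P O f v w b) (hQ : Q w b) : Calls P O f v Q := ⟨w, b, h, hQ⟩

theorem Asks.of_eq (hw : O.answer q v = w) (h : O.cost q v ≤ b) (hQ : Q w b) : Asks O q v Q :=
  ⟨b, h, hw ▸ hQ⟩

end

/-! ## Programs for the lifting -/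

def codeScope (sc : Scope) : Val := codePairs (sc.map fun p => (p.1, slotTerm p.2))

/-- Encoding of slots. -/
def codeSlots (l : List ℕ) : Val := codeList (l.map slotTerm)

def codeRecScope (κ : RecScope) : Val := codeAssoc (κ.map fun p => (p.1, codeSlots p.2))

theorem slotTerm_injective : Function.Injective slotTerm := fun a b h => by simpa [slotTerm] using h

theorem filter_map_slot (sc : Scope) (bl : List ℕ) (us : List Term) :
    (us.filter fun u => decide (u ∈ vars bl) == false).map sc.slot =
      us.flatMap (slotsOf sc bl) := by
  induction us with
  | nil => rfl
  | cons u us ih =>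
    rw [List.flatMap_cons, ← ih]
    cases u with
    | name a => simp [slotsOf, vars]
    | var x => by_cases h : x ∈ bl <;> simp [slotsOf, vars, h]

/-- Pairs in front of an association list take precedence; this implements the overwriting of slots.
-/
theorem setSlots_assocSub (bnd : List (Term × Term)) (d : ℕ) (vs : List Term) :
    setSlots (fun ℓ => assocSub bnd (slotTerm ℓ)) d vs =
      fun ℓ => assocSub ((slotTerms d vs.length).zip vs ++ bnd) (slotTerm ℓ) := by
  induction vs generalizing d with
  | nil => rfl
  | cons v vs ih =>
    funext ℓ
    have e : slotTerms d (v :: vs).length = slotTerm d :: slotTerms (d + 1) vs.length := by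
      simp [slotTerms, List.range'_succ]
    rw [setSlots, ih, e, List.zip_cons_cons, List.cons_append, assocSub, List.lookup_cons]
    by_cases h : ℓ = d
    · subst h; simp
    · rw [Function.update_of_ne h, beq_false_of_ne (fun h' => h (slotTerm_injective h'))]
      rfl

theorem Scope.enter_map (sc : Scope) (us : List Term) (d : ℕ) :
    (sc.enter us d).map (fun p => (p.1, slotTerm p.2)) =
      us.zip (slotTerms d us.length) ++ sc.map fun p => (p.1, slotTerm p.2) := by
  induction us generalizing d with
  | nil => rfl
  | cons u us ih => simp [Scope.enter, ih, slotTerms, List.range'_succ]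

theorem Scope.length_enter (sc : Scope) (us : List Term) (d : ℕ) :
    (sc.enter us d).length = us.length + sc.length := by
  induction us generalizing d with
  | nil => simp [Scope.enter]
  | cons u us ih => simp [Scope.enter, ih]; omega

theorem RecScope.length_slots {κ : RecScope} {K : ℕ} (h : ∀ p ∈ κ, p.2.length ≤ K) (X : ℕ) :
    (κ.slots X).length ≤ K := by
  unfold RecScope.slots
  cases hX : κ.lookup X with
  | none => simp
  | some l => exact h _ (mem_of_lookup hX)

theorem RecScope.slots_le {κ : RecScope} {K : ℕ} (h : ∀ p ∈ κ, ∀ ℓ ∈ p.2, ℓ ≤ K) (X : ℕ) :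
    ∀ ℓ ∈ κ.slots X, ℓ ≤ K := by
  unfold RecScope.slots
  cases hX : κ.lookup X with
  | none => simp
  | some l => exact h _ (mem_of_lookup hX)

theorem Scope.slot_le {sc : Scope} {K : ℕ} (h : ∀ p ∈ sc, p.2 ≤ K) (u : Term) : sc.slot u ≤ K := by
  rcases sc.slot_mem_or u with h' | h'
  · exact h _ h'
  · omega

theorem List.Nodup.length_le_of_le {l : List ℕ} (h : l.Nodup) {K : ℕ} (hl : ∀ x ∈ l, x ≤ K) :
    l.length ≤ K + 1 := by
  have : l.toFinset ⊆ Finset.range (K + 1) := fun x hx =>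
    Finset.mem_range.2 (Nat.lt_succ_of_le (hl x (List.mem_toFinset.1 hx)))
  rw [← List.toFinset_card_of_nodup h]
  simpa using Finset.card_le_card this

/-- Bounds for the size of a scope. -/
structure Bounded (K G : ℕ) (sc : Scope) (κ : RecScope) (d : ℕ) (t : FTree) : Prop where
  slot : ∀ p ∈ sc, p.2 ≤ K
  scope : sc.length + t.depth ≤ K
  next : d + t.depth ≤ K + 1
  recs : κ.length + t.weight ≤ G
  slots_length : ∀ p ∈ κ, p.2.length ≤ K + 1
  slots : ∀ p ∈ κ, ∀ ℓ ∈ p.2, ℓ ≤ K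
  tagged : t.Tagged

namespace Bounded

variable {K G : ℕ} {sc : Scope} {κ : RecScope} {d c m : ℕ} {xs : List ℕ} {us : List Term}
  {l r t : FTree}

theorem hid_le (h : Bounded K G sc κ d t) (X : ℕ) (xs : List ℕ) (l : FTree) :
    ∀ ℓ ∈ hid sc κ X xs l, ℓ ≤ K := by
  intro ℓ hl
  rcases slot_mem_coll hl with ⟨u, rfl⟩ | ⟨Y, hY⟩
  · exact Scope.slot_le h.slot u
  · exact RecScope.slots_le h.slots Y ℓ hY

theorem length_hid (h : Bounded K G sc κ d t) (X : ℕ) (xs : List ℕ) (l : FTree) :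
    (hid sc κ X xs l).length ≤ K + 1 :=
  List.Nodup.length_le_of_le (List.nodup_dedup _) (h.hid_le X xs l)

theorem child (h : Bounded K G sc κ d (.node c m xs us l r)) {t : FTree} (ht : t = l ∨ t = r) :
    Bounded K G (sc.enter (vars xs) d) (if 10 ≤ c then (m, hid sc κ m xs l) :: κ else κ)
      (d + xs.length) t := by
  have h1 := h.scope
  have h2 := h.next
  have h3 := h.recs
  have h4 := h.tagged
  rw [FTree.depth] at h1 h2
  rw [FTree.weight] at h3
  have hd : t.depth ≤ max l.depth r.depth := by rcases ht with rfl | rfl <;> simp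
  have hw : t.weight ≤ l.weight + r.weight := by rcases ht with rfl | rfl <;> simp
  refine ⟨?_, ?_, ?_, ?_, ?_, ?_, ?_⟩
  · intro p hp
    rcases Scope.mem_enter hp with hp | ⟨-, -, hp⟩
    · exact h.slot p hp
    · rw [length_vars] at hp; omega
  · rw [Scope.length_enter, length_vars]; omega
  · omega
  · split_ifs <;> first | omega | (rw [List.length_cons]; omega)
  · intro p hp
    split_ifs at hp
    · rcases List.mem_cons.1 hp with rfl | hp
      · exact h.length_hid _ _ _
      · exact h.slots_length p hp
    · exact h.slots_length p hp
  · intro p hp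
    split_ifs at hp
    · rcases List.mem_cons.1 hp with rfl | hp
      · exact h.hid_le _ _ _
      · exact h.slots p hp
    · exact h.slots p hp
  · rcases ht with rfl | rfl
    · exact h4.2.1
    · exact h4.2.2

end Bounded

theorem length_coll_le {K : ℕ} {sc : Scope} {κ : RecScope} (hκ : ∀ p ∈ κ, p.2.length ≤ K + 1)
    (bl rl : List ℕ) (t : FTree) : (coll sc κ bl rl t).length ≤ t.weight * (K + 1) := by
  induction t generalizing bl rl with
  | nil => simp [coll]
  | node c m xs us l r ihl ihr =>
    have h1 : (us.flatMap (slotsOf sc bl)).length ≤ us.length := by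
      rw [← filter_map_slot, List.length_map]; exact List.length_filter_le _ _
    have h2 : (if c = 9 ∧ m ∉ rl then κ.slots m else []).length ≤ K + 1 := by
      split_ifs
      · exact RecScope.length_slots hκ m
      · simp
    have h3 := ihl (xs ++ bl) (if 10 ≤ c then m :: rl else rl)
    have h4 := ihr (xs ++ bl) (if 10 ≤ c then m :: rl else rl)
    simp only [coll, List.length_append, FTree.weight]
    nlinarith

section

variable {O : Oracle}

theorem comp_mapSlot (sc : Scope) (us : List Term) :
    Comp orbitProgram O 28 (.pair (codeScope sc) (codeList us)) (codeSlots (us.map sc.slot))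
      (200 * (us.length + 1) * (sc.length + 1)) := by
  induction us with
  | nil =>
    refine Comp.of_run ⟨rfl, ?_⟩
    nlinarith [sc.length.zero_le]
  | cons u us ih =>
    have h := comp_lookup_pairs (O := O) u (slotTerm 0) (sc.map fun p => (p.1, slotTerm p.2))
    rw [lookup_map_snd, List.length_map] at h
    have e : ((sc.lookup u).map slotTerm).getD (slotTerm 0) = slotTerm (sc.slot u) := by
      unfold Scope.slot; cases sc.lookup u <;> rfl
    rw [e] at h
    refine Comp.of_run (h.calls (ih.calls ⟨rfl, ?_⟩))
    rw [List.length_cons]; nlinarith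

theorem comp_slots_lookup (κ : RecScope) (X : ℕ) :
    Comp orbitProgram O 3 (.pair (.atom X) (.pair (.atom 0) (codeRecScope κ)))
      (codeSlots (κ.slots X)) (150 * (κ.length + 1)) := by
  have h := comp_lookup (O := O) X (.atom 0) (κ.map fun p => (p.1, codeSlots p.2))
  rw [lookup_map_snd, List.length_map] at h
  unfold RecScope.slots
  cases hX : κ.lookup X <;> rw [hX] at h <;> exact h

theorem comp_append_slots (l h : List ℕ) :
    Comp orbitProgram O 4 (.pair (codeSlots l) (codeSlots h)) (codeSlots (l ++ h))
      (20 * (l.length + 1)) := by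
  have := comp_append_code (O := O) (l.map slotTerm) (h.map slotTerm)
  rwa [← List.map_append, List.length_map] at this

theorem comp_append_vars (xs bl : List ℕ) :
    Comp orbitProgram O 4 (.pair (codeList (vars xs)) (codeList (vars bl)))
      (codeList (vars (xs ++ bl))) (20 * (xs.length + 1)) := by
  have := comp_append_code (O := O) (vars xs) (vars bl)
  rw [length_vars] at this
  simpa [vars] using this

theorem comp_filter_slot (sc : Scope) (bl : List ℕ) (us : List Term) :
    ∃ vs : List Term, vs.length ≤ us.length ∧
      Comp orbitProgram O 12 (.pair (.atom 0) (.pair (codeList (vars bl)) (codeList us)))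
        (codeList vs) (200 * (us.length + 1) * (bl.length + 1)) ∧
      Comp orbitProgram O 28 (.pair (codeScope sc) (codeList vs))
        (codeSlots (us.flatMap (slotsOf sc bl))) (200 * (us.length + 1) * (sc.length + 1)) := by
  have h := comp_filter (O := O) false (vars bl) us
  rw [length_vars] at h
  have hl := List.length_filter_le (fun u => decide (u ∈ vars bl) == false) us
  refine ⟨_, hl, h, ?_⟩
  rw [← filter_map_slot]
  exact (comp_mapSlot sc _).mono (Nat.mul_le_mul_right _ (by omega))

/-- The list collected so far is handed on, so a node pays only for prepending its own slots and for
look-ups in lists of length at most `G` or `K`. -/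
theorem comp_coll {K G : ℕ} {sc : Scope} {κ : RecScope} (hsc : sc.length ≤ K) (hκ : κ.length ≤ G)
    (hκK : ∀ p ∈ κ, p.2.length ≤ K + 1) (t : FTree) (ht : t.Tagged) (bl rl acc : List ℕ)
    (hbl : bl.length + t.depth ≤ K) (hrl : rl.length + t.weight ≤ G) :
    Comp orbitProgram O 29 (.pair (codeList (vars bl)) (.pair (codeList rl) (.pair (codeScope sc)
        (.pair (codeRecScope κ) (.pair t.code (codeSlots acc))))))
      (codeSlots (coll sc κ bl rl t ++ acc)) (2000 * t.weight * (G + K + 1) + 30) := by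
  induction t generalizing bl rl acc with
  | nil => exact Comp.of_run ⟨rfl, by omega⟩
  | node c m xs us l r ihl ihr =>
    obtain ⟨hc, hl, hr⟩ := ht
    simp only [FTree.depth, FTree.weight] at hbl hrl
    set rl' := if 10 ≤ c then m :: rl else rl with hrl'
    have hlen : rl'.length ≤ rl.length + 1 := by
      rw [hrl']; split_ifs <;> simp
    have hL := fun acc => ihl hl (xs ++ bl) rl' acc (by simp only [List.length_append]; omega)
      (by omega)
    have hR := fun acc => ihr hr (xs ++ bl) rl' acc (by simp only [List.length_append]; omega)
      (by omega)
    obtain ⟨vs, hvs, hf1, hf2⟩ := comp_filter_slot (O := O) sc bl us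
    have hslots := RecScope.length_slots hκK m
    have h1 : (us.flatMap (slotsOf sc bl)).length ≤ us.length := by
      rw [← filter_map_slot, List.length_map]; exact List.length_filter_le _ _
    have a1 : (us.length + 1) * (bl.length + 1) ≤ (us.length + 1) * (G + K + 1) :=
      Nat.mul_le_mul_left _ (by omega)
    have a2 : (us.length + 1) * (sc.length + 1) ≤ (us.length + 1) * (G + K + 1) :=
      Nat.mul_le_mul_left _ (by omega)
    have a3 : xs.length + 1 ≤ (xs.length + 1) * (G + K + 1) := Nat.le_mul_of_pos_right _ (by omega)
    have a4 : us.length + 1 ≤ (us.length + 1) * (G + K + 1) := Nat.le_mul_of_pos_right _ (by omega)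
    have hcost : ∀ k, k ≤ 200 → k + 150 * (rl.length + 1) + 150 * (κ.length + 1) +
        50 * (xs.length + 1) + 20 * (xs.length + 1) + 200 * (us.length + 1) * (bl.length + 1) +
        200 * (us.length + 1) * (sc.length + 1) + 20 * ((us.flatMap (slotsOf sc bl)).length + 1) +
        20 * ((κ.slots m).length + 1) + (2000 * l.weight * (G + K + 1) + 30) +
        (2000 * r.weight * (G + K + 1) + 30) ≤
        2000 * (1 + xs.length + us.length + (l.weight + r.weight)) * (G + K + 1) + 30 := by
      intro k hk
      nlinarith
    have hnil : codeSlots [] = .atom 0 := rfl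
    have hm9 := comp_slots_lookup (O := O) κ m
    have hv := comp_vars (O := O) xs
    have hav := comp_append_vars (O := O) xs bl
    have hap := comp_append_slots (O := O) (us.flatMap (slotsOf sc bl))
    have hcoll : coll sc κ bl rl (.node c m xs us l r) ++ acc = us.flatMap (slotsOf sc bl) ++
        ((if c = 9 ∧ m ∉ rl then κ.slots m else []) ++ (coll sc κ (xs ++ bl) rl' l ++
          (coll sc κ (xs ++ bl) rl' r ++ acc))) := by simp [coll, hrl']
    rw [hcoll]
    -- The program branches on the code, so evaluation needs its concrete value; the cost estimate
    -- is the same in all cases.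
    rcases (by omega : c = 9 ∨ c = 10 ∨ c = 11 ∨ c < 9) with rfl | rfl | rfl | hc9
    · by_cases hm : m ∈ rl
      · have hmem := comp_mem (O := O) m rl
        rw [Val.bit_pos hm] at hmem
        rw [if_neg (by simp [hm])]
        refine Comp.of_run (hv.calls (hav.calls (hf1.calls (hf2.calls (hmem.calls ((hR acc).calls
          ((hL _).calls ((comp_append_slots [] _).calls ((hap _).calls ⟨rfl, ?_⟩)))))))))
        refine le_trans ?_ (hcost 200 le_rfl)
        simp only [List.length_nil]; omega
      · have hmem := comp_mem (O := O) m rl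
        rw [Val.bit_neg hm] at hmem
        rw [if_pos (by simp [hm])]
        refine Comp.of_run (hv.calls (hav.calls (hf1.calls (hf2.calls (hmem.calls (hm9.calls
          ((hR acc).calls ((hL _).calls ((comp_append_slots _ _).calls ((hap _).calls
          ⟨rfl, ?_⟩))))))))))
        refine le_trans ?_ (hcost 200 le_rfl)
        omega
    · refine Comp.of_run (hv.calls (hav.calls (hf1.calls (hf2.calls ((hR acc).calls
          ((hL _).calls ((comp_append_slots [] _).calls ((hap _).calls ⟨rfl, ?_⟩))))))))
      refine le_trans ?_ (hcost 200 le_rfl)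
      simp only [List.length_nil]; omega
    · refine Comp.of_run (hv.calls (hav.calls (hf1.calls (hf2.calls ((hR acc).calls
          ((hL _).calls ((comp_append_slots [] _).calls ((hap _).calls ⟨rfl, ?_⟩))))))))
      refine le_trans ?_ (hcost 200 le_rfl)
      simp only [List.length_nil]; omega
    · rw [if_neg (by omega)] at hrl'
      clear_value rl'
      subst hrl'
      interval_cases c
      all_goals
        refine Comp.of_run (hv.calls (hav.calls (hf1.calls (hf2.calls ((hR acc).calls
          ((hL _).calls ((comp_append_slots [] _).calls ((hap _).calls ⟨rfl, ?_⟩))))))))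
        refine le_trans ?_ (hcost 200 le_rfl)
        simp only [List.length_nil]; omega

/-- The collected list may have `(K + 1)` times as many entries as the tree has weight, but at most
`K + 1` of them differ. Removing duplicates therefore adds a factor `K + 1` and no second factor of
weight. -/
theorem comp_hid {K G : ℕ} {sc : Scope} {κ : RecScope} {d c m : ℕ} {xs : List ℕ} {us : List Term}
    {l r : FTree} (h : Bounded K G sc κ d (.node c m xs us l r)) :
    Comp orbitProgram O 33 (.pair (codeScope sc) (.pair (codeRecScope κ)
      (FTree.code (.node c m xs us l r)))) (codeSlots (hid sc κ m xs l))
      (4000 * (FTree.node c m xs us l r).weight * ((G + K + 1) * (K + 1)) + 100) := by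
  have h1 := h.scope
  have h2 := h.recs
  have h3 := h.length_hid m xs l
  have h4 := h.tagged
  have h5 := length_coll_le (sc := sc) h.slots_length xs [m] l
  simp only [FTree.depth, FTree.weight] at h1 h2 ⊢
  have hc := comp_coll (O := O) (K := K) (G := G) (sc := sc) (κ := κ) (by omega) (by omega)
    h.slots_length l h4.2.1 xs [m] [] (by omega) (by simp only [List.length_singleton]; omega)
  rw [List.append_nil] at hc
  have hd := comp_dedup (O := O) ((coll sc κ xs [m] l).map slotTerm)
  rw [List.dedup_map_of_injective slotTerm_injective, List.length_map, List.length_map] at hd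
  refine Comp.of_run ((comp_vars xs).calls (hc.calls (hd.calls ⟨rfl, ?_⟩)))
  rw [hid] at h3
  have e1 : 200 * ((coll sc κ xs [m] l).length + 1) * ((coll sc κ xs [m] l).dedup.length + 1) ≤
      200 * (l.weight * (K + 1) + 1) * (2 * (K + 1)) := by
    gcongr <;> omega
  have e2 : l.weight * (K + 1) * (K + 1) ≤ l.weight * ((G + K + 1) * (K + 1)) := by
    rw [mul_assoc]; gcongr; omega
  have e3 : l.weight * (G + K + 1) ≤ l.weight * ((G + K + 1) * (K + 1)) :=
    Nat.mul_le_mul_left _ (Nat.le_mul_of_pos_right _ (by omega))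
  have e4 : K + 1 ≤ (G + K + 1) * (K + 1) := Nat.le_mul_of_pos_left _ (by omega)
  have e5 : xs.length ≤ xs.length * ((G + K + 1) * (K + 1)) :=
    Nat.le_mul_of_pos_right _ (by positivity)
  nlinarith

end

/-- The values of slots given by an association list. -/
def slotVal (bnd : List (Term × Term)) (ℓ : ℕ) : Term := assocSub bnd (slotTerm ℓ)

/-- The row of the table of definitions that a fixpoint node makes. -/
def Ctx.row (C : Ctx) : Option (ℕ × Val) :=
  match C.t with
  | .nil => none
  | .node c m xs _ l _ =>
    if 10 ≤ c then some (m, .pair (codeSlots (List.range' C.d xs.length ++ hid C.sc C.κ m xs l))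
      (.pair ((C.child c m xs l l).lift slotTerm).code
        (.atom (2 * C.t.height + if c = 10 then 1 else 0))))
    else none

section

variable {O : Oracle} {K G : ℕ} {sc : Scope} {κ : RecScope} {d : ℕ}

theorem comp_mapSub_slots (bnd : List (Term × Term)) (l : List ℕ) :
    Comp orbitProgram O 10 (.pair (codePairs bnd) (codeSlots l)) (codeList (l.map (slotVal bnd)))
      (200 * (l.length + 1) * (bnd.length + 1)) := by
  have := comp_mapSub (O := O) bnd (l.map slotTerm)
  rwa [List.map_map, List.length_map] at this

theorem comp_slots_vars (d : ℕ) (xs : List ℕ) :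
    Comp orbitProgram O 31 (.pair (enc (slotTerm d)) (codeList (vars xs)))
      (codeList (slotTerms d xs.length)) (50 * (xs.length + 1)) := by
  have := comp_slots (O := O) d ((vars xs).map enc)
  simp only [List.length_map, length_vars] at this
  exact this

theorem comp_advance_vars (d : ℕ) (xs : List ℕ) :
    Comp orbitProgram O 32 (.pair (enc (slotTerm d)) (codeList (vars xs)))
      (enc (slotTerm (d + xs.length))) (50 * (xs.length + 1)) := by
  have := comp_advance (O := O) d ((vars xs).map enc)
  simp only [List.length_map, length_vars] at this
  exact this

theorem comp_advance_slots (d : ℕ) (l : List Term) :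
    Comp orbitProgram O 32 (.pair (enc (slotTerm d)) (codeList l))
      (enc (slotTerm (d + l.length))) (50 * (l.length + 1)) := by
  have := comp_advance (O := O) d (l.map enc)
  rwa [List.length_map] at this

theorem comp_enter (sc : Scope) (xs : List ℕ) (d : ℕ) :
    Comp orbitProgram O 6 (.pair (codeList (vars xs)) (.pair (codeList (slotTerms d xs.length))
      (codeScope sc))) (codeScope (sc.enter (vars xs) d)) (50 * (xs.length + 1)) := by
  have := comp_zip_pairs (O := O) (vars xs) (slotTerms d xs.length)
    (sc.map fun p => (p.1, slotTerm p.2))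
  have e := Scope.enter_map sc (vars xs) d
  rw [length_vars] at e this
  rw [← e] at this
  exact this

set_option maxHeartbeats 1000000 in
-- A fixpoint node becomes a call and is not entered any further. The cost of finding its hidden
-- slots is proportional to its whole weight, but it does not accumulate along a branch.
theorem comp_lift (t : FTree) (h : Bounded K G sc κ d t) (bnd : List (Term × Term))
    (hb : bnd.length + t.depth ≤ K) :
    Comp orbitProgram O 30 (.pair (codeScope sc) (.pair (codePairs bnd) (.pair (codeRecScope κ)
        (.pair (enc (slotTerm d)) t.code)))) (FTree.lift sc (slotVal bnd) κ d t).code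
      (10000 * t.weight * ((G + K + 1) * (K + 1)) + 50) := by
  induction t generalizing sc d bnd with
  | nil => exact Comp.of_run ⟨rfl, by omega⟩
  | node c m xs us l r ihl ihr =>
    have hsc := h.scope
    have hκ := h.recs
    have hc := h.tagged.1
    have hch := fun t ht => h.child (t := t) ht
    have hslots := RecScope.length_slots h.slots_length m
    have hh := comp_hid (O := O) h
    have hhl := h.length_hid m xs l
    simp only [FTree.depth] at hsc hb
    rw [FTree.weight] at hκ hh
    have h1 := comp_mapSlot (O := O) sc us
    have h2 := comp_mapSub_slots (O := O) bnd (us.map sc.slot)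
    rw [List.map_map, List.length_map] at h2
    set Q := (G + K + 1) * (K + 1) with hQ
    have q1 : K + 1 ≤ Q := Nat.le_mul_of_pos_left _ (by omega)
    have q2 : G + K + 1 ≤ Q := Nat.le_mul_of_pos_right _ (by omega)
    have q3 : (K + 2) * (K + 1) ≤ 2 * Q := by rw [hQ]; nlinarith
    have q0 : 1 ≤ Q := by omega
    have a1 : (us.length + 1) * (sc.length + 1) ≤ (us.length + 1) * Q :=
      Nat.mul_le_mul_left _ (by omega)
    have a2 : (us.length + 1) * (bnd.length + 1) ≤ (us.length + 1) * Q :=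
      Nat.mul_le_mul_left _ (by omega)
    have a3 : ((κ.slots m).length + 1) * (bnd.length + 1) ≤ (K + 2) * (K + 1) :=
      Nat.mul_le_mul (by omega) (by omega)
    have a4 : ((hid sc κ m xs l).length + 1) * (bnd.length + 1) ≤ (K + 2) * (K + 1) :=
      Nat.mul_le_mul (by omega) (by omega)
    have a5 : xs.length ≤ xs.length * Q := Nat.le_mul_of_pos_right _ (by omega)
    have a6 : us.length ≤ us.length * Q := Nat.le_mul_of_pos_right _ (by omega)
    rcases (by omega : c = 9 ∨ (c = 10 ∨ c = 11) ∨ c < 9) with rfl | hc | hc9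
    · refine Comp.of_run (h1.calls (h2.calls ((comp_slots_lookup κ m).calls
        ((comp_mapSub_slots bnd _).calls ((comp_append_code _ _).calls ⟨rfl, ?_⟩)))))
      simp only [List.length_map, FTree.weight]
      nlinarith
    · rcases hc with rfl | rfl
      all_goals
        refine Comp.of_run (h1.calls (h2.calls (hh.calls
          ((comp_mapSub_slots bnd _).calls ((comp_append_code _ _).calls ⟨rfl, ?_⟩)))))
        simp only [List.length_map, FTree.weight]
        nlinarith
    · have e := setSlots_assocSub bnd d (vars xs)
      rw [length_vars] at e
      have hb' : ((slotTerms d xs.length).zip (vars xs) ++ bnd).length = xs.length + bnd.length := by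
        simp
      simp only [show ¬ 10 ≤ c by omega, if_false] at hch
      have hL := ihl (hch l (Or.inl rfl)) ((slotTerms d xs.length).zip (vars xs) ++ bnd) (by omega)
      have hR := ihr (hch r (Or.inr rfl)) ((slotTerms d xs.length).zip (vars xs) ++ bnd) (by omega)
      have hz := comp_zip_pairs (O := O) (slotTerms d xs.length) (vars xs) bnd
      rw [length_slotTerms] at hz
      have hlift : FTree.lift sc (slotVal bnd) κ d (.node c m xs us l r) =
          .node c m xs (us.map (slotVal bnd ∘ sc.slot))
            (FTree.lift (sc.enter (vars xs) d)
              (slotVal ((slotTerms d xs.length).zip (vars xs) ++ bnd)) κ (d + xs.length) l)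
            (FTree.lift (sc.enter (vars xs) d)
              (slotVal ((slotTerms d xs.length).zip (vars xs) ++ bnd)) κ (d + xs.length) r) := by
        rw [FTree.lift, if_neg (by omega), if_neg (by omega)]
        congr 2
      rw [hlift]
      have hw : 10000 * (FTree.node c m xs us l r).weight * Q + 50 = 10000 * Q + 10000 * (xs.length * Q)
          + 10000 * (us.length * Q) + 10000 * l.weight * Q + 10000 * r.weight * Q + 50 := by
        rw [FTree.weight]; ring
      have a7 : (us.length + 1) * Q = us.length * Q + Q := by ring
      rw [mul_assoc 200] at h1 h2
      rw [hw]
      clear hh hch ihl ihr h hlift e hκ hw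
      interval_cases c
      all_goals
        refine Comp.of_run (h1.calls (h2.calls ((comp_vars xs).calls ((comp_slots_vars d xs).calls
          ((comp_enter sc xs d).calls (hz.calls ((comp_advance_vars d xs).calls
          (hL.calls (hR.calls ⟨rfl, ?_⟩)))))))))
        omega

set_option maxHeartbeats 1000000 in
-- Here fixpoint nodes are entered. Each of them pays for hidden slots, lifting and height in
-- proportion to its own weight, which is at most `G`; this gives the additional factor `G`.
theorem comp_entries (C : Ctx) (h : Bounded K G C.sc C.κ C.d C.t) (acc : List (ℕ × Val)) :
    Comp orbitProgram O 36 (.pair (codeScope C.sc) (.pair (codeRecScope C.κ)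
        (.pair (enc (slotTerm C.d)) (.pair C.t.code (codeAssoc acc)))))
      (codeAssoc (C.all.filterMap Ctx.row ++ acc))
      (20000 * C.t.weight * (G * ((G + K + 1) * (K + 1))) + 50) := by
  induction C using Ctx.induction generalizing acc with
  | nil C hC =>
    rw [C.all_nil hC, hC]
    exact Comp.of_run ⟨rfl, by omega⟩
  | node C c m xs us l r ht ihl ihr =>
    rw [C.all_node ht, List.filterMap_cons]
    rw [ht] at h ⊢
    have hsc := h.scope
    have hκ := h.recs
    have htag := h.tagged
    have hc := htag.1
    have hL := ihl (h.child (t := l) (Or.inl rfl))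
    have hR := ihr (h.child (t := r) (Or.inr rfl)) acc
    have hh := comp_hid (O := O) h
    have hhl := h.length_hid m xs l
    have hheight := comp_height (O := O) _ htag
    have hhw := (FTree.node c m xs us l r).height_le_weight
    have hlift := comp_lift (O := O) l (h.child (t := l) (Or.inl rfl)) [] (by
      simp only [FTree.depth] at hsc; simp only [List.length_nil]; omega)
    set Q := (G + K + 1) * (K + 1) with hQ
    have q2 : G + K + 1 ≤ Q := Nat.le_mul_of_pos_right _ (by omega)
    have hG : 1 ≤ G := by rw [FTree.weight] at hκ; omega
    have q3 : Q ≤ G * Q := Nat.le_mul_of_pos_left _ (by omega)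
    have q4 : G ≤ G * Q := Nat.le_mul_of_pos_right _ (by omega)
    have a1 : (FTree.node c m xs us l r).weight * Q ≤ G * Q := Nat.mul_le_mul_right _ (by omega)
    have a2 : l.weight * Q ≤ G * Q :=
      Nat.mul_le_mul_right _ (by rw [FTree.weight] at hκ; omega)
    have a3 : (FTree.node c m xs us l r).weight * ((FTree.node c m xs us l r).weight + 1) ≤ G * Q :=
      Nat.mul_le_mul (by omega) (by omega)
    have a4 : xs.length ≤ xs.length * (G * Q) := Nat.le_mul_of_pos_right _ (by omega)
    have hw : 20000 * (FTree.node c m xs us l r).weight * (G * Q) + 50 = 20000 * (G * Q) +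
        20000 * (xs.length * (G * Q)) + 20000 * (us.length * (G * Q)) +
        20000 * l.weight * (G * Q) + 20000 * r.weight * (G * Q) + 50 := by
      rw [FTree.weight]; ring
    rw [hw]
    rw [mul_assoc] at hh hheight hlift
    by_cases hc10 : 10 ≤ c
    · have hrow : C.row = some (m, .pair (codeSlots (List.range' C.d xs.length ++
          hid C.sc C.κ m xs l)) (.pair ((C.child c m xs l l).lift slotTerm).code
          (.atom (2 * (FTree.node c m xs us l r).height + if c = 10 then 1 else 0)))) := by
        rw [Ctx.row, ht]; exact if_pos hc10
      rw [hrow]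
      simp only [List.filterMap_append, List.append_assoc, List.cons_append]
      simp only [Ctx.child, hc10, if_true] at hL hR ⊢
      simp only [hc10, if_true] at hlift
      have hslots := comp_append_slots (O := O) (List.range' C.d xs.length) (hid C.sc C.κ m xs l)
      rw [List.length_range'] at hslots
      have hdouble := comp_double (O := O) (FTree.node c m xs us l r).height
      clear ihl ihr
      rcases (by omega : c = 10 ∨ c = 11) with rfl | rfl
      all_goals
        refine Comp.of_run ((comp_vars xs).calls ((comp_slots_vars C.d xs).calls
          (hh.calls ((comp_enter C.sc xs C.d).calls ((comp_advance_vars C.d xs).calls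
          (hR.calls ((hL _).calls (hslots.calls (hlift.calls (hheight.calls
          ((hdouble _).calls ⟨rfl, ?_⟩)))))))))))
        omega
    · have hrow : C.row = none := by
        rw [Ctx.row, ht]; exact if_neg hc10
      rw [hrow]
      simp only [List.filterMap_append, List.append_assoc]
      simp only [Ctx.child, hc10, if_false] at hL hR ⊢
      clear hh hheight hlift ihl ihr
      interval_cases c
      all_goals
        refine Comp.of_run ((comp_vars xs).calls ((comp_slots_vars C.d xs).calls
          ((comp_enter C.sc xs C.d).calls ((comp_advance_vars C.d xs).calls
          (hR.calls ((hL _).calls ⟨rfl, ?_⟩))))))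
        omega

end

/-! ## The table of definitions, and the size of lifted trees -/

namespace FTree

/-- The number of nested fixpoints in the fixpoint that binds `X`. -/
def binderHeight (X : ℕ) : FTree → ℕ
  | nil => 0
  | node c m _ _ l r => if 10 ≤ c ∧ m = X then max l.height r.height + 1
      else max (l.binderHeight X) (r.binderHeight X)

theorem binderHeight_of_notMem {X : ℕ} {t : FTree} (h : X ∉ t.binders) : t.binderHeight X = 0 := by
  induction t with
  | nil => rfl
  | node c m xs us l r ihl ihr =>
    simp only [binders, List.mem_append, not_or] at h
    rw [binderHeight, if_neg, ihl h.2.1, ihr h.2.2, max_self]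
    rintro ⟨hc, rfl⟩
    simp [hc] at h

/-- Since `X` is bound only once, the other branches contribute 0 to the maximum. -/
theorem binderHeight_of_mem_all {C C' : Ctx} (hnd : C.t.binders.Nodup) (hC : C' ∈ C.all) {c X : ℕ}
    {xs : List ℕ} {us : List Term} {l r : FTree} (ht : C'.t = .node c X xs us l r) (hc : 10 ≤ c) :
    C.t.binderHeight X = C'.t.height := by
  induction C using Ctx.induction with
  | nil C h => rw [C.all_nil h] at hC; simp at hC
  | node C c₀ m xs₀ us₀ l₀ r₀ h ihl ihr =>
    have hmem : ∀ t : FTree, C' ∈ (C.child c₀ m xs₀ l₀ t).all → X ∈ t.binders := by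
      intro t h'
      have := Ctx.keys_entries (C.child c₀ m xs₀ l₀ t)
      change _ = t.binders at this
      rw [← this]
      exact List.mem_map.2 ⟨_, List.mem_filterMap.2 ⟨_, h', C'.entry_of_node ht hc⟩, rfl⟩
    rw [h] at hnd ⊢
    rw [C.all_node h, List.mem_cons, List.mem_append] at hC
    rw [binders, List.nodup_append, List.nodup_append] at hnd
    obtain ⟨-, ⟨hl, hr, hlr⟩, hm⟩ := hnd
    have hne : ∀ Y ∈ l₀.binders ++ r₀.binders, ¬ (10 ≤ c₀ ∧ m = Y) := by
      rintro Y hY ⟨h1, rfl⟩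
      exact hm m (by simp [h1]) m hY rfl
    rcases hC with rfl | hC | hC
    · rw [h] at ht ⊢
      simp only [node.injEq] at ht
      obtain ⟨rfl, rfl, -⟩ := ht
      rw [binderHeight, if_pos ⟨hc, rfl⟩, height, if_pos hc]
    · have hX := hmem _ hC
      rw [binderHeight, if_neg (hne X (by simp [hX])),
        binderHeight_of_notMem (t := r₀) (fun h' => hlr X hX X h' rfl), Nat.max_zero]
      exact ihl hl hC
    · have hX := hmem _ hC
      rw [binderHeight, if_neg (hne X (by simp [hX])),
        binderHeight_of_notMem (t := l₀) (fun h' => hlr X h' X hX rfl), Nat.zero_max]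
      exact ihr hr hC

theorem depth_lift_le (sc : Scope) (τ : ℕ → Term) (κ : RecScope) (d : ℕ) (t : FTree) :
    (lift sc τ κ d t).depth ≤ t.depth := by
  induction t generalizing sc τ d with
  | nil => exact le_rfl
  | node c m xs us l r ihl ihr =>
    rw [lift]
    split_ifs
    · simp [depth]
    · simp [depth]
    · have h1 := ihl (sc.enter (vars xs) d) (setSlots τ d (vars xs)) (d + xs.length)
      have h2 := ihr (sc.enter (vars xs) d) (setSlots τ d (vars xs)) (d + xs.length)
      simp only [depth]; omega

/-- Only calls and fixpoints grow, each by at most `K + 1` hidden arguments. This keeps positions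
small, in contrast to repeated unfolding. -/
theorem weight_lift_le {K G : ℕ} {sc : Scope} {κ : RecScope} {d : ℕ} {t : FTree}
    (h : Bounded K G sc κ d t) (τ : ℕ → Term) :
    (lift sc τ κ d t).weight ≤ t.weight * (K + 2) := by
  induction t generalizing sc τ d with
  | nil => simp [lift, weight]
  | node c m xs us l r ihl ihr =>
    have h1 := RecScope.length_slots h.slots_length m
    have h2 := h.length_hid m xs l
    have hch := fun t ht => h.child (t := t) ht
    rw [lift]
    split_ifs with h9 hc
    · simp only [weight, List.length_append, List.length_map, List.length_nil]; nlinarith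
    · simp only [weight, List.length_append, List.length_map, List.length_nil]; nlinarith
    · simp only [hc, if_false] at hch
      have hL := ihl (hch l (Or.inl rfl)) (setSlots τ d (vars xs))
      have hR := ihr (hch r (Or.inr rfl)) (setSlots τ d (vars xs))
      simp only [weight, List.length_map]; nlinarith

end FTree

theorem Formula.binderHeight_tree (φ : Formula) (X : ℕ) :
    φ.tree.binderHeight X = φ.binderHeight X := by
  induction φ with
  | fix σ Y xs φ us ih =>
    simp [Formula.tree, FTree.binderHeight, Formula.binderHeight, ih, σ.ten_le_code,
      Formula.height_tree, FTree.height, add_comm]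
  | _ => simp_all [Formula.tree, FTree.binderHeight, Formula.binderHeight]

/-- The table of definitions of a formula. -/
def Formula.rows (φ : Formula) : List (ℕ × Val) := (rootCtx φ).all.filterMap Ctx.row

section

variable {φ₀ : Formula} (hφ : φ₀.Closed)
include hφ

theorem rows_lookup {σ : FixKind} {X : ℕ} {D : Def} (hD : φ₀.defs X = some D) (hc : D.c = σ.code)
    (xs : List ℕ) (φ : Formula) (us : List Term) :
    φ₀.rows.lookup X = some (.pair (codeSlots (List.range' D.d D.xs.length ++ D.h))
      (.pair D.T.code (.atom (φ₀.rank (.fix σ X xs φ us))))) := by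
  obtain ⟨C, hC, us', l, ht, h10, hh, -, hd, hT, -⟩ := exists_ctx_of_defs hφ hD
  -- The rows have the same keys as the definitions, so each recursion variable has one row.
  have hkeys : φ₀.rows.map Prod.fst = φ₀.recBinders := by
    rw [← Formula.binders_tree]
    change _ = (rootCtx φ₀).t.binders
    rw [← Ctx.keys_entries, Formula.rows, List.map_filterMap, List.map_filterMap]
    congr 1
    funext C
    rw [Ctx.row, Ctx.entry]
    cases C.t with
    | nil => rfl
    | node c m xs us l r =>
      dsimp only
      split_ifs <;> rfl
  refine lookup_of_mem_of_nodup (by rw [hkeys]; exact hφ.2) (List.mem_filterMap.2 ⟨C, hC, ?_⟩)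
  have hheight : φ₀.binderHeight X = C.t.height := by
    rw [← Formula.binderHeight_tree]
    exact binderHeight_of_mem_all (C := rootCtx φ₀)
      (by rw [rootCtx, Formula.binders_tree]; exact hφ.2) hC ht h10
  have hrank : φ₀.rank (.fix σ X xs φ us) = 2 * C.t.height + if D.c = 10 then 1 else 0 := by
    rw [hc, ← hheight]
    cases σ <;> simp [Formula.rank, FixKind.code]
  rw [hrank, hh, hd, hT]
  have : C.row = some (X, .pair (codeSlots (List.range' C.d D.xs.length ++ hid C.sc C.κ X D.xs l))
      (.pair ((C.child D.c X D.xs l l).lift slotTerm).code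
        (.atom (2 * C.t.height + if D.c = 10 then 1 else 0)))) := by
    rw [Ctx.row, ht]; exact if_pos h10
  exact this

theorem bounded_root : Bounded (φ₀.supp.card + φ₀.depth) (2 * φ₀.size) (rootCtx φ₀).sc []
    (1 + φ₀.supp.card) φ₀.tree := by
  have hl := φ₀.length_consts
  refine ⟨?_, ?_, ?_, ?_, by simp, by simp, φ₀.tagged_tree⟩
  · intro p hp
    rcases Scope.mem_enter hp with hp | ⟨-, -, hp⟩
    · simp at hp
    · rw [List.length_map] at hp; omega
  · rw [rootCtx, Scope.length_enter, φ₀.depth_tree]; simp [hl]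
  · rw [φ₀.depth_tree]; omega
  · simpa using Formula.weight_tree hφ.1

theorem bounded_of_mem {C : Ctx} (hC : C ∈ (rootCtx φ₀).all) :
    Bounded (φ₀.supp.card + φ₀.depth) (2 * φ₀.size) C.sc C.κ C.d C.t := by
  have key : ∀ C : Ctx, Bounded (φ₀.supp.card + φ₀.depth) (2 * φ₀.size) C.sc C.κ C.d C.t →
      ∀ C' ∈ C.all, Bounded (φ₀.supp.card + φ₀.depth) (2 * φ₀.size) C'.sc C'.κ C'.d C'.t := by
    intro C
    induction C using Ctx.induction with
    | nil C h => rw [C.all_nil h]; simp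
    | node C c m xs us l r h ihl ihr =>
      intro hb C' hC'
      rw [C.all_node h, List.mem_cons, List.mem_append] at hC'
      rcases hC' with rfl | hC' | hC'
      · exact hb
      · rw [h] at hb; exact ihl (hb.child (Or.inl rfl)) C' hC'
      · rw [h] at hb; exact ihr (hb.child (Or.inr rfl)) C' hC'
  refine key _ ?_ C hC
  have := bounded_root hφ
  rw [← φ₀.length_consts] at this ⊢
  exact this

/-- The maximal size of lifted trees. -/
theorem weight_lift_of_mem {C : Ctx} (hC : C ∈ (rootCtx φ₀).all) (τ : ℕ → Term) :
    (C.lift τ).weight ≤ 2 * φ₀.size * (φ₀.supp.card + φ₀.depth + 2) := by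
  have h := bounded_of_mem hφ hC
  refine (weight_lift_le h τ).trans (Nat.mul_le_mul_right _ ?_)
  have := h.recs
  omega

theorem Represents.weight_le {T : FTree} {F : Formula} (h : Represents φ₀ T F) :
    T.weight ≤ 2 * φ₀.size * (φ₀.supp.card + φ₀.depth + 2) := by
  obtain ⟨C, τ, h, rfl⟩ := h
  exact weight_lift_of_mem hφ h.mem τ

theorem Represents.depth_le {T : FTree} {F : Formula} (h : Represents φ₀ T F) :
    T.depth ≤ φ₀.supp.card + φ₀.depth := by
  obtain ⟨C, τ, h, rfl⟩ := h
  have := (bounded_of_mem hφ h.mem).scope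
  exact (depth_lift_le _ _ _ _ _).trans (by omega)

theorem weight_def_le {X : ℕ} {D : Def} (hD : φ₀.defs X = some D) :
    D.T.weight ≤ 2 * φ₀.size * (φ₀.supp.card + φ₀.depth + 2) ∧
      D.T.depth ≤ φ₀.supp.card + φ₀.depth ∧ D.xs.length + D.h.length ≤
        2 * (φ₀.supp.card + φ₀.depth) + 1 ∧ φ₀.rows.length ≤ φ₀.size := by
  obtain ⟨C, hC, us, l, ht, h10, hh, -, hd, hT, -⟩ := exists_ctx_of_defs hφ hD
  have hb := bounded_of_mem hφ hC
  have h1 := hb.length_hid X D.xs l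
  rw [← hh] at h1
  rw [ht] at hb
  have hch := hb.child (t := l) (Or.inl rfl)
  have hs := hb.scope
  have hr := hb.recs
  simp only [FTree.depth, FTree.weight] at hs hr
  rw [hT]
  refine ⟨(weight_lift_le hch _).trans (Nat.mul_le_mul_right _ (by omega)),
    (depth_lift_le _ _ _ _ _).trans (by change l.depth ≤ _; omega), by omega, ?_⟩
  refine (List.length_filterMap_le _ _).trans ?_
  rw [Ctx.length_all]
  exact φ₀.nodes_tree_le

end

/-! ## Programs on positions -/

section

variable {S : Type u} [Nominal S]

def CPos.code (code : S ↪ ℕ) (p : CPos S) : Val :=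
  .pair (.atom (code p.s)) (.pair (codeList p.hs) p.T.code)

def codePositions (code : S ↪ ℕ) (ps : List (CPos S)) : Val := .ofList (ps.map (CPos.code code))

/-- Bounds for the size of a position. -/
structure CPos.Small (K W N : ℕ) (p : CPos S) : Prop where
  names : p.T.names.dedup.length ≤ K
  weight : p.T.weight ≤ W
  depth : p.T.depth ≤ K
  hist : p.hs.length ≤ N + 1

theorem FTree.length_names_le (t : FTree) : t.names.length ≤ t.weight := by
  induction t with
  | nil => simp [FTree.names]
  | node c m xs us l r ihl ihr =>
    have : (us.flatMap Term.nameList).length ≤ us.length := by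
      clear ihl ihr
      induction us with
      | nil => simp
      | cons u us ih =>
        rw [List.flatMap_cons, List.length_append, List.length_cons]
        have : u.nameList.length ≤ 1 := by cases u <;> simp [Term.nameList]
        omega
    simp only [FTree.names, FTree.weight, List.length_append]; omega

theorem FTree.weight_tmap (f : Term → Term) (t : FTree) : (t.tmap f).weight = t.weight := by
  induction t with
  | nil => rfl
  | node c m xs us l r ihl ihr => simp [FTree.tmap, FTree.weight, ihl, ihr]

theorem Val.bit_eq_bit {p q : Prop} [Decidable p] [Decidable q] :
    Val.bit p = Val.bit q ↔ decide p = decide q := by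
  by_cases hp : p <;> by_cases hq : q <;> simp [Val.bit, hp, hq]

theorem Val.ofList_bits {α : Type} [DecidableEq α] {l l' h h' : List α} :
    Val.ofList (l.map fun a => .bit (a ∈ h)) = Val.ofList (l'.map fun a => .bit (a ∈ h')) ↔
      l.map (fun a => decide (a ∈ h)) = l'.map (fun a => decide (a ∈ h')) := by
  rw [Val.ofList_injective.eq_iff]
  induction l generalizing l' with
  | nil => cases l' <;> simp
  | cons a l ih =>
    cases l' with
    | nil => simp
    | cons b l' => simp only [List.map_cons, List.cons.injEq, ih, Val.bit_eq_bit]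

theorem Val.size_bits (l : List Prop) : (Val.ofList (l.map .bit)).size ≤ 2 * l.length + 1 := by
  induction l with
  | nil => simp [Val.size]
  | cons a l ih => simp only [List.map_cons, Val.ofList, Val.size, Val.bit, List.length_cons]; omega

theorem assocSub_names (l l' : List Name) :
    assocSub ((l.map Term.name).zip (l'.map Term.name)) =
      tsub fun a => .name (((l.zip l').lookup a).getD a) := by
  funext u
  cases u with
  | name a =>
    rw [tsub, assocSub]
    induction l generalizing l' with
    | nil => rfl
    | cons b l ih =>
      cases l' with
      | nil => rfl
      | cons b' l' =>
        rw [List.map_cons, List.map_cons, List.zip_cons_cons, List.zip_cons_cons, List.lookup_cons,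
          List.lookup_cons]
        by_cases h : a = b
        · simp [h]
        · rw [beq_false_of_ne h, beq_false_of_ne (by simpa using h)]
          exact ih l'
  | var x =>
    have : ((l.map Term.name).zip (l'.map Term.name)).lookup (.var x) = none := by
      rw [List.lookup_eq_none_iff]
      rintro ⟨u, v⟩ h
      obtain ⟨a, -, rfl⟩ := List.mem_map.1 (List.of_mem_zip h).1
      simp
    rw [assocSub, this]; rfl

theorem getElem?_of_prefix {α : Type*} {l l' : List α} (h : l <+: l') {i : ℕ} {a : α}
    (hi : l[i]? = some a) : l'[i]? = some a := by
  obtain ⟨t, rfl⟩ := h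
  rw [List.getElem?_append_left (List.getElem?_eq_some_iff.1 hi).1, hi]

/-- The cost of a test for equivalence. -/
def equivCost (K W N : ℕ) (Φ : ℕ → ℕ) : ℕ := 10000 * ((W + N + 2) * (K + 1)) + Φ K

variable {L : FLTS S} {code : S ↪ ℕ} {Φ : ℕ → ℕ} {O : Oracle} (hO : Presents L code Φ O)
  (hΦ : Monotone Φ)
include hO hΦ

/-- The oracle is asked last and only about the names of the trees, of which there are at most `K`;
this is where monotonicity of `Φ` enters. All other tests handle lists of at most `K` names against
trees and histories, whence the factor `K + 1`. -/
theorem comp_equiv {K W N : ℕ} {p p' : CPos S} (h : p.Small K W N) (h' : p'.Small K W N) :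
    Comp orbitProgram O 16 (.pair (p.code code) (p'.code code)) (.bit (p.Equiv p'))
      (equivCost K W N Φ) := by
  have hw := h.weight
  have hw' := h'.weight
  have n1 := p.T.length_names_le
  have n2 := p'.T.length_names_le
  have k1 := h.names
  have k2 := h'.names
  have d1 := h.depth
  have l1 := h.hist
  have l2 := h'.hist
  have hn := comp_names (O := O) p.T []
  have hn' := comp_names (O := O) p'.T []
  rw [List.append_nil] at hn hn'
  have hd := comp_dedup (O := O) p.T.names
  have hd' := comp_dedup (O := O) p'.T.names
  set ns := p.T.names.dedup with hns
  set ns' := p'.T.names.dedup with hns'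
  have hp := comp_pattern (O := O) ns p.hs
  have hp' := comp_pattern (O := O) ns' p'.hs
  have he := comp_eqv (O := O) (.ofList (ns.map fun a => .bit (a ∈ p.hs)))
    (.ofList (ns'.map fun a => .bit (a ∈ p'.hs)))
  have hes : (Val.ofList (ns.map fun a => .bit (a ∈ p.hs))).size ≤ 2 * ns.length + 1 := by
    have := Val.size_bits (ns.map fun a => a ∈ p.hs)
    rwa [List.map_map, List.length_map] at this
  set X := (W + N + 2) * (K + 1) with hX
  have x1 : (p.T.names.length + 1) * (ns.length + 1) ≤ X := Nat.mul_le_mul (by omega) (by omega)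
  have x2 : (p'.T.names.length + 1) * (ns'.length + 1) ≤ X := Nat.mul_le_mul (by omega) (by omega)
  have x3 : (ns.length + 1) * (p.hs.length + 1) ≤ X := by
    rw [mul_comm]; exact Nat.mul_le_mul (by omega) (by omega)
  have x4 : (ns'.length + 1) * (p'.hs.length + 1) ≤ X := by
    rw [mul_comm]; exact Nat.mul_le_mul (by omega) (by omega)
  have x5 : W + N + 2 ≤ X := Nat.le_mul_of_pos_right _ (by omega)
  have x6 : K + 1 ≤ X := Nat.le_mul_of_pos_left _ (by omega)
  rw [mul_assoc] at hd hd' hp hp'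
  rw [equivCost, ← hX]
  by_cases c1 : ns.map (fun a => decide (a ∈ p.hs)) = ns'.map (fun a => decide (a ∈ p'.hs))
  · rw [Val.bit_pos (Val.ofList_bits.2 c1)] at he
    -- The oracle is specified only for lists of the same length, which the equality of the patterns
    -- guarantees.
    have hlen : ns.length = ns'.length := by simpa using congrArg List.length c1
    have hl := comp_eqLength (O := O) (p.hs.map enc) (p'.hs.map enc)
    rw [List.length_map, List.length_map] at hl
    by_cases c2 : p.hs.length = p'.hs.length
    · rw [Val.bit_pos c2] at hl
      have hz := comp_zip_pairs (O := O) (ns.map Term.name) (ns'.map Term.name) []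
      rw [List.append_nil, List.length_map] at hz
      have hs := comp_subst (O := O) p.T ((ns.map Term.name).zip (ns'.map Term.name))
      rw [den_empty_of_vars (fun x => by rw [assocSub_names]; rfl), assocSub_names] at hs
      have x7 : p.T.weight * (((ns.map Term.name).zip (ns'.map Term.name)).length + p.T.depth + 1) ≤
          2 * X := by
        rw [List.length_zip, List.length_map, List.length_map, hX, ← mul_assoc,
          mul_comm 2, mul_assoc]
        exact Nat.mul_le_mul (by omega) (by omega)
      rw [mul_assoc] at hs
      have hq := comp_eqv (O := O) (p.T.tmap (tsub fun a =>
        .name (((ns.zip ns').lookup a).getD a))).code p'.T.code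
      have hqs := (p.T.tmap (tsub fun a => .name (((ns.zip ns').lookup a).getD a))).size_code
      rw [weight_tmap] at hqs
      by_cases c3 : p.T.tmap (tsub fun a => .name (((ns.zip ns').lookup a).getD a)) = p'.T
      · rw [Val.bit_pos (congrArg _ c3)] at hq
        obtain ⟨a1, a2⟩ := hO.equiv ns ns' p.s p'.s (List.nodup_dedup _) (List.nodup_dedup _) hlen
        have a3 := hΦ k1
        by_cases c4 : ∃ π : FinPerm, ns.map (π • ·) = ns' ∧ π • p.s = p'.s
        · rw [if_pos c4] at a1
          rw [Val.bit_pos ⟨c1, c2, c3, c4⟩]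
          refine Comp.of_run (hn.calls (hd.calls (hn'.calls (hd'.calls (hp.calls (hp'.calls
            (he.calls (hl.calls ((comp_nameTerms ns).calls ((comp_nameTerms ns').calls (hz.calls
            (hs.calls (hq.calls (Asks.of_eq a1 a2 ⟨rfl, ?_⟩))))))))))))))
          omega
        · rw [if_neg c4] at a1
          rw [Val.bit_neg (fun hE => c4 hE.2.2.2)]
          refine Comp.of_run (hn.calls (hd.calls (hn'.calls (hd'.calls (hp.calls (hp'.calls
            (he.calls (hl.calls ((comp_nameTerms ns).calls ((comp_nameTerms ns').calls (hz.calls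
            (hs.calls (hq.calls (Asks.of_eq a1 a2 ⟨rfl, ?_⟩))))))))))))))
          omega
      · rw [Val.bit_neg (fun h => c3 (FTree.code_injective h))] at hq
        rw [Val.bit_neg (fun hE => c3 hE.2.2.1)]
        refine Comp.of_run (hn.calls (hd.calls (hn'.calls (hd'.calls (hp.calls (hp'.calls
          (he.calls (hl.calls ((comp_nameTerms ns).calls ((comp_nameTerms ns').calls (hz.calls
          (hs.calls (hq.calls ⟨rfl, ?_⟩)))))))))))))
        omega
    · rw [Val.bit_neg c2] at hl
      rw [Val.bit_neg (fun hE => c2 hE.2.1)]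
      refine Comp.of_run (hn.calls (hd.calls (hn'.calls (hd'.calls (hp.calls (hp'.calls
        (he.calls (hl.calls ⟨rfl, ?_⟩))))))))
      omega
  · rw [Val.bit_neg (fun h => c1 (Val.ofList_bits.1 h))] at he
    rw [Val.bit_neg (fun hE => c1 hE.1)]
    refine Comp.of_run (hn.calls (hd.calls (hn'.calls (hd'.calls (hp.calls (hp'.calls
      (he.calls ⟨rfl, ?_⟩)))))))
    omega

/-- Insertion of a position into a list of positions. -/
theorem comp_insert {K W N : ℕ} {p : CPos S} (h : p.Small K W N) (all : List (CPos S))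
    (hall : ∀ q ∈ all, q.Small K W N) :
    ∃ i all', Comp orbitProgram O 17 (.pair (p.code code) (codePositions code all))
        (.pair (.atom i) (codePositions code all')) ((equivCost K W N Φ + 100) * (all.length + 1)) ∧
      ((all' = all ∧ ∃ q, all[i]? = some q ∧ p.Equiv q) ∨
        (all' = all ++ [p] ∧ i = all.length ∧ ∀ q ∈ all, ¬ p.Equiv q)) := by
  induction all with
  | nil => exact ⟨0, [p], Comp.of_run ⟨rfl, by simp⟩, Or.inr ⟨rfl, rfl, by simp⟩⟩
  | cons q all ih =>
    have he := comp_equiv hO hΦ h (hall q (by simp))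
    by_cases hq : p.Equiv q
    · rw [Val.bit_pos hq] at he
      refine ⟨0, q :: all, Comp.of_run (he.calls ⟨rfl, ?_⟩), Or.inl ⟨rfl, q, rfl, hq⟩⟩
      rw [List.length_cons]
      nlinarith
    · rw [Val.bit_neg hq] at he
      obtain ⟨i, all', hc, hi⟩ := ih (fun q hq => hall q (by simp [hq]))
      refine ⟨i + 1, q :: all', Comp.of_run (he.calls (hc.calls ⟨rfl, ?_⟩)), ?_⟩
      · rw [List.length_cons]
        nlinarith
      · rcases hi with ⟨rfl, q', h1, h2⟩ | ⟨rfl, rfl, h2⟩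
        · exact Or.inl ⟨rfl, q', by simpa using h1, h2⟩
        · refine Or.inr ⟨rfl, rfl, ?_⟩
          intro q' hq'
          rcases List.mem_cons.1 hq' with rfl | hq'
          · exact hq
          · exact h2 q' hq'

/-- Insertion of a list of positions. -/
theorem comp_insertAll {K W N : ℕ} (ps : List (CPos S)) (hps : ∀ p ∈ ps, p.Small K W N)
    (all : List (CPos S)) (hall : ∀ q ∈ all, q.Small K W N) :
    ∃ (is : List ℕ) (all' : List (CPos S)),
      Comp orbitProgram O 18 (.pair (codePositions code ps) (codePositions code all))
        (.pair (codeList is) (codePositions code all'))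
        ((equivCost K W N Φ + 200) * (all'.length + 1) * (ps.length + 1)) ∧
      all <+: all' ∧ (∀ q ∈ all', q ∈ all ∨ q ∈ ps) ∧
      (all.Pairwise (fun q p => ¬ p.Equiv q) → all'.Pairwise (fun q p => ¬ p.Equiv q)) ∧
      List.Forall₂ (fun i p => ∃ q, all'[i]? = some q ∧ (q = p ∨ p.Equiv q)) is ps := by
  induction ps generalizing all with
  | nil =>
    refine ⟨[], all, Comp.of_run ⟨rfl, ?_⟩, List.prefix_rfl, fun q hq => Or.inl hq, id, .nil⟩
    simp only [List.length_nil]; nlinarith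
  | cons p ps ih =>
    obtain ⟨i, all₁, hc, hi⟩ := comp_insert hO hΦ (hps p (by simp)) all hall
    have hsub : ∀ q ∈ all₁, q ∈ all ∨ q = p := by
      rcases hi with ⟨rfl, -⟩ | ⟨rfl, -⟩
      · exact fun q hq => Or.inl hq
      · intro q hq; simpa using hq
    have hpre : all <+: all₁ := by
      rcases hi with ⟨rfl, -⟩ | ⟨rfl, -⟩
      · exact List.prefix_rfl
      · exact List.prefix_append _ _
    obtain ⟨is, all', hc', h1, h2, h3, h4⟩ := ih (fun q hq => hps q (by simp [hq])) all₁ (by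
      intro q hq
      rcases hsub q hq with hq | rfl
      · exact hall q hq
      · exact hps q (by simp))
    refine ⟨i :: is, all', Comp.of_run (hc.calls (hc'.calls ⟨rfl, ?_⟩)), hpre.trans h1, ?_, ?_, ?_⟩
    · have hl : all.length ≤ all'.length := (hpre.trans h1).length_le
      have e1 : (equivCost K W N Φ + 100) * (all.length + 1) ≤
          (equivCost K W N Φ + 100) * (all'.length + 1) := by gcongr
      rw [List.length_cons]
      nlinarith
    · intro q hq
      rcases h2 q hq with hq | hq
      · rcases hsub q hq with hq | rfl
        · exact Or.inl hq
        · right; simp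
      · right; simp [hq]
    · intro hp
      refine h3 ?_
      rcases hi with ⟨rfl, -⟩ | ⟨rfl, -, hi⟩
      · exact hp
      · rw [List.pairwise_append]
        refine ⟨hp, List.pairwise_singleton _ _, ?_⟩
        intro a ha b hb
        rw [List.mem_singleton.1 hb]
        exact hi a ha
    · refine .cons ?_ h4
      rcases hi with ⟨rfl, q, hq, he⟩ | ⟨rfl, rfl, -⟩
      · exact ⟨q, getElem?_of_prefix h1 hq, Or.inr he⟩
      · exact ⟨p, getElem?_of_prefix h1 (by simp), Or.inl rfl⟩

end

/-! ## The computation of successors -/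

theorem assocSub_inst (x : ℕ) (a : Name) : assocSub [(.var x, .name a)] = Term.inst [(x, a)] := by
  funext u
  cases u with
  | name b => rfl
  | var y =>
    simp only [assocSub, Term.inst, List.lookup_cons, List.lookup_nil]
    by_cases h : y = x
    · simp [h]
    · rw [beq_false_of_ne h, beq_false_of_ne (by simpa using h)]; rfl

theorem assocSub_slots (l : List ℕ) (us : List Term) :
    assocSub ((l.map slotTerm).zip us) = tsub (look l us) := by
  funext u
  cases u with
  | name a =>
    rw [tsub, look, assocSub]
    congr 1
    induction l generalizing us with
    | nil => rfl
    | cons b l ih =>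
      cases us with
      | nil => rfl
      | cons v us =>
        rw [List.map_cons, List.zip_cons_cons, List.zip_cons_cons, List.lookup_cons,
          List.lookup_cons, ih]
        by_cases h : a.id = b
        · have : Term.name a = slotTerm b := by rw [slotTerm, ← h]
          rw [this, h]; simp
        · rw [beq_false_of_ne h, beq_false_of_ne]
          intro h'
          rw [slotTerm, Term.name.injEq] at h'
          exact h (by rw [h'])
  | var x =>
    have : ((l.map slotTerm).zip us).lookup (.var x) = none := by
      rw [List.lookup_eq_none_iff]
      rintro ⟨u, v⟩ h
      obtain ⟨a, -, rfl⟩ := List.mem_map.1 (List.of_mem_zip h).1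
      simp [slotTerm]
    rw [assocSub, this]; rfl

theorem Term.flatMap_nameList (as : List Name) :
    (as.map Term.name).flatMap Term.nameList = as := by
  induction as with
  | nil => rfl
  | cons a as ih => rw [List.map_cons, List.flatMap_cons, ih]; rfl

section

variable {S : Type u} [Nominal S] {L : FLTS S} {code : S ↪ ℕ} {Φ : ℕ → ℕ} {O : Oracle}

theorem comp_instances (s : S) (hs : List Name) (x : ℕ) (l : FTree) (as : List Name) :
    Comp orbitProgram O 20 (.pair (.atom x) (.pair (CPos.code code ⟨s, hs, l⟩) (codeList as)))
      (codePositions code (as.map fun a => ⟨s, hs, den (Term.inst [(x, a)]) RecEnv.empty l⟩))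
      ((1000 * (l.weight * (l.depth + 2)) + 120) * (as.length + 1)) := by
  induction as with
  | nil => refine Comp.of_run ⟨rfl, ?_⟩; simp only [List.length_nil]; omega
  | cons a as ih =>
    have hs := comp_subst (O := O) l [(.var x, .name a)]
    rw [assocSub_inst, mul_assoc, List.length_singleton, show 1 + l.depth + 1 = l.depth + 2 by ring]
      at hs
    refine Comp.of_run (hs.calls (ih.calls ⟨rfl, ?_⟩))
    rw [List.length_cons]
    nlinarith

theorem comp_targets {sup : S → List Name}
    (h1 : ∀ s, O.answer .support (.atom (code s)) = encodeNames (sup s))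
    (h2 : ∀ s, O.cost .support (.atom (code s)) ≤ (sup s).length + 1) {N : ℕ}
    (h3 : ∀ s, (sup s).length ≤ N) (hs : List Name) (l : FTree) (ss : List S) :
    Comp orbitProgram O 21 (.pair (.ofList (ss.map fun s => .atom (code s)))
        (.pair (.atom (N + 1)) (.pair (codeList hs) l.code)))
      (codePositions code (ss.map fun s => ⟨s, prune N (sup s ++ l.names) hs, l⟩))
      (2000 * ((l.weight + N + 1) * (hs.length + 1)) * (ss.length + 1)) := by
  have hpos : l.weight + N + 1 ≤ (l.weight + N + 1) * (hs.length + 1) :=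
    Nat.le_mul_of_pos_right _ (by omega)
  have hpos' : hs.length + 1 ≤ (l.weight + N + 1) * (hs.length + 1) :=
    Nat.le_mul_of_pos_left _ (by omega)
  induction ss with
  | nil =>
    refine Comp.of_run ⟨rfl, ?_⟩
    simp only [List.length_nil]; omega
  | cons s ss ih =>
    have hn := comp_names (O := O) l []
    rw [List.append_nil] at hn
    have ha := comp_append_code (O := O) (sup s) l.names
    have f1 := comp_filter (O := O) true (sup s ++ l.names) hs
    have f2 := comp_filter (O := O) false (sup s ++ l.names) hs
    have e1 : (fun a => decide (a ∈ sup s ++ l.names) == true) =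
        fun a => decide (a ∈ sup s ++ l.names) := by funext a; simp
    have e2 : (fun a => decide (a ∈ sup s ++ l.names) == false) =
        fun a => decide (a ∉ sup s ++ l.names) := by
      funext a; by_cases h : a ∈ sup s ++ l.names <;> simp [h]
    rw [e1] at f1
    rw [e2] at f2
    have ha' := comp_append_code (O := O) (hs.filter fun a => decide (a ∈ sup s ++ l.names))
      (hs.filter fun a => decide (a ∉ sup s ++ l.names))
    have ht := comp_take_code (O := O) (N + 1) (hs.filter (fun a => decide (a ∈ sup s ++ l.names)) ++
      hs.filter (fun a => decide (a ∉ sup s ++ l.names)))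
    have q1 := List.length_filter_le (fun a => decide (a ∈ sup s ++ l.names)) hs
    have q2 := List.length_filter_le (fun a => decide (a ∉ sup s ++ l.names)) hs
    have q3 := l.length_names_le
    have q4 := h3 s
    rw [List.length_append] at ht
    have q5 : (hs.length + 1) * ((sup s ++ l.names).length + 1) ≤
        (l.weight + N + 1) * (hs.length + 1) := by
      rw [mul_comm, List.length_append]; exact Nat.mul_le_mul_right _ (by omega)
    rw [mul_assoc] at f1 f2
    refine Comp.of_run (Asks.of_eq (h1 s) (h2 s) (hn.calls (ha.calls (f1.calls (f2.calls
      (ha'.calls (ht.calls (ih.calls ⟨rfl, ?_⟩))))))))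
    rw [List.length_cons, mul_add _ (ss.length + 1) 1]
    omega

/-- The cost of the computation of the successors of a position. -/
def succCost (W N m : ℕ) : ℕ := 100000 * (m * ((N + 2) * (W + N + 2)))

variable {K W N m : ℕ} {s : S} {hs : List Name} {c i : ℕ} {xs : List ℕ} {us : List Term}
  {l r : FTree} {x : ℕ} (tb : List (ℕ × Val))

/-- Bounds for the first steps of the computation of successors. -/
theorem succs_prefix {T : FTree} (h : CPos.Small K W N (⟨s, hs, T⟩ : CPos S)) (hK : K ≤ N)
    (hm : N + 2 ≤ m) :
    Comp orbitProgram O 8 (.pair T.code (.atom 0)) (codeList T.names) (500 * W + 20) ∧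
      Comp orbitProgram O 5 (codeList T.names) (codeList T.names.dedup)
        (200 * ((N + 2) * (W + N + 2))) ∧
      T.names.dedup.length ≤ N ∧ hs.length ≤ N + 1 ∧ T.weight ≤ W ∧ T.depth ≤ K ∧
      (N + 2) * (W + N + 2) + (N + 2) * (W + N + 2) ≤ m * ((N + 2) * (W + N + 2)) ∧
      W + N + 2 + W + N + 2 ≤ (N + 2) * (W + N + 2) := by
  have hn := comp_names (O := O) T []
  have h1 : T.names.dedup.length ≤ K := h.names
  have h2 : T.weight ≤ W := h.weight
  have h3 := T.length_names_le
  rw [List.append_nil] at hn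
  refine ⟨hn.mono (by omega), (comp_dedup T.names).mono ?_, by omega, h.hist, h2, h.depth,
    by nlinarith [Nat.zero_le ((N + 2) * (W + N + 2))], by nlinarith⟩
  rw [mul_assoc, mul_comm (N + 2)]
  exact Nat.mul_le_mul_left _ (Nat.mul_le_mul (by omega) (by omega))

theorem comp_succs_leaf (h : CPos.Small K W N (⟨s, hs, .node c i xs us l r⟩ : CPos S))
    (hc : c = 0 ∨ c = 1) (hK : K ≤ N) (hm : N + 2 ≤ m) :
    Comp orbitProgram O 22 (.pair (CPos.code code ⟨s, hs, .node c i xs us l r⟩)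
      (.pair (.atom (N + 1)) (codeAssoc tb))) (codePositions code []) (succCost W N m) := by
  obtain ⟨hn, hd, -, -, -, -, b1, b2⟩ := succs_prefix (O := O) h hK hm
  rcases hc with rfl | rfl
  all_goals
    refine Comp.of_run (hn.calls (hd.calls ⟨rfl, ?_⟩))
    rw [succCost]
    omega

theorem comp_succs_branch (h : CPos.Small K W N (⟨s, hs, .node c i xs us l r⟩ : CPos S))
    (hc : c = 2 ∨ c = 3) (hK : K ≤ N) (hm : N + 2 ≤ m) :
    Comp orbitProgram O 22 (.pair (CPos.code code ⟨s, hs, .node c i xs us l r⟩)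
      (.pair (.atom (N + 1)) (codeAssoc tb))) (codePositions code [⟨s, hs, l⟩, ⟨s, hs, r⟩])
      (succCost W N m) := by
  obtain ⟨hn, hd, -, -, -, -, b1, b2⟩ := succs_prefix (O := O) h hK hm
  rcases hc with rfl | rfl
  all_goals
    refine Comp.of_run (hn.calls (hd.calls ⟨rfl, ?_⟩))
    rw [succCost]
    omega

theorem instances_cost {l : FTree} {as : List Name} (hw : l.weight ≤ W) (hd : l.depth ≤ N)
    (has : as.length ≤ 2 * (N + 1)) (hm : N + 2 ≤ m) :
    (1000 * (l.weight * (l.depth + 2)) + 120) * (as.length + 1) ≤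
      3000 * (m * ((N + 2) * (W + N + 2))) := by
  have h1 : l.weight * (l.depth + 2) ≤ W * (N + 2) := Nat.mul_le_mul hw (by omega)
  have h2 : 1000 * (l.weight * (l.depth + 2)) + 120 ≤ 1000 * ((N + 2) * (W + N + 2)) := by nlinarith
  calc _ ≤ 1000 * ((N + 2) * (W + N + 2)) * (2 * m) := Nat.mul_le_mul h2 (by omega)
    _ ≤ _ := by
      rw [mul_comm m]
      nlinarith [Nat.zero_le ((N + 2) * (W + N + 2) * m)]

/-- All names outside of the history and the formula lead to one orbit, so the known names and a
single fresh one suffice. Altogether they are at most `2 (N + 1)` names. -/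
theorem comp_succs_quant (h : CPos.Small K W N (⟨s, hs, .node c i (x :: xs) us l r⟩ : CPos S))
    (hc : c = 4 ∨ c = 5) (hK : K ≤ N) (hm : N + 2 ≤ m) :
    ∃ as : List Name, as.length ≤ 2 * m ∧
      (∀ a, a ∈ hs ∨ a ∈ (node c i (x :: xs) us l r).names → a ∈ as) ∧
      (∃ a ∈ as, a ∉ hs ∧ a ∉ (node c i (x :: xs) us l r).names) ∧
      Comp orbitProgram O 22 (.pair (CPos.code code ⟨s, hs, .node c i (x :: xs) us l r⟩)
        (.pair (.atom (N + 1)) (codeAssoc tb)))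
        (codePositions code (as.map fun a => ⟨s, hs, den (Term.inst [(x, a)]) RecEnv.empty l⟩))
        (succCost W N m) := by
  obtain ⟨hn, hd, h1, h2, h3, h4, b1, b2⟩ := succs_prefix (O := O) h hK hm
  set ns := (node c i (x :: xs) us l r).names.dedup with hns
  have ha := comp_append_code (O := O) hs ns
  obtain ⟨a, hna, hf⟩ := comp_fresh (O := O) (hs ++ ns) 0 (by simp)
  simp only [FTree.weight, FTree.depth, List.length_cons] at h3 h4
  have hl : (a :: (hs ++ ns)).length ≤ 2 * (N + 1) := by
    rw [List.length_cons, List.length_append]; omega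
  have hi := (comp_instances (O := O) (code := code) s hs x l (a :: (hs ++ ns))).mono
    (instances_cost (W := W) (by omega) (by omega) hl hm)
  rw [List.mem_append, not_or, hns, List.mem_dedup] at hna
  refine ⟨a :: (hs ++ ns), by omega, ?_, ⟨a, by simp, hna⟩, ?_⟩
  · intro b hb
    rw [List.mem_cons, List.mem_append, hns, List.mem_dedup]
    exact Or.inr hb
  · have q : ((hs ++ ns).length + 1) * ((hs ++ ns).length + 1 - 0) ≤
        4 * (m * ((N + 2) * (W + N + 2))) := by
      rw [List.length_append]
      calc _ ≤ (2 * (N + 2)) * (2 * (N + 2)) := Nat.mul_le_mul (by omega) (by omega)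
        _ = 4 * ((N + 2) * (N + 2)) := by ring
        _ ≤ 4 * ((N + 2) * (W + N + 2)) :=
          Nat.mul_le_mul_left _ (Nat.mul_le_mul_left _ (by omega))
        _ ≤ _ := by omega
    rw [mul_assoc] at hf
    rcases hc with rfl | rfl
    all_goals
      refine Comp.of_run (hn.calls (hd.calls (ha.calls (hf.calls (hi.calls ⟨rfl, ?_⟩)))))
      rw [succCost]
      omega

theorem comp_succs_fresh (h : CPos.Small K W N (⟨s, hs, .node 6 i (x :: xs) us l r⟩ : CPos S))
    (hK : K ≤ N) (hm : N + 2 ≤ m) :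
    ∃ a, a ∉ hs ∧ a ∉ (node 6 i (x :: xs) us l r).names ∧
      Comp orbitProgram O 22 (.pair (CPos.code code ⟨s, hs, .node 6 i (x :: xs) us l r⟩)
        (.pair (.atom (N + 1)) (codeAssoc tb)))
        (codePositions code [⟨s, hs, den (Term.inst [(x, a)]) RecEnv.empty l⟩])
        (succCost W N m) := by
  obtain ⟨hn, hd, h1, h2, h3, h4, b1, b2⟩ := succs_prefix (O := O) h hK hm
  set ns := (node 6 i (x :: xs) us l r).names.dedup with hns
  have ha := comp_append_code (O := O) hs ns
  obtain ⟨a, hna, hf⟩ := comp_fresh (O := O) (hs ++ ns) 0 (by simp)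
  simp only [FTree.weight, FTree.depth, List.length_cons] at h3 h4
  have hi := (comp_instances (O := O) (code := code) s hs x l [a]).mono
    (instances_cost (W := W) (N := N) (by omega) (by omega) (by rw [List.length_singleton]; omega) hm)
  rw [List.mem_append, not_or, hns, List.mem_dedup] at hna
  refine ⟨a, hna.1, hna.2, ?_⟩
  have q : ((hs ++ ns).length + 1) * ((hs ++ ns).length + 1 - 0) ≤
      4 * (m * ((N + 2) * (W + N + 2))) := by
    rw [List.length_append]
    calc _ ≤ (2 * (N + 2)) * (2 * (N + 2)) := Nat.mul_le_mul (by omega) (by omega)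
      _ = 4 * ((N + 2) * (N + 2)) := by ring
      _ ≤ 4 * ((N + 2) * (W + N + 2)) :=
        Nat.mul_le_mul_left _ (Nat.mul_le_mul_left _ (by omega))
      _ ≤ _ := by omega
  rw [mul_assoc] at hf
  refine Comp.of_run (hn.calls (hd.calls (ha.calls (hf.calls (hi.calls ⟨rfl, ?_⟩)))))
  rw [succCost]
  omega

theorem comp_succs_modal (hO : Presents L code Φ O) {t : ℕ} {as : List Name}
    (h : CPos.Small K W N (⟨s, hs, .node c t xs (as.map .name) l r⟩ : CPos S))
    (hc : c = 7 ∨ c = 8) (hK : K ≤ N) (hm : N + 2 ≤ m) (hs1 : hs.Nodup)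
    (hs2 : supp s ⊆ hs.toFinset) (hN : ∀ s : S, (supp s).card ≤ N)
    (hb : ∀ ss : List S, ss.Nodup → (∀ s' ∈ ss, ∃ H', L.step (s, hs.toFinset) ⟨t, as⟩ (s', H')) →
      ss.length ≤ m) :
    ∃ (sup : S → List Name) (ss : List S) (hs' : List Name),
      (∀ s, (sup s).toFinset = supp s) ∧ ss.length ≤ m ∧
      (∀ s', s' ∈ ss ↔ ∃ H', L.step (s, hs.toFinset) ⟨t, as⟩ (s', H')) ∧ hs'.Nodup ∧
      hs'.toFinset = hs.toFinset ∪ as.toFinset ∧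
      Comp orbitProgram O 22 (.pair (CPos.code code ⟨s, hs, .node c t xs (as.map .name) l r⟩)
        (.pair (.atom (N + 1)) (codeAssoc tb)))
        (codePositions code (ss.map fun s' => ⟨s', prune N (sup s' ++ l.names) hs', l⟩))
        (succCost W N m) := by
  obtain ⟨hn, hd, h1, h2, h3, h4, b1, b2⟩ := succs_prefix (O := O) h hK hm
  choose sup p1 p2 p3 p4 using hO.support
  obtain ⟨ss, s1, s2, s3, s4⟩ := hO.next s hs t as hs1 hs2
  have hm' := hb ss s1 fun s' hs' => (s2 s').1 hs'
  -- The names of the label that are new to the history are put in front of it. Before pruning the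
  -- list has at most `2 N + 1` entries.
  set hs' := (as.filter fun a => decide (a ∈ hs) == false).dedup ++ hs with hs'_def
  have hns : as ⊆ (node c t xs (as.map .name) l r).names := by
    intro a ha
    rw [FTree.names, Term.flatMap_nameList]
    exact List.mem_append_left _ ha
  have hlen : (as.filter fun a => decide (a ∈ hs) == false).dedup.length ≤ N := by
    refine le_trans ?_ h1
    rw [← List.card_toFinset, ← List.card_toFinset]
    refine Finset.card_le_card fun a ha => ?_
    rw [List.mem_toFinset, List.mem_filter] at ha
    exact List.mem_toFinset.2 (hns ha.1)
  have hsl : ∀ s, (sup s).length ≤ N := by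
    intro s
    rw [← List.toFinset_card_of_nodup (p1 s), p2 s]; exact hN s
  simp only [FTree.weight, List.length_map] at h3
  have hu := comp_namesL (O := O) (as.map .name) []
  rw [List.append_nil, Term.flatMap_nameList, List.length_map] at hu
  have hf := comp_filter (O := O) false hs as
  have hdd := comp_dedup (O := O) (as.filter fun a => decide (a ∈ hs) == false)
  have hfl := List.length_filter_le (fun a => decide (a ∈ hs) == false) as
  have ha := comp_append_code (O := O) (as.filter fun a => decide (a ∈ hs) == false).dedup hs
  have ht := comp_targets p3 p4 hsl hs' l ss
  have l1 : hs'.length ≤ 2 * N + 1 := by rw [hs'_def, List.length_append]; omega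
  have q1 : (as.length + 1) * (hs.length + 1) ≤ (N + 2) * (W + N + 2) := by
    rw [mul_comm]; exact Nat.mul_le_mul (by omega) (by omega)
  have q2 : ((as.filter fun a => decide (a ∈ hs) == false).length + 1) *
      ((as.filter fun a => decide (a ∈ hs) == false).dedup.length + 1) ≤
        (N + 2) * (W + N + 2) := by
    rw [mul_comm]; exact Nat.mul_le_mul (by omega) (by omega)
  have q3 : (l.weight + N + 1) * (hs'.length + 1) * (ss.length + 1) ≤
      4 * (m * ((N + 2) * (W + N + 2))) := by
    calc _ ≤ (W + N + 2) * (2 * (N + 2)) * (2 * m) :=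
          Nat.mul_le_mul (Nat.mul_le_mul (by omega) (by omega)) (by omega)
      _ = _ := by ring
  have b3 : m ≤ m * ((N + 2) * (W + N + 2)) := Nat.le_mul_of_pos_right _ (by positivity)
  rw [mul_assoc] at hf hdd
  rw [mul_assoc] at ht
  refine ⟨sup, ss, hs', p2, hm', s2, ?_, ?_, ?_⟩
  · rw [hs'_def, List.nodup_append]
    refine ⟨List.nodup_dedup _, hs1, ?_⟩
    rintro a ha b hb rfl
    simp [hb] at ha
  · ext a
    simp only [hs'_def, List.mem_toFinset, List.mem_append, List.mem_dedup, List.mem_filter,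
      Finset.mem_union]
    by_cases a ∈ hs <;> simp_all
  · rcases hc with rfl | rfl
    all_goals
      refine Comp.of_run (hn.calls (hd.calls (hu.calls (Asks.of_eq s3 s4 (hf.calls (hdd.calls
        (ha.calls (ht.calls ⟨rfl, ?_⟩))))))))
      rw [succCost]
      omega

theorem comp_succs_fix {X k : ℕ} {js : List ℕ} {T : FTree}
    (h : CPos.Small K W N (⟨s, hs, .node 9 X xs us l r⟩ : CPos S)) (hK : K ≤ N) (hm : N + 2 ≤ m)
    (hX : tb.lookup X = some (.pair (codeSlots js) (.pair T.code (.atom k))))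
    (htb : tb.length ≤ W) (hT : T.weight ≤ W) (hTd : T.depth ≤ K) (hjs : js.length ≤ 2 * K + 1) :
    Comp orbitProgram O 22 (.pair (CPos.code code ⟨s, hs, .node 9 X xs us l r⟩)
      (.pair (.atom (N + 1)) (codeAssoc tb)))
      (codePositions code [⟨s, hs, T.tmap (tsub (look js us))⟩]) (succCost W N m) := by
  obtain ⟨hn, hd, h1, h2, h3, h4, b1, b2⟩ := succs_prefix (O := O) h hK hm
  have hl := comp_lookup (O := O) X (.atom 0) tb
  rw [hX] at hl
  have hz := comp_zip_pairs (O := O) (js.map slotTerm) us []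
  rw [List.append_nil, List.length_map] at hz
  have hs := comp_subst (O := O) T ((js.map slotTerm).zip us)
  rw [den_empty_of_vars (fun x => by rw [assocSub_slots]; rfl), assocSub_slots] at hs
  have q : T.weight * (((js.map slotTerm).zip us).length + T.depth + 1) ≤
      3 * ((N + 2) * (W + N + 2)) := by
    rw [List.length_zip, List.length_map]
    calc _ ≤ (W + N + 2) * (3 * (N + 2)) := Nat.mul_le_mul (by omega) (by omega)
      _ = _ := by ring
  rw [mul_assoc] at hs
  refine Comp.of_run (hn.calls (hd.calls (hl.calls (hz.calls (hs.calls ⟨rfl, ?_⟩)))))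
  rw [succCost]
  omega

/-! ## Successors -/

theorem boundedMove_dia_iff {L : FLTS S} {N t : ℕ} {c : S × Finset Name} {as : List Name}
    {φ : Formula} {P' : Position S} :
    BoundedMove L N (c, .dia t (as.map .name) φ) P' ↔ ∃ s' H₁ H', L.step c ⟨t, as⟩ (s', H₁) ∧
      HistBound N (supp s' ∪ φ.supp) H₁ H' ∧ P' = ((s', H'), φ) := by
  constructor
  · intro h
    generalize hus : as.map Term.name = us at h
    cases h with
    | dia c t φ as' s' H₁ H' h hH =>
      obtain rfl := (List.map_injective_iff.2 fun a b h => Term.name.inj h) hus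
      exact ⟨s', H₁, H', h, hH, rfl⟩
  · rintro ⟨s', H₁, H', h, hH, rfl⟩
    exact .dia _ _ _ _ _ _ _ h hH

theorem boundedMove_box_iff {L : FLTS S} {N t : ℕ} {c : S × Finset Name} {as : List Name}
    {φ : Formula} {P' : Position S} :
    BoundedMove L N (c, .box t (as.map .name) φ) P' ↔ ∃ s' H₁ H', L.step c ⟨t, as⟩ (s', H₁) ∧
      HistBound N (supp s' ∪ φ.supp) H₁ H' ∧ P' = ((s', H'), φ) := by
  constructor
  · intro h
    generalize hus : as.map Term.name = us at h
    cases h with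
    | box c t φ as' s' H₁ H' h hH =>
      obtain rfl := (List.map_injective_iff.2 fun a b h => Term.name.inj h) hus
      exact ⟨s', H₁, H', h, hH, rfl⟩
  · rintro ⟨s', H₁, H', h, hH, rfl⟩
    exact .box _ _ _ _ _ _ _ h hH

theorem Denotes.args {φ₀ : Formula} {C : Ctx} {τ : ℕ → Term} {F : Formula} (h : Denotes φ₀ C τ F)
    (hF : F.tree = .node c i xs us l r) : ∃ as : List Name, us = as.map .name := by
  have key : ∀ us : List Term, ∃ as : List Name, us.map (τ ∘ C.sc.slot) = as.map .name := by
    intro us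
    choose f hf using h.names
    exact ⟨us.map fun u => f (C.sc.slot u), by simp [hf, Function.comp_def]⟩
  have := h.tree
  rw [hF] at this
  cases ht : C.t with
  | nil => rw [ht] at this; simp [den] at this
  | node c' i' xs' us' l' r' =>
    rw [ht, den] at this
    split at this
    all_goals
      simp only [node.injEq] at this
      rw [this.2.2.2.1]
      exact key _

/-- The successors under a label. -/
theorem succList_modal {φ₀ : Formula} {t : ℕ} {as : List Name} {φ : Formula}
    {F : Formula} (hmove : ∀ P', BoundedMove L N ((s, hs.toFinset), F) P' ↔
      ∃ s' H₁ H', L.step (s, hs.toFinset) ⟨t, as⟩ (s', H₁) ∧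
      HistBound N (supp s' ∪ φ.supp) H₁ H' ∧ P' = ((s', H'), φ)) (hl : Represents φ₀ l φ)
    (hsupp : l.names.toFinset = φ.supp)
    (hN : ∀ s : S, (supp s).card + φ.supp.card ≤ N + 1) {sup : S → List Name} {ss : List S}
    {hs' : List Name} (h1 : ∀ s, (sup s).toFinset = supp s)
    (h2 : ∀ s', s' ∈ ss ↔ ∃ H', L.step (s, hs.toFinset) ⟨t, as⟩ (s', H')) (h3 : hs'.Nodup)
    (h4 : hs'.toFinset = hs.toFinset ∪ as.toFinset) :
    SuccList L φ₀ N ((s, hs.toFinset), F) (ss.map fun s' => ⟨s', prune N (sup s' ++ l.names) hs', l⟩) := by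
  have hA : ∀ s', (sup s' ++ l.names).toFinset = supp s' ∪ φ.supp := by
    intro s'; rw [List.toFinset_append, h1, hsupp]
  have hprune : ∀ s', (prune N (sup s' ++ l.names) hs').Nodup ∧
      HistBound N (supp s' ∪ φ.supp) hs'.toFinset (prune N (sup s' ++ l.names) hs').toFinset := by
    intro s'
    have := histBound_prune (N := N) (A := sup s' ++ l.names) h3 (by
      rw [hA]; exact (Finset.card_union_le _ _).trans (hN s'))
    rwa [hA] at this
  have hstep : ∀ {s' H'}, L.step (s, hs.toFinset) ⟨t, as⟩ (s', H') → H' = hs'.toFinset := by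
    intro s' H' h
    rw [(L.step_supp _ _ _ _ _ h).2, h4]; rfl
  refine SuccList.of_exact (fun q => ((q.s, q.hs.toFinset), φ)) ?_ ?_
  · intro q hq
    obtain ⟨s', hss, rfl⟩ := List.mem_map.1 hq
    obtain ⟨H', h⟩ := (h2 s').1 hss
    obtain rfl := hstep h
    have hsub : supp s' ⊆ (prune N (sup s' ++ l.names) hs').toFinset :=
      (Finset.subset_inter Finset.subset_union_left (L.step_conf _ _ _ h).2).trans
        (hprune s').2.inter_subset
    refine ⟨(hmove _).2 ⟨s', _, _, h, (hprune s').2, rfl⟩, rfl, (hprune s').1, rfl,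
      hl, hsub⟩
  · intro P' h
    obtain ⟨s', H₁, H', hst, hH, rfl⟩ := (hmove P').1 h
    obtain rfl := hstep hst
    exact ⟨_, List.mem_map.2 ⟨s', (h2 s').2 ⟨_, hst⟩, rfl⟩, (hprune s').2.orbit_eq hH⟩

theorem CPos.Rep.small {φ₀ : Formula} (hφ : φ₀.Closed) {p : CPos S} {P : Position S} (h : p.Rep φ₀ P)
    (hc : P.1.2.card ≤ N + 1) : p.Small (φ₀.supp.card + φ₀.depth)
      (2 * φ₀.size * (φ₀.supp.card + φ₀.depth + 2)) N := by
  refine ⟨?_, h.rep.weight_le hφ, h.rep.depth_le hφ, ?_⟩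
  · rw [← List.card_toFinset]; exact h.rep.card_names hφ
  · rw [← List.toFinset_card_of_nodup h.nodup, ← h.hist]; exact hc

theorem Formula.size_pos (φ : Formula) : 0 < φ.size := by
  cases φ <;> simp only [Formula.size] <;> omega

/-- The program computes the successors of a position. -/
theorem comp_succs {φ₀ : Formula} (hφ : φ₀.Closed) (hO : Presents L code Φ O)
    (hN : ∀ s : S, φ₀.supp.card + φ₀.depth + (supp s).card ≤ N) (hm : N + 2 ≤ m)
    (hb : ∀ (c : S × Finset Name) (ℓ : Label) (ss : List S), ss.Nodup →
      (∀ s' ∈ ss, ∃ H', L.step c ℓ (s', H')) → ss.length ≤ m)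
    {p : CPos S} {P : Position S} (hp : p.Rep φ₀ P) (hcard : P.1.2.card ≤ N + 1) :
    ∃ ps, Comp orbitProgram O 22 (.pair (p.code code) (.pair (.atom (N + 1)) (codeAssoc φ₀.rows)))
        (codePositions code ps)
        (succCost (2 * φ₀.size * (φ₀.supp.card + φ₀.depth + 2)) N m) ∧
      SuccList L φ₀ N P ps ∧ ps.length ≤ 2 * m := by
  have hsm := CPos.Rep.small hφ hp hcard
  have hK : φ₀.supp.card + φ₀.depth ≤ N := (Nat.le_add_right _ _).trans (hN p.s)
  set K := φ₀.supp.card + φ₀.depth with hKdef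
  obtain ⟨s, hs, T⟩ := p
  obtain ⟨⟨s', H⟩, F⟩ := P
  obtain ⟨e1, hnd, e2, hrep, hconf⟩ := hp
  dsimp only at e1 e2 hnd hconf hrep hcard
  subst e1 e2
  have hsupp := fun a => hrep.mem_supp hφ a
  obtain ⟨C, τ, hC, rfl⟩ := hrep
  have rep : ∀ {l φ}, Represents φ₀ l φ → CPos.Rep φ₀ ⟨s', hs, l⟩ ((s', hs.toFinset), φ) :=
    fun hl => ⟨rfl, hnd, rfl, hl, hconf⟩
  have hquant : ∀ {x : ℕ} {φ : Formula} {c : ℕ}, F.tree = .node c 0 [x] [] φ.tree .nil →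
      (∀ P', BoundedMove L N ((s', hs.toFinset), F) P' ↔
        ∃ a, P' = ((s', hs.toFinset), φ.inst [(x, a)])) → (c = 4 ∨ c = 5) →
      ∃ ps, Comp orbitProgram O 22 (.pair (CPos.code code ⟨s', hs, C.lift τ⟩)
          (.pair (.atom (N + 1)) (codeAssoc φ₀.rows))) (codePositions code ps)
          (succCost (2 * φ₀.size * (K + 2)) N m) ∧
        SuccList L φ₀ N ((s', hs.toFinset), F) ps ∧ ps.length ≤ 2 * m := by
    intro x φ c hF hmove hc
    obtain ⟨l, hT, hl, hinst⟩ := hC.open hφ hF (by omega)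
    rw [hT] at hsm ⊢
    obtain ⟨as, h1, h2, ⟨b, hb, hb1, hb2⟩, h3⟩ :=
      comp_succs_quant (O := O) (code := code) φ₀.rows hsm hc hK hm
    have hnames : ∀ a, a ∈ (node c 0 [x] [] l .nil).names ↔ a ∈ φ.supp := by
      intro a; rw [hl]; simp [FTree.names]
    refine ⟨_, h3, ⟨?_, ?_⟩, by rw [List.length_map]; exact h1⟩
    · intro q hq
      obtain ⟨a, -, rfl⟩ := List.mem_map.1 hq
      exact ⟨_, (hmove _).2 ⟨a, rfl⟩, rep (hinst a)⟩
    · intro P' h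
      obtain ⟨a, rfl⟩ := (hmove P').1 h
      by_cases ha : a ∈ as
      · exact ⟨_, List.mem_map.2 ⟨a, ha, rfl⟩, _, rep (hinst a), rfl⟩
      -- A name missing from the list is fresh for history and formula, so the listed fresh name `b`
      -- leads to the same orbit.
      · have ha' : ¬ _ := fun h => ha (h2 a h)
        rw [not_or, hnames] at ha'
        rw [hnames] at hb2
        exact ⟨_, List.mem_map.2 ⟨b, hb, rfl⟩, _, rep (hinst b), orbit_inst_fresh hconf
          ⟨by simpa using hb1, hb2⟩ ⟨by simpa using ha'.1, ha'.2⟩⟩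
  have hmodal : ∀ {t c : ℕ} {as : List Name} {φ : Formula},
      F.tree = .node c t [] (as.map .name) φ.tree .nil →
      (∀ P', BoundedMove L N ((s', hs.toFinset), F) P' ↔ ∃ s'' H₁ H',
        L.step (s', hs.toFinset) ⟨t, as⟩ (s'', H₁) ∧ HistBound N (supp s'' ∪ φ.supp) H₁ H' ∧
          P' = ((s'', H'), φ)) → (c = 7 ∨ c = 8) →
      ∃ ps, Comp orbitProgram O 22 (.pair (CPos.code code ⟨s', hs, C.lift τ⟩)
          (.pair (.atom (N + 1)) (codeAssoc φ₀.rows))) (codePositions code ps)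
          (succCost (2 * φ₀.size * (K + 2)) N m) ∧
        SuccList L φ₀ N ((s', hs.toFinset), F) ps ∧ ps.length ≤ 2 * m := by
    intro t c as φ hF hmove hc
    obtain ⟨l, r, hT, hl, -⟩ := hC.sub hφ hF (by omega)
    have hl := hl φ rfl
    rw [hT] at hsm ⊢
    obtain ⟨sup, ss, hs', h1, h2, h3, h4, h5, h6⟩ := comp_succs_modal (O := O) φ₀.rows hO hsm hc hK
      hm hnd hconf (fun s => (Nat.le_add_left _ _).trans (hN s)) (fun ss => hb _ _ ss)
    refine ⟨_, h6, succList_modal hmove hl ?_ ?_ h1 h3 h4 h5, ?_⟩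
    · ext a; rw [List.mem_toFinset, hl.mem_supp hφ]
    · intro s
      have := hl.card_supp hφ
      have := hN s
      omega
    · rw [List.length_map]; omega
  cases F with
  | eq u v =>
    obtain ⟨l, r, hT, -, -, -⟩ := hC.sub hφ (by rw [Formula.tree]) (by omega)
    rw [hT] at hsm ⊢
    refine ⟨[], comp_succs_leaf (O := O) φ₀.rows hsm (by omega) hK hm, ⟨by simp, ?_⟩, by simp⟩
    intro P' h; cases h
  | ne u v =>
    obtain ⟨l, r, hT, -, -, -⟩ := hC.sub hφ (by rw [Formula.tree]) (by omega)
    rw [hT] at hsm ⊢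
    refine ⟨[], comp_succs_leaf (O := O) φ₀.rows hsm (by omega) hK hm, ⟨by simp, ?_⟩, by simp⟩
    intro P' h; cases h
  | or φ ψ =>
    obtain ⟨l, r, hT, hl, hr, -⟩ := hC.sub hφ (by rw [Formula.tree]) (by omega)
    rw [hT] at hsm ⊢
    refine ⟨_, comp_succs_branch (O := O) φ₀.rows hsm (by omega) hK hm, ⟨?_, ?_⟩,
      by simp only [List.length_cons, List.length_nil]; omega⟩
    · simp only [List.mem_cons, List.not_mem_nil, or_false, forall_eq_or_imp, forall_eq]
      exact ⟨⟨_, .or_left _ _ _, rep (hl φ rfl)⟩, ⟨_, .or_right _ _ _, rep (hr ψ rfl)⟩⟩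
    · intro P' h
      cases h
      · exact ⟨_, List.mem_cons_self, _, rep (hl φ rfl), rfl⟩
      · exact ⟨_, List.mem_cons_of_mem _ List.mem_cons_self, _, rep (hr ψ rfl), rfl⟩
  | and φ ψ =>
    obtain ⟨l, r, hT, hl, hr, -⟩ := hC.sub hφ (by rw [Formula.tree]) (by omega)
    rw [hT] at hsm ⊢
    refine ⟨_, comp_succs_branch (O := O) φ₀.rows hsm (by omega) hK hm, ⟨?_, ?_⟩,
      by simp only [List.length_cons, List.length_nil]; omega⟩
    · simp only [List.mem_cons, List.not_mem_nil, or_false, forall_eq_or_imp, forall_eq]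
      exact ⟨⟨_, .and_left _ _ _, rep (hl φ rfl)⟩, ⟨_, .and_right _ _ _, rep (hr ψ rfl)⟩⟩
    · intro P' h
      cases h
      · exact ⟨_, List.mem_cons_self, _, rep (hl φ rfl), rfl⟩
      · exact ⟨_, List.mem_cons_of_mem _ List.mem_cons_self, _, rep (hr ψ rfl), rfl⟩
  | some x φ =>
    refine hquant (x := x) (φ := φ) (by rw [Formula.tree]) (fun P' => ⟨fun h => ?_, ?_⟩) (by omega)
    · cases h with | some c x φ a => exact ⟨a, rfl⟩
    · rintro ⟨a, rfl⟩; exact .some _ _ _ _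
  | all x φ =>
    refine hquant (x := x) (φ := φ) (by rw [Formula.tree]) (fun P' => ⟨fun h => ?_, ?_⟩) (by omega)
    · cases h with | all c x φ a => exact ⟨a, rfl⟩
    · rintro ⟨a, rfl⟩; exact .all _ _ _ _
  | fresh x φ =>
    obtain ⟨l, hT, hl, hinst⟩ := hC.open hφ (φ := φ) (by rw [Formula.tree]) (by omega)
    rw [hT] at hsm ⊢
    obtain ⟨b, hb1, hb2, h3⟩ := comp_succs_fresh (O := O) (code := code) φ₀.rows hsm hK hm
    have hb : b ∉ hs.toFinset ∧ b ∉ φ.supp := by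
      refine ⟨by simpa using hb1, fun h => hb2 ?_⟩
      rw [hl] at h; simp [FTree.names, h]
    refine ⟨_, h3, ⟨?_, ?_⟩, by rw [List.length_singleton]; omega⟩
    · simp only [List.mem_singleton, forall_eq]
      exact ⟨_, .fresh _ _ _ b hb.1 hb.2, rep (hinst b)⟩
    · intro P' h
      cases h with
      | fresh c x φ a ha ha' =>
        exact ⟨_, List.mem_singleton_self _, _, rep (hinst b), orbit_inst_fresh hconf hb ⟨ha, ha'⟩⟩
  | dia t us φ =>
    obtain ⟨as, rfl⟩ := hC.args (by rw [Formula.tree])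
    exact hmodal (by rw [Formula.tree]) (fun P' => boundedMove_dia_iff) (by omega)
  | box t us φ =>
    obtain ⟨as, rfl⟩ := hC.args (by rw [Formula.tree])
    exact hmodal (by rw [Formula.tree]) (fun P' => boundedMove_box_iff) (by omega)
  | call X us => exact absurd ⟨C, τ, hC, rfl⟩ (not_represents_call hφ)
  | fix σ X xs φ us =>
    obtain ⟨as, rfl⟩ := hC.args (by rw [Formula.tree])
    obtain ⟨D, vs, hD, hc, hxs, h1, h2, hT, h3⟩ := hC.unfold hφ
    obtain ⟨w1, w2, w3, w4⟩ := weight_def_le hφ hD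
    have hX := rows_lookup hφ hD hc xs φ (as.map .name)
    have hn := φ₀.size_pos
    rw [hT] at hsm ⊢
    rw [hxs] at hX w3
    have w5 : φ₀.size ≤ 2 * φ₀.size * (K + 2) := by nlinarith
    have hcomp := comp_succs_fix (O := O) (code := code) φ₀.rows hsm hK hm hX (w4.trans w5) w1 w2
      (by rw [List.length_append, List.length_range']; exact w3)
    refine ⟨_, hcomp, ⟨?_, ?_⟩, by rw [List.length_singleton]; omega⟩
    · simp only [List.mem_singleton, forall_eq]
      exact ⟨_, .fix _ _ _ _ _ as, rep (h3 as rfl)⟩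
    · intro P' h
      refine ⟨_, List.mem_singleton_self _, _, rep (h3 as rfl), ?_⟩
      generalize hus : as.map Term.name = us at h
      cases h with
      | fix c σ X xs φ as' =>
        obtain rfl := (List.map_injective_iff.2 fun a b h => Term.name.inj h) hus
        rfl

/-! ## Owners and ranks -/

theorem comp_owner {φ₀ : Formula} (hφ : φ₀.Closed) {T : FTree} {F : Formula}
    (h : Represents φ₀ T F) :
    Comp orbitProgram O 23 T.code (.bit F.DefenderMoves) 200 := by
  obtain ⟨C, τ, hC, rfl⟩ := h
  have heq : ∀ u v : Term, Comp orbitProgram O 1 (.pair (enc u) (enc v)) (.bit (u = v)) 90 := by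
    intro u v
    have h1 := comp_eqv (O := O) (enc u) (enc v)
    have h2 := Coded.size_le u
    have h3 : Val.bit (enc u = enc v) = Val.bit (u = v) := congrArg Val.bit (propext Coded.inj.eq_iff)
    rw [h3] at h1
    exact h1.mono (by omega)
  have leaf : ∀ {c i : ℕ} {us : List Term} {l r : FTree}, F.tree = .node c i [] us l r → c < 10 →
      ∃ l' r', C.lift τ = .node c i [] us l' r' := by
    intro c i us l r hF hc
    obtain ⟨l', r', h, -⟩ := hC.sub hφ hF hc
    exact ⟨l', r', h⟩
  have quant : ∀ {c i x : ℕ} {us : List Term} {φ : Formula},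
      F.tree = .node c i [x] us φ.tree .nil → c < 10 →
      ∃ l', C.lift τ = .node c i [x] us l' .nil := by
    intro c i x us φ hF hc
    obtain ⟨l', h, -⟩ := hC.open hφ hF hc
    exact ⟨l', h⟩
  have t : Val.bit True = .atom 1 := Val.bit_pos trivial
  have f : Val.bit False = .atom 0 := Val.bit_neg not_false
  cases F with
  | eq u v =>
    obtain ⟨l, r, hT⟩ := leaf (by rw [Formula.tree]) (by omega)
    have he := heq u v
    rw [hT, Formula.DefenderMoves]
    by_cases h : u = v
    · rw [Val.bit_pos h] at he
      rw [Val.bit_neg (not_not.2 h)]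
      exact Comp.of_run (he.calls ⟨rfl, by omega⟩)
    · rw [Val.bit_neg h] at he
      rw [Val.bit_pos h]
      exact Comp.of_run (he.calls ⟨rfl, by omega⟩)
  | ne u v =>
    obtain ⟨l, r, hT⟩ := leaf (by rw [Formula.tree]) (by omega)
    rw [hT]
    exact Comp.of_run ((heq u v).calls ⟨rfl, by omega⟩)
  | or φ ψ =>
    obtain ⟨l, r, hT⟩ := leaf (by rw [Formula.tree]) (by omega)
    rw [hT, Formula.DefenderMoves, t]
    · exact Comp.of_run ⟨rfl, by omega⟩
    all_goals simp
  | dia c us φ =>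
    obtain ⟨l, r, hT⟩ := leaf (by rw [Formula.tree]) (by omega)
    rw [hT, Formula.DefenderMoves, t]
    · exact Comp.of_run ⟨rfl, by omega⟩
    all_goals simp
  | and φ ψ | box c us φ =>
    obtain ⟨l, r, hT⟩ := leaf (by rw [Formula.tree]) (by omega)
    rw [hT, Formula.DefenderMoves, f]
    exact Comp.of_run ⟨rfl, by omega⟩
  | all x φ =>
    obtain ⟨l, hT⟩ := quant (φ := φ) (by rw [Formula.tree]) (by omega)
    rw [hT, Formula.DefenderMoves, f]
    exact Comp.of_run ⟨rfl, by omega⟩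
  | some x φ | fresh x φ =>
    obtain ⟨l, hT⟩ := quant (φ := φ) (by rw [Formula.tree]) (by omega)
    rw [hT, Formula.DefenderMoves, t]
    · exact Comp.of_run ⟨rfl, by omega⟩
    all_goals simp
  | call X us => exact absurd ⟨C, τ, hC, rfl⟩ (not_represents_call hφ)
  | fix σ X xs φ us =>
    obtain ⟨D, vs, -, -, -, -, -, hT, -⟩ := hC.unfold hφ
    rw [hT, Formula.DefenderMoves, t]
    · exact Comp.of_run ⟨rfl, by omega⟩
    all_goals simp

theorem comp_rank {φ₀ : Formula} (hφ : φ₀.Closed) {T : FTree} {F : Formula}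
    (h : Represents φ₀ T F) :
    Comp orbitProgram O 24 (.pair T.code (codeAssoc φ₀.rows)) (.atom (φ₀.rank F))
      (200 * (φ₀.size + 1)) := by
  obtain ⟨C, τ, hC, rfl⟩ := h
  have hn := φ₀.size_pos
  have leaf : ∀ {c i : ℕ} {xs : List ℕ} {us : List Term} {l r : FTree},
      F.tree = .node c i xs us l r → c < 10 → φ₀.rank F = 0 →
      Comp orbitProgram O 24 (.pair (C.lift τ).code (codeAssoc φ₀.rows)) (.atom (φ₀.rank F))
        (200 * (φ₀.size + 1)) := by
    intro c i xs us l r hF hc h0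
    obtain ⟨hc, us₀, l₀, r₀, -, hT, -⟩ := hC.inv hφ hF hc
    rw [hT, h0]
    interval_cases c
    all_goals exact Comp.of_run ⟨rfl, by omega⟩
  cases F with
  | fix σ X xs φ us =>
    obtain ⟨D, vs, hD, hc, -, -, -, hT, -⟩ := hC.unfold hφ
    have hl := comp_lookup (O := O) X (.atom 0) φ₀.rows
    rw [rows_lookup hφ hD hc xs φ us] at hl
    have := (weight_def_le hφ hD).2.2.2
    rw [hT]
    exact Comp.of_run (hl.calls ⟨rfl, by omega⟩)
  | call X us => exact absurd ⟨C, τ, hC, rfl⟩ (not_represents_call hφ)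
  | _ => exact leaf (by rw [Formula.tree]) (by omega) rfl

end

/-! ## The exploration of the game -/

theorem List.exists_of_forall₂_left {α β : Type*} {R : α → β → Prop} {l : List α} {m : List β}
    (h : List.Forall₂ R l m) {a : α} (ha : a ∈ l) : ∃ b ∈ m, R a b := by
  induction h with
  | nil => simp at ha
  | cons h _ ih =>
    rcases List.mem_cons.1 ha with rfl | ha
    · exact ⟨_, List.mem_cons_self, h⟩
    · obtain ⟨b, hb, h⟩ := ih ha
      exact ⟨b, List.mem_cons_of_mem _ hb, h⟩

theorem List.exists_of_forall₂_right {α β : Type*} {R : α → β → Prop} {l : List α} {m : List β}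
    (h : List.Forall₂ R l m) {b : β} (hb : b ∈ m) : ∃ a ∈ l, R a b :=
  List.exists_of_forall₂_left h.flip hb

section

variable {S : Type u} [Nominal S] {L : FLTS S} {φ₀ : Formula} {s₀ : S} {H₀ : Finset Name} {N : ℕ}

/-- A list of representatives of different positions of the orbit game. -/
structure Explored (L : FLTS S) (φ₀ : Formula) (s₀ : S) (H₀ : Finset Name) (N : ℕ)
    (all : List (CPos S)) : Prop where
  rep : ∀ q ∈ all, ∃ P ∈ (boundedGame L φ₀ s₀ H₀ N).pos, q.Rep φ₀ P
  pairwise : all.Pairwise fun q p => ¬ p.Equiv q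

/-- Pairwise inequivalent representatives lie in different orbits. So the list never outgrows the
game, and the exploration ends. -/
theorem Explored.length_le (hφ : φ₀.Closed) {all : List (CPos S)}
    (h : Explored L φ₀ s₀ H₀ N all)
    (hfin : (orbitGame (boundedGame L φ₀ s₀ H₀ N)).pos.Finite) :
    all.length ≤ (orbitGame (boundedGame L φ₀ s₀ H₀ N)).pos.ncard := by
  classical
  choose P hP hrep using h.rep
  have hnd : (all.pmap (fun q hq => MulAction.orbit FinPerm (P q hq)) fun _ h => h).Nodup := by
    rw [List.Nodup, List.pairwise_pmap]
    refine h.pairwise.imp_of_mem ?_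
    intro q p hq hp hne _ _ he
    exact hne ((CPos.equiv_iff hφ (hrep p hp) (hrep q hq)).2 he.symm)
  have : (all.pmap (fun q hq => MulAction.orbit FinPerm (P q hq)) fun _ h => h).length =
      all.length := by simp
  rw [← this, ← List.toFinset_card_of_nodup hnd, ← Set.ncard_coe_finset]
  refine Set.ncard_le_ncard ?_ hfin
  intro o ho
  rw [Finset.mem_coe, List.mem_toFinset, List.mem_pmap] at ho
  obtain ⟨q, hq, rfl⟩ := ho
  exact ⟨_, hP q hq, rfl⟩

/-- The entry `v` of the output describes the position `p`. -/
def IsRow (L : FLTS S) (φ₀ : Formula) (N : ℕ) (all : List (CPos S)) (p : CPos S) (v : Val) : Prop :=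
  ∃ (P : Position S) (is : List ℕ), p.Rep φ₀ P ∧
    v = .ofList [.bit P.2.DefenderMoves, .atom (φ₀.rank P.2), codeList is] ∧ is.Nodup ∧
    (∀ i ∈ is, ∃ q P' P'', all[i]? = some q ∧ q.Rep φ₀ P' ∧ BoundedMove L N P P'' ∧
      MulAction.orbit FinPerm P'' = MulAction.orbit FinPerm P') ∧
    ∀ P'', BoundedMove L N P P'' → ∃ i ∈ is, ∃ q P', all[i]? = some q ∧ q.Rep φ₀ P' ∧
      MulAction.orbit FinPerm P'' = MulAction.orbit FinPerm P'

theorem IsRow.mono {all all' : List (CPos S)} (h : all <+: all') {p : CPos S} {v : Val}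
    (hv : IsRow L φ₀ N all p v) : IsRow L φ₀ N all' p v := by
  obtain ⟨P, is, h1, h2, h3, h4, h5⟩ := hv
  refine ⟨P, is, h1, h2, h3, fun i hi => ?_, fun P'' hP => ?_⟩
  · obtain ⟨q, P', P'', h6, h7⟩ := h4 i hi
    exact ⟨q, P', P'', getElem?_of_prefix h h6, h7⟩
  · obtain ⟨i, hi, q, P', h6, h7⟩ := h5 P'' hP
    exact ⟨i, hi, q, P', getElem?_of_prefix h h6, h7⟩

/-- Different successors may lie in one orbit, hence the removal of duplicates among the indices. -/
theorem isRow_of_forall₂ (hφ : φ₀.Closed) {p : CPos S} {P : Position S} (hp : p.Rep φ₀ P)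
    {ps : List (CPos S)} (hps : SuccList L φ₀ N P ps) {is : List ℕ} {all : List (CPos S)}
    (hall : ∀ q ∈ all, ∃ P, q.Rep φ₀ P)
    (h : List.Forall₂ (fun i p => ∃ q, all[i]? = some q ∧ (q = p ∨ p.Equiv q)) is ps) :
    IsRow L φ₀ N all p (.ofList [.bit P.2.DefenderMoves, .atom (φ₀.rank P.2),
      codeList is.dedup]) := by
  have key : ∀ {i : ℕ} {q : CPos S} {P' : Position S}, (∃ q', all[i]? = some q' ∧ (q' = q ∨ q.Equiv q')) → q.Rep φ₀ P' →
      ∃ q' P'', all[i]? = some q' ∧ q'.Rep φ₀ P'' ∧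
        MulAction.orbit FinPerm P' = MulAction.orbit FinPerm P'' := by
    rintro i q P' ⟨q', h1, rfl | h2⟩ hq
    · exact ⟨q', P', h1, hq, rfl⟩
    · obtain ⟨P'', hq'⟩ := hall q' (List.mem_of_getElem? h1)
      exact ⟨q', P'', h1, hq', (CPos.equiv_iff hφ hq hq').1 h2⟩
  refine ⟨P, _, hp, rfl, List.nodup_dedup _, fun i hi => ?_, fun P'' hP => ?_⟩
  · obtain ⟨q, hq, h'⟩ := List.exists_of_forall₂_left h (List.mem_dedup.1 hi)
    obtain ⟨P', hm, hr⟩ := hps.sound q hq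
    obtain ⟨q', P'', h1, h2, h3⟩ := key h' hr
    exact ⟨q', P'', P', h1, h2, hm, h3⟩
  · obtain ⟨q, hq, P', hr, ho⟩ := hps.complete P'' hP
    obtain ⟨i, hi, h'⟩ := List.exists_of_forall₂_right h hq
    obtain ⟨q', P₁, h1, h2, h3⟩ := key h' hr
    exact ⟨i, List.mem_dedup.2 hi, q', P₁, h1, h2, ho ▸ h3⟩

/-- The cost of a row. -/
def rowCost (n K N m M : ℕ) (Φ : ℕ → ℕ) : ℕ :=
  succCost (2 * n * (K + 2)) N m +
    (equivCost K (2 * n * (K + 2)) N Φ + 200) * (M + 1) * (2 * m + 1) + 200 * (n + 1) +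
    200 * (2 * m + 1) * (M + 2) + 50 * (M + 1) + 1000

variable {code : S ↪ ℕ} {Φ : ℕ → ℕ} {O : Oracle}

/-- The first `d` entries of the list have been treated, and `k` bounds the number of rounds that
are still possible, as the list has at most `M` entries. Positions are only appended at the end, so
the indices in earlier rows stay valid (`IsRow.mono`). -/
theorem comp_loop (hφ : φ₀.Closed) (hO : Presents L code Φ O) (hΦ : Monotone Φ)
    (hs₀ : supp s₀ ⊆ H₀) (hN : ∀ s : S, φ₀.supp.card + φ₀.depth + (supp s).card ≤ N) {m : ℕ}
    (hm : N + 2 ≤ m) (hb : ∀ (c : S × Finset Name) (ℓ : Label) (ss : List S), ss.Nodup →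
      (∀ s' ∈ ss, ∃ H', L.step c ℓ (s', H')) → ss.length ≤ m)
    (hfin : (orbitGame (boundedGame L φ₀ s₀ H₀ N)).pos.Finite) {M : ℕ}
    (hM : (orbitGame (boundedGame L φ₀ s₀ H₀ N)).pos.ncard = M) (k : ℕ) :
    ∀ (d : ℕ) (all : List (CPos S)), d ≤ all.length → M ≤ d + k → Explored L φ₀ s₀ H₀ N all →
    ∃ (all' : List (CPos S)) (rows : List Val),
      Comp orbitProgram O 26 (.pair (unary d) (.pair (codePositions code all)
        (.pair (.atom (N + 1)) (codeAssoc φ₀.rows)))) (.ofList rows)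
        ((rowCost φ₀.size (φ₀.supp.card + φ₀.depth) N m M Φ) * (k + 1)) ∧
      all <+: all' ∧ Explored L φ₀ s₀ H₀ N all' ∧
      List.Forall₂ (IsRow L φ₀ N all') (all'.drop d) rows := by
  set K := φ₀.supp.card + φ₀.depth with hK
  induction k with
  | zero =>
    intro d all hd hk hall
    -- The list has at most `M ≤ d` entries, so nothing is left to treat.
    have hlen := hall.length_le hφ hfin
    rw [hM] at hlen
    have hdrop := comp_drop (O := O) (List.replicate d (.atom 0)) (all.map (CPos.code code))
    rw [List.length_replicate, List.drop_of_length_le (by rw [List.length_map]; omega)] at hdrop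
    refine ⟨all, [], Comp.of_run (hdrop.calls ⟨rfl, ?_⟩), List.prefix_rfl, hall, ?_⟩
    · rw [zero_add, mul_one, rowCost]; omega
    · rw [List.drop_of_length_le (by omega)]; exact .nil
  | succ k ih =>
    intro d all hd hk hall
    have hlen := hall.length_le hφ hfin
    rw [hM] at hlen
    have hdrop := comp_drop (O := O) (List.replicate d (.atom 0)) (all.map (CPos.code code))
    rw [List.length_replicate] at hdrop
    rcases hd.eq_or_lt with rfl | hd
    · rw [List.drop_of_length_le (by rw [List.length_map])] at hdrop
      refine ⟨all, [], Comp.of_run (hdrop.calls ⟨rfl, ?_⟩), List.prefix_rfl, hall, ?_⟩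
      · rw [mul_add _ (k + 1) 1, mul_one]
        generalize rowCost φ₀.size K N m M Φ * (k + 1) = R
        rw [rowCost]; omega
      · rw [List.drop_of_length_le le_rfl]; exact .nil
    · rw [← List.map_drop, List.drop_eq_getElem_cons hd, List.map_cons] at hdrop
      obtain ⟨P, hP, hrep⟩ := hall.rep _ (List.getElem_mem hd)
      set p := all[d] with hp
      have hadm := admissible_of_pos hφ hs₀ hP
      obtain ⟨ps, hc, hps, hpl⟩ := comp_succs hφ hO hN hm hb hrep hadm.card
      rw [← hK] at hc
      have hsmall : ∀ q : CPos S, (∃ P ∈ (boundedGame L φ₀ s₀ H₀ N).pos, q.Rep φ₀ P) →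
          q.Small K (2 * φ₀.size * (K + 2)) N := by
        rintro q ⟨P', hP', hq⟩
        exact CPos.Rep.small hφ hq (admissible_of_pos hφ hs₀ hP').card
      have hpos : ∀ q ∈ ps, ∃ P ∈ (boundedGame L φ₀ s₀ H₀ N).pos, q.Rep φ₀ P := by
        intro q hq
        obtain ⟨P', hm, hr⟩ := hps.sound q hq
        exact ⟨P', pos_move hP hm, hr⟩
      obtain ⟨is, all₁, hi, i1, i2, i3, i4⟩ := comp_insertAll hO hΦ ps
        (fun q hq => hsmall q (hpos q hq)) all (fun q hq => hsmall q (hall.rep q hq))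
      have hall₁ : Explored L φ₀ s₀ H₀ N all₁ :=
        ⟨fun q hq => (i2 q hq).elim (hall.rep q) (hpos q), i3 hall.pairwise⟩
      have hlen₁ := hall₁.length_le hφ hfin
      rw [hM] at hlen₁
      obtain ⟨all', rows, hl, j1, j2, j3⟩ := ih (d + 1) all₁ (by have := i1.length_le; omega)
        (by omega) hall₁
      have hisl := i4.length_eq
      have hdd := comp_dedup (O := O) is
      have hddl : is.dedup.length ≤ M + 1 := by
        refine List.Nodup.length_le_of_le (List.nodup_dedup _) fun i hi => ?_
        obtain ⟨q, -, q', hq', -⟩ := List.exists_of_forall₂_left i4 (List.mem_dedup.1 hi)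
        have := (List.getElem?_eq_some_iff.1 hq').1
        omega
      have e : all'.drop d = p :: all'.drop (d + 1) := by
        have hd' : d < all'.length := by have := (i1.trans j1).length_le; omega
        rw [List.drop_eq_getElem_cons hd']
        congr 1
        have := getElem?_of_prefix (i1.trans j1) (List.getElem?_eq_getElem hd)
        exact (List.getElem?_eq_some_iff.1 this).2
      refine ⟨all', .ofList [.bit P.2.DefenderMoves, .atom (φ₀.rank P.2), codeList is.dedup] :: rows,
        Comp.of_run (hdrop.calls (hc.calls (hi.calls
        ((comp_owner hφ hrep.rep).calls ((comp_rank hφ hrep.rep).calls (hdd.calls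
        (hl.calls ⟨rfl, ?_⟩))))))), i1.trans j1, j2, ?_⟩
      · rw [mul_add _ (k + 1) 1, mul_one]
        have q1 : 200 * (is.length + 1) * (is.dedup.length + 1) ≤ 200 * (2 * m + 1) * (M + 2) :=
          Nat.mul_le_mul (by omega) (by omega)
        have q2 : (equivCost K (2 * φ₀.size * (K + 2)) N Φ + 200) * (all₁.length + 1) *
            (ps.length + 1) ≤ (equivCost K (2 * φ₀.size * (K + 2)) N Φ + 200) * (M + 1) *
            (2 * m + 1) := Nat.mul_le_mul (Nat.mul_le_mul_left _ (by omega)) (by omega)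
        generalize rowCost φ₀.size K N m M Φ * (k + 1) = R
        rw [rowCost]
        omega
      · rw [e]
        refine .cons ((isRow_of_forall₂ hφ hrep hps (fun q hq => ?_) i4).mono j1) j3
        obtain ⟨P', -, h⟩ := hall₁.rep q hq
        exact ⟨P', h⟩

/-- The list is complete because it contains the initial position and, up to permutations, all
successors of its entries. The final list of indices is an enumeration without repetition, since
inequivalent entries have different orbits. -/
theorem describesGame_of_rows (hφ : φ₀.Closed) {all : List (CPos S)} {rows : List Val}
    {H : Finset Name} (hall : Explored L φ₀ s₀ H₀ N all)
    (hH : HistBound N (supp s₀ ∪ φ₀.supp) H₀ H) {p₀ : CPos S} (h₀ : all[0]? = some p₀)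
    (hp₀ : p₀.Rep φ₀ ((s₀, H), φ₀)) (hrows : List.Forall₂ (IsRow L φ₀ N all) all rows) :
    DescribesGame (orbitGame (boundedGame L φ₀ s₀ H₀ N))
      (MulAction.orbit FinPerm (((s₀, H), φ₀) : Position S))
      (.pair (.atom 0) (.ofList rows)) := by
  have hlen := hrows.length_eq
  have hrow : ∀ i : Fin all.length, IsRow L φ₀ N all all[i] (rows[i]'(hlen ▸ i.2)) := fun i =>
    hrows.get i.2 (hlen ▸ i.2)
  choose P is hrep hv hnd hsound hcomplete using hrow
  have hpos : ∀ i, P i ∈ (boundedGame L φ₀ s₀ H₀ N).pos := by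
    intro i
    obtain ⟨P', hP', h⟩ := hall.rep _ (List.getElem_mem i.2)
    rwa [(hrep i).unique hφ h]
  have hget : ∀ {j : ℕ} {q : CPos S} {P' : Position S}, all[j]? = some q → q.Rep φ₀ P' →
      ∃ h : j < all.length, P ⟨j, h⟩ = P' := by
    intro j q P' h hq
    obtain ⟨hj, rfl⟩ := List.getElem?_eq_some_iff.1 h
    exact ⟨hj, (hrep ⟨j, hj⟩).unique hφ hq⟩
  have hlt : ∀ i, ∀ j ∈ is i, j < all.length := by
    intro i j hj
    obtain ⟨q, P', P'', h, hq, -⟩ := hsound i j hj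
    exact (hget h hq).1
  obtain ⟨h0, hP0⟩ := hget h₀ hp₀
  have hinj : Function.Injective fun i => MulAction.orbit FinPerm (P i) := by
    have : ∀ i j : Fin all.length, i < j →
        MulAction.orbit FinPerm (P i) ≠ MulAction.orbit FinPerm (P j) := by
      intro i j hij he
      exact (List.pairwise_iff_getElem.1 hall.pairwise) i j i.2 j.2 hij
        ((CPos.equiv_iff hφ (hrep j) (hrep i)).2 he.symm)
    intro i j he
    by_contra hne
    rcases lt_or_gt_of_ne hne with h | h
    · exact this i j h he
    · exact this j i h he.symm
  refine ⟨all.length, fun i => MulAction.orbit FinPerm (P i), ⟨0, h0⟩,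
    fun i => (is i).pmap (fun j hj => ⟨j, hj⟩) (hlt i), hinj, ?_, ?_, ?_, ?_⟩
  · refine Set.Subset.antisymm ?_ ?_
    · rintro _ ⟨i, rfl⟩
      exact ⟨P i, hpos i, rfl⟩
    · rintro _ ⟨P₁, hP₁, rfl⟩
      -- A move from any position in a listed orbit is carried to a move from the listed
      -- representative.
      refine orbit_mem_of_closed (Q := Set.range fun i => MulAction.orbit FinPerm (P i)) hH ⟨⟨0, h0⟩, by simp only [hP0]⟩ ?_ hP₁
      rintro P₂ P₃ ⟨i, hi⟩ hmove
      obtain ⟨π, hπ⟩ := MulAction.orbit_eq_iff.1 hi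
      simp only at hπ
      have := hmove.smul π
      rw [hπ] at this
      obtain ⟨j, hj, q, P', h1, h2, h3⟩ := hcomplete i _ this
      obtain ⟨h4, rfl⟩ := hget h1 h2
      refine ⟨⟨j, h4⟩, by simp only; rw [← MulAction.orbit_smul π P₃, h3]⟩
  · simp only [hP0]
  · intro i
    refine ⟨(hnd i).pmap fun a _ b _ h => Fin.mk.inj h, fun j => ?_⟩
    rw [orbitGame_move_iff (hpos i), List.mem_pmap]
    constructor
    · rintro ⟨j, hj, rfl⟩
      obtain ⟨q, P', P'', h1, h2, h3, h4⟩ := hsound i j hj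
      obtain ⟨h5, rfl⟩ := hget h1 h2
      exact ⟨P'', h3, h4⟩
    · rintro ⟨P', h1, h2⟩
      obtain ⟨k, hk, q, P'', h3, h4, h5⟩ := hcomplete i P' h1
      obtain ⟨h6, rfl⟩ := hget h3 h4
      exact ⟨k, hk, hinj (h5.symm.trans h2)⟩
  · congr 2
    refine List.ext_getElem (by simp [hlen]) fun i h1 h2 => ?_
    rw [List.getElem_ofFn]
    have h3 : i < all.length := hlen ▸ h1
    refine (hv ⟨i, h3⟩).trans ?_
    have e : (P ⟨i, h3⟩).2.DefenderMoves = (MulAction.orbit FinPerm (P ⟨i, h3⟩) ∈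
        (orbitGame (boundedGame L φ₀ s₀ H₀ N)).defender) :=
      propext (orbitGame_defender_iff (hpos _)).symm
    -- The coercion from lists of indices to lists of numbers is written monadically; it is a plain
    -- map.
    have e' : ∀ l : List (Fin all.length), (l >>= fun a => pure (a : ℕ)) = l.map Fin.val := by
      intro l
      rw [List.map_eq_flatMap]; rfl
    rw [e, orbitGame_rank (hpos _), e', List.map_pmap]
    simp only [List.pmap_eq_map, List.map_id']
    rfl

end

/-! ## The main function -/

section

variable {S : Type u} [Nominal S] {L : FLTS S} {φ₀ : Formula} {s₀ : S} {H₀ : Finset Name}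
  {code : S ↪ ℕ} {Φ : ℕ → ℕ} {O : Oracle}

/-- The cost of the computation of the initial position and of the table of definitions. -/
def initCost (n K : ℕ) : ℕ := 200000 * (n * n * ((2 * n + K + 1) * (K + 1)))

theorem comp_main (hφ : φ₀.Closed) {hs : List Name} {v : Val} {b : ℕ}
    (h : Comp orbitProgram O 26 (.pair (unary 0) (.pair
      (codePositions code [⟨s₀, hs, (rootCtx φ₀).lift (rootVal φ₀)⟩])
      (.pair (.atom (setupGrade S φ₀ + 1)) (codeAssoc φ₀.rows)))) v b) :
    Comp orbitProgram O 0 (encodeInput code φ₀ s₀ hs) (.pair (.atom 0) v)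
      (b + initCost φ₀.size (φ₀.supp.card + φ₀.depth)) := by
  have hn := φ₀.size_pos
  have hB := bounded_root hφ
  have hl := φ₀.length_consts
  have hw := Formula.weight_tree hφ.1
  have hnl := φ₀.tree.length_names_le
  set K := φ₀.supp.card + φ₀.depth with hK
  have hnames := comp_names (O := O) φ₀.tree []
  rw [List.append_nil] at hnames
  have hd := comp_dedup (O := O) φ₀.tree.names
  have ht := comp_nameTerms (O := O) φ₀.tree.names.dedup
  change Comp orbitProgram O 5 _ (codeList φ₀.consts) (_ * (φ₀.consts.length + 1)) at hd
  change Comp orbitProgram O 9 (.pair (.atom 0) (codeList φ₀.consts)) _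
    (50 * (φ₀.consts.length + 1)) at ht
  have hsl := comp_slots (O := O) 1 ((φ₀.consts.map Term.name).map enc)
  rw [List.length_map, List.length_map] at hsl
  have hz := comp_zip_pairs (O := O) (φ₀.consts.map Term.name) (slotTerms 1 φ₀.consts.length) []
  have hsc : codePairs ((φ₀.consts.map Term.name).zip (slotTerms 1 φ₀.consts.length) ++ []) =
      codeScope (rootCtx φ₀).sc := by
    rw [codeScope, rootCtx, Scope.enter_map, List.length_map]; rfl
  rw [hsc, List.length_map] at hz
  have hadv := comp_advance_slots (O := O) 1 (slotTerms 1 φ₀.consts.length)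
  have hlen : (slotTerms 1 φ₀.consts.length).length = φ₀.consts.length := by simp [slotTerms]
  have hz' := comp_zip_pairs (O := O) (slotTerms 1 φ₀.consts.length) (φ₀.consts.map Term.name) []
  rw [List.append_nil] at hz'
  rw [hlen] at hadv hz'
  -- The constants are entered over the empty association list, under which each slot name has
  -- itself as value.
  have hval : rootVal φ₀ = slotVal ((slotTerms 1 φ₀.consts.length).zip (φ₀.consts.map Term.name)) := by
    have := setSlots_assocSub [] 1 (φ₀.consts.map Term.name)
    rw [List.append_nil, List.length_map] at this
    exact this
  rw [← hl] at hB
  have hlift := comp_lift (O := O) φ₀.tree hB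
    ((slotTerms 1 φ₀.consts.length).zip (φ₀.consts.map Term.name)) (by
      rw [List.length_zip, hlen, List.length_map, φ₀.depth_tree]; omega)
  rw [← hval] at hlift
  have hent := comp_entries (O := O) (rootCtx φ₀) hB []
  rw [List.append_nil] at hent
  change Comp orbitProgram O 36 _ (codeAssoc φ₀.rows) (20000 * φ₀.tree.weight * _ + 50) at hent
  set Z := (2 * φ₀.size + K + 1) * (K + 1) with hZ
  have q1 : 10000 * φ₀.tree.weight * Z ≤ 20000 * (φ₀.size * φ₀.size * Z) := by
    have : φ₀.tree.weight * Z ≤ 2 * (φ₀.size * φ₀.size * Z) := by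
      calc _ ≤ 2 * (φ₀.size * φ₀.size) * Z := Nat.mul_le_mul_right _ (by nlinarith)
        _ = _ := by ring
    rw [mul_assoc]; omega
  have q2 : 20000 * φ₀.tree.weight * (2 * φ₀.size * Z) ≤ 80000 * (φ₀.size * φ₀.size * Z) := by
    calc _ = 40000 * (φ₀.tree.weight * φ₀.size * Z) := by ring
      _ ≤ 40000 * ((2 * φ₀.size) * φ₀.size * Z) := by gcongr
      _ = _ := by ring
  have q3 : 200 * (φ₀.tree.names.length + 1) * (φ₀.consts.length + 1) ≤
      600 * (φ₀.size * φ₀.size * Z) := by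
    have : (φ₀.tree.names.length + 1) * (φ₀.consts.length + 1) ≤ (3 * φ₀.size) * Z :=
      Nat.mul_le_mul (by omega) (by rw [hZ]; nlinarith)
    have : φ₀.size * Z ≤ φ₀.size * φ₀.size * Z := Nat.mul_le_mul_right _ (by nlinarith)
    rw [mul_assoc]; nlinarith
  have q4 : φ₀.size + K + 1 ≤ φ₀.size * φ₀.size * Z := by
    have h1 : φ₀.size + K + 1 ≤ Z := by rw [hZ]; nlinarith
    exact h1.trans (Nat.le_mul_of_pos_left _ (by positivity))
  refine Comp.of_run ((comp_tree φ₀).calls (hnames.calls (hd.calls (ht.calls (hsl.calls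
    (hz.calls (hadv.calls (hz'.calls (hlift.calls (hent.calls (h.calls ⟨rfl, ?_⟩)))))))))))
  rw [initCost, ← hZ]
  omega

/-! ## The time bound -/

/-- The successors account for the summand with `(N + 1)(K + 1)`. The other one comes from comparing
up to `2 m` successors with up to `M` positions, each comparison costing at most a constant times
`(n + Φ K + N)(K + 1)²`. -/
theorem rowCost_le {n K N m M : ℕ} (Φ : ℕ → ℕ) (hn : 0 < n) (hM : 0 < M) (hK : K ≤ N)
    (hm : N + 2 ≤ m) : rowCost n K N m M Φ ≤
      10000000 * ((n + Φ K + N) * m * ((N + 1) * (K + 1) + M * ((K + 1) * (K + 1)))) := by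
  set D := n + Φ K + N with hD
  have w : 2 * n * (K + 2) + N + 2 ≤ 6 * (D * (K + 1)) := by
    have h1 : n * (K + 2) ≤ D * (2 * (K + 1)) := Nat.mul_le_mul (by omega) (by omega)
    have h2 : D ≤ D * (K + 1) := Nat.le_mul_of_pos_right _ (by omega)
    have h3 : N + 2 ≤ 2 * D := by omega
    nlinarith
  have a1 : succCost (2 * n * (K + 2)) N m ≤ 1200000 * (D * m * ((N + 1) * (K + 1))) := by
    rw [succCost]
    calc _ ≤ 100000 * (m * ((2 * (N + 1)) * (6 * (D * (K + 1))))) := by gcongr; omega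
      _ = _ := by ring
  have a2 : equivCost K (2 * n * (K + 2)) N Φ + 200 ≤ 61000 * (D * ((K + 1) * (K + 1))) := by
    rw [equivCost]
    have h1 : (2 * n * (K + 2) + N + 2) * (K + 1) ≤ 6 * (D * ((K + 1) * (K + 1))) := by
      calc _ ≤ 6 * (D * (K + 1)) * (K + 1) := Nat.mul_le_mul_right _ w
        _ = _ := by ring
    have h2 : D ≤ D * ((K + 1) * (K + 1)) := Nat.le_mul_of_pos_right _ (by positivity)
    omega
  set X := D * m * (M * ((K + 1) * (K + 1))) with hX
  have a3 : (equivCost K (2 * n * (K + 2)) N Φ + 200) * (M + 1) * (2 * m + 1) ≤ 366000 * X := by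
    calc _ ≤ 61000 * (D * ((K + 1) * (K + 1))) * (2 * M) * (3 * m) := by gcongr <;> omega
      _ = _ := by rw [hX]; ring
  have a4 : m * M ≤ X := by
    calc m * M = 1 * m * (M * (1 * 1)) := by ring
      _ ≤ X := by rw [hX]; gcongr <;> omega
  have a5 : D ≤ X := by
    calc D = D * 1 * (1 * (1 * 1)) := by ring
      _ ≤ X := by rw [hX]; gcongr <;> omega
  have a6 : 200 * (2 * m + 1) * (M + 2) ≤ 1800 * X := by
    calc _ ≤ 200 * (3 * m) * (3 * M) := by gcongr <;> omega
      _ = 1800 * (m * M) := by ring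
      _ ≤ _ := by omega
  have a7 : M ≤ m * M := Nat.le_mul_of_pos_left _ (by omega)
  rw [mul_add (D * m), rowCost]
  omega

theorem initCost_le {n K N m : ℕ} (hn : 0 < n) (hK : K ≤ N) (hm : N + 2 ≤ m) :
    initCost n K ≤ 600000 * ((n + N) * m * (n * n)) := by
  rw [initCost]
  calc _ ≤ 200000 * (n * n * ((3 * (n + N)) * m)) := by gcongr <;> omega
    _ = _ := by ring

theorem one_le_numOrbits (h : OrbitFinite S) (s : S) : 1 ≤ numOrbits S := by
  have : Finite (MulAction.orbitRel.Quotient FinPerm S) := h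
  have : Nonempty (MulAction.orbitRel.Quotient FinPerm S) := ⟨Quotient.mk'' s⟩
  exact Nat.card_pos

theorem size_mul_le_sizeBound (h : OrbitFinite S) (s : S) (φ : Formula) :
    (φ.size : ℝ) * (setupGrade S φ + 1) ≤ sizeBound S φ := by
  rw [sizeBound]
  have h1 : (1 : ℝ) ≤ numOrbits S := by exact_mod_cast one_le_numOrbits h s
  have h2 : (1 : ℝ) ≤ (φ.supp.card + φ.depth).factorial / φ.supp.card.factorial := by
    rw [one_le_div (by positivity)]
    exact_mod_cast Nat.factorial_le (Nat.le_add_right _ _)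
  have h3 : (setupGrade S φ + 1 : ℝ) ≤
      ((setupGrade S φ : ℝ) + 1) ^ (φ.supp.card + φ.depth + 1) :=
    le_self_pow₀ (by linarith [Nat.cast_nonneg (α := ℝ) (setupGrade S φ)]) (by omega)
  have h4 : (φ.size : ℝ) ≤ numOrbits S * φ.size *
      ((φ.supp.card + φ.depth).factorial / φ.supp.card.factorial) := by
    calc (φ.size : ℝ) = 1 * φ.size * 1 := by ring
      _ ≤ _ := by gcongr
  exact mul_le_mul h4 h3 (by positivity) (by positivity)

/-- The total cost is within the bound. -/
theorem totalCost_le {n K N m M : ℕ} {Φ : ℕ → ℕ} {B : ℝ} (hn : 0 < n) (hM : 0 < M) (hK : K ≤ N)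
    (hm : N + 2 ≤ m) (hB : (n : ℝ) * (N + 1) ≤ B) (hMB : ((K : ℝ) + 1) * M ≤ 32 * B) :
    ((rowCost n K N m M Φ * (M + 1) + initCost n K : ℕ) : ℝ) ≤
      30000000000 * (((n : ℝ) + Φ K + N) * m * B ^ 2) := by
  have h1 := rowCost_le Φ hn hM hK hm
  have h2 := initCost_le hn hK hm
  have hn1 : (1 : ℝ) ≤ n := by exact_mod_cast hn
  have hN0 : (0 : ℝ) ≤ N := N.cast_nonneg
  have hnB : (n : ℝ) ≤ B := le_trans (by nlinarith) hB
  have hNB : (N : ℝ) + 1 ≤ B := le_trans (by nlinarith) hB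
  have hB0 : 0 ≤ B := by linarith
  -- The number of rounds, `M + 1`, is at most `2 M`, and the products are regrouped so that each `K
  -- + 1` stands next to an `M`.
  have e : rowCost n K N m M Φ * (M + 1) + initCost n K ≤
      20000000 * ((n + Φ K + N) * m * ((N + 1) * ((K + 1) * M) + ((K + 1) * M) * ((K + 1) * M))) +
        600000 * ((n + Φ K + N) * m * (n * n)) := by
    refine Nat.add_le_add ?_ (h2.trans (by gcongr; omega))
    calc _ ≤ 10000000 * ((n + Φ K + N) * m * ((N + 1) * (K + 1) + M * ((K + 1) * (K + 1)))) *
          (2 * M) := Nat.mul_le_mul h1 (by omega)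
      _ = _ := by ring
  have e' : ((rowCost n K N m M Φ * (M + 1) + initCost n K : ℕ) : ℝ) ≤
      20000000 * (((n : ℝ) + Φ K + N) * m * ((N + 1) * (((K : ℝ) + 1) * M) +
        (((K : ℝ) + 1) * M) * (((K : ℝ) + 1) * M))) +
        600000 * (((n : ℝ) + Φ K + N) * m * (n * n)) := by exact_mod_cast e
  refine e'.trans ?_
  -- The reserve is spent here: every `(K + 1) M` is replaced by `32 B`.
  have f1 : ((N : ℝ) + 1) * (((K : ℝ) + 1) * M) ≤ B * (32 * B) :=
    mul_le_mul hNB hMB (by positivity) hB0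
  have f2 : (((K : ℝ) + 1) * M) * (((K : ℝ) + 1) * M) ≤ (32 * B) * (32 * B) :=
    mul_le_mul hMB hMB (by positivity) (by positivity)
  have f3 : (n : ℝ) * n ≤ B * B := mul_le_mul hnB hnB (by positivity) hB0
  -- The constant is `20000000 · (32 + 32²) + 600000 = 21120600000`.
  calc _ ≤ 20000000 * (((n : ℝ) + Φ K + N) * m * (B * (32 * B) + (32 * B) * (32 * B))) +
        600000 * (((n : ℝ) + Φ K + N) * m * (B * B)) := by gcongr
    _ = 21120600000 * (((n : ℝ) + Φ K + N) * m * B ^ 2) := by ring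
    _ ≤ _ := by gcongr; norm_num

end

theorem mainTheorem6 :
    (∃ ε : ℕ → ℝ, Tendsto ε atTop (𝓝 0) ∧
      ∀ (S : Type u) [Nominal S] (L : FLTS S) (φ₀ : Formula) (s₀ : S) (H₀ : Finset Name),
        IsSetup L φ₀ s₀ H₀ →
          (boundedOrbitGame L φ₀ s₀ H₀).pos.Finite ∧
          ((boundedOrbitGame L φ₀ s₀ H₀).pos.ncard : ℝ) ≤
            sizeBound S φ₀ * (1 + ε (setupGrade S φ₀))) ∧
    (∃ (P : Program) (C : ℝ),
      ∀ (S : Type u) [Nominal S] (L : FLTS S) (φ₀ : Formula) (s₀ : S) (H₀ : Finset Name),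
        IsSetup L φ₀ s₀ H₀ →
          L.branching < ⊤ ∧
          ∀ (code : S ↪ ℕ) (Φ : ℕ → ℕ) (O : Oracle), Monotone Φ → Presents L code Φ O →
            ∀ hs : List Name, hs.Nodup →
              HistBound (setupGrade S φ₀) (supp s₀ ∪ φ₀.supp) H₀ hs.toFinset →
              ∃ (v : Val) (k : ℕ),
                P.Runs O (encodeInput code φ₀ s₀ hs) v k ∧
                DescribesGame (boundedOrbitGame L φ₀ s₀ H₀)
                  (MulAction.orbit FinPerm (((s₀, hs.toFinset), φ₀) : Position S)) v ∧
                (k : ℝ) ≤ C * timeBound S φ₀ Φ L.branching.toNat) := by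
  refine ⟨⟨_, tendsto_ratio, fun S _ L φ₀ s₀ H₀ h => ⟨h.finite_pos.1, h.ncard_pos_le⟩⟩,
    orbitProgram, 30000000000, fun S _ L φ₀ s₀ H₀ h => ⟨FLTS.branching_lt_top h.orbitFinite, ?_⟩⟩
  intro code Φ O hΦ hO hs hnd hH
  have hφ := h.closed
  have hfin := h.finite_pos.1
  set M := (boundedOrbitGame L φ₀ s₀ H₀).pos.ncard with hM
  -- One parameter bounds both the names to be tried at a quantifier and the targets of a
  -- transition.
  set m := max (setupGrade S φ₀ + 2) L.branching.toNat with hm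
  have hconf : supp s₀ ⊆ hs.toFinset :=
    (Finset.subset_inter Finset.subset_union_left h.conf).trans hH.inter_subset
  have hrep : CPos.Rep φ₀ (⟨s₀, hs, (rootCtx φ₀).lift (rootVal φ₀)⟩ : CPos S)
      ((s₀, hs.toFinset), φ₀) := ⟨rfl, hnd, rfl, represents_root hφ, hconf⟩
  have hpos : (((s₀, hs.toFinset), φ₀) : Position S) ∈
      (boundedGame L φ₀ s₀ H₀ (setupGrade S φ₀)).pos := ⟨_, hH, .refl⟩
  have hM0 : 0 < M := (Set.ncard_pos hfin).2 ⟨_, _, hpos, rfl⟩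
  have hex : Explored L φ₀ s₀ H₀ (setupGrade S φ₀)
      [⟨s₀, hs, (rootCtx φ₀).lift (rootVal φ₀)⟩] :=
    ⟨by simpa using ⟨_, _, _, hpos, hrep⟩, List.pairwise_singleton _ _⟩
  -- The exploration starts with the initial position alone and with no position treated, so `M`
  -- rounds suffice.
  obtain ⟨all, rows, hloop, hpre, hall, hrows⟩ := comp_loop (m := m) hφ hO hΦ h.conf
    (fun s => Nat.add_le_add_left (card_supp_le_regIndex h.orbitFinite.1 s) _) (le_max_left _ _)
    (fun c ℓ ss h1 h2 => (FLTS.length_le_branching h.orbitFinite h1 h2).trans (le_max_right _ _))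
    hfin hM.symm M 0 _ (Nat.zero_le _) (by omega) hex
  obtain ⟨k, hk, hrun⟩ := comp_main hφ hloop
  refine ⟨_, k, hrun, describesGame_of_rows hφ hall hH (getElem?_of_prefix hpre rfl) hrep hrows, ?_⟩
  have ht := totalCost_le (Φ := Φ) (m := m) φ₀.size_pos hM0 (le_setupGrade S φ₀)
    (le_max_left _ _) (size_mul_le_sizeBound h.orbitFinite.1 s₀ φ₀)
    (by exact_mod_cast h.mul_ncard_pos_le)
  rw [timeBound]
  have : ((m : ℕ) : ℝ) = max ((setupGrade S φ₀ : ℝ) + 2) L.branching.toNat := by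
    rw [hm]; push_cast; rfl
  rw [← this]
  exact (Nat.cast_le.2 hk).trans ht
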